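/- Let $k$ be a field and $A$ a finite-dimensional associative (not necessarily unital) $k$-algebra with basis $\{e_i\}$ and structure constants $e_ie_j=c_{ij}{}^a e_a$ (summation over repeated indices). Let $\Psi:A\otimes A\to A\otimes A$ make $A$ a braided algebra, i.e. $\Psi$ obeys the braid relations and $$\Psi(ab\otimes c)=(\mathrm{id}\otimes\cdot)(\Psi\otimes\mathrm{id})(\mathrm{id}\otimes\Psi)(a\otimes b\otimes c),\qquad \Psi(a\otimes bc)=(\cdot\otimes\mathrm{id})(\mathrm{id}\otimes\Psi)(\Psi\otimes\mathrm{id})(a\otimes b\otimes c),$$ and write $\Psi(e_i\otimes e_j)=e_b\otimes e_a R^a{}_i{}^b{}_j$. Assume that $R$ is bi-invertible: $R^{-1}$ and $\tilde R=((R^{t_2})^{-1})^{t_2}$ exist, where $t_2$ is transposition in the second matrix factor. Let $M_1(R,A)$ be the bialgebra generated by $1$ and $\mathbf t=(t^i{}_j)$ with relations $R_{12}\mathbf t_1\mathbf t_2=\mathbf t_2\mathbf t_1R_{12}$ and $\mathbf t_3c_{12}{}^3=c_{12}{}^3\mathbf t_1\mathbf t_2$ (i.e. $c_{ij}{}^at^k{}_a=c_{ab}{}^kt^a{}_it^b{}_j$),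 and with $\Delta t^i{}_j=t^i{}_a\otimes t^a{}_j$, $\epsilon(t^i{}_j)=\delta^i{}_j$. A dual quasitriangular structure on a bialgebra $M$ is a convolution-invertible $\mathcal R:M\otimes M\to k$ with $\mathcal R(ab,c)=\mathcal R(a,c_{(1)})\mathcal R(b,c_{(2)})$, $\mathcal R(a,bc)=\mathcal R(a_{(1)},c)\mathcal R(a_{(2)},b)$ and $b_{(1)}a_{(1)}\mathcal R(a_{(2)},b_{(2)})=\mathcal R(a_{(1)},b_{(1)})a_{(2)}b_{(2)}$. A second inverse is $\tilde{\mathcal R}:M\otimes M\to k$ with $\tilde{\mathcal R}(a_{(1)},b_{(2)})\mathcal R(a_{(2)},b_{(1)})=\epsilon(a)\epsilon(b)=\mathcal R(a_{(1)},b_{(2)})\tilde{\mathcal R}(a_{(2)},b_{(1)})$; it is unique if it exists, and is $\mathcal R(a,Sb)$ if $M$ has an antipode $S$. The transmutation of $M$ is the vector space $M$ with the same unit and coalgebra, the product $$a\,\underline\cdot\,b=\mathcal R(a_{(1)},b_{(2)})\,a_{(2)}b_{(3)}\,\tilde{\mathcal R}(a_{(3)},b_{(1)})$$ and the braiding $$a\otimes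 b\mapsto \mathcal R(a_{(1)},b_{(2)})\,\mathcal R^{-1}(a_{(2)},b_{(4)})\,\mathcal R(a_{(4)},b_{(5)})\,\tilde{\mathcal R}(a_{(5)},b_{(1)})\;b_{(3)}\otimes a_{(3)}$$ (when there is an antipode, these are $a_{(2)}b_{(2)}\mathcal R((Sa_{(1)})a_{(3)},Sb_{(1)})$ and $b_{(2)}\otimes a_{(2)}\,\mathcal R((Sa_{(1)})a_{(3)},(Sb_{(1)})b_{(3)})$). **Statement.** (i) $M_1(R,A)$ has a unique dual quasitriangular structure $\mathcal R$ with $\mathcal R(t^i{}_j,t^k{}_l)=R^i{}_j{}^k{}_l$, and it has a second inverse. (ii) Let $\underline M_1(R,A)$ be the algebra generated by $1$ and $\mathbf u=(u^i{}_j)$ with the braided matrix relations $R_{21}\mathbf u_1R_{12}\mathbf u_2=\mathbf u_2R_{21}\mathbf u_1R_{12}$ and the relations $\mathbf u_3c_{12}{}^3=c_{12}{}^3R_{12}^{-1}\mathbf u_1R_{12}\mathbf u_2$. It has a unique structure of braided bialgebra (invertible braiding obeying the braid relations, all structure maps functorial for it, coproduct an algebra map to the braided tensor product algebra) such that $$\Delta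 u^i{}_j=u^i{}_a\otimes u^a{}_j,\quad \epsilon(u^i{}_j)=\delta^i{}_j,\quad \Psi(u^i{}_j\otimes u^k{}_l)=u^m{}_n\otimes u^r{}_s\,R^i{}_a{}^d{}_m\,R^{-1}{}^a{}_r{}^n{}_b\,R^s{}_c{}^b{}_l\,\tilde R^c{}_j{}^k{}_d .$$ (iii) The transmutation of $M_1(R,A)$ is $\underline M_1(R,A)$: there is a linear isomorphism $\underline M_1(R,A)\to M_1(R,A)$ with $u^i{}_j\mapsto t^i{}_j$ that carries the unit, product, coproduct, counit and braiding of $\underline M_1(R,A)$ to those of the transmutation. It sends the entries of $\mathbf u_1R_{12}\mathbf u_2$ to those of $R_{12}\mathbf t_1\mathbf t_2$. (iv) $\underline M_1(R,A)$ comeasures $A$: there are invertible braidings between $\underline M_1(R,A)$ and $A$, which together with those of $A$ and of $\underline M_1(R,A)$ satisfy all the braid relations and are functorial for all the structure maps, with $$\Psi(u^i{}_j\otimes e_k)=e_m\otimes u^a{}_b\,R^{-1}{}^i{}_a{}^m{}_n R^b{}_j{}^n{}_k,\qquad \Psi(e_k\otimes u^i{}_j)=u^a{}_b\otimes e_m\,\tilde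 R^n{}_k{}^i{}_a R^m{}_n{}^b{}_j,$$ and $\beta(e_j)=e_a\otimes u^a{}_j$ is a coaction $A\to A\otimes\underline M_1(R,A)$ that is functorial for these braidings and an algebra map to the braided tensor product algebra. -/

import Mathlib

open scoped TensorProduct

/-! ### Linear algebra of braidings

A braiding between two modules `X`, `Y` is a linear map `X ⊗ Y → Y ⊗ X`. -/

/-- The braiding of `X ⊗ Y` with `Z`: move `Z` past `Y` by `g` and then past `X` by `f`. -/
noncomputable def braidTensorLeft {K X Y Z : Type*} [Field K] [AddCommMonoid X] [Module K X]
    [AddCommMonoid Y] [Module K Y] [AddCommMonoid Z] [Module K Z]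
    (f : X ⊗[K] Z →ₗ[K] Z ⊗[K] X) (g : Y ⊗[K] Z →ₗ[K] Z ⊗[K] Y) :
    (X ⊗[K] Y) ⊗[K] Z →ₗ[K] Z ⊗[K] (X ⊗[K] Y) :=
  (TensorProduct.assoc K Z X Y).toLinearMap ∘ₗ
    TensorProduct.map f (LinearMap.id : Y →ₗ[K] Y) ∘ₗ
    (TensorProduct.assoc K X Z Y).symm.toLinearMap ∘ₗ
    TensorProduct.map (LinearMap.id : X →ₗ[K] X) g ∘ₗ
    (TensorProduct.assoc K X Y Z).toLinearMap

/-- The braiding of `X` with `Y ⊗ Z`: move `X` past `Y` by `f` and then past `Z` by `g`. -/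
noncomputable def braidTensorRight {K X Y Z : Type*} [Field K] [AddCommMonoid X] [Module K X]
    [AddCommMonoid Y] [Module K Y] [AddCommMonoid Z] [Module K Z]
    (f : X ⊗[K] Y →ₗ[K] Y ⊗[K] X) (g : X ⊗[K] Z →ₗ[K] Z ⊗[K] X) :
    X ⊗[K] (Y ⊗[K] Z) →ₗ[K] (Y ⊗[K] Z) ⊗[K] X :=
  (TensorProduct.assoc K Y Z X).symm.toLinearMap ∘ₗ
    TensorProduct.map (LinearMap.id : Y →ₗ[K] Y) g ∘ₗ
    (TensorProduct.assoc K Y X Z).toLinearMap ∘ₗ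
    TensorProduct.map f (LinearMap.id : Z →ₗ[K] Z) ∘ₗ
    (TensorProduct.assoc K X Y Z).symm.toLinearMap

/-- The braid relation for braidings `f`, `g`, `h` of `X` with `Y`, `X` with `Z`, `Y` with `Z`. -/
def BraidRelation {K X Y Z : Type*} [Field K] [AddCommMonoid X] [Module K X]
    [AddCommMonoid Y] [Module K Y] [AddCommMonoid Z] [Module K Z]
    (f : X ⊗[K] Y →ₗ[K] Y ⊗[K] X) (g : X ⊗[K] Z →ₗ[K] Z ⊗[K] X)
    (h : Y ⊗[K] Z →ₗ[K] Z ⊗[K] Y) : Prop :=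
  TensorProduct.map (LinearMap.id : Z →ₗ[K] Z) f ∘ₗ braidTensorLeft g h =
    braidTensorLeft h g ∘ₗ TensorProduct.map f (LinearMap.id : Z →ₗ[K] Z)

/-- A map `p : X → X'` is functorial for braidings with `Z` on the right of `X`, `X'`. -/
def NaturalLeft {K X X' Z : Type*} [Field K] [AddCommMonoid X] [Module K X]
    [AddCommMonoid X'] [Module K X'] [AddCommMonoid Z] [Module K Z]
    (p : X →ₗ[K] X') (f : X ⊗[K] Z →ₗ[K] Z ⊗[K] X) (f' : X' ⊗[K] Z →ₗ[K] Z ⊗[K] X') : Prop :=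
  f' ∘ₗ TensorProduct.map p (LinearMap.id : Z →ₗ[K] Z) =
    TensorProduct.map (LinearMap.id : Z →ₗ[K] Z) p ∘ₗ f

/-- A map `p : X → X'` is functorial for braidings with `Z` on the left of `X`, `X'`. -/
def NaturalRight {K X X' Z : Type*} [Field K] [AddCommMonoid X] [Module K X]
    [AddCommMonoid X'] [Module K X'] [AddCommMonoid Z] [Module K Z]
    (p : X →ₗ[K] X') (f : Z ⊗[K] X →ₗ[K] X ⊗[K] Z) (f' : Z ⊗[K] X' →ₗ[K] X' ⊗[K] Z) : Prop :=
  f' ∘ₗ TensorProduct.map (LinearMap.id : Z →ₗ[K] Z) p =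
    TensorProduct.map p (LinearMap.id : Z →ₗ[K] Z) ∘ₗ f

/-- The product `(x ⊗ y)(x' ⊗ y') = x ψ(y ⊗ x') y'` of the braided tensor product of algebras
with products `mX`, `mY`, where `ψ` is the braiding of `Y` with `X`. -/
noncomputable def braidedTensorMul {K X Y : Type*} [Field K] [AddCommMonoid X] [Module K X]
    [AddCommMonoid Y] [Module K Y] (mX : X ⊗[K] X →ₗ[K] X) (mY : Y ⊗[K] Y →ₗ[K] Y)
    (ψ : Y ⊗[K] X →ₗ[K] X ⊗[K] Y) :
    (X ⊗[K] Y) ⊗[K] (X ⊗[K] Y) →ₗ[K] X ⊗[K] Y :=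
  TensorProduct.map mX mY ∘ₗ
    (TensorProduct.assoc K X X (Y ⊗[K] Y)).symm.toLinearMap ∘ₗ
    TensorProduct.map (LinearMap.id : X →ₗ[K] X)
      ((TensorProduct.assoc K X Y Y).toLinearMap ∘ₗ
        TensorProduct.map ψ (LinearMap.id : Y →ₗ[K] Y) ∘ₗ
        (TensorProduct.assoc K Y X Y).symm.toLinearMap) ∘ₗ
    (TensorProduct.assoc K X Y (X ⊗[K] Y)).toLinearMap

/-- `Ψ` makes the (not necessarily unital) algebra `A` a braided algebra: `Ψ` obeys the braid
relation and is functorial with respect to the product on either side. -/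
structure IsBraidedAlgebra {K A : Type*} [Field K] [NonUnitalRing A] [Module K A]
    [SMulCommClass K A A] [IsScalarTower K A A] (Ψ : A ⊗[K] A →ₗ[K] A ⊗[K] A) : Prop where
  braid : BraidRelation Ψ Ψ Ψ
  mul_left : NaturalLeft (LinearMap.mul' K A) (braidTensorLeft Ψ Ψ) Ψ
  mul_right : NaturalRight (LinearMap.mul' K A) (braidTensorRight Ψ Ψ) Ψ

/-! ### Braided bialgebras -/

/-- The structure maps of a braided bialgebra, without axioms. -/
structure BraidedBialgebraData (K B : Type*) [Field K] [AddCommMonoid B] [Module K B] where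
  mul : B ⊗[K] B →ₗ[K] B
  one : B
  comul : B →ₗ[K] B ⊗[K] B
  counit : B →ₗ[K] K
  braiding : B ⊗[K] B →ₗ[K] B ⊗[K] B

/-- All structure maps of `D` are functorial for the braiding `f` of `B` with an object `Z`. -/
structure BraidedBialgebraData.FunctorialLeft {K B Z : Type*} [Field K] [AddCommMonoid B]
    [Module K B] [AddCommMonoid Z] [Module K Z] (D : BraidedBialgebraData K B)
    (f : B ⊗[K] Z →ₗ[K] Z ⊗[K] B) : Prop where
  mul : NaturalLeft D.mul (braidTensorLeft f f) f
  one : ∀ z : Z, f (D.one ⊗ₜ z) = z ⊗ₜ D.one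
  comul : NaturalLeft D.comul f (braidTensorLeft f f)
  counit : NaturalLeft D.counit f (TensorProduct.comm K K Z).toLinearMap

/-- All structure maps of `D` are functorial for the braiding `f` of an object `Z` with `B`. -/
structure BraidedBialgebraData.FunctorialRight {K B Z : Type*} [Field K] [AddCommMonoid B]
    [Module K B] [AddCommMonoid Z] [Module K Z] (D : BraidedBialgebraData K B)
    (f : Z ⊗[K] B →ₗ[K] B ⊗[K] Z) : Prop where
  mul : NaturalRight D.mul (braidTensorRight f f) f
  one : ∀ z : Z, f (z ⊗ₜ D.one) = D.one ⊗ₜ z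
  comul : NaturalRight D.comul f (braidTensorRight f f)
  counit : NaturalRight D.counit f (TensorProduct.comm K Z K).toLinearMap

/-- `D` is a braided bialgebra (a bialgebra in a braided category, also called a braided group):
a unital algebra and a coalgebra with an invertible braiding for which all structure maps are
functorial, such that the coproduct is an algebra map to the braided tensor product algebra and
the counit is an algebra map. -/
structure BraidedBialgebraData.IsBraidedBialgebra {K B : Type*} [Field K] [AddCommMonoid B]
    [Module K B] (D : BraidedBialgebraData K B) : Prop where
  mul_assoc : ∀ x y z : B, D.mul (D.mul (x ⊗ₜ y) ⊗ₜ z) = D.mul (x ⊗ₜ D.mul (y ⊗ₜ z))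
  one_mul : ∀ x : B, D.mul (D.one ⊗ₜ x) = x
  mul_one : ∀ x : B, D.mul (x ⊗ₜ D.one) = x
  coassoc : (TensorProduct.assoc K B B B).toLinearMap ∘ₗ
      TensorProduct.map D.comul (LinearMap.id : B →ₗ[K] B) ∘ₗ D.comul =
    TensorProduct.map (LinearMap.id : B →ₗ[K] B) D.comul ∘ₗ D.comul
  counit_comul : ∀ x : B,
    TensorProduct.map D.counit (LinearMap.id : B →ₗ[K] B) (D.comul x) = (1 : K) ⊗ₜ x
  comul_counit : ∀ x : B,
    TensorProduct.map (LinearMap.id : B →ₗ[K] B) D.counit (D.comul x) = x ⊗ₜ (1 : K)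
  comul_mul : D.comul ∘ₗ D.mul =
    braidedTensorMul D.mul D.mul D.braiding ∘ₗ TensorProduct.map D.comul D.comul
  comul_one : D.comul D.one = D.one ⊗ₜ D.one
  counit_mul : ∀ x y : B, D.counit (D.mul (x ⊗ₜ y)) = D.counit x * D.counit y
  counit_one : D.counit D.one = 1
  braiding_bijective : Function.Bijective D.braiding
  braid : BraidRelation D.braiding D.braiding D.braiding
  functorial_left : D.FunctorialLeft D.braiding
  functorial_right : D.FunctorialRight D.braiding

/-- A linear isomorphism that respects all structure maps. -/
structure BraidedBialgebraData.IsIso {K B C : Type*} [Field K] [AddCommMonoid B] [Module K B]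
    [AddCommMonoid C] [Module K C] (D : BraidedBialgebraData K B) (E : BraidedBialgebraData K C)
    (φ : B ≃ₗ[K] C) : Prop where
  map_mul : ∀ x y : B, φ (D.mul (x ⊗ₜ y)) = E.mul (φ x ⊗ₜ φ y)
  map_one : φ D.one = E.one
  map_comul : ∀ x : B,
    TensorProduct.map φ.toLinearMap φ.toLinearMap (D.comul x) = E.comul (φ x)
  map_counit : ∀ x : B, E.counit (φ x) = D.counit x
  map_braiding : ∀ x y : B,
    TensorProduct.map φ.toLinearMap φ.toLinearMap (D.braiding (x ⊗ₜ y)) =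
      E.braiding (φ x ⊗ₜ φ y)

/-- The braided bialgebra `D` comeasures the braided algebra `(A, Ψ)` by `β : A → A ⊗ B`:
the braidings `Ψ`, `ΨBA`, `ΨAB`, `D.braiding` put `A` and `B` into one braided category, and `β`
is a morphism there, an algebra map to the braided tensor product algebra, and a coaction. -/
structure IsBraidedComeasuring {K A B : Type*} [Field K] [NonUnitalRing A] [Module K A]
    [SMulCommClass K A A] [IsScalarTower K A A] [AddCommMonoid B] [Module K B]
    (Ψ : A ⊗[K] A →ₗ[K] A ⊗[K] A) (D : BraidedBialgebraData K B)
    (ΨBA : B ⊗[K] A →ₗ[K] A ⊗[K] B) (ΨAB : A ⊗[K] B →ₗ[K] B ⊗[K] A)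
    (β : A →ₗ[K] A ⊗[K] B) : Prop where
  bijective_BA : Function.Bijective ΨBA
  bijective_AB : Function.Bijective ΨAB
  braid_AAB : BraidRelation Ψ ΨAB ΨAB
  braid_ABA : BraidRelation ΨAB Ψ ΨBA
  braid_BAA : BraidRelation ΨBA ΨBA Ψ
  braid_ABB : BraidRelation ΨAB ΨAB D.braiding
  braid_BAB : BraidRelation ΨBA D.braiding ΨAB
  braid_BBA : BraidRelation D.braiding ΨBA ΨBA
  functorial_left : D.FunctorialLeft ΨBA
  functorial_right : D.FunctorialRight ΨAB
  mul_left : NaturalLeft (LinearMap.mul' K A) (braidTensorLeft ΨAB ΨAB) ΨAB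
  mul_right : NaturalRight (LinearMap.mul' K A) (braidTensorRight ΨBA ΨBA) ΨBA
  coact_left_A : NaturalLeft β Ψ (braidTensorLeft Ψ ΨBA)
  coact_left_B : NaturalLeft β ΨAB (braidTensorLeft ΨAB D.braiding)
  coact_right_A : NaturalRight β Ψ (braidTensorRight Ψ ΨAB)
  coact_right_B : NaturalRight β ΨBA (braidTensorRight ΨBA D.braiding)
  coact_mul : β ∘ₗ LinearMap.mul' K A =
    braidedTensorMul (LinearMap.mul' K A) D.mul ΨBA ∘ₗ TensorProduct.map β β
  coact_comul : (TensorProduct.assoc K A B B).toLinearMap ∘ₗ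
      TensorProduct.map β (LinearMap.id : B →ₗ[K] B) ∘ₗ β =
    TensorProduct.map (LinearMap.id : A →ₗ[K] A) D.comul ∘ₗ β
  coact_counit : ∀ a : A,
    TensorProduct.map (LinearMap.id : A →ₗ[K] A) D.counit (β a) = a ⊗ₜ (1 : K)

/-! ### Dual quasitriangular bialgebras and transmutation -/

/-- The opposite coproduct `a ↦ a₂ ⊗ a₁`. -/
noncomputable def comulOp (K M : Type*) [Field K] [Semiring M] [Bialgebra K M] :
    M →ₗ[K] M ⊗[K] M :=
  (TensorProduct.comm K M M).toLinearMap ∘ₗ Coalgebra.comul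

/-- With `δ(a) = a' ⊗ a''` and `δ'(b) = b' ⊗ b''`, the map `a ⊗ b ↦ f(a', b') g(a'', b'')`. -/
noncomputable def convWith {K M : Type*} [Field K] [AddCommMonoid M] [Module K M]
    (f g : M ⊗[K] M →ₗ[K] K) (δ δ' : M →ₗ[K] M ⊗[K] M) : M ⊗[K] M →ₗ[K] K :=
  LinearMap.mul' K K ∘ₗ TensorProduct.map f g ∘ₗ
    (TensorProduct.tensorTensorTensorComm K M M M M).toLinearMap ∘ₗ TensorProduct.map δ δ'

/-- With `δ(a) = a' ⊗ a''` and `δ'(b) = b' ⊗ b''`, the map `a ⊗ b ↦ f(a', b') a'' ⊗ b''`. -/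
noncomputable def actWith {K M : Type*} [Field K] [AddCommMonoid M] [Module K M]
    (f : M ⊗[K] M →ₗ[K] K) (δ δ' : M →ₗ[K] M ⊗[K] M) : M ⊗[K] M →ₗ[K] M ⊗[K] M :=
  (TensorProduct.lid K (M ⊗[K] M)).toLinearMap ∘ₗ
    TensorProduct.map f (LinearMap.id : M ⊗[K] M →ₗ[K] M ⊗[K] M) ∘ₗ
    (TensorProduct.tensorTensorTensorComm K M M M M).toLinearMap ∘ₗ TensorProduct.map δ δ'

/-- The functional `a ⊗ b ↦ ε(a) ε(b)`. -/
noncomputable def counitPair (K M : Type*) [Field K] [Semiring M] [Bialgebra K M] :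
    M ⊗[K] M →ₗ[K] K :=
  LinearMap.mul' K K ∘ₗ TensorProduct.map Coalgebra.counit Coalgebra.counit

/-- A dual quasitriangular structure `𝓡 = form` on a bialgebra, with its convolution inverse. -/
structure DualQuasitriangular (K M : Type*) [Field K] [Semiring M] [Bialgebra K M] where
  form : M ⊗[K] M →ₗ[K] K
  inv : M ⊗[K] M →ₗ[K] K
  form_inv : convWith form inv Coalgebra.comul Coalgebra.comul = counitPair K M
  inv_form : convWith inv form Coalgebra.comul Coalgebra.comul = counitPair K M
  /-- `𝓡(ab, c) = 𝓡(a, c₁) 𝓡(b, c₂)` -/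
  form_mul_left : ∀ a b c : M, form ((a * b) ⊗ₜ c) =
    LinearMap.mul' K K (TensorProduct.map form form
      (TensorProduct.tensorTensorTensorComm K M M M M ((a ⊗ₜ b) ⊗ₜ Coalgebra.comul c)))
  /-- `𝓡(a, bc) = 𝓡(a₁, c) 𝓡(a₂, b)` -/
  form_mul_right : ∀ a b c : M, form (a ⊗ₜ (b * c)) =
    LinearMap.mul' K K (TensorProduct.map form form
      (TensorProduct.tensorTensorTensorComm K M M M M (Coalgebra.comul a ⊗ₜ (c ⊗ₜ b))))
  /-- `b₁ a₁ 𝓡(a₂, b₂) = 𝓡(a₁, b₁) a₂ b₂` -/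
  form_comm : ∀ a b : M,
    LinearMap.mul' K M (TensorProduct.comm K M M
        (actWith form (comulOp K M) (comulOp K M) (a ⊗ₜ b))) =
      LinearMap.mul' K M (actWith form Coalgebra.comul Coalgebra.comul (a ⊗ₜ b))

/-- The second inverse `𝓡̃ = til` of a dual quasitriangular structure `𝓡`:
`𝓡̃(a₁, b₂) 𝓡(a₂, b₁) = ε(a) ε(b) = 𝓡(a₁, b₂) 𝓡̃(a₂, b₁)`. It is unique if it exists, and
`𝓡̃(a, b) = 𝓡(a, S b)` when there is an antipode `S`. -/
structure DualQuasitriangular.SecondInverse {K M : Type*} [Field K] [Semiring M] [Bialgebra K M]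
    (Q : DualQuasitriangular K M) where
  til : M ⊗[K] M →ₗ[K] K
  til_form : convWith til Q.form Coalgebra.comul (comulOp K M) = counitPair K M
  form_til : convWith Q.form til Coalgebra.comul (comulOp K M) = counitPair K M

/-- The transmutation of a dual quasitriangular bialgebra `M`: the same unit and coalgebra, with
product `a · b = 𝓡(a₁, b₂) a₂ b₃ 𝓡̃(a₃, b₁)` and braiding
`a ⊗ b ↦ 𝓡(a₁, b₂) 𝓡⁻¹(a₂, b₄) 𝓡(a₄, b₅) 𝓡̃(a₅, b₁) b₃ ⊗ a₃`. When there is an antipode, so that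
`𝓡⁻¹(a, b) = 𝓡(S a, b)` and `𝓡̃(a, b) = 𝓡(a, S b)`, these are the usual expressions
`a₂ b₂ 𝓡((S a₁) a₃, S b₁)` and `b₂ ⊗ a₂ 𝓡((S a₁) a₃, (S b₁) b₃)`, the latter being the braiding
of comodules for the right adjoint coaction `a ↦ a₂ ⊗ (S a₁) a₃`. -/
noncomputable def transmutation {K M : Type*} [Field K] [Semiring M] [Bialgebra K M]
    (Q : DualQuasitriangular K M) (S : Q.SecondInverse) : BraidedBialgebraData K M where
  mul := LinearMap.mul' K M ∘ₗ actWith Q.form Coalgebra.comul Coalgebra.comul ∘ₗ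
    actWith S.til (comulOp K M) Coalgebra.comul
  one := 1
  comul := Coalgebra.comul
  counit := Coalgebra.counit
  braiding := (TensorProduct.comm K M M).toLinearMap ∘ₗ
    actWith Q.inv Coalgebra.comul (comulOp K M) ∘ₗ
    actWith Q.form Coalgebra.comul Coalgebra.comul ∘ₗ
    actWith Q.form (comulOp K M) (comulOp K M) ∘ₗ
    actWith S.til (comulOp K M) Coalgebra.comul

/-! ### Matrices and compact notation

A matrix `R` indexed by pairs stands for the element of `Mₙ ⊗ Mₙ` with
`R (i, k) (j, l) = Rⁱⱼᵏₗ`. -/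

/-- `x₁ = x ⊗ id`. -/
def leg₁ {ι S : Type*} [DecidableEq ι] [Zero S] (x : Matrix ι ι S) :
    Matrix (ι × ι) (ι × ι) S :=
  Matrix.of fun p q => if p.2 = q.2 then x p.1 q.1 else 0

/-- `x₂ = id ⊗ x`. -/
def leg₂ {ι S : Type*} [DecidableEq ι] [Zero S] (x : Matrix ι ι S) :
    Matrix (ι × ι) (ι × ι) S :=
  Matrix.of fun p q => if p.1 = q.1 then x p.2 q.2 else 0

/-- `R₂₁`, with both tensor factors exchanged. -/
def flip₂₁ {ι S : Type*} (R : Matrix (ι × ι) (ι × ι) S) : Matrix (ι × ι) (ι × ι) S :=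
  Matrix.of fun p q => R (p.2, p.1) (q.2, q.1)

/-- `R ^ t₂`, the transpose in the second tensor factor. -/
def transpose₂ {ι S : Type*} (R : Matrix (ι × ι) (ι × ι) S) : Matrix (ι × ι) (ι × ι) S :=
  Matrix.of fun p q => R (p.1, q.2) (q.1, p.2)

/-- `R̃ = ((R ^ t₂)⁻¹) ^ t₂`. -/
noncomputable def tildeMatrix {ι K : Type*} [Fintype ι] [DecidableEq ι] [Field K]
    (R : Matrix (ι × ι) (ι × ι) K) : Matrix (ι × ι) (ι × ι) K :=
  transpose₂ (transpose₂ R)⁻¹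

/-- A scalar matrix viewed as a matrix over a `K`-algebra. -/
def scalars {m n K : Type*} (S : Type*) [Field K] [Semiring S] [Algebra K S]
    (X : Matrix m n K) : Matrix m n S :=
  X.map (algebraMap K S)

/-- The structure constants `cᵢⱼˡ`, `eᵢ eⱼ = ∑ cᵢⱼˡ eₗ`, as the matrix `l, (i, j) ↦ cᵢⱼˡ`. -/
noncomputable def structureMatrix {ι K A : Type*} [Field K] [NonUnitalRing A]
    [Module K A] (e : Module.Basis ι K A) : Matrix ι (ι × ι) K :=
  Matrix.of fun l p => e.repr (e p.1 * e p.2) l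

/-- The matrix of generators of the free algebra. -/
def freeGen (K ι : Type*) [Field K] : Matrix ι ι (FreeAlgebra K (ι × ι)) :=
  Matrix.of fun i j => FreeAlgebra.ι K (i, j)

/-! ### The dual quasitriangular comeasuring bialgebra -/

/-- The relations `R t₁ t₂ = t₂ t₁ R` and `t₃ c₁₂³ = c₁₂³ t₁ t₂`. -/
inductive ComeasuringRel {K ι : Type*} [Field K] [Fintype ι] [DecidableEq ι]
    (R : Matrix (ι × ι) (ι × ι) K) (c : Matrix ι (ι × ι) K) :
    FreeAlgebra K (ι × ι) → FreeAlgebra K (ι × ι) → Prop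
  | quantum (p q : ι × ι) : ComeasuringRel R c
      ((scalars (FreeAlgebra K (ι × ι)) R * leg₁ (freeGen K ι) * leg₂ (freeGen K ι)) p q)
      ((leg₂ (freeGen K ι) * leg₁ (freeGen K ι) * scalars (FreeAlgebra K (ι × ι)) R) p q)
  | comeasure (l : ι) (q : ι × ι) : ComeasuringRel R c
      ((freeGen K ι * scalars (FreeAlgebra K (ι × ι)) c) l q)
      ((scalars (FreeAlgebra K (ι × ι)) c * leg₁ (freeGen K ι) * leg₂ (freeGen K ι)) l q)

/-- The algebra `M₁(R, A)`, for `A` with structure constants `c`. -/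
abbrev Comeasuring {K ι : Type*} [Field K] [Fintype ι] [DecidableEq ι]
    (R : Matrix (ι × ι) (ι × ι) K) (c : Matrix ι (ι × ι) K) : Type _ :=
  RingQuot (ComeasuringRel R c)

/-- The matrix `t` of generators of `M₁(R, A)`. -/
noncomputable def tGen {K ι : Type*} [Field K] [Fintype ι] [DecidableEq ι]
    (R : Matrix (ι × ι) (ι × ι) K) (c : Matrix ι (ι × ι) K) : Matrix ι ι (Comeasuring R c) :=
  Matrix.of fun i j => RingQuot.mkAlgHom K (ComeasuringRel R c) (freeGen K ι i j)

theorem leg₁_mul {ι S : Type*} [Fintype ι] [DecidableEq ι] [Semiring S] (x y : Matrix ι ι S) :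
    leg₁ (x * y) = leg₁ x * leg₁ y := by
  ext p q
  by_cases h : p.2 = q.2
  · simp [leg₁, Matrix.mul_apply, Fintype.sum_prod_type, h]
  · simp [leg₁, Matrix.mul_apply, Fintype.sum_prod_type, h]

theorem leg₂_mul {ι S : Type*} [Fintype ι] [DecidableEq ι] [Semiring S] (x y : Matrix ι ι S) :
    leg₂ (x * y) = leg₂ x * leg₂ y := by
  ext p q
  by_cases h : p.1 = q.1
  · simp [leg₂, Matrix.mul_apply, Fintype.sum_prod_type, h]
  · simp [leg₂, Matrix.mul_apply, Fintype.sum_prod_type, h]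

theorem leg₁_mul_leg₂ {ι S : Type*} [Fintype ι] [DecidableEq ι] [Semiring S]
    (x y : Matrix ι ι S) (p q : ι × ι) :
    (leg₁ x * leg₂ y) p q = x p.1 q.1 * y p.2 q.2 := by
  simp [leg₁, leg₂, Matrix.mul_apply, Fintype.sum_prod_type]

theorem leg₂_mul_leg₁ {ι S : Type*} [Fintype ι] [DecidableEq ι] [Semiring S]
    (x y : Matrix ι ι S) (p q : ι × ι) :
    (leg₂ y * leg₁ x) p q = y p.2 q.2 * x p.1 q.1 := by
  simp [leg₁, leg₂, Matrix.mul_apply, Fintype.sum_prod_type]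

theorem leg₁_comm_leg₂ {ι S : Type*} [Fintype ι] [DecidableEq ι] [Semiring S]
    {x y : Matrix ι ι S} (h : ∀ i j a b, Commute (x i j) (y a b)) :
    leg₁ x * leg₂ y = leg₂ y * leg₁ x := by
  ext p q
  rw [leg₁_mul_leg₂, leg₂_mul_leg₁]
  exact h _ _ _ _

theorem leg₁_map {ι S T : Type*} [DecidableEq ι] [Semiring S] [Semiring T] (f : S →+* T)
    (x : Matrix ι ι S) : (leg₁ x).map f = leg₁ (x.map f) := by
  ext p q
  by_cases h : p.2 = q.2 <;> simp [leg₁, h]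

theorem leg₂_map {ι S T : Type*} [DecidableEq ι] [Semiring S] [Semiring T] (f : S →+* T)
    (x : Matrix ι ι S) : (leg₂ x).map f = leg₂ (x.map f) := by
  ext p q
  by_cases h : p.1 = q.1 <;> simp [leg₂, h]

theorem scalars_map {m n K S T : Type*} [Field K] [Semiring S] [Semiring T] [Algebra K S]
    [Algebra K T] (f : S →ₐ[K] T) (X : Matrix m n K) :
    (scalars S X).map (f : S →+* T) = scalars T X := by
  ext p q
  simp [scalars]

/-- `x` satisfies the defining relations of `M₁(R, A)`. -/
def SatisfiesComeasuring {K ι S : Type*} [Field K] [Fintype ι] [DecidableEq ι]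
    [Semiring S] [Algebra K S] (R : Matrix (ι × ι) (ι × ι) K) (c : Matrix ι (ι × ι) K)
    (x : Matrix ι ι S) : Prop :=
  scalars S R * leg₁ x * leg₂ x = leg₂ x * leg₁ x * scalars S R ∧
    x * scalars S c = scalars S c * leg₁ x * leg₂ x

theorem SatisfiesComeasuring.map {K ι S T : Type*} [Field K] [Fintype ι] [DecidableEq ι]
    [Semiring S] [Algebra K S] [Semiring T] [Algebra K T] {R : Matrix (ι × ι) (ι × ι) K}
    {c : Matrix ι (ι × ι) K} {x : Matrix ι ι S} (h : SatisfiesComeasuring R c x)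
    (f : S →ₐ[K] T) : SatisfiesComeasuring R c (x.map f) := by
  have h1 := congrArg (fun X => X.map (f : S →+* T)) h.1
  have h2 := congrArg (fun X => X.map (f : S →+* T)) h.2
  simp only [Matrix.map_mul, leg₁_map, leg₂_map, scalars_map] at h1 h2
  exact ⟨h1, h2⟩

theorem satisfiesComeasuring_tGen {K ι : Type*} [Field K] [Fintype ι] [DecidableEq ι]
    (R : Matrix (ι × ι) (ι × ι) K) (c : Matrix ι (ι × ι) K) :
    SatisfiesComeasuring R c (tGen R c) := by
  let π := RingQuot.mkAlgHom K (ComeasuringRel R c)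
  have ht : tGen R c = (freeGen K ι).map (π : FreeAlgebra K (ι × ι) →+* Comeasuring R c) := rfl
  have h1 : (scalars (FreeAlgebra K (ι × ι)) R * leg₁ (freeGen K ι) * leg₂ (freeGen K ι)).map
        (π : FreeAlgebra K (ι × ι) →+* Comeasuring R c) =
      (leg₂ (freeGen K ι) * leg₁ (freeGen K ι) * scalars (FreeAlgebra K (ι × ι)) R).map
        (π : FreeAlgebra K (ι × ι) →+* Comeasuring R c) := by
    ext p q
    exact RingQuot.mkAlgHom_rel K (ComeasuringRel.quantum p q)
  have h2 : (freeGen K ι * scalars (FreeAlgebra K (ι × ι)) c).map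
        (π : FreeAlgebra K (ι × ι) →+* Comeasuring R c) =
      (scalars (FreeAlgebra K (ι × ι)) c * leg₁ (freeGen K ι) * leg₂ (freeGen K ι)).map
        (π : FreeAlgebra K (ι × ι) →+* Comeasuring R c) := by
    ext p q
    exact RingQuot.mkAlgHom_rel K (ComeasuringRel.comeasure p q)
  simp only [Matrix.map_mul, leg₁_map, leg₂_map, scalars_map, ← ht] at h1 h2
  exact ⟨h1, h2⟩

/-- Universal property of the algebra `M₁(R, A)`. -/
noncomputable def Comeasuring.lift {K ι S : Type*} [Field K] [Fintype ι] [DecidableEq ι]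
    [Semiring S] [Algebra K S] {R : Matrix (ι × ι) (ι × ι) K} {c : Matrix ι (ι × ι) K}
    (x : Matrix ι ι S) (h : SatisfiesComeasuring R c x) : Comeasuring R c →ₐ[K] S :=
  RingQuot.liftAlgHom K ⟨FreeAlgebra.lift K fun p : ι × ι => x p.1 p.2, by
    have hx : (freeGen K ι).map
        ((FreeAlgebra.lift K fun p : ι × ι => x p.1 p.2 : FreeAlgebra K (ι × ι) →ₐ[K] S) :
          FreeAlgebra K (ι × ι) →+* S) = x := by
      ext i j
      simp [freeGen]
    intro a b hab
    cases hab with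
    | quantum p q =>
      have := congrFun (congrFun h.1 p) q
      rw [← hx] at this
      simp only [← leg₁_map, ← leg₂_map, ← scalars_map
        (FreeAlgebra.lift K fun p : ι × ι => x p.1 p.2), ← Matrix.map_mul] at this
      exact this
    | comeasure l q =>
      have := congrFun (congrFun h.2 l) q
      rw [← hx] at this
      simp only [← leg₁_map, ← leg₂_map, ← scalars_map
        (FreeAlgebra.lift K fun p : ι × ι => x p.1 p.2), ← Matrix.map_mul] at this
      exact this⟩

theorem Comeasuring.lift_tGen {K ι S : Type*} [Field K] [Fintype ι] [DecidableEq ι]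
    [Semiring S] [Algebra K S] {R : Matrix (ι × ι) (ι × ι) K} {c : Matrix ι (ι × ι) K}
    (x : Matrix ι ι S) (h : SatisfiesComeasuring R c x) (i j : ι) :
    Comeasuring.lift x h (tGen R c i j) = x i j := by
  simp [Comeasuring.lift, tGen, freeGen]

theorem Comeasuring.hom_ext {K ι S : Type*} [Field K] [Fintype ι] [DecidableEq ι]
    [Semiring S] [Algebra K S] {R : Matrix (ι × ι) (ι × ι) K} {c : Matrix ι (ι × ι) K}
    {f g : Comeasuring R c →ₐ[K] S} (h : ∀ i j, f (tGen R c i j) = g (tGen R c i j)) :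
    f = g := by
  apply RingQuot.ringQuot_ext'
  apply FreeAlgebra.hom_ext
  funext p
  exact h p.1 p.2

theorem satisfiesComeasuring_one {K ι : Type*} [Field K] [Fintype ι] [DecidableEq ι]
    (R : Matrix (ι × ι) (ι × ι) K) (c : Matrix ι (ι × ι) K) :
    SatisfiesComeasuring R c (1 : Matrix ι ι K) := by
  have h1 : leg₁ (1 : Matrix ι ι K) = 1 := by
    ext p q
    simp only [leg₁, Matrix.of_apply, Matrix.one_apply, Prod.ext_iff]
    split_ifs <;> simp_all
  have h2 : leg₂ (1 : Matrix ι ι K) = 1 := by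
    ext p q
    simp only [leg₂, Matrix.of_apply, Matrix.one_apply, Prod.ext_iff]
    split_ifs <;> simp_all
  constructor <;> simp [h1, h2]

theorem SatisfiesComeasuring.mul {K ι S : Type*} [Field K] [Fintype ι] [DecidableEq ι]
    [Semiring S] [Algebra K S] {R : Matrix (ι × ι) (ι × ι) K} {c : Matrix ι (ι × ι) K}
    {x y : Matrix ι ι S} (hx : SatisfiesComeasuring R c x) (hy : SatisfiesComeasuring R c y)
    (h : ∀ i j a b, Commute (x i j) (y a b)) : SatisfiesComeasuring R c (x * y) := by
  have e1 : leg₁ y * leg₂ x = leg₂ x * leg₁ y :=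
    leg₁_comm_leg₂ fun i j a b => (h a b i j).symm
  have e2 : leg₁ x * leg₂ y = leg₂ y * leg₁ x := leg₁_comm_leg₂ h
  constructor
  · calc scalars S R * leg₁ (x * y) * leg₂ (x * y)
        = scalars S R * leg₁ x * (leg₁ y * leg₂ x) * leg₂ y := by
          simp only [leg₁_mul, leg₂_mul, Matrix.mul_assoc]
      _ = (scalars S R * leg₁ x * leg₂ x) * leg₁ y * leg₂ y := by
          simp only [e1, Matrix.mul_assoc]
      _ = leg₂ x * leg₁ x * (scalars S R * leg₁ y * leg₂ y) := by
          simp only [hx.1, Matrix.mul_assoc]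
      _ = leg₂ x * (leg₁ x * leg₂ y) * leg₁ y * scalars S R := by
          simp only [hy.1, Matrix.mul_assoc]
      _ = leg₂ (x * y) * leg₁ (x * y) * scalars S R := by
          simp only [e2, leg₁_mul, leg₂_mul, Matrix.mul_assoc]
  · calc x * y * scalars S c = (x * scalars S c) * leg₁ y * leg₂ y := by
          simp only [hy.2, Matrix.mul_assoc]
      _ = scalars S c * leg₁ x * (leg₂ x * leg₁ y) * leg₂ y := by
          simp only [hx.2, Matrix.mul_assoc]
      _ = scalars S c * leg₁ (x * y) * leg₂ (x * y) := by
          simp only [← e1, leg₁_mul, leg₂_mul, Matrix.mul_assoc]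

/-- The matrix `∑ tⁱₐ ⊗ tᵃⱼ`. -/
noncomputable def tComul {K ι : Type*} [Field K] [Fintype ι] [DecidableEq ι]
    (R : Matrix (ι × ι) (ι × ι) K) (c : Matrix ι (ι × ι) K) :
    Matrix ι ι (Comeasuring R c ⊗[K] Comeasuring R c) :=
  Matrix.of fun i j => ∑ a, tGen R c i a ⊗ₜ tGen R c a j

theorem satisfiesComeasuring_tComul {K ι : Type*} [Field K] [Fintype ι] [DecidableEq ι]
    (R : Matrix (ι × ι) (ι × ι) K) (c : Matrix ι (ι × ι) K) :
    SatisfiesComeasuring R c (tComul R c) := by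
  have hx : tComul R c = (tGen R c).map
        (Algebra.TensorProduct.includeLeft :
          Comeasuring R c →ₐ[K] Comeasuring R c ⊗[K] Comeasuring R c) *
      (tGen R c).map
        (Algebra.TensorProduct.includeRight :
          Comeasuring R c →ₐ[K] Comeasuring R c ⊗[K] Comeasuring R c) := by
    ext i j
    simp [tComul, Matrix.mul_apply]
  rw [hx]
  exact ((satisfiesComeasuring_tGen R c).map _).mul ((satisfiesComeasuring_tGen R c).map _)
    fun i j a b => by simp [Commute, SemiconjBy]

/-- The matrix coalgebra `Δ tⁱⱼ = ∑ tⁱₐ ⊗ tᵃⱼ`, `ε tⁱⱼ = δⁱⱼ` makes `M₁(R, A)` a bialgebra. -/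
noncomputable instance Comeasuring.instBialgebra {K ι : Type*} [Field K] [Fintype ι]
    [DecidableEq ι] (R : Matrix (ι × ι) (ι × ι) K) (c : Matrix ι (ι × ι) K) :
    Bialgebra K (Comeasuring R c) :=
  Bialgebra.ofAlgHom (Comeasuring.lift (tComul R c) (satisfiesComeasuring_tComul R c))
    (Comeasuring.lift (1 : Matrix ι ι K) (satisfiesComeasuring_one R c))
    (Comeasuring.hom_ext fun i j => by
      simp [Comeasuring.lift_tGen, tComul, TensorProduct.tmul_sum, TensorProduct.sum_tmul]
      exact Finset.sum_comm)
    (Comeasuring.hom_ext fun i j => by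
      simp [Comeasuring.lift_tGen, tComul, Matrix.one_apply, TensorProduct.ite_tmul])
    (Comeasuring.hom_ext fun i j => by
      simp [Comeasuring.lift_tGen, tComul, Matrix.one_apply, TensorProduct.tmul_ite])

/-! ### The braided comeasuring bialgebra -/

/-- The relations `R₂₁ u₁ R u₂ = u₂ R₂₁ u₁ R` and `u₃ c₁₂³ = c₁₂³ R⁻¹ u₁ R u₂`. -/
inductive BraidedComeasuringRel {K ι : Type*} [Field K] [Fintype ι] [DecidableEq ι]
    (R : Matrix (ι × ι) (ι × ι) K) (c : Matrix ι (ι × ι) K) :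
    FreeAlgebra K (ι × ι) → FreeAlgebra K (ι × ι) → Prop
  | braided (p q : ι × ι) : BraidedComeasuringRel R c
      ((scalars (FreeAlgebra K (ι × ι)) (flip₂₁ R) * leg₁ (freeGen K ι) * scalars (FreeAlgebra K (ι × ι)) R * leg₂ (freeGen K ι)) p q)
      ((leg₂ (freeGen K ι) * scalars (FreeAlgebra K (ι × ι)) (flip₂₁ R) * leg₁ (freeGen K ι) * scalars (FreeAlgebra K (ι × ι)) R) p q)
  | comeasure (l : ι) (q : ι × ι) : BraidedComeasuringRel R c
      ((freeGen K ι * scalars (FreeAlgebra K (ι × ι)) c) l q)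
      ((scalars (FreeAlgebra K (ι × ι)) c * scalars (FreeAlgebra K (ι × ι)) R⁻¹ * leg₁ (freeGen K ι) * scalars (FreeAlgebra K (ι × ι)) R *
        leg₂ (freeGen K ι)) l q)

/-- The algebra of the braided comeasuring bialgebra. -/
abbrev BraidedComeasuring {K ι : Type*} [Field K] [Fintype ι] [DecidableEq ι]
    (R : Matrix (ι × ι) (ι × ι) K) (c : Matrix ι (ι × ι) K) : Type _ :=
  RingQuot (BraidedComeasuringRel R c)

/-- The matrix `u` of generators of the braided comeasuring bialgebra. -/
noncomputable def uGen {K ι : Type*} [Field K] [Fintype ι] [DecidableEq ι]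
    (R : Matrix (ι × ι) (ι × ι) K) (c : Matrix ι (ι × ι) K) :
    Matrix ι ι (BraidedComeasuring R c) :=
  Matrix.of fun i j => RingQuot.mkAlgHom K (BraidedComeasuringRel R c) (freeGen K ι i j)

/-- `D` is the braided bialgebra structure of the braided comeasuring bialgebra: its algebra is
the one presented above, and its coalgebra and braiding are the stated ones on the generators. -/
structure IsBraidedComeasuringStructure {K ι : Type*} [Field K] [Fintype ι] [DecidableEq ι]
    (R : Matrix (ι × ι) (ι × ι) K) (c : Matrix ι (ι × ι) K)
    (D : BraidedBialgebraData K (BraidedComeasuring R c)) : Prop where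
  isBraidedBialgebra : D.IsBraidedBialgebra
  mul_eq : D.mul = LinearMap.mul' K (BraidedComeasuring R c)
  one_eq : D.one = 1
  comul_gen : ∀ i j, D.comul (uGen R c i j) = ∑ a, uGen R c i a ⊗ₜ uGen R c a j
  counit_gen : ∀ i j, D.counit (uGen R c i j) = if i = j then 1 else 0
  braiding_gen : ∀ i j k l, D.braiding (uGen R c i j ⊗ₜ uGen R c k l) =
    ∑ m, ∑ n, ∑ r, ∑ s, (∑ a, ∑ b, ∑ x, ∑ d,
      R (i, d) (a, m) * R⁻¹ (a, n) (r, b) * R (s, b) (x, l) * tildeMatrix R (x, k) (j, d)) •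
        (uGen R c m n ⊗ₜ[K] uGen R c r s)

open TensorProduct (add_tmul tmul_add map_tmul assoc_tmul assoc_symm_tmul comm_tmul smul_tmul'
  tmul_smul sum_tmul tmul_sum tensorTensorTensorComm_tmul rightComm_tmul tensorTensorTensorComm
  rightComm curry_apply)
open LinearMap (comp_apply comp_assoc rTensor_tmul lTensor_tmul restrictScalars_self mul'
  mul'_apply rTensor_comp convMul_apply)
open LinearEquiv (coe_coe)
open Finset (sum_congr sum_comm)

/-! ### Coactions and the operators they induce -/

section Slots

variable {K C D E W W' W'' : Type*} [Field K] [AddCommMonoid C] [Module K C]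
  [AddCommMonoid D] [Module K D] [AddCommMonoid E] [Module K E] [AddCommMonoid W] [Module K W]
  [AddCommMonoid W'] [Module K W'] [AddCommMonoid W''] [Module K W'']

/-- For a coaction `w ↦ w₀ ⊗ w₁`, the map `w ↦ Φ(w₁)(w₀)`. -/
noncomputable def coev (δ : W →ₗ[K] W ⊗[K] C) (Φ : C →ₗ[K] W →ₗ[K] W') : W →ₗ[K] W' :=
  TensorProduct.lift Φ.flip ∘ₗ δ

/-- For a coaction `w ↦ w₀ ⊗ w₁`, the operator `w ↦ φ(w₁) w₀`. -/
noncomputable def evalFun (δ : W →ₗ[K] W ⊗[K] C) : (C →ₗ[K] K) →ₗ[K] Module.End K W where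
  toFun φ := (TensorProduct.rid K W).toLinearMap ∘ₗ φ.lTensor W ∘ₗ δ
  map_add' φ ψ := by
    ext w; simp [LinearMap.lTensor_add]
  map_smul' a φ := by
    ext w; simp [LinearMap.lTensor_smul]

theorem evalFun_apply (δ : W →ₗ[K] W ⊗[K] C) (φ : C →ₗ[K] K) (w : W) :
    evalFun δ φ w = TensorProduct.rid K W (φ.lTensor W (δ w)) := rfl

theorem coev_apply (δ : W →ₗ[K] W ⊗[K] C) (Φ : C →ₗ[K] W →ₗ[K] W') (w : W) :
    coev δ Φ w = TensorProduct.lift Φ.flip (δ w) := rfl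

/-- Two successive coactions, as a coaction of the tensor product. -/
noncomputable def joint (δ : W →ₗ[K] W ⊗[K] C) (ε : W →ₗ[K] W ⊗[K] D) :
    W →ₗ[K] W ⊗[K] (C ⊗[K] D) :=
  (TensorProduct.assoc K W C D).toLinearMap ∘ₗ δ.rTensor D ∘ₗ ε

/-- The operator `w ↦ f(w_δ, w_ε) w₀`. -/
noncomputable def pairOp (f : C ⊗[K] D →ₗ[K] K) (δ : W →ₗ[K] W ⊗[K] C)
    (ε : W →ₗ[K] W ⊗[K] D) : Module.End K W :=
  evalFun (joint δ ε) f

/-- `p` is colinear. -/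
def Colin (p : W →ₗ[K] W') (δ : W →ₗ[K] W ⊗[K] C) (δ' : W' →ₗ[K] W' ⊗[K] C) : Prop :=
  δ' ∘ₗ p = p.rTensor C ∘ₗ δ

theorem Colin.apply {p : W →ₗ[K] W'} {δ : W →ₗ[K] W ⊗[K] C} {δ' : W' →ₗ[K] W' ⊗[K] C}
    (h : Colin p δ δ') (w : W) : δ' (p w) = p.rTensor C (δ w) := LinearMap.congr_fun h w

/-- The coactions commute. -/
def CoComm (δ : W →ₗ[K] W ⊗[K] C) (ε : W →ₗ[K] W ⊗[K] D) : Prop :=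
  δ.rTensor D ∘ₗ ε = (rightComm K W D C).toLinearMap ∘ₗ ε.rTensor C ∘ₗ δ

theorem CoComm.symm {δ : W →ₗ[K] W ⊗[K] C} {ε : W →ₗ[K] W ⊗[K] D} (h : CoComm δ ε) :
    CoComm ε δ := by
  unfold CoComm at *
  rw [h, ← comp_assoc]
  have : (rightComm K W C D).toLinearMap ∘ₗ
      (rightComm K W D C).toLinearMap = LinearMap.id := by
    ext; simp
  rw [this, LinearMap.id_comp]

theorem CoComm.apply {δ : W →ₗ[K] W ⊗[K] C} {ε : W →ₗ[K] W ⊗[K] D} (h : CoComm δ ε) (w : W) :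
    δ.rTensor D (ε w) = rightComm K W D C (ε.rTensor C (δ w)) :=
  LinearMap.congr_fun h w

/-- `δ` is a coassociative counital coaction of `C` with coproduct `d` and counit `e`. -/
structure IsSlot (d : C →ₗ[K] C ⊗[K] C) (e : C →ₗ[K] K) (δ : W →ₗ[K] W ⊗[K] C) : Prop where
  coassoc : joint δ δ = d.lTensor W ∘ₗ δ
  counit : evalFun δ e = 1

theorem coev_comp {δ : W →ₗ[K] W ⊗[K] C} {δ' : W' →ₗ[K] W' ⊗[K] C} {p : W →ₗ[K] W'}
    (h : Colin p δ δ') (Φ : C →ₗ[K] W' →ₗ[K] W'') (Φ' : C →ₗ[K] W →ₗ[K] W'')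
    (hΦ : ∀ m, Φ m ∘ₗ p = Φ' m) : coev δ' Φ ∘ₗ p = coev δ Φ' := by
  ext w
  simp only [comp_apply, coev_apply, h.apply]
  generalize δ w = t
  induction t with
  | zero => simp
  | add x y hx hy => simp only [map_add, hx, hy]
  | tmul w m => simp [← hΦ]

theorem comp_coev (δ : W →ₗ[K] W ⊗[K] C) {q : W' →ₗ[K] W''}
    (Φ : C →ₗ[K] W →ₗ[K] W') (Φ' : C →ₗ[K] W →ₗ[K] W'')
    (hΦ : ∀ m, q ∘ₗ Φ m = Φ' m) : q ∘ₗ coev δ Φ = coev δ Φ' := by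
  ext w
  simp only [comp_apply, coev_apply]
  generalize δ w = t
  induction t with
  | zero => simp
  | add x y hx hy => simp only [map_add, hx, hy]
  | tmul w m => simp [← hΦ]

theorem evalFun_comp {δ : W →ₗ[K] W ⊗[K] C} {δ' : W' →ₗ[K] W' ⊗[K] C} {p : W →ₗ[K] W'}
    (h : Colin p δ δ') (φ : C →ₗ[K] K) : evalFun δ' φ ∘ₗ p = p ∘ₗ evalFun δ φ := by
  ext w
  simp only [comp_apply, evalFun_apply, h.apply]
  generalize δ w = t
  induction t with
  | zero => simp
  | add x y hx hy => simp only [map_add, hx, hy]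
  | tmul w m => simp

theorem Colin.joint {δ : W →ₗ[K] W ⊗[K] C} {δ' : W' →ₗ[K] W' ⊗[K] C} {p : W →ₗ[K] W'}
    {ε : W →ₗ[K] W ⊗[K] D} {ε' : W' →ₗ[K] W' ⊗[K] D}
    (h : Colin p δ δ') (h' : Colin p ε ε') : Colin p (joint δ ε) (joint δ' ε') := by
  ext w
  simp only [comp_apply, _root_.joint, h'.apply]
  generalize ε w = t
  induction t with
  | zero => simp
  | add x y hx hy => simp only [map_add, hx, hy]
  | tmul w m =>
    simp only [rTensor_tmul, h.apply]
    generalize δ w = t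
    induction t with
    | zero => simp
    | add x y hx hy => simp only [map_add, add_tmul, hx, hy]
    | tmul w m => simp

theorem pairOp_comp {δ : W →ₗ[K] W ⊗[K] C} {δ' : W' →ₗ[K] W' ⊗[K] C} {p : W →ₗ[K] W'}
    {ε : W →ₗ[K] W ⊗[K] D} {ε' : W' →ₗ[K] W' ⊗[K] D}
    (h : Colin p δ δ') (h' : Colin p ε ε') (f : C ⊗[K] D →ₗ[K] K) :
    pairOp f δ' ε' ∘ₗ p = p ∘ₗ pairOp f δ ε :=
  evalFun_comp (h.joint h') f

theorem pairOp_eq_coev (f : C ⊗[K] D →ₗ[K] K) (δ : W →ₗ[K] W ⊗[K] C) (ε : W →ₗ[K] W ⊗[K] D) :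
    pairOp f δ ε = coev ε (evalFun δ ∘ₗ (TensorProduct.curry f).flip) := by
  ext w
  simp only [pairOp, joint, evalFun_apply, coev_apply, comp_apply]
  generalize ε w = t
  induction t with
  | zero => simp
  | add x y hx hy => simp only [map_add, hx, hy]
  | tmul w m =>
    simp only [rTensor_tmul, TensorProduct.lift.tmul, LinearMap.flip_apply,
      comp_apply, evalFun_apply]
    generalize δ w = t
    induction t with
    | zero => simp
    | add x y hx hy => simp only [map_add, add_tmul, hx, hy]
    | tmul w m => simp

theorem pairOp_flip {δ : W →ₗ[K] W ⊗[K] C} {ε : W →ₗ[K] W ⊗[K] D} (h : CoComm δ ε)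
    (f : C ⊗[K] D →ₗ[K] K) :
    pairOp f δ ε = pairOp (f ∘ₗ (TensorProduct.comm K D C).toLinearMap) ε δ := by
  ext w
  simp only [pairOp, joint, evalFun_apply, comp_apply, h.apply]
  generalize ε.rTensor C (δ w) = t
  induction t with
  | zero => simp
  | add x y hx hy => simp only [map_add, hx, hy]
  | tmul w m =>
    induction w with
    | zero => simp
    | add x y hx hy => simp only [map_add, add_tmul, hx, hy]
    | tmul w n => simp

theorem coev_mul_coev {d : C →ₗ[K] C ⊗[K] C} {e : C →ₗ[K] K} {δ : W →ₗ[K] W ⊗[K] C}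
    (h : IsSlot d e δ) (Φ Ψ : C →ₗ[K] Module.End K W) (hΨ : ∀ m, Colin (Ψ m) δ δ) :
    coev δ Φ ∘ₗ coev δ Ψ =
      coev δ (mul' K (Module.End K W) ∘ₗ TensorProduct.map Φ Ψ ∘ₗ d) := by
  let G : W ⊗[K] (C ⊗[K] C) →ₗ[K] W := TensorProduct.lift
    (LinearMap.flip (mul' K (Module.End K W) ∘ₗ TensorProduct.map Φ Ψ))
  have h1 : ∀ t : W ⊗[K] C, TensorProduct.lift Φ.flip (δ (TensorProduct.lift Ψ.flip t)) =
      G (TensorProduct.assoc K W C C (δ.rTensor C t)) := by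
    intro t
    induction t with
    | zero => simp
    | add x y hx hy => simp only [map_add, hx, hy]
    | tmul w y =>
      simp only [TensorProduct.lift.tmul, LinearMap.flip_apply, (hΨ y).apply,
        rTensor_tmul]
      generalize δ w = t
      induction t with
      | zero => simp
      | add x y hx hy => simp only [map_add, add_tmul, hx, hy]
      | tmul w m => simp [G]
  ext w
  simp only [comp_apply, coev_apply, h1]
  have h2 := LinearMap.congr_fun h.coassoc w
  simp only [joint, comp_apply, coe_coe] at h2
  rw [h2]
  generalize δ w = t
  induction t with
  | zero => simp
  | add x y hx hy => simp only [map_add, hx, hy]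
  | tmul w y => simp [G]

theorem evalFun_eq_coev (δ : W →ₗ[K] W ⊗[K] C) (φ : C →ₗ[K] K) :
    evalFun δ φ = coev δ (φ.smulRight (1 : Module.End K W)) := by
  ext w
  simp only [evalFun_apply, coev_apply]
  generalize δ w = t
  induction t with
  | zero => simp
  | add x y hx hy => simp only [map_add, hx, hy]
  | tmul w y => simp

theorem evalFun_mul {d : C →ₗ[K] C ⊗[K] C} {e : C →ₗ[K] K} {δ : W →ₗ[K] W ⊗[K] C}
    (h : IsSlot d e δ) (φ ψ : C →ₗ[K] K) :
    evalFun δ φ * evalFun δ ψ = evalFun δ (mul' K K ∘ₗ TensorProduct.map φ ψ ∘ₗ d) := by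
  rw [evalFun_eq_coev, evalFun_eq_coev, evalFun_eq_coev, Module.End.mul_eq_comp, coev_mul_coev h]
  · congr 1
    ext m : 1
    simp only [comp_apply, LinearMap.smulRight_apply]
    generalize d m = t
    induction t with
    | zero => simp
    | add x y hx hy => simp only [map_add, hx, hy, add_smul]
    | tmul w y => simp [smul_smul, mul_comm]
  · intro m
    ext w
    simp only [LinearMap.smulRight_apply, comp_apply, LinearMap.smul_apply, map_smul,
      LinearMap.rTensor_smul]
    congr 1
    exact (LinearMap.rTensor_id_apply C W (δ w)).symm

/-- A coaction commuting with `ε` gives operators that are colinear for `ε`. -/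
theorem CoComm.colin_evalFun {δ : W →ₗ[K] W ⊗[K] C} {ε : W →ₗ[K] W ⊗[K] D} (h : CoComm δ ε)
    (φ : C →ₗ[K] K) : Colin (evalFun δ φ) ε ε := by
  have key : ∀ t : W ⊗[K] C, ε (TensorProduct.rid K W (φ.lTensor W t)) =
      TensorProduct.rid K (W ⊗[K] D) (φ.lTensor (W ⊗[K] D) (ε.rTensor C t)) := by
    intro t
    induction t with
    | zero => simp
    | add x y hx hy => simp only [map_add, hx, hy]
    | tmul w y => simp
  ext w
  simp only [comp_apply, evalFun_apply, key, h.symm.apply]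
  generalize ε w = t
  induction t with
  | zero => simp
  | add x y hx hy => simp only [map_add, hx, hy]
  | tmul w y =>
    simp only [rTensor_tmul, evalFun_apply]
    generalize δ w = t
    induction t with
    | zero => simp
    | add x y hx hy => simp only [map_add, add_tmul, hx, hy]
    | tmul w m => simp [smul_tmul']

/-- A coaction commuting with `η`, evaluated on operators colinear for `η`. -/
theorem CoComm.colin_coev {ε : W →ₗ[K] W ⊗[K] D} {η : W →ₗ[K] W ⊗[K] E} (h : CoComm ε η)
    (Φ : D →ₗ[K] Module.End K W) (hΦ : ∀ m, Colin (Φ m) η η) : Colin (coev ε Φ) η η := by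
  have key : ∀ t : W ⊗[K] D, η (TensorProduct.lift Φ.flip t) =
      (TensorProduct.lift Φ.flip).rTensor E
        (rightComm K W E D (η.rTensor D t)) := by
    intro t
    induction t with
    | zero => simp
    | add x y hx hy => simp only [map_add, hx, hy]
    | tmul w m =>
      simp only [TensorProduct.lift.tmul, LinearMap.flip_apply, (hΦ m).apply,
        rTensor_tmul]
      generalize η w = t
      induction t with
      | zero => simp
      | add x y hx hy => simp only [map_add, add_tmul, hx, hy]
      | tmul w n => simp
  ext w
  simp only [comp_apply, coev_apply, key, h.symm.apply]
  generalize η w = t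
  induction t with
  | zero => simp
  | add x y hx hy => simp only [map_add, hx, hy]
  | tmul w m =>
    simp only [rTensor_tmul, coev_apply]
    generalize ε w = t
    induction t with
    | zero => simp
    | add x y hx hy => simp only [map_add, add_tmul, hx, hy]
    | tmul w n => simp

theorem colin_pairOp {δ : W →ₗ[K] W ⊗[K] C} {ε : W →ₗ[K] W ⊗[K] D}
    {η : W →ₗ[K] W ⊗[K] E} (h : CoComm δ η) (h' : CoComm ε η) (f : C ⊗[K] D →ₗ[K] K) :
    Colin (pairOp f δ ε) η η := by
  rw [pairOp_eq_coev]
  exact h'.colin_coev _ fun m => h.colin_evalFun _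

/-- Operators on disjoint pairs of coactions commute. -/
theorem commute_pairOp {E' : Type*} [AddCommMonoid E'] [Module K E'] {δ : W →ₗ[K] W ⊗[K] C}
    {ε : W →ₗ[K] W ⊗[K] D} {η : W →ₗ[K] W ⊗[K] E} {θ : W →ₗ[K] W ⊗[K] E'}
    (h1 : CoComm δ η) (h2 : CoComm δ θ) (h3 : CoComm ε η) (h4 : CoComm ε θ)
    (f : C ⊗[K] D →ₗ[K] K) (g : E ⊗[K] E' →ₗ[K] K) :
    Commute (pairOp f δ ε) (pairOp g η θ) :=
  (pairOp_comp (colin_pairOp h1 h3 f) (colin_pairOp h2 h4 f) g).symm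

end Slots

section PairSlots

variable {K M W W' : Type*} [Field K] [AddCommMonoid M] [Module K M]
  [AddCommMonoid W] [Module K W] [AddCommMonoid W'] [Module K W']

/-- With `u = c ⊗ d`, the functional `x ⊗ y ↦ f(x, c) g(y, d)`. -/
noncomputable def pairAt (f g : M ⊗[K] M →ₗ[K] K) :
    M ⊗[K] M →ₗ[K] M ⊗[K] M →ₗ[K] K :=
  TensorProduct.curry (mul' K K ∘ₗ TensorProduct.map f g ∘ₗ
    (tensorTensorTensorComm K M M M M).toLinearMap)

theorem pairAt_apply (f g : M ⊗[K] M →ₗ[K] K) (u v : M ⊗[K] M) : pairAt f g u v =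
    mul' K K (TensorProduct.map f g
      (tensorTensorTensorComm K M M M M (u ⊗ₜ v))) := rfl

@[simp]
theorem pairAt_tmul (f g : M ⊗[K] M →ₗ[K] K) (x y c d : M) :
    pairAt f g (x ⊗ₜ y) (c ⊗ₜ d) = f (x ⊗ₜ c) * g (y ⊗ₜ d) := by
  simp [pairAt]

theorem convWith_tmul (f g : M ⊗[K] M →ₗ[K] K) (δ δ' : M →ₗ[K] M ⊗[K] M) (x y : M) :
    convWith f g δ δ' (x ⊗ₜ y) = pairAt f g (δ x) (δ' y) := by
  simp [convWith, pairAt_apply]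

/-- `pairOp` as a linear map of the functional. -/
noncomputable def pairOpL (δ ε : W →ₗ[K] W ⊗[K] M) : (M ⊗[K] M →ₗ[K] K) →ₗ[K] Module.End K W :=
  evalFun (joint δ ε)

theorem pairOpL_apply (δ ε : W →ₗ[K] W ⊗[K] M) (f : M ⊗[K] M →ₗ[K] K) :
    pairOpL δ ε f = pairOp f δ ε := rfl

theorem evalFun_mul_evalFun (δ ε : W →ₗ[K] W ⊗[K] M) (φ ψ : M →ₗ[K] K) :
    evalFun δ φ * evalFun ε ψ =
      pairOp (mul' K K ∘ₗ TensorProduct.map φ ψ) δ ε := by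
  ext w
  simp only [Module.End.mul_apply, pairOp, joint, evalFun_apply, comp_apply]
  generalize ε w = t
  induction t with
  | zero => simp
  | add x y hx hy => simp only [map_add, hx, hy]
  | tmul w m =>
    simp only [lTensor_tmul, TensorProduct.rid_tmul, map_smul, rTensor_tmul]
    generalize δ w = t
    induction t with
    | zero => simp
    | add x y hx hy => simp only [map_add, add_tmul, hx, hy, smul_add]
    | tmul w m => simp [smul_smul, mul_comm]

/-- Operators with a common second coaction. -/
theorem pairOp_mul_pairOp {d : M →ₗ[K] M ⊗[K] M} {e : M →ₗ[K] K} {δ₁ δ₂ δ₃ : W →ₗ[K] W ⊗[K] M}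
    (h : IsSlot d e δ₃) (h23 : CoComm δ₂ δ₃) (f g : M ⊗[K] M →ₗ[K] K) :
    pairOp f δ₁ δ₃ * pairOp g δ₂ δ₃ = coev δ₃ (pairOpL δ₁ δ₂ ∘ₗ (pairAt f g).flip ∘ₗ d) := by
  rw [pairOp_eq_coev, pairOp_eq_coev, Module.End.mul_eq_comp, coev_mul_coev h]
  · congr 1
    ext m : 1
    simp only [comp_apply]
    generalize d m = t
    induction t with
    | zero => simp
    | add x y hx hy => simp only [map_add, hx, hy]
    | tmul w y =>
      simp only [map_tmul, mul'_apply, comp_apply,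
        evalFun_mul_evalFun, pairOpL_apply]
      congr 1
      ext a b
      simp
  · exact fun m => h23.colin_evalFun _

theorem evalFun_comm {δ ε : W →ₗ[K] W ⊗[K] M} (h : CoComm δ ε) (φ ψ : M →ₗ[K] K) :
    evalFun δ φ * evalFun ε ψ = evalFun ε ψ * evalFun δ φ :=
  (evalFun_comp (h.colin_evalFun φ) ψ).symm

theorem pairOp_mul_pairOp' {d : M →ₗ[K] M ⊗[K] M} {e : M →ₗ[K] K} {δ₁ δ₂ δ₃ : W →ₗ[K] W ⊗[K] M}
    (h : IsSlot d e δ₃) (h12 : CoComm δ₁ δ₂) (h13 : CoComm δ₁ δ₃) (f g : M ⊗[K] M →ₗ[K] K) :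
    pairOp g δ₂ δ₃ * pairOp f δ₁ δ₃ = coev δ₃ (pairOpL δ₁ δ₂ ∘ₗ (pairAt f g).flip ∘ₗ
      (TensorProduct.comm K M M).toLinearMap ∘ₗ d) := by
  rw [pairOp_eq_coev, pairOp_eq_coev, Module.End.mul_eq_comp, coev_mul_coev h]
  · congr 1
    ext m : 1
    simp only [comp_apply]
    generalize d m = t
    induction t with
    | zero => simp
    | add x y hx hy => simp only [map_add, hx, hy]
    | tmul w y =>
      simp only [map_tmul, mul'_apply, comp_apply,
        ← evalFun_comm h12, evalFun_mul_evalFun, pairOpL_apply]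
      congr 1
      ext a b
      simp
  · exact fun m => h13.colin_evalFun _

theorem pairOp_mul {d d' : M →ₗ[K] M ⊗[K] M} {e e' : M →ₗ[K] K} {δ ε : W →ₗ[K] W ⊗[K] M}
    (h : IsSlot d e δ) (h' : IsSlot d' e' ε) (hc : CoComm δ ε) (f g : M ⊗[K] M →ₗ[K] K) :
    pairOp f δ ε * pairOp g δ ε = pairOp (convWith f g d d') δ ε := by
  rw [pairOp_eq_coev, pairOp_eq_coev, pairOp_eq_coev, Module.End.mul_eq_comp, coev_mul_coev h']
  · congr 1
    ext m : 1
    simp only [comp_apply]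
    have : (TensorProduct.curry (convWith f g d d')).flip m = (pairAt f g).flip (d' m) ∘ₗ d := by
      ext x
      simp [convWith_tmul]
    rw [this]
    generalize d' m = t
    induction t with
    | zero => simp
    | add x y hx hy => simp only [map_add, LinearMap.add_comp, hx, hy]
    | tmul w y =>
      simp only [map_tmul, mul'_apply, comp_apply,
        evalFun_mul h]
      congr 1
      ext a
      simp only [comp_apply]
      generalize d a = t
      induction t with
      | zero => simp
      | add x y hx hy => simp only [map_add, hx, hy]
      | tmul x y => simp
  · exact fun m => hc.colin_evalFun _

theorem evalFun_unit {e : M →ₗ[K] K} {δ : W →ₗ[K] W ⊗[K] M} (he : evalFun δ e = 1)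
    (p : W →ₗ[K] W') : coev δ (e.smulRight p) = p := by
  ext w
  have h1 := LinearMap.congr_fun he w
  rw [evalFun_apply] at h1
  conv_rhs => rw [show w = (1 : Module.End K W) w from rfl, ← h1]
  rw [coev_apply]
  generalize δ w = t
  induction t with
  | zero => simp
  | add x y hx hy => simp only [map_add, hx, hy]
  | tmul x y => simp

theorem pairOp_unit {e e' : M →ₗ[K] K} {δ ε : W →ₗ[K] W ⊗[K] M} (he : evalFun δ e = 1)
    (he' : evalFun ε e' = 1) : pairOp (mul' K K ∘ₗ TensorProduct.map e e') δ ε = 1 := by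
  rw [← evalFun_mul_evalFun, he, he', one_mul]

/-- The Yang–Baxter equation for operators follows from that of the functionals. -/
theorem yangBaxter_pairOp {d₁ d₂ d₃ : M →ₗ[K] M ⊗[K] M} {e : M →ₗ[K] K}
    {δ₁ δ₂ δ₃ : W →ₗ[K] W ⊗[K] M} (h1 : IsSlot d₁ e δ₁) (h2 : IsSlot d₂ e δ₂)
    (h3 : IsSlot d₃ e δ₃) (h12 : CoComm δ₁ δ₂) (h13 : CoComm δ₁ δ₃) (h23 : CoComm δ₂ δ₃)
    {f g h : M ⊗[K] M →ₗ[K] K}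
    (H : ∀ z, convWith f ((pairAt g h).flip (d₃ z)) d₁ d₂ =
      convWith ((pairAt g h).flip (TensorProduct.comm K M M (d₃ z))) f d₁ d₂) :
    pairOp f δ₁ δ₂ * pairOp g δ₁ δ₃ * pairOp h δ₂ δ₃ =
      pairOp h δ₂ δ₃ * pairOp g δ₁ δ₃ * pairOp f δ₁ δ₂ := by
  rw [mul_assoc, pairOp_mul_pairOp h3 h23, pairOp_mul_pairOp' h3 h12 h13,
    Module.End.mul_eq_comp, Module.End.mul_eq_comp]
  have e1 : ∀ u, (pairOp f δ₁ δ₂) ∘ₗ (pairOp u δ₁ δ₂) = pairOp (convWith f u d₁ d₂) δ₁ δ₂ :=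
    fun u => pairOp_mul h1 h2 h12 f u
  have e2 : ∀ u, (pairOp u δ₁ δ₂) ∘ₗ (pairOp f δ₁ δ₂) = pairOp (convWith u f d₁ d₂) δ₁ δ₂ :=
    fun u => pairOp_mul h1 h2 h12 u f
  rw [comp_coev (W'' := W) δ₃ (q := pairOp f δ₁ δ₂) _
    (LinearMap.mulLeft K (pairOp f δ₁ δ₂) ∘ₗ
      (pairOpL δ₁ δ₂ ∘ₗ (pairAt g h).flip ∘ₗ d₃)) fun m => rfl,
    coev_comp (colin_pairOp h13 h23 f) _ (LinearMap.mulRight K (pairOp f δ₁ δ₂) ∘ₗ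
      (pairOpL δ₁ δ₂ ∘ₗ (pairAt g h).flip ∘ₗ (TensorProduct.comm K M M).toLinearMap ∘ₗ d₃))
      fun m => rfl]
  congr 1
  ext m : 1
  simp only [comp_apply, LinearMap.mulLeft_apply, LinearMap.mulRight_apply,
    pairOpL_apply, pairOp_mul h1 h2 h12, coe_coe, H]

theorem convWith_comm (f g : M ⊗[K] M →ₗ[K] K) (δ δ' : M →ₗ[K] M ⊗[K] M) :
    convWith (f ∘ₗ (TensorProduct.comm K M M).toLinearMap)
      (g ∘ₗ (TensorProduct.comm K M M).toLinearMap) δ δ' =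
      convWith f g δ' δ ∘ₗ (TensorProduct.comm K M M).toLinearMap := by
  ext x y
  simp only [TensorProduct.AlgebraTensorModule.curry_apply, restrictScalars_self,
    curry_apply, convWith_tmul, comp_apply, coe_coe,
    comm_tmul]
  generalize δ x = s
  generalize δ' y = t
  induction s with
  | zero => simp
  | add x y hx hy => simp only [map_add, LinearMap.add_apply, hx, hy]
  | tmul x x' =>
    induction t with
    | zero => simp
    | add x y hx hy => simp only [map_add, LinearMap.add_apply, hx, hy]
    | tmul y y' => simp

end PairSlots

/-! ### Coactions on tensor products -/

section Lifts

variable {K M X X' Y Y' Z : Type*} [Field K] [AddCommMonoid M] [Module K M]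
  [AddCommMonoid X] [Module K X] [AddCommMonoid X'] [Module K X']
  [AddCommMonoid Y] [Module K Y] [AddCommMonoid Y'] [Module K Y']
  [AddCommMonoid Z] [Module K Z]

/-- The coaction on the first factor of `X ⊗ Y`. -/
noncomputable def liftL (Y : Type*) [AddCommMonoid Y] [Module K Y] (δ : X →ₗ[K] X ⊗[K] M) :
    X ⊗[K] Y →ₗ[K] (X ⊗[K] Y) ⊗[K] M :=
  (rightComm K X M Y).toLinearMap ∘ₗ δ.rTensor Y

/-- The coaction on the second factor of `X ⊗ Y`. -/
noncomputable def liftR (X : Type*) [AddCommMonoid X] [Module K X] (ε : Y →ₗ[K] Y ⊗[K] M) :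
    X ⊗[K] Y →ₗ[K] (X ⊗[K] Y) ⊗[K] M :=
  (TensorProduct.assoc K X Y M).symm.toLinearMap ∘ₗ ε.lTensor X

theorem liftL_tmul (δ : X →ₗ[K] X ⊗[K] M) (x : X) (y : Y) :
    liftL Y δ (x ⊗ₜ y) = rightComm K X M Y (δ x ⊗ₜ y) := rfl

theorem liftR_tmul (ε : Y →ₗ[K] Y ⊗[K] M) (x : X) (y : Y) :
    liftR X ε (x ⊗ₜ y) = (TensorProduct.assoc K X Y M).symm (x ⊗ₜ ε y) := rfl

theorem evalFun_liftL (δ : X →ₗ[K] X ⊗[K] M) (φ : M →ₗ[K] K) :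
    evalFun (liftL Y δ) φ = (evalFun δ φ).rTensor Y := by
  ext x y
  simp only [TensorProduct.AlgebraTensorModule.curry_apply, restrictScalars_self,
    curry_apply, evalFun_apply, liftL_tmul, rTensor_tmul]
  generalize δ x = t
  induction t with
  | zero => simp
  | add x y hx hy => simp only [map_add, add_tmul, hx, hy]
  | tmul x m => simp [smul_tmul']

theorem evalFun_liftR (ε : Y →ₗ[K] Y ⊗[K] M) (φ : M →ₗ[K] K) :
    evalFun (liftR X ε) φ = (evalFun ε φ).lTensor X := by
  ext x y
  simp only [TensorProduct.AlgebraTensorModule.curry_apply, restrictScalars_self,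
    curry_apply, evalFun_apply, liftR_tmul, lTensor_tmul]
  generalize ε y = t
  induction t with
  | zero => simp
  | add x y hx hy => simp only [map_add, tmul_add, hx, hy]
  | tmul x m => simp

/-- Rearrange `((x ⊗ c) ⊗ d) ⊗ y` to `((x ⊗ y) ⊗ c) ⊗ d`. -/
theorem joint_liftL (δ δ' : X →ₗ[K] X ⊗[K] M) :
    joint (liftL Y δ) (liftL Y δ') =
      (rightComm K X (M ⊗[K] M) Y).toLinearMap ∘ₗ (joint δ δ').rTensor Y := by
  ext x y
  simp only [TensorProduct.AlgebraTensorModule.curry_apply, restrictScalars_self,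
    curry_apply, joint, comp_apply, liftL_tmul, rTensor_tmul,
    coe_coe]
  generalize δ' x = t
  induction t with
  | zero => simp
  | add x y hx hy => simp only [map_add, add_tmul, hx, hy]
  | tmul x m =>
    simp only [rightComm_tmul, rTensor_tmul, liftL_tmul]
    generalize δ x = t
    induction t with
    | zero => simp
    | add x y hx hy => simp only [map_add, add_tmul, hx, hy]
    | tmul x m => simp

theorem joint_liftR (ε ε' : Y →ₗ[K] Y ⊗[K] M) :
    joint (liftR X ε) (liftR X ε') =
      (TensorProduct.assoc K X Y (M ⊗[K] M)).symm.toLinearMap ∘ₗ (joint ε ε').lTensor X := by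
  ext x y
  simp only [TensorProduct.AlgebraTensorModule.curry_apply, restrictScalars_self,
    curry_apply, joint, comp_apply, liftR_tmul, lTensor_tmul,
    coe_coe]
  generalize ε' y = t
  induction t with
  | zero => simp
  | add x y hx hy => simp only [map_add, tmul_add, hx, hy]
  | tmul y m =>
    simp only [assoc_symm_tmul, rTensor_tmul, liftR_tmul]
    generalize ε y = t
    induction t with
    | zero => simp
    | add x y hx hy => simp only [map_add, add_tmul, tmul_add, hx, hy]
    | tmul x m => simp

theorem IsSlot.liftL {d : M →ₗ[K] M ⊗[K] M} {e : M →ₗ[K] K} {δ : X →ₗ[K] X ⊗[K] M}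
    (h : IsSlot d e δ) : IsSlot d e (liftL Y δ) := by
  constructor
  · rw [joint_liftL, h.coassoc]
    ext x y
    simp only [TensorProduct.AlgebraTensorModule.curry_apply, restrictScalars_self,
      curry_apply, comp_apply, liftL_tmul, rTensor_tmul,
      coe_coe]
    generalize δ x = t
    induction t with
    | zero => simp
    | add x y hx hy => simp only [map_add, add_tmul, hx, hy]
    | tmul x m => simp
  · rw [evalFun_liftL, h.counit]
    exact LinearMap.rTensor_id Y X

theorem IsSlot.liftR {d : M →ₗ[K] M ⊗[K] M} {e : M →ₗ[K] K} {ε : Y →ₗ[K] Y ⊗[K] M}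
    (h : IsSlot d e ε) : IsSlot d e (liftR X ε) := by
  constructor
  · rw [joint_liftR, h.coassoc]
    ext x y
    simp only [TensorProduct.AlgebraTensorModule.curry_apply, restrictScalars_self,
      curry_apply, comp_apply, liftR_tmul, lTensor_tmul,
      coe_coe]
    generalize ε y = t
    induction t with
    | zero => simp
    | add x y hx hy => simp only [map_add, tmul_add, hx, hy]
    | tmul x m => simp
  · rw [evalFun_liftR, h.counit]
    exact LinearMap.lTensor_id X Y

theorem coComm_liftL_liftR (δ : X →ₗ[K] X ⊗[K] M) (ε : Y →ₗ[K] Y ⊗[K] M) :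
    CoComm (liftL Y δ) (liftR X ε) := by
  ext x y
  simp only [TensorProduct.AlgebraTensorModule.curry_apply, restrictScalars_self,
    curry_apply, comp_apply, liftR_tmul, liftL_tmul, coe_coe]
  have h1 : ∀ m : M, ∀ y : Y, (liftL Y δ).rTensor M ((TensorProduct.assoc K X Y M).symm
      (x ⊗ₜ (y ⊗ₜ m))) = (rightComm K X M Y (δ x ⊗ₜ y)) ⊗ₜ m := by
    intro m y; simp [liftL_tmul]
  have h2 : ∀ s : X ⊗[K] M, (liftR X ε).rTensor M (rightComm K X M Y (s ⊗ₜ y)) =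
      rightComm K (X ⊗[K] Y) M M ((rightComm K X M Y).toLinearMap.rTensor M
        ((TensorProduct.assoc K (X ⊗[K] M) Y M).symm (s ⊗ₜ ε y))) := by
    intro s
    induction s with
    | zero => simp
    | add x y hx hy => simp only [map_add, add_tmul, hx, hy]
    | tmul x m =>
      simp only [rightComm_tmul, rTensor_tmul, liftR_tmul]
      generalize ε y = t
      induction t with
      | zero => simp
      | add x y hx hy => simp only [map_add, add_tmul, tmul_add, hx, hy]
      | tmul y n => simp
  have h3 : ∀ u, rightComm K (X ⊗[K] Y) M M
      (rightComm K (X ⊗[K] Y) M M u) = u :=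
    fun u => (rightComm K (X ⊗[K] Y) M M).symm_apply_apply u
  rw [h2, h3]
  generalize ε y = t
  induction t with
  | zero => simp
  | add x y hx hy => simp only [map_add, tmul_add, hx, hy]
  | tmul y n => rw [h1]; simp

theorem coComm_iff {δ ε : X →ₗ[K] X ⊗[K] M} : CoComm δ ε ↔
    joint δ ε = (TensorProduct.comm K M M).toLinearMap.lTensor X ∘ₗ joint ε δ := by
  have h1 : (TensorProduct.comm K M M).toLinearMap.lTensor X ∘ₗ
      (TensorProduct.assoc K X M M).toLinearMap = (TensorProduct.assoc K X M M).toLinearMap ∘ₗ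
        (rightComm K X M M).toLinearMap := by
    ext; simp
  have h2 : (TensorProduct.comm K M M).toLinearMap.lTensor X ∘ₗ joint ε δ =
      (TensorProduct.assoc K X M M).toLinearMap ∘ₗ
        (rightComm K X M M).toLinearMap ∘ₗ ε.rTensor M ∘ₗ δ := by
    rw [joint, ← comp_assoc, h1, comp_assoc]
  rw [h2, joint]
  constructor
  · intro h; rw [h]
  · intro h
    ext x
    have := LinearMap.congr_fun h x
    exact (TensorProduct.assoc K X M M).injective this

theorem CoComm.liftL {δ δ' : X →ₗ[K] X ⊗[K] M} (h : CoComm δ δ') :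
    CoComm (liftL Y δ) (liftL Y δ') := by
  rw [coComm_iff] at *
  rw [joint_liftL, joint_liftL, h, rTensor_comp, ← comp_assoc,
    ← comp_assoc]
  congr 1
  ext; simp

theorem CoComm.liftR {ε ε' : Y →ₗ[K] Y ⊗[K] M} (h : CoComm ε ε') :
    CoComm (liftR X ε) (liftR X ε') := by
  rw [coComm_iff] at *
  rw [joint_liftR, joint_liftR, h, LinearMap.lTensor_comp, ← comp_assoc,
    ← comp_assoc]
  congr 1
  ext; simp

theorem pairOp_liftL (f : M ⊗[K] M →ₗ[K] K) (δ δ' : X →ₗ[K] X ⊗[K] M) :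
    pairOp f (liftL Y δ) (liftL Y δ') = (pairOp f δ δ').rTensor Y := by
  ext x y
  simp only [TensorProduct.AlgebraTensorModule.curry_apply, restrictScalars_self,
    curry_apply, pairOp, evalFun_apply, joint_liftL, comp_apply,
    rTensor_tmul]
  generalize joint δ δ' x = t
  induction t with
  | zero => simp
  | add x y hx hy => simp only [map_add, add_tmul, hx, hy]
  | tmul x m => simp [smul_tmul']

theorem pairOp_liftR (f : M ⊗[K] M →ₗ[K] K) (ε ε' : Y →ₗ[K] Y ⊗[K] M) :
    pairOp f (liftR X ε) (liftR X ε') = (pairOp f ε ε').lTensor X := by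
  ext x y
  simp only [TensorProduct.AlgebraTensorModule.curry_apply, restrictScalars_self,
    curry_apply, pairOp, evalFun_apply, joint_liftR, comp_apply,
    lTensor_tmul]
  generalize joint ε ε' y = t
  induction t with
  | zero => simp
  | add x y hx hy => simp only [map_add, tmul_add, hx, hy]
  | tmul x m => simp

theorem Colin.rTensor_liftL {p : X →ₗ[K] X'} {δ : X →ₗ[K] X ⊗[K] M} {δ' : X' →ₗ[K] X' ⊗[K] M}
    (h : Colin p δ δ') : Colin (p.rTensor Y) (liftL Y δ) (liftL Y δ') := by
  ext x y
  simp only [TensorProduct.AlgebraTensorModule.curry_apply, restrictScalars_self,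
    curry_apply, comp_apply, liftL_tmul, rTensor_tmul, h.apply]
  generalize δ x = t
  induction t with
  | zero => simp
  | add x y hx hy => simp only [map_add, add_tmul, hx, hy]
  | tmul x m => simp

theorem Colin.lTensor_liftR {p : Y →ₗ[K] Y'} {ε : Y →ₗ[K] Y ⊗[K] M} {ε' : Y' →ₗ[K] Y' ⊗[K] M}
    (h : Colin p ε ε') : Colin (p.lTensor X) (liftR X ε) (liftR X ε') := by
  ext x y
  simp only [TensorProduct.AlgebraTensorModule.curry_apply, restrictScalars_self,
    curry_apply, comp_apply, liftR_tmul, lTensor_tmul, h.apply]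
  generalize ε y = t
  induction t with
  | zero => simp
  | add x y hx hy => simp only [map_add, tmul_add, hx, hy]
  | tmul x m => simp

theorem colin_rTensor_liftR (p : X →ₗ[K] X') (ε : Y →ₗ[K] Y ⊗[K] M) :
    Colin (p.rTensor Y) (liftR X ε) (liftR X' ε) := by
  ext x y
  simp only [TensorProduct.AlgebraTensorModule.curry_apply, restrictScalars_self,
    curry_apply, comp_apply, liftR_tmul, rTensor_tmul]
  generalize ε y = t
  induction t with
  | zero => simp
  | add x y hx hy => simp only [map_add, tmul_add, hx, hy]
  | tmul x m => simp

theorem colin_lTensor_liftL (p : Y →ₗ[K] Y') (δ : X →ₗ[K] X ⊗[K] M) :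
    Colin (p.lTensor X) (liftL Y δ) (liftL Y' δ) := by
  ext x y
  simp only [TensorProduct.AlgebraTensorModule.curry_apply, restrictScalars_self,
    curry_apply, comp_apply, liftL_tmul, lTensor_tmul]
  generalize δ x = t
  induction t with
  | zero => simp
  | add x y hx hy => simp only [map_add, add_tmul, hx, hy]
  | tmul x m => simp

theorem colin_assoc₁ (δ : X →ₗ[K] X ⊗[K] M) :
    Colin (TensorProduct.assoc K X Y Z).toLinearMap (liftL Z (liftL Y δ)) (liftL (Y ⊗[K] Z) δ) := by
  ext x y z
  simp only [TensorProduct.AlgebraTensorModule.curry_apply, restrictScalars_self,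
    curry_apply, comp_apply, liftL_tmul, coe_coe,
    assoc_tmul]
  generalize δ x = t
  induction t with
  | zero => simp
  | add x y hx hy => simp only [map_add, add_tmul, hx, hy]
  | tmul x m => simp

theorem colin_assoc₂ (δ : Y →ₗ[K] Y ⊗[K] M) :
    Colin (TensorProduct.assoc K X Y Z).toLinearMap (liftL Z (liftR X δ))
      (liftR X (liftL Z δ)) := by
  ext x y z
  simp only [TensorProduct.AlgebraTensorModule.curry_apply, restrictScalars_self,
    curry_apply, comp_apply, liftL_tmul, liftR_tmul, coe_coe,
    assoc_tmul]
  generalize δ y = t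
  induction t with
  | zero => simp
  | add x y hx hy => simp only [map_add, add_tmul, tmul_add, hx, hy]
  | tmul x m => simp

theorem colin_assoc₃ (δ : Z →ₗ[K] Z ⊗[K] M) :
    Colin (TensorProduct.assoc K X Y Z).toLinearMap (liftR (X ⊗[K] Y) δ)
      (liftR X (liftR Y δ)) := by
  ext x y z
  simp only [TensorProduct.AlgebraTensorModule.curry_apply, restrictScalars_self,
    curry_apply, comp_apply, liftR_tmul, coe_coe,
    assoc_tmul]
  generalize δ z = t
  induction t with
  | zero => simp
  | add x y hx hy => simp only [map_add, tmul_add, hx, hy]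
  | tmul x m => simp

theorem colin_rightComm₁ (δ : X →ₗ[K] X ⊗[K] M) :
    Colin (rightComm K X Y Z).toLinearMap (liftL Z (liftL Y δ))
      (liftL Y (liftL Z δ)) := by
  ext x y z
  simp only [TensorProduct.AlgebraTensorModule.curry_apply, restrictScalars_self,
    curry_apply, comp_apply, liftL_tmul, coe_coe,
    rightComm_tmul]
  generalize δ x = t
  induction t with
  | zero => simp
  | add x y hx hy => simp only [map_add, add_tmul, hx, hy]
  | tmul x m => simp

theorem colin_rightComm₃ (δ : Z →ₗ[K] Z ⊗[K] M) :
    Colin (rightComm K X Y Z).toLinearMap (liftR (X ⊗[K] Y) δ)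
      (liftL Y (liftR X δ)) := by
  ext x y z
  simp only [TensorProduct.AlgebraTensorModule.curry_apply, restrictScalars_self,
    curry_apply, comp_apply, liftL_tmul, liftR_tmul, coe_coe,
    rightComm_tmul]
  generalize δ z = t
  induction t with
  | zero => simp
  | add x y hx hy => simp only [map_add, add_tmul, tmul_add, hx, hy]
  | tmul x m => simp

/-- The operator `F` on the first and second factors of `(X ⊗ Y) ⊗ Z`. -/
noncomputable def leg12 (Z : Type*) [AddCommMonoid Z] [Module K Z] (F : Module.End K (X ⊗[K] Y)) :
    Module.End K ((X ⊗[K] Y) ⊗[K] Z) := F.rTensor Z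

/-- The operator `F` on the second and third factors of `(X ⊗ Y) ⊗ Z`. -/
noncomputable def leg23 (X : Type*) [AddCommMonoid X] [Module K X] (F : Module.End K (Y ⊗[K] Z)) :
    Module.End K ((X ⊗[K] Y) ⊗[K] Z) :=
  (TensorProduct.assoc K X Y Z).symm.toLinearMap ∘ₗ F.lTensor X ∘ₗ
    (TensorProduct.assoc K X Y Z).toLinearMap

/-- The operator `F` on the first and third factors of `(X ⊗ Y) ⊗ Z`. -/
noncomputable def leg13 (Y : Type*) [AddCommMonoid Y] [Module K Y] (F : Module.End K (X ⊗[K] Z)) :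
    Module.End K ((X ⊗[K] Y) ⊗[K] Z) :=
  (rightComm K X Z Y).toLinearMap ∘ₗ F.rTensor Y ∘ₗ
    (rightComm K X Y Z).toLinearMap

theorem leg12_mul (F G : Module.End K (X ⊗[K] Y)) : leg12 Z (F * G) = leg12 Z F * leg12 Z G :=
  LinearMap.rTensor_mul _ _ _

theorem leg23_mul (F G : Module.End K (Y ⊗[K] Z)) : leg23 X (F * G) = leg23 X F * leg23 X G := by
  ext x y z
  simp [leg23, LinearMap.lTensor_mul]

theorem leg13_mul (F G : Module.End K (X ⊗[K] Z)) : leg13 Y (F * G) = leg13 Y F * leg13 Y G := by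
  have h (u : (X ⊗[K] Z) ⊗[K] Y) : rightComm K X Y Z
    (rightComm K X Z Y u) = u := (rightComm K X Z Y).symm_apply_apply u
  ext x y z
  simp [leg13, LinearMap.rTensor_mul, h]

theorem pairOp_leg12 (f : M ⊗[K] M →ₗ[K] K) (δ ε : X ⊗[K] Y →ₗ[K] (X ⊗[K] Y) ⊗[K] M) :
    pairOp f (liftL Z δ) (liftL Z ε) = leg12 Z (pairOp f δ ε) := pairOp_liftL f δ ε

theorem pairOp_leg23 (f : M ⊗[K] M →ₗ[K] K) (δ : Y →ₗ[K] Y ⊗[K] M) (ε : Z →ₗ[K] Z ⊗[K] M) :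
    pairOp f (liftL Z (liftR X δ)) (liftR (X ⊗[K] Y) ε) =
      leg23 X (pairOp f (liftL Z δ) (liftR Y ε)) := by
  have h := pairOp_comp (colin_assoc₂ (X := X) (Z := Z) δ) (colin_assoc₃ (X := X) (Y := Y) ε) f
  ext1
  rw [leg23, ← pairOp_liftR, h]
  ext; simp

theorem pairOp_leg13 (f : M ⊗[K] M →ₗ[K] K) (δ : X →ₗ[K] X ⊗[K] M) (ε : Z →ₗ[K] Z ⊗[K] M) :
    pairOp f (liftL Z (liftL Y δ)) (liftR (X ⊗[K] Y) ε) =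
      leg13 Y (pairOp f (liftL Z δ) (liftR X ε)) := by
  have h := pairOp_comp (colin_rightComm₁ (Y := Y) (Z := Z) δ)
    (colin_rightComm₃ (X := X) (Y := Y) ε) f
  rw [leg13, ← pairOp_liftL, h, ← comp_assoc]
  have : (rightComm K X Z Y).toLinearMap ∘ₗ
      (rightComm K X Y Z).toLinearMap = LinearMap.id := by
    ext; simp
  rw [this, LinearMap.id_comp]

end Lifts

/-! ### Braidings of the form `flip ∘ F` -/

section Strip

variable {K X X' Y Z : Type*} [Field K]
  [AddCommMonoid X] [Module K X] [AddCommMonoid X'] [Module K X']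
  [AddCommMonoid Y] [Module K Y] [AddCommMonoid Z] [Module K Z]

/-- The braiding `flip ∘ F`. -/
noncomputable def flipOp (F : Module.End K (X ⊗[K] Y)) : X ⊗[K] Y →ₗ[K] Y ⊗[K] X :=
  (TensorProduct.comm K X Y).toLinearMap ∘ₗ F

theorem braidTensorLeft_flipOp (F : Module.End K (X ⊗[K] Z)) (G : Module.End K (Y ⊗[K] Z)) :
    braidTensorLeft (flipOp F) (flipOp G) = flipOp (leg13 Y F * leg23 X G) := by
  ext x y z
  simp only [TensorProduct.AlgebraTensorModule.curry_apply, restrictScalars_self,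
    curry_apply, braidTensorLeft, flipOp, comp_apply, leg13, leg23,
    Module.End.mul_apply, coe_coe, assoc_tmul, map_tmul,
    LinearMap.id_apply, lTensor_tmul]
  generalize G (y ⊗ₜ z) = t
  induction t with
  | zero => simp
  | add x y hx hy => simp only [map_add, tmul_add, hx, hy]
  | tmul y z =>
    simp only [comm_tmul, assoc_symm_tmul, map_tmul,
      comp_apply, rightComm_tmul, rTensor_tmul,
      coe_coe, LinearMap.id_apply]
    generalize F (x ⊗ₜ z) = t
    induction t with
    | zero => simp
    | add x y hx hy => simp only [map_add, add_tmul, hx, hy]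
    | tmul y z => simp

theorem braidTensorRight_flipOp (F : Module.End K (X ⊗[K] Y)) (G : Module.End K (X ⊗[K] Z)) :
    braidTensorRight (flipOp F) (flipOp G) = flipOp
      ((TensorProduct.assoc K X Y Z).toLinearMap ∘ₗ (leg13 Y G * leg12 Z F) ∘ₗ
        (TensorProduct.assoc K X Y Z).symm.toLinearMap) := by
  ext x y z
  simp only [TensorProduct.AlgebraTensorModule.curry_apply, restrictScalars_self,
    curry_apply, braidTensorRight, flipOp, comp_apply, leg13, leg12,
    Module.End.mul_apply, coe_coe, assoc_symm_tmul,
    map_tmul, LinearMap.id_apply, rTensor_tmul]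
  generalize F (x ⊗ₜ y) = t
  induction t with
  | zero => simp
  | add x y hx hy => simp only [map_add, add_tmul, hx, hy]
  | tmul x y =>
    simp only [comm_tmul, assoc_tmul, map_tmul,
      comp_apply, rightComm_tmul, rTensor_tmul,
      coe_coe, LinearMap.id_apply]
    generalize G (x ⊗ₜ z) = t
    induction t with
    | zero => simp
    | add x y hx hy => simp only [map_add, add_tmul, tmul_add, hx, hy]
    | tmul y z => simp

theorem naturalLeft_flipOp {p : X →ₗ[K] X'} {F : Module.End K (X ⊗[K] Z)}
    {F' : Module.End K (X' ⊗[K] Z)} (h : F' ∘ₗ p.rTensor Z = p.rTensor Z ∘ₗ F) :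
    NaturalLeft p (flipOp F) (flipOp F') := by
  have h' : (TensorProduct.comm K X' Z).toLinearMap ∘ₗ p.rTensor Z =
      p.lTensor Z ∘ₗ (TensorProduct.comm K X Z).toLinearMap := by ext; simp
  rw [NaturalLeft, flipOp, flipOp, comp_assoc, ← LinearMap.rTensor_def, h,
    ← comp_assoc, h']
  rfl

theorem naturalRight_flipOp {p : X →ₗ[K] X'} {F : Module.End K (Z ⊗[K] X)}
    {F' : Module.End K (Z ⊗[K] X')} (h : F' ∘ₗ p.lTensor Z = p.lTensor Z ∘ₗ F) :
    NaturalRight p (flipOp F) (flipOp F') := by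
  have h' : (TensorProduct.comm K Z X').toLinearMap ∘ₗ p.lTensor Z =
      p.rTensor Z ∘ₗ (TensorProduct.comm K Z X).toLinearMap := by ext; simp
  rw [NaturalRight, flipOp, flipOp, comp_assoc, ← LinearMap.lTensor_def, h,
    ← comp_assoc, h']
  rfl

theorem braidRelation_flipOp {F : Module.End K (X ⊗[K] Y)} {G : Module.End K (X ⊗[K] Z)}
    {H : Module.End K (Y ⊗[K] Z)}
    (h : leg12 Z F * leg13 Y G * leg23 X H = leg23 X H * leg13 Y G * leg12 Z F) :
    BraidRelation (flipOp F) (flipOp G) (flipOp H) := by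
  have e1 : (flipOp F).lTensor Z ∘ₗ (TensorProduct.comm K (X ⊗[K] Y) Z).toLinearMap =
      (TensorProduct.comm K X Y).toLinearMap.lTensor Z ∘ₗ
        (TensorProduct.comm K (X ⊗[K] Y) Z).toLinearMap ∘ₗ leg12 Z F := by
    ext x y z
    simp [flipOp, leg12]
  have e2 : leg13 X H ∘ₗ (TensorProduct.comm K X Y).toLinearMap.rTensor Z =
      (TensorProduct.comm K X Y).toLinearMap.rTensor Z ∘ₗ leg23 X H := by
    ext x y z
    simp only [TensorProduct.AlgebraTensorModule.curry_apply, restrictScalars_self,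
      curry_apply, comp_apply, leg13, leg23, rTensor_tmul,
      coe_coe, comm_tmul, rightComm_tmul,
      assoc_tmul, lTensor_tmul]
    generalize H (y ⊗ₜ z) = t
    induction t with
    | zero => simp
    | add x y hx hy => simp only [map_add, add_tmul, tmul_add, hx, hy]
    | tmul y z => simp
  have e3 : leg23 Y G ∘ₗ (TensorProduct.comm K X Y).toLinearMap.rTensor Z =
      (TensorProduct.comm K X Y).toLinearMap.rTensor Z ∘ₗ leg13 Y G := by
    ext x y z
    simp only [TensorProduct.AlgebraTensorModule.curry_apply, restrictScalars_self,
      curry_apply, comp_apply, leg13, leg23, rTensor_tmul,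
      coe_coe, comm_tmul, rightComm_tmul,
      assoc_tmul, lTensor_tmul]
    generalize G (x ⊗ₜ z) = t
    induction t with
    | zero => simp
    | add x y hx hy => simp only [map_add, add_tmul, tmul_add, hx, hy]
    | tmul y z => simp
  have e4 : (TensorProduct.comm K (Y ⊗[K] X) Z).toLinearMap ∘ₗ
      (TensorProduct.comm K X Y).toLinearMap.rTensor Z =
      (TensorProduct.comm K X Y).toLinearMap.lTensor Z ∘ₗ
        (TensorProduct.comm K (X ⊗[K] Y) Z).toLinearMap := by
    ext x y z
    simp
  rw [BraidRelation, braidTensorLeft_flipOp, braidTensorLeft_flipOp, ← LinearMap.lTensor_def,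
    ← LinearMap.rTensor_def]
  have e0 : ∀ L : Module.End K ((X ⊗[K] Y) ⊗[K] Z),
    flipOp L = (TensorProduct.comm K (X ⊗[K] Y) Z).toLinearMap ∘ₗ L := fun _ => rfl
  have e0' : ∀ L : Module.End K ((Y ⊗[K] X) ⊗[K] Z),
    flipOp L = (TensorProduct.comm K (Y ⊗[K] X) Z).toLinearMap ∘ₗ L := fun _ => rfl
  rw [e0, e0', ← comp_assoc, e1]
  have e5 : (flipOp F).rTensor Z = (TensorProduct.comm K X Y).toLinearMap.rTensor Z ∘ₗ leg12 Z F :=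
    rTensor_comp _ _ _
  rw [e5]
  simp only [Module.End.mul_eq_comp, comp_assoc] at h ⊢
  rw [h, ← comp_assoc _ _ (leg23 Y G), e3, comp_assoc,
    ← comp_assoc _ _ (leg13 X H), e2, comp_assoc,
    ← comp_assoc _ (LinearMap.rTensor Z _), e4]
  simp only [comp_assoc]

end Strip

/-! ### Functional Yang–Baxter identities -/

section Tri

variable {K M : Type*} [Field K] [AddCommMonoid M] [Module K M]

/-- With `u = a' ⊗ a''` and so on, `f(a', b') g(a'', c') h(b'', c'')`. -/
noncomputable def tri (f g h : M ⊗[K] M →ₗ[K] K) (u v w : M ⊗[K] M) : K :=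
  pairAt f ((pairAt g h).flip w) u v

theorem pairAt_add_right (f g g' : M ⊗[K] M →ₗ[K] K) (u v : M ⊗[K] M) :
    pairAt f (g + g') u v = pairAt f g u v + pairAt f g' u v := by
  simp [pairAt_apply, TensorProduct.map_add_right]

theorem pairAt_zero_right (f : M ⊗[K] M →ₗ[K] K) (u v : M ⊗[K] M) :
    pairAt f 0 u v = 0 := by
  simp [pairAt_apply]

@[simp]
theorem tri_zero₁ (f g h : M ⊗[K] M →ₗ[K] K) (v w : M ⊗[K] M) : tri f g h 0 v w = 0 := by
  simp [tri]

@[simp]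
theorem tri_zero₂ (f g h : M ⊗[K] M →ₗ[K] K) (v w : M ⊗[K] M) : tri f g h v 0 w = 0 := by
  simp [tri]

@[simp]
theorem tri_zero₃ (f g h : M ⊗[K] M →ₗ[K] K) (v w : M ⊗[K] M) : tri f g h v w 0 = 0 := by
  simp [tri, pairAt_zero_right]

theorem tri_add₁ (f g h : M ⊗[K] M →ₗ[K] K) (u u' v w : M ⊗[K] M) :
    tri f g h (u + u') v w = tri f g h u v w + tri f g h u' v w := by
  simp [tri]

theorem tri_add₂ (f g h : M ⊗[K] M →ₗ[K] K) (u u' v w : M ⊗[K] M) :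
    tri f g h v (u + u') w = tri f g h v u w + tri f g h v u' w := by
  simp [tri]

theorem tri_add₃ (f g h : M ⊗[K] M →ₗ[K] K) (u u' v w : M ⊗[K] M) :
    tri f g h v w (u + u') = tri f g h v w u + tri f g h v w u' := by
  simp [tri, pairAt_add_right]

@[simp]
theorem tri_tmul (f g h : M ⊗[K] M →ₗ[K] K) (a a' b b' c c' : M) :
    tri f g h (a ⊗ₜ a') (b ⊗ₜ b') (c ⊗ₜ c') = f (a ⊗ₜ b) * (g (a' ⊗ₜ c) * h (b' ⊗ₜ c')) := by
  simp [tri]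

/-- To prove an identity of trilinear expressions, check it on pure tensors. -/
theorem tri_induction {P : M ⊗[K] M → M ⊗[K] M → M ⊗[K] M → Prop}
    (h0 : ∀ u v, P 0 u v ∧ P u 0 v ∧ P u v 0)
    (h1 : ∀ u u' v w, P u v w → P u' v w → P (u + u') v w)
    (h2 : ∀ u v v' w, P u v w → P u v' w → P u (v + v') w)
    (h3 : ∀ u v w w', P u v w → P u v w' → P u v (w + w'))
    (h : ∀ a a' b b' c c', P (a ⊗ₜ a') (b ⊗ₜ b') (c ⊗ₜ c')) (u v w : M ⊗[K] M) : P u v w := by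
  induction u with
  | zero => exact (h0 _ _).1
  | add x y hx hy => exact h1 _ _ _ _ hx hy
  | tmul a a' =>
    induction v with
    | zero => exact (h0 _ _).2.1
    | add x y hx hy => exact h2 _ _ _ _ hx hy
    | tmul b b' =>
      induction w with
      | zero => exact (h0 _ _).2.2
      | add x y hx hy => exact h3 _ _ _ _ hx hy
      | tmul c c' => exact h _ _ _ _ _ _

local notation "sw" => TensorProduct.comm K M M

/-- Reorder the first two slots. -/
theorem tri_swap₁₂ (f g h : M ⊗[K] M →ₗ[K] K) (u v w : M ⊗[K] M) :
    tri (f ∘ₗ (sw).toLinearMap) h g v u (sw w) = tri f g h u v w := by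
  refine tri_induction (P := fun u v w => tri (f ∘ₗ (sw).toLinearMap) h g v u (sw w) =
    tri f g h u v w) ?_ ?_ ?_ ?_ ?_ u v w
  · simp
  · intro u u' v w h1 h2; rw [tri_add₁, tri_add₂, h1, h2]
  · intro u u' v w h1 h2; rw [tri_add₁, tri_add₂, h1, h2]
  · intro u u' v w h1 h2; rw [map_add, tri_add₃, tri_add₃, h1, h2]
  · intro a a' b b' c c'
    simp only [tri_tmul, comp_apply, coe_coe, comm_tmul]
    ring

/-- Reorder the last two slots. -/
theorem tri_swap₂₃ (f g h : M ⊗[K] M →ₗ[K] K) (u v w : M ⊗[K] M) :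
    tri g f (h ∘ₗ (sw).toLinearMap) (sw u) w v = tri f g h u v w := by
  refine tri_induction (P := fun u v w => tri g f (h ∘ₗ (sw).toLinearMap) (sw u) w v =
    tri f g h u v w) ?_ ?_ ?_ ?_ ?_ u v w
  · simp
  · intro u u' v w h1 h2; rw [map_add, tri_add₁, tri_add₁, h1, h2]
  · intro u u' v w h1 h2; rw [tri_add₂, tri_add₃, h1, h2]
  · intro u u' v w h1 h2; rw [tri_add₂, tri_add₃, h1, h2]
  · intro a a' b b' c c'
    simp only [tri_tmul, comp_apply, coe_coe, comm_tmul]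
    ring

/-- Move the first slot to the end. -/
theorem tri_cycle (f g h : M ⊗[K] M →ₗ[K] K) (u v w : M ⊗[K] M) :
    tri h (f ∘ₗ (sw).toLinearMap) (g ∘ₗ (sw).toLinearMap) (sw v) (sw w) u = tri f g h u v w := by
  refine tri_induction (P := fun u v w => tri h (f ∘ₗ (sw).toLinearMap) (g ∘ₗ (sw).toLinearMap)
    (sw v) (sw w) u = tri f g h u v w) ?_ ?_ ?_ ?_ ?_ u v w
  · simp
  · intro u u' v w h1 h2; rw [tri_add₁, tri_add₃, h1, h2]
  · intro u u' v w h1 h2; rw [map_add, tri_add₁, tri_add₂, h1, h2]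
  · intro u u' v w h1 h2; rw [map_add, tri_add₃, tri_add₂, h1, h2]
  · intro a a' b b' c c'
    simp only [tri_tmul, comp_apply, coe_coe, comm_tmul]
    ring

theorem pairAt_swap (f g : M ⊗[K] M →ₗ[K] K) (u v : M ⊗[K] M) :
    pairAt g f u v = pairAt f g (sw u) (sw v) := by
  induction u with
  | zero => simp
  | add x y hx hy => simp only [map_add, LinearMap.add_apply, hx, hy]
  | tmul a a' =>
    induction v with
    | zero => simp
    | add x y hx hy => simp only [map_add, hx, hy]
    | tmul b b' => simp [mul_comm]

theorem yangBaxter_of_tri {W : Type*} [AddCommMonoid W] [Module K W]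
    {d₁ d₂ d₃ : M →ₗ[K] M ⊗[K] M} {e : M →ₗ[K] K}
    {δ₁ δ₂ δ₃ : W →ₗ[K] W ⊗[K] M} (h1 : IsSlot d₁ e δ₁) (h2 : IsSlot d₂ e δ₂)
    (h3 : IsSlot d₃ e δ₃) (h12 : CoComm δ₁ δ₂) (h13 : CoComm δ₁ δ₃) (h23 : CoComm δ₂ δ₃)
    {f g h : M ⊗[K] M →ₗ[K] K}
    (H : ∀ x y z, tri f g h (d₁ x) (d₂ y) (d₃ z) =
      tri f g h (sw (d₁ x)) (sw (d₂ y)) (sw (d₃ z))) :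
    pairOp f δ₁ δ₂ * pairOp g δ₁ δ₃ * pairOp h δ₂ δ₃ =
      pairOp h δ₂ δ₃ * pairOp g δ₁ δ₃ * pairOp f δ₁ δ₂ := by
  refine yangBaxter_pairOp h1 h2 h3 h12 h13 h23 fun z => ?_
  ext x y
  simp only [TensorProduct.AlgebraTensorModule.curry_apply, restrictScalars_self,
    curry_apply, convWith_tmul]
  exact (H x y z).trans (pairAt_swap _ _ _ _).symm

/-- With `u = a' ⊗ a''` and `v = b' ⊗ b''`, the element `f(a', b') a'' ⊗ b''`. -/
noncomputable def actAt (f : M ⊗[K] M →ₗ[K] K) : M ⊗[K] M →ₗ[K] M ⊗[K] M →ₗ[K] M ⊗[K] M :=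
  TensorProduct.curry ((TensorProduct.lid K (M ⊗[K] M)).toLinearMap ∘ₗ
    TensorProduct.map f (LinearMap.id : M ⊗[K] M →ₗ[K] M ⊗[K] M) ∘ₗ
    (tensorTensorTensorComm K M M M M).toLinearMap)

theorem actWith_tmul (f : M ⊗[K] M →ₗ[K] K) (δ δ' : M →ₗ[K] M ⊗[K] M) (a b : M) :
    actWith f δ δ' (a ⊗ₜ b) = actAt f (δ a) (δ' b) := by
  simp [actWith, actAt]

@[simp]
theorem actAt_tmul (f : M ⊗[K] M →ₗ[K] K) (a a' b b' : M) :
    actAt f (a ⊗ₜ a') (b ⊗ₜ b') = f (a ⊗ₜ b) • (a' ⊗ₜ b') := by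
  simp [actAt]

theorem apply_actAt (f k : M ⊗[K] M →ₗ[K] K) (u v : M ⊗[K] M) :
    k (actAt f u v) = pairAt f k u v := by
  induction u with
  | zero => simp
  | add x y hx hy => simp only [map_add, LinearMap.add_apply, hx, hy]
  | tmul a a' =>
    induction v with
    | zero => simp
    | add x y hx hy => simp only [map_add, hx, hy]
    | tmul b b' => simp

theorem actWith_eq_pairOp (f : M ⊗[K] M →ₗ[K] K) (δ δ' : M →ₗ[K] M ⊗[K] M) :
    actWith f δ δ' = pairOp f (liftL M ((sw).toLinearMap ∘ₗ δ))
      (liftR M ((sw).toLinearMap ∘ₗ δ')) := by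
  ext a b
  simp only [TensorProduct.AlgebraTensorModule.curry_apply, restrictScalars_self,
    curry_apply, actWith_tmul, pairOp, evalFun_apply, joint, comp_apply,
    liftR_tmul, coe_coe]
  generalize δ' b = v
  induction v with
  | zero => simp
  | add x y hx hy => simp only [map_add, tmul_add, hx, hy]
  | tmul b b' =>
    simp only [comm_tmul, assoc_symm_tmul, rTensor_tmul,
      liftL_tmul, comp_apply, coe_coe]
    generalize δ a = u
    induction u with
    | zero => simp
    | add x y hx hy => simp only [map_add, LinearMap.add_apply, add_tmul, hx, hy]
    | tmul a a' => simp

end Tri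

section Convolution

variable {K M : Type*} [Field K] [Semiring M] [Bialgebra K M]

local notation "sw" => TensorProduct.comm K M M
local notation "Δ" => (Coalgebra.comul : M →ₗ[K] M ⊗[K] M)
local notation "Δop" => comulOp K M

theorem comulOp_apply (x : M) : Δop x = sw (Δ x) := rfl

@[simp]
theorem comm_comulOp (x : M) : sw (Δop x) = Δ x :=
  (sw).symm_apply_apply (Δ x)

@[simp]
theorem comm_comul (x : M) : sw (Δ x) = Δop x := rfl

@[simp]
theorem comm_comp_comulOp : (sw).toLinearMap ∘ₗ Δop = Δ := by ext; simp

@[simp]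
theorem comm_comp_comul : (sw).toLinearMap ∘ₗ Δ = Δop := rfl

end Convolution

/-! ### Products along a map -/

section MulAlong

variable {K M W W' : Type*} [Field K] [Semiring M] [Algebra K M]
  [AddCommMonoid W] [Module K W] [AddCommMonoid W'] [Module K W']

local notation "sw" => TensorProduct.comm K M M

/-- `k` is multiplicative in the first argument, for the coproduct `d` of the second. -/
def MulAt (k : M ⊗[K] M →ₗ[K] K) (d : M →ₗ[K] M ⊗[K] M) : Prop :=
  ∀ x y c : M, k ((x * y) ⊗ₜ c) = pairAt k k (x ⊗ₜ y) (d c)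

theorem MulAt.apply_mul' {k : M ⊗[K] M →ₗ[K] K} {d : M →ₗ[K] M ⊗[K] M} (h : MulAt k d)
    (u : M ⊗[K] M) (c : M) : k (mul' K M u ⊗ₜ c) = pairAt k k u (d c) := by
  induction u with
  | zero => simp
  | add x y hx hy => simp only [map_add, add_tmul, LinearMap.add_apply, hx, hy]
  | tmul x y => simp [h x y c]

/-- The functional identity behind the Yang–Baxter equation, from a commutation relation. -/
theorem tri_of_comm {f k : M ⊗[K] M →ₗ[K] K} {d d' d'' : M →ₗ[K] M ⊗[K] M}
    (H : ∀ a b, mul' K M (sw (actAt f (d a) (d' b))) =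
      mul' K M (actAt f (sw (d a)) (sw (d' b))))
    (hk : MulAt k d'') (a b c : M) :
    tri f k k (d a) (d' b) (sw (d'' c)) = tri f k k (sw (d a)) (sw (d' b)) (d'' c) := by
  have h := congrArg (fun m => k (m ⊗ₜ c)) (H a b)
  simp only [hk.apply_mul'] at h
  rw [pairAt_swap] at h
  rw [show sw (sw (actAt f (d a) (d' b))) = actAt f (d a) (d' b) from
    (sw).symm_apply_apply _] at h
  have e (u v w : M ⊗[K] M) : pairAt k k (actAt f u v) w = tri f k k u v w :=
    apply_actAt f ((pairAt k k).flip w) u v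
  rwa [e, e] at h

/-- The slot `s` of the target is the product of `s₁` and `s₂` along `P`. -/
def ProdAlong (P : W →ₗ[K] W') (s₁ s₂ : W →ₗ[K] W ⊗[K] M) (s : W' →ₗ[K] W' ⊗[K] M) : Prop :=
  s ∘ₗ P = TensorProduct.map P (mul' K M) ∘ₗ joint s₁ s₂

theorem ProdAlong.evalFun_comp {P : W →ₗ[K] W'} {s₁ s₂ : W →ₗ[K] W ⊗[K] M}
    {s : W' →ₗ[K] W' ⊗[K] M} (h : ProdAlong P s₁ s₂ s) (φ : M →ₗ[K] K) :
    evalFun s φ ∘ₗ P = P ∘ₗ pairOp (φ ∘ₗ mul' K M) s₁ s₂ := by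
  ext w
  have := LinearMap.congr_fun h w
  simp only [comp_apply] at this
  simp only [comp_apply, evalFun_apply, pairOp, this]
  generalize joint s₁ s₂ w = t
  induction t with
  | zero => simp
  | add x y hx hy => simp only [map_add, hx, hy]
  | tmul w m => simp

theorem ProdAlong.pairOp_comp {P : W →ₗ[K] W'} {s₁ s₂ z : W →ₗ[K] W ⊗[K] M}
    {s z' : W' →ₗ[K] W' ⊗[K] M} (h : ProdAlong P s₁ s₂ s) (hz : Colin P z z')
    {k : M ⊗[K] M →ₗ[K] K} {d : M →ₗ[K] M ⊗[K] M} {e : M →ₗ[K] K} (hk : MulAt k d)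
    (hs : IsSlot d e z) (h2 : CoComm s₂ z) :
    pairOp k s z' ∘ₗ P = P ∘ₗ (pairOp k s₁ z * pairOp k s₂ z) := by
  rw [pairOp_mul_pairOp hs h2, pairOp_eq_coev,
    coev_comp hz _ (LinearMap.lcomp K W' P ∘ₗ (evalFun s ∘ₗ (TensorProduct.curry k).flip))
      fun m => rfl,
    comp_coev z (q := P) _ (LinearMap.llcomp K W W W' P ∘ₗ
      (pairOpL s₁ s₂ ∘ₗ (pairAt k k).flip ∘ₗ d)) fun m => rfl]
  congr 1
  ext m : 1
  simp only [comp_apply, LinearMap.lcomp_apply', LinearMap.llcomp_apply', h.evalFun_comp,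
    pairOpL_apply]
  congr 2
  ext x y
  simp [hk x y m]

theorem ProdAlong.pairOp_comp' {P : W →ₗ[K] W'} {s₁ s₂ z : W →ₗ[K] W ⊗[K] M}
    {s z' : W' →ₗ[K] W' ⊗[K] M} (h : ProdAlong P s₁ s₂ s) (hz : Colin P z z')
    {k : M ⊗[K] M →ₗ[K] K} {d : M →ₗ[K] M ⊗[K] M} {e : M →ₗ[K] K} (hk : MulAt k d)
    (hs : IsSlot ((sw).toLinearMap ∘ₗ d) e z) (h12 : CoComm s₁ s₂) (h1 : CoComm s₁ z) :
    pairOp k s z' ∘ₗ P = P ∘ₗ (pairOp k s₂ z * pairOp k s₁ z) := by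
  rw [pairOp_mul_pairOp' hs h12 h1, pairOp_eq_coev,
    coev_comp hz _ (LinearMap.lcomp K W' P ∘ₗ (evalFun s ∘ₗ (TensorProduct.curry k).flip))
      fun m => rfl,
    comp_coev z (q := P) _ (LinearMap.llcomp K W W W' P ∘ₗ
      (pairOpL s₁ s₂ ∘ₗ (pairAt k k).flip ∘ₗ (sw).toLinearMap ∘ₗ (sw).toLinearMap ∘ₗ d))
      fun m => rfl]
  congr 1
  ext m : 1
  simp only [comp_apply, LinearMap.lcomp_apply', LinearMap.llcomp_apply', h.evalFun_comp,
    pairOpL_apply, coe_coe]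
  rw [show sw (sw (d m)) = d m from (sw).symm_apply_apply _]
  congr 2
  ext x y
  simp [hk x y m]

end MulAlong

/-! ### The inverse of a multiplicative pairing -/

section Inverse

variable {K M : Type*} [Field K] [Semiring M] [Bialgebra K M]

local notation "sw" => TensorProduct.comm K M M
local notation "Δ" => (Coalgebra.comul : M →ₗ[K] M ⊗[K] M)
local notation "Δop" => comulOp K M
local notation "ε" => (Coalgebra.counit : M →ₗ[K] K)

theorem pairAt_comm (f g : M ⊗[K] M →ₗ[K] K) (u v : M ⊗[K] M) :
    pairAt (f ∘ₗ (sw).toLinearMap) (g ∘ₗ (sw).toLinearMap) u v = pairAt f g v u := by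
  induction u with
  | zero => simp
  | add x y hx hy => simp only [map_add, LinearMap.add_apply, hx, hy]
  | tmul a a' =>
    induction v with
    | zero => simp
    | add x y hx hy => simp only [map_add, LinearMap.add_apply, hx, hy]
    | tmul b b' => simp

theorem pairAt_counitPair (f : M ⊗[K] M →ₗ[K] K) (u v : M ⊗[K] M) :
    pairAt (counitPair K M) f u v = f (TensorProduct.lid K M ((ε).rTensor M u) ⊗ₜ
      TensorProduct.lid K M ((ε).rTensor M v)) := by
  induction u with
  | zero => simp
  | add x y hx hy => simp only [map_add, LinearMap.add_apply, add_tmul, hx, hy]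
  | tmul a a' =>
    induction v with
    | zero => simp
    | add x y hx hy => simp only [map_add, tmul_add, hx, hy]
    | tmul b b' =>
      have e : (Coalgebra.counit (R := K) a • a') ⊗ₜ[K] (Coalgebra.counit (R := K) b • b') =
          (Coalgebra.counit (R := K) a * Coalgebra.counit (R := K) b) • (a' ⊗ₜ[K] b') := by
        rw [tmul_smul, ← smul_tmul', smul_smul, mul_comm]
      simp [counitPair, e]

theorem lid_counit_comul (x : M) : TensorProduct.lid K M ((ε).rTensor M (Δ x)) = x := by simp

theorem convWith_counitPair (f : M ⊗[K] M →ₗ[K] K) : convWith (counitPair K M) f Δ Δ = f := by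
  ext x y
  simp only [TensorProduct.AlgebraTensorModule.curry_apply, restrictScalars_self,
    curry_apply, convWith_tmul, pairAt_counitPair, lid_counit_comul]

theorem counitPair_pairOp (f : M ⊗[K] M →ₗ[K] K) :
    counitPair K M ∘ₗ pairOp f (liftL M Δ) (liftR M Δ) = f := by
  conv_rhs => rw [← convWith_counitPair f]
  have := actWith_eq_pairOp f Δop Δop
  rw [comm_comp_comulOp] at this
  rw [← this]
  ext x y
  simp only [TensorProduct.AlgebraTensorModule.curry_apply, restrictScalars_self,
    curry_apply, convWith_tmul, comp_apply, actWith_tmul, apply_actAt]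
  rw [pairAt_swap, comm_comulOp, comm_comulOp]

theorem isSlot_comul : IsSlot Δ ε Δ := by
  constructor
  · ext x
    exact Coalgebra.coassoc_apply x
  · ext x
    simp [evalFun_apply]

theorem isSlot_comulOp : IsSlot Δop ε Δop := by
  constructor
  · ext x
    have h := Coalgebra.coassoc_apply (R := K) x
    let τ : M ⊗[K] (M ⊗[K] M) →ₗ[K] M ⊗[K] (M ⊗[K] M) :=
      (TensorProduct.assoc K M M M).toLinearMap ∘ₗ
        (TensorProduct.comm K M (M ⊗[K] M)).toLinearMap ∘ₗ (sw).toLinearMap.lTensor M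
    have h1 : ∀ u : M ⊗[K] M, TensorProduct.assoc K M M M ((Δop).rTensor M (sw u)) =
        τ ((Δ).lTensor M u) := by
      intro u
      induction u with
      | zero => simp
      | add x y hx hy => simp only [map_add, hx, hy]
      | tmul a b =>
        simp only [comm_tmul, rTensor_tmul, lTensor_tmul,
          comulOp_apply]
        simp [τ]
    have h2 : ∀ u : M ⊗[K] M, (Δop).lTensor M (sw u) =
        τ (TensorProduct.assoc K M M M ((Δ).rTensor M u)) := by
      intro u
      induction u with
      | zero => simp
      | add x y hx hy => simp only [map_add, hx, hy]
      | tmul a b =>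
        simp only [comm_tmul, rTensor_tmul, lTensor_tmul,
          comulOp_apply]
        generalize Δ a = t
        induction t with
        | zero => simp
        | add x y hx hy => simp only [map_add, add_tmul, tmul_add,
            hx, hy]
        | tmul c d => simp [τ]
    simp only [joint, comp_apply, coe_coe]
    rw [comulOp_apply, h1, h2, h]
  · ext x
    have h1 : ∀ u : M ⊗[K] M, TensorProduct.rid K M ((ε).lTensor M (sw u)) =
        TensorProduct.lid K M ((ε).rTensor M u) := by
      intro u
      induction u with
      | zero => simp
      | add x y hx hy => simp only [map_add, hx, hy]
      | tmul a b => simp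
    rw [evalFun_apply, comulOp_apply, h1, lid_counit_comul]
    rfl

theorem coComm_comulOp_comul : CoComm Δop Δ := by
  ext x
  have h := Coalgebra.coassoc_apply (R := K) x
  let τ : M ⊗[K] (M ⊗[K] M) →ₗ[K] (M ⊗[K] M) ⊗[K] M :=
    (sw).toLinearMap.rTensor M ∘ₗ (TensorProduct.assoc K M M M).symm.toLinearMap
  have h1 : ∀ u : M ⊗[K] M, (Δop).rTensor M u =
      τ (TensorProduct.assoc K M M M ((Δ).rTensor M u)) := by
    intro u
    induction u with
    | zero => simp
    | add x y hx hy => simp only [map_add, hx, hy]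
    | tmul a b => simp [τ]
  have h2 : ∀ u : M ⊗[K] M, rightComm K M M M ((Δ).rTensor M (sw u)) =
      τ ((Δ).lTensor M u) := by
    intro u
    induction u with
    | zero => simp
    | add x y hx hy => simp only [map_add, hx, hy]
    | tmul a b =>
      simp only [comm_tmul, rTensor_tmul, lTensor_tmul]
      generalize Δ b = t
      induction t with
      | zero => simp
      | add x y hx hy => simp only [map_add, add_tmul, tmul_add,
          hx, hy]
      | tmul c d => simp [τ]
  simp only [comp_apply, coe_coe]
  rw [h1, comulOp_apply, h2, h]

theorem prodAlong_mul'_comul : ProdAlong (mul' K M) (liftL M Δ) (liftR M Δ) Δ := by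
  ext x y
  simp only [TensorProduct.AlgebraTensorModule.curry_apply, restrictScalars_self,
    curry_apply, comp_apply, mul'_apply, joint, liftR_tmul,
    coe_coe, Bialgebra.comul_mul]
  generalize Δ y = t
  induction t with
  | zero => simp
  | add x y hx hy => simp only [map_add, tmul_add, mul_add, hx, hy]
  | tmul y y' =>
    simp only [assoc_symm_tmul, rTensor_tmul, liftL_tmul]
    generalize Δ x = t
    induction t with
    | zero => simp
    | add x y hx hy => simp only [map_add, add_tmul, add_mul, hx, hy]
    | tmul x x' => simp

theorem prodAlong_mul'_comulOp :
    ProdAlong (mul' K M) (liftL M Δop) (liftR M Δop) Δop := by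
  ext x y
  simp only [TensorProduct.AlgebraTensorModule.curry_apply, restrictScalars_self,
    curry_apply, comp_apply, mul'_apply, joint, liftR_tmul,
    coe_coe, Bialgebra.comul_mul, comulOp_apply]
  generalize Δ y = t
  induction t with
  | zero => simp
  | add x y hx hy => simp only [map_add, tmul_add, mul_add, hx, hy]
  | tmul y y' =>
    simp only [comm_tmul, assoc_symm_tmul, rTensor_tmul,
      liftL_tmul, comulOp_apply]
    generalize Δ x = t
    induction t with
    | zero => simp
    | add x y hx hy => simp only [map_add, add_tmul, add_mul, hx, hy]
    | tmul x x' => simp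

theorem ProdAlong.rTensor {X Y Z : Type*} [AddCommMonoid X] [Module K X] [AddCommMonoid Y]
    [Module K Y] [AddCommMonoid Z] [Module K Z] {P : X →ₗ[K] Y} {s₁ s₂ : X →ₗ[K] X ⊗[K] M}
    {s : Y →ₗ[K] Y ⊗[K] M} (h : ProdAlong P s₁ s₂ s) :
    ProdAlong (P.rTensor Z) (liftL Z s₁) (liftL Z s₂) (liftL Z s) := by
  ext x z
  have h' := LinearMap.congr_fun h x
  simp only [comp_apply] at h'
  simp only [TensorProduct.AlgebraTensorModule.curry_apply, restrictScalars_self,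
    curry_apply, comp_apply, joint_liftL, rTensor_tmul,
    liftL_tmul, h', coe_coe]
  generalize joint s₁ s₂ x = t
  induction t with
  | zero => simp
  | add x y hx hy => simp only [map_add, add_tmul, hx, hy]
  | tmul x m => simp

theorem ProdAlong.lTensor {X Y Z : Type*} [AddCommMonoid X] [Module K X] [AddCommMonoid Y]
    [Module K Y] [AddCommMonoid Z] [Module K Z] {P : X →ₗ[K] Y} {s₁ s₂ : X →ₗ[K] X ⊗[K] M}
    {s : Y →ₗ[K] Y ⊗[K] M} (h : ProdAlong P s₁ s₂ s) :
    ProdAlong (P.lTensor Z) (liftR Z s₁) (liftR Z s₂) (liftR Z s) := by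
  ext z x
  have h' := LinearMap.congr_fun h x
  simp only [comp_apply] at h'
  simp only [TensorProduct.AlgebraTensorModule.curry_apply, restrictScalars_self,
    curry_apply, comp_apply, joint_liftR, lTensor_tmul,
    liftR_tmul, h', coe_coe]
  generalize joint s₁ s₂ x = t
  induction t with
  | zero => simp
  | add x y hx hy => simp only [map_add, tmul_add, hx, hy]
  | tmul x m => simp

end Inverse

section InverseMul

variable {K M : Type*} [Field K] [Semiring M] [Bialgebra K M]

local notation "sw" => TensorProduct.comm K M M
local notation "Δ" => (Coalgebra.comul : M →ₗ[K] M ⊗[K] M)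
local notation "Δop" => comulOp K M
local notation "ε" => (Coalgebra.counit : M →ₗ[K] K)

/-- Inverse of an operator, intertwined by `P`. -/
theorem inv_comp_eq {W W' : Type*} [AddCommMonoid W] [Module K W] [AddCommMonoid W'] [Module K W']
    {P : W →ₗ[K] W'} {A A' : Module.End K W'} {B B' : Module.End K W} (h : A ∘ₗ P = P ∘ₗ B)
    (hA : A' * A = 1) (hB : B * B' = 1) : A' ∘ₗ P = P ∘ₗ B' := by
  calc A' ∘ₗ P = A' ∘ₗ P ∘ₗ (B * B') := by rw [hB]; rfl
    _ = A' ∘ₗ (P ∘ₗ B) ∘ₗ B' := rfl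
    _ = (A' * A) ∘ₗ P ∘ₗ B' := by rw [← h]; rfl
    _ = P ∘ₗ B' := by rw [hA]; rfl

theorem comp_inv_eq {W V : Type*} [AddCommMonoid W] [Module K W] [AddCommMonoid V] [Module K V]
    {p q : W →ₗ[K] V} {F F' G G' : Module.End K W} (e : q ∘ₗ F = p ∘ₗ F') (h : F * G = 1)
    (h' : F' * G' = 1) (c : G * G' = G' * G) : q ∘ₗ G' = p ∘ₗ G := by
  calc q ∘ₗ G' = q ∘ₗ ((F * G) * G') := by rw [h, one_mul]
    _ = (q ∘ₗ F) ∘ₗ (G' * G) := by rw [← c, mul_assoc]; rfl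
    _ = p ∘ₗ ((F' * G') * G) := by rw [e, mul_assoc]; rfl
    _ = p ∘ₗ G := by rw [h', one_mul]

theorem counit_coev_liftR {X : Type*} [AddCommMonoid X] [Module K X] (q : X →ₗ[K] K)
    (Φ : M →ₗ[K] Module.End K X) (x : X) (c : M) :
    TensorProduct.lid K K (TensorProduct.map q ε (coev (liftR X Δ)
      (LinearMap.rTensorHom M ∘ₗ Φ) (x ⊗ₜ c))) = q (Φ c x) := by
  have h : ∀ t : M ⊗[K] M, TensorProduct.lid K K (TensorProduct.map q ε
      (TensorProduct.lift (LinearMap.rTensorHom M ∘ₗ Φ).flip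
        ((TensorProduct.assoc K X M M).symm (x ⊗ₜ t)))) =
      q (Φ (TensorProduct.lid K M ((ε).rTensor M t)) x) := by
    intro t
    induction t with
    | zero => simp
    | add x y hx hy => simp only [map_add, tmul_add, LinearMap.add_apply, hx, hy]
    | tmul a b => simp [mul_comm]
  rw [coev_apply, liftR_tmul, h, lid_counit_comul]

theorem counit_pairOp_mul_pairOp (f : M ⊗[K] M →ₗ[K] K) (d : M →ₗ[K] M ⊗[K] M)
    (u : M ⊗[K] M) (c : M) :
    TensorProduct.lid K K (TensorProduct.map (counitPair K M) ε
      (coev (liftR (M ⊗[K] M) Δ) (pairOpL (liftL M (liftL M Δ)) (liftL M (liftR M Δ)) ∘ₗ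
        (pairAt f f).flip ∘ₗ d) (u ⊗ₜ c))) = pairAt f f u (d c) := by
  have h := counit_coev_liftR (counitPair K M)
    (pairOpL (liftL M Δ) (liftR M Δ) ∘ₗ (pairAt f f).flip ∘ₗ d) u c
  have e : LinearMap.rTensorHom M ∘ₗ (pairOpL (liftL M Δ) (liftR M Δ) ∘ₗ
      (pairAt f f).flip ∘ₗ d) = pairOpL (liftL M (liftL M Δ)) (liftL M (liftR M Δ)) ∘ₗ
        (pairAt f f).flip ∘ₗ d := by
    ext m : 1
    simp only [comp_apply, pairOpL_apply, pairOp_liftL]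
    rfl
  rw [e] at h
  rw [h]
  simp only [comp_apply, pairOpL_apply]
  exact LinearMap.congr_fun (counitPair_pairOp _) u

theorem counitPair_pairOp_mul (f : M ⊗[K] M →ₗ[K] K) (x y c : M) :
    counitPair K M (pairOp f (liftL M Δ) (liftR M Δ) (mul' K M (x ⊗ₜ y) ⊗ₜ c)) =
      f ((x * y) ⊗ₜ c) := LinearMap.congr_fun (counitPair_pairOp f) _

theorem counitPair_mul_eq (u : M ⊗[K] M) (c : M) :
    counitPair K M ((mul' K M).rTensor M (u ⊗ₜ c)) =
      TensorProduct.lid K K (TensorProduct.map (counitPair K M) ε (u ⊗ₜ c)) := by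
  induction u with
  | zero => simp
  | add x y hx hy => simp only [map_add, add_tmul, hx, hy]
  | tmul x y => simp [counitPair]

theorem counitPair_comp_mul : counitPair K M ∘ₗ (mul' K M).rTensor M =
    (TensorProduct.lid K K).toLinearMap ∘ₗ TensorProduct.map (counitPair K M) ε := by
  ext x y c
  exact counitPair_mul_eq (x ⊗ₜ y) c

theorem pairOp_eq_one_of_counitPair {W : Type*} [AddCommMonoid W] [Module K W]
    {δ δ' : W →ₗ[K] W ⊗[K] M} {d d' : M →ₗ[K] M ⊗[K] M} (h : IsSlot d ε δ)
    (h' : IsSlot d' ε δ') (hc : CoComm δ δ') {f g : M ⊗[K] M →ₗ[K] K}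
    (hfg : convWith f g d d' = counitPair K M) : pairOp f δ δ' * pairOp g δ δ' = 1 := by
  rw [pairOp_mul h h' hc, hfg]
  exact pairOp_unit h.counit h'.counit

theorem MulAt.inv_op {k k' : M ⊗[K] M →ₗ[K] K} (hk : MulAt k Δ)
    (h1 : convWith k k' Δ Δ = counitPair K M) (h2 : convWith k' k Δ Δ = counitPair K M) :
    MulAt k' Δop := by
  have s := isSlot_comul (K := K) (M := M)
  have hP := (prodAlong_mul'_comul (K := K) (M := M)).rTensor (Z := M)
  have hz := colin_rTensor_liftR (mul' K M) Δ
  have H := hP.pairOp_comp hz hk s.liftR (coComm_liftL_liftR _ _)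
  have c1 := coComm_liftL_liftR (liftL M Δ) Δ
  have c2 := coComm_liftL_liftR (liftR M Δ) Δ
  have e1 := pairOp_eq_one_of_counitPair s.liftL.liftL s.liftR c1 h1
  have e2 := pairOp_eq_one_of_counitPair s.liftR.liftL s.liftR c2 h1
  have H' := inv_comp_eq H (A' := pairOp k' (liftL M Δ) (liftR M Δ))
    (B' := pairOp k' (liftL M (liftR M Δ)) (liftR (M ⊗[K] M) Δ) *
      pairOp k' (liftL M (liftL M Δ)) (liftR (M ⊗[K] M) Δ))
    (pairOp_eq_one_of_counitPair s.liftL s.liftR (coComm_liftL_liftR _ _) h2)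
    (by rw [mul_assoc, ← mul_assoc (pairOp k (liftL M (liftR M Δ)) _), e2, one_mul, e1])
  rw [pairOp_mul_pairOp' s.liftR (coComm_liftL_liftR _ _).liftL c1] at H'
  intro x y c
  have := congrArg (counitPair K M) (LinearMap.congr_fun H' ((x ⊗ₜ y) ⊗ₜ c))
  simp only [comp_apply, rTensor_tmul, counitPair_pairOp_mul] at this
  rw [this]
  rw [← comp_apply, counitPair_comp_mul]
  exact counit_pairOp_mul_pairOp k' Δop (x ⊗ₜ y) c

theorem MulAt.inv {k k' : M ⊗[K] M →ₗ[K] K} (hk : MulAt k Δop)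
    (h1 : convWith k k' Δ Δ = counitPair K M) (h2 : convWith k' k Δ Δ = counitPair K M) :
    MulAt k' Δ := by
  have s := isSlot_comul (K := K) (M := M)
  have hP := (prodAlong_mul'_comul (K := K) (M := M)).rTensor (Z := M)
  have hz := colin_rTensor_liftR (mul' K M) Δ
  have H := hP.pairOp_comp' hz hk (by rw [comm_comp_comulOp]; exact s.liftR)
    (coComm_liftL_liftR _ _).liftL (coComm_liftL_liftR _ _)
  have c1 := coComm_liftL_liftR (liftL M Δ) Δ
  have c2 := coComm_liftL_liftR (liftR M Δ) Δ
  have e1 := pairOp_eq_one_of_counitPair s.liftL.liftL s.liftR c1 h1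
  have e2 := pairOp_eq_one_of_counitPair s.liftR.liftL s.liftR c2 h1
  have H' := inv_comp_eq H (A' := pairOp k' (liftL M Δ) (liftR M Δ))
    (B' := pairOp k' (liftL M (liftL M Δ)) (liftR (M ⊗[K] M) Δ) *
      pairOp k' (liftL M (liftR M Δ)) (liftR (M ⊗[K] M) Δ))
    (pairOp_eq_one_of_counitPair s.liftL s.liftR (coComm_liftL_liftR _ _) h2)
    (by rw [mul_assoc, ← mul_assoc (pairOp k (liftL M (liftL M Δ)) _), e1, one_mul, e2])
  rw [pairOp_mul_pairOp s.liftR c2] at H'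
  intro x y c
  have := congrArg (counitPair K M) (LinearMap.congr_fun H' ((x ⊗ₜ y) ⊗ₜ c))
  simp only [comp_apply, rTensor_tmul, counitPair_pairOp_mul] at this
  rw [this]
  rw [← comp_apply, counitPair_comp_mul]
  exact counit_pairOp_mul_pairOp k' Δ (x ⊗ₜ y) c

end InverseMul

section Quasi

variable {K M : Type*} [Field K] [Semiring M] [Bialgebra K M] (Q : DualQuasitriangular K M)

local notation "sw" => TensorProduct.comm K M M
local notation "Δ" => (Coalgebra.comul : M →ₗ[K] M ⊗[K] M)
local notation "Δop" => comulOp K M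
local notation "ε" => (Coalgebra.counit : M →ₗ[K] K)

theorem DualQuasitriangular.mulAt_form : MulAt Q.form Δ := fun x y c => by
  rw [Q.form_mul_left, pairAt_apply]

theorem DualQuasitriangular.mulAt_form_comm : MulAt (Q.form ∘ₗ (sw).toLinearMap) Δop :=
  fun x y c => by
    rw [pairAt_comm, pairAt_swap, comm_comulOp, comm_tmul, pairAt_apply,
      ← Q.form_mul_right]
    rfl

theorem counitPair_comm : counitPair K M ∘ₗ (sw).toLinearMap = counitPair K M := by
  ext; simp [counitPair, mul_comm]

theorem DualQuasitriangular.mulAt_inv : MulAt Q.inv Δop :=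
  Q.mulAt_form.inv_op Q.form_inv Q.inv_form

theorem DualQuasitriangular.mulAt_inv_comm : MulAt (Q.inv ∘ₗ (sw).toLinearMap) Δ :=
  Q.mulAt_form_comm.inv (by rw [convWith_comm, Q.form_inv, counitPair_comm])
    (by rw [convWith_comm, Q.inv_form, counitPair_comm])

theorem convWith_comm_slots (f g : M ⊗[K] M →ₗ[K] K) (d d' : M →ₗ[K] M ⊗[K] M) :
    convWith f g ((sw).toLinearMap ∘ₗ d) ((sw).toLinearMap ∘ₗ d') = convWith g f d d' := by
  ext x y
  simp only [TensorProduct.AlgebraTensorModule.curry_apply, restrictScalars_self,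
    curry_apply, convWith_tmul, comp_apply, coe_coe]
  exact (pairAt_swap f g _ _).symm

theorem DualQuasitriangular.form_comm_actAt (a b : M) :
    mul' K M (sw (actAt Q.form (Δop a) (Δop b))) =
      mul' K M (actAt Q.form (sw (Δop a)) (sw (Δop b))) := by
  have := Q.form_comm a b
  rwa [actWith_tmul, actWith_tmul, ← comm_comulOp a, ← comm_comulOp b] at this

theorem DualQuasitriangular.inv_comm_actAt (a b : M) :
    mul' K M (sw (actAt Q.inv (Δ a) (Δ b))) =
      mul' K M (actAt Q.inv (sw (Δ a)) (sw (Δ b))) := by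
  have s := isSlot_comul (K := K) (M := M)
  have s' := isSlot_comulOp (K := K) (M := M)
  have h (f) (d d' : M →ₗ[K] M ⊗[K] M) (a b : M) :
      actAt f (d a) (d' b) = pairOp f (liftL M ((sw).toLinearMap ∘ₗ d))
      (liftR M ((sw).toLinearMap ∘ₗ d')) (a ⊗ₜ b) := by
    rw [← actWith_tmul, actWith_eq_pairOp]
  have e : ((mul' K M) ∘ₗ (sw).toLinearMap) ∘ₗ pairOp Q.form (liftL M Δ) (liftR M Δ) =
      mul' K M ∘ₗ pairOp Q.form (liftL M Δop) (liftR M Δop) := by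
    ext a b
    have := Q.form_comm_actAt a b
    rw [comm_comulOp, comm_comulOp, h, h] at this
    simpa using this
  have i1 := pairOp_eq_one_of_counitPair s.liftL s.liftR (coComm_liftL_liftR _ _) Q.form_inv
  have i2 := pairOp_eq_one_of_counitPair (f := Q.form) (g := Q.inv) s'.liftL s'.liftR
    (coComm_liftL_liftR _ _) (by
      have := convWith_comm_slots Q.form Q.inv Δ Δ
      rw [comm_comp_comul] at this
      rw [this, Q.inv_form])
  have c : pairOp Q.inv (liftL M Δ) (liftR M Δ) * pairOp Q.inv (liftL M Δop) (liftR M Δop) =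
      pairOp Q.inv (liftL M Δop) (liftR M Δop) * pairOp Q.inv (liftL M Δ) (liftR M Δ) := by
    have c0 := coComm_comulOp_comul (K := K) (M := M)
    exact commute_pairOp c0.symm.liftL (coComm_liftL_liftR _ _) (coComm_liftL_liftR _ _).symm
      c0.symm.liftR _ _
  have key := comp_inv_eq e i1 i2 c
  rw [comm_comul, comm_comul, h, h, comm_comp_comulOp]
  exact LinearMap.congr_fun key (a ⊗ₜ b)

end Quasi

/-! ### Lines and their crossings -/

/-- The coproduct of a line of type `t`. -/
noncomputable def cop (K M : Type*) [Field K] [Semiring M] [Bialgebra K M] (t : Bool) :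
    M →ₗ[K] M ⊗[K] M := cond t Coalgebra.comul (comulOp K M)

/-- A coaction of `M` (`t = true`) or of `M` with the opposite coproduct (`t = false`) on `W`. -/
structure Line (K M : Type*) [Field K] [Semiring M] [Bialgebra K M] (t : Bool) (W : Type*)
    [AddCommMonoid W] [Module K W] where
  δ : W →ₗ[K] W ⊗[K] M
  isSlot : IsSlot (cop K M t) Coalgebra.counit δ

section Lines

variable {K M W W' : Type*} [Field K] [Semiring M] [Bialgebra K M]
  [AddCommMonoid W] [Module K W] [AddCommMonoid W'] [Module K W']

local notation "sw" => TensorProduct.comm K M M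
local notation "Δ" => (Coalgebra.comul : M →ₗ[K] M ⊗[K] M)
local notation "Δop" => comulOp K M
local notation "ε" => (Coalgebra.counit : M →ₗ[K] K)

/-- The pairing attached to the crossing of lines of types `s` and `t`. -/
def DualQuasitriangular.SecondInverse.letter {Q : DualQuasitriangular K M}
    (S : Q.SecondInverse) (s t : Bool) : M ⊗[K] M →ₗ[K] K :=
  match s, t with
  | true, true => Q.form
  | false, false => Q.form
  | false, true => Q.inv
  | true, false => S.til

variable {Q : DualQuasitriangular K M} (S : Q.SecondInverse)

/-- The operator attached to the crossing of two lines. -/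
noncomputable def DualQuasitriangular.SecondInverse.cross {s t : Bool} (x : Line K M s W)
    (y : Line K M t W) : Module.End K W := pairOp (S.letter s t) x.δ y.δ

/-- Commuting lines. -/
def Line.Indep {s t : Bool} (x : Line K M s W) (y : Line K M t W) : Prop := CoComm x.δ y.δ

theorem Line.Indep.symm {s t : Bool} {x : Line K M s W} {y : Line K M t W} (h : x.Indep y) :
    y.Indep x := CoComm.symm h

/-- The map `p` is colinear for the lines `x` and `x'`. -/
def Line.Along {s : Bool} (p : W →ₗ[K] W') (x : Line K M s W) (x' : Line K M s W') : Prop :=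
  Colin p x.δ x'.δ

theorem form_mul_inv {t : Bool} {x y : Line K M t W} (h : x.Indep y) :
    pairOp Q.form x.δ y.δ * pairOp Q.inv x.δ y.δ = 1 := by
  refine pairOp_eq_one_of_counitPair x.isSlot y.isSlot h ?_
  cases t
  · exact (convWith_comm_slots _ _ Δ Δ).trans Q.inv_form
  · exact Q.form_inv

theorem inv_mul_form {t : Bool} {x y : Line K M t W} (h : x.Indep y) :
    pairOp Q.inv x.δ y.δ * pairOp Q.form x.δ y.δ = 1 := by
  refine pairOp_eq_one_of_counitPair x.isSlot y.isSlot h ?_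
  cases t
  · exact (convWith_comm_slots _ _ Δ Δ).trans Q.form_inv
  · exact Q.inv_form

theorem form_mul_til {x : Line K M true W} {y : Line K M false W} (h : x.Indep y) :
    pairOp Q.form x.δ y.δ * S.cross x y = 1 :=
  pairOp_eq_one_of_counitPair x.isSlot y.isSlot h S.form_til

theorem til_mul_form {x : Line K M true W} {y : Line K M false W} (h : x.Indep y) :
    S.cross x y * pairOp Q.form x.δ y.δ = 1 :=
  pairOp_eq_one_of_counitPair x.isSlot y.isSlot h S.til_form

theorem cross_commute {s t u v : Bool} {x : Line K M s W} {y : Line K M t W} {z : Line K M u W}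
    {w : Line K M v W} (h1 : x.Indep z) (h2 : x.Indep w) (h3 : y.Indep z) (h4 : y.Indep w) :
    Commute (S.cross x y) (S.cross z w) := commute_pairOp h1 h2 h3 h4 _ _

theorem cross_comp {s t : Bool} {x : Line K M s W} {y : Line K M t W} {x' : Line K M s W'}
    {y' : Line K M t W'} {p : W →ₗ[K] W'} (hx : Line.Along p x x') (hy : Line.Along p y y') :
    S.cross x' y' ∘ₗ p = p ∘ₗ S.cross x y := pairOp_comp hx hy _

theorem tri_rrr (a b c : M) : tri Q.form Q.form Q.form (Δ a) (Δ b) (Δ c) =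
    tri Q.form Q.form Q.form (Δop a) (Δop b) (Δop c) := by
  have := tri_of_comm Q.form_comm_actAt Q.mulAt_form a b c
  simp only [comm_comul, comm_comulOp] at this
  exact this.symm

theorem tri_llr (a b c : M) : tri Q.form Q.inv Q.inv (Δop a) (Δop b) (Δ c) =
    tri Q.form Q.inv Q.inv (Δ a) (Δ b) (Δop c) := by
  have := tri_of_comm Q.form_comm_actAt Q.mulAt_inv a b c
  simpa only [comm_comul, comm_comulOp] using this

theorem tri_lrr (a b c : M) : tri Q.inv Q.inv Q.form (Δop a) (Δ b) (Δ c) =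
    tri Q.inv Q.inv Q.form (Δ a) (Δop b) (Δop c) := by
  have := tri_of_comm Q.form_comm_actAt Q.mulAt_inv_comm b c a
  rw [← tri_cycle _ _ _ (Δop a), ← tri_cycle _ _ _ (Δ a)]
  simpa only [comm_comul, comm_comulOp] using this

theorem tri_lrr' (a b c : M) : tri Q.form Q.form Q.inv (Δ a) (Δop b) (Δop c) =
    tri Q.form Q.form Q.inv (Δop a) (Δ b) (Δ c) := by
  have := tri_of_comm Q.inv_comm_actAt Q.mulAt_form_comm b c a
  rw [← tri_cycle _ _ _ (Δop a), ← tri_cycle _ _ _ (Δ a)]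
  simpa only [comm_comul, comm_comulOp] using this

theorem tri_rrl' (a b c : M) : tri Q.inv Q.form Q.form (Δ a) (Δ b) (Δop c) =
    tri Q.inv Q.form Q.form (Δop a) (Δop b) (Δ c) := by
  have := tri_of_comm Q.inv_comm_actAt Q.mulAt_form a b c
  simpa only [comm_comul, comm_comulOp] using this

local notation "τ" f => f ∘ₗ LinearEquiv.toLinearMap (TensorProduct.comm K M M)

theorem tri_swap₁₂_eq {f g h : M ⊗[K] M →ₗ[K] K} {u u' v v' w w' : M ⊗[K] M}
    (H : tri f g h u v (sw w) = tri f g h u' v' (sw w')) :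
    tri (τ f) h g v u w = tri (τ f) h g v' u' w' := by
  have e (w : M ⊗[K] M) : sw (sw w) = w := (sw).symm_apply_apply w
  rw [← tri_swap₁₂, ← tri_swap₁₂ _ _ _ u', e, e] at H
  exact H

theorem tri_swap₂₃_eq {f g h : M ⊗[K] M →ₗ[K] K} {u u' v v' w w' : M ⊗[K] M}
    (H : tri f g h (sw u) v w = tri f g h (sw u') v' w') :
    tri g f (τ h) u w v = tri g f (τ h) u' w' v' := by
  have e (w : M ⊗[K] M) : sw (sw w) = w := (sw).symm_apply_apply w
  rw [← tri_swap₂₃, ← tri_swap₂₃ _ _ _ (sw u'), e, e] at H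
  exact H

theorem tri_rrl_base (a b c : M) : tri (τ Q.form) Q.form Q.form (Δ b) (Δ a) (Δop c) =
    tri (τ Q.form) Q.form Q.form (Δop b) (Δop a) (Δ c) :=
  tri_swap₁₂_eq (by rw [comm_comulOp, comm_comul]; exact tri_rrr a b c)

theorem tri_rll_base (a b c : M) : tri Q.form Q.form (τ Q.form) (Δ a) (Δop c) (Δop b) =
    tri Q.form Q.form (τ Q.form) (Δop a) (Δ c) (Δ b) :=
  tri_swap₂₃_eq (by rw [comm_comulOp, comm_comul]; exact (tri_rrr a b c).symm)

theorem tri_rlr_base (a b c : M) : tri (τ Q.form) Q.inv Q.form (Δop b) (Δ a) (Δ c) =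
    tri (τ Q.form) Q.inv Q.form (Δ b) (Δop a) (Δop c) :=
  tri_swap₁₂_eq (by rw [comm_comulOp, comm_comul]; exact tri_lrr' a b c)

theorem tri_lrl_base (a b c : M) : tri Q.form Q.inv (τ Q.form) (Δop a) (Δop c) (Δ b) =
    tri Q.form Q.inv (τ Q.form) (Δ a) (Δ c) (Δop b) :=
  tri_swap₂₃_eq (by rw [comm_comulOp, comm_comul]; exact tri_rrl' a b c)

end Lines

section Invert

variable {G : Type*} [Monoid G]

theorem invert₁₂ {a b c a' b' : G} (ha : a * a' = 1) (ha' : a' * a = 1) (hb : b * b' = 1)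
    (hb' : b' * b = 1) (h : c * a * b = b * a * c) : c * b' * a' = a' * b' * c := by
  calc c * b' * a' = a' * b' * (b * a * c) * b' * a' := by
        rw [show a' * b' * (b * a * c) * b' * a' = a' * (b' * b) * a * c * b' * a' by
          simp only [mul_assoc], hb', mul_one, ha', one_mul]
    _ = a' * b' * (c * a * b) * b' * a' := by rw [h]
    _ = a' * b' * c * (a * (b * b') * a') := by simp only [mul_assoc]
    _ = a' * b' * c := by rw [hb, mul_one, ha, mul_one]

theorem invert₁ {a a' b c : G} (ha : a * a' = 1) (ha' : a' * a = 1) (h : a * b * c = c * b * a) :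
    a' * c * b = b * c * a' := by
  calc a' * c * b = a' * (c * b * a) * a' := by
        rw [show a' * (c * b * a) * a' = a' * c * b * (a * a') by simp only [mul_assoc], ha,
          mul_one]
    _ = a' * (a * b * c) * a' := by rw [h]
    _ = (a' * a) * b * c * a' := by simp only [mul_assoc]
    _ = b * c * a' := by rw [ha', one_mul]

end Invert

section YangBaxter

variable {K M W W' : Type*} [Field K] [Semiring M] [Bialgebra K M]
  [AddCommMonoid W] [Module K W] [AddCommMonoid W'] [Module K W']

local notation "sw" => TensorProduct.comm K M M
local notation "Δ" => (Coalgebra.comul : M →ₗ[K] M ⊗[K] M)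
local notation "Δop" => comulOp K M
local notation "ε" => (Coalgebra.counit : M →ₗ[K] K)

theorem Line.slot_true (x : Line K M true W) : IsSlot Δ ε x.δ := x.isSlot

theorem Line.slot_false (x : Line K M false W) : IsSlot Δop ε x.δ := x.isSlot

variable {Q : DualQuasitriangular K M} (S : Q.SecondInverse)

theorem cross_yangBaxter_rrl {x : Line K M true W} {y : Line K M true W} {z : Line K M false W}
    (h12 : x.Indep y) (h13 : x.Indep z) (h23 : y.Indep z) :
    S.cross x y * S.cross x z * S.cross y z = S.cross y z * S.cross x z * S.cross x y := by
  have base := yangBaxter_of_tri y.slot_true x.slot_true z.slot_false h12.symm h23 h13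
    (f := Q.form ∘ₗ (sw).toLinearMap) (g := Q.form) (h := Q.form)
    fun b a c => by rw [comm_comul, comm_comul, comm_comulOp]; exact tri_rrl_base a b c
  rw [← pairOp_flip h12] at base
  exact invert₁₂ (form_mul_til S h23) (til_mul_form S h23) (form_mul_til S h13)
    (til_mul_form S h13) base

theorem cross_yangBaxter_rll {x : Line K M true W} {y : Line K M false W} {z : Line K M false W}
    (h12 : x.Indep y) (h13 : x.Indep z) (h23 : y.Indep z) :
    S.cross x y * S.cross x z * S.cross y z = S.cross y z * S.cross x z * S.cross x y := by
  have base := yangBaxter_of_tri x.slot_true z.slot_false y.slot_false h13 h12 h23.symm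
    (f := Q.form) (g := Q.form) (h := Q.form ∘ₗ (sw).toLinearMap)
    fun a c b => by rw [comm_comul, comm_comulOp, comm_comulOp]; exact tri_rll_base a b c
  rw [← pairOp_flip h23] at base
  exact (invert₁₂ (form_mul_til S h12) (til_mul_form S h12) (form_mul_til S h13)
    (til_mul_form S h13) base.symm).symm

theorem cross_yangBaxter_rlr {x : Line K M true W} {y : Line K M false W} {z : Line K M true W}
    (h12 : x.Indep y) (h13 : x.Indep z) (h23 : y.Indep z) :
    S.cross x y * S.cross x z * S.cross y z = S.cross y z * S.cross x z * S.cross x y := by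
  have base := yangBaxter_of_tri y.slot_false x.slot_true z.slot_true h12.symm h23 h13
    (f := Q.form ∘ₗ (sw).toLinearMap) (g := Q.inv) (h := Q.form)
    fun b a c => by rw [comm_comul, comm_comul, comm_comulOp]; exact tri_rlr_base a b c
  rw [← pairOp_flip h12] at base
  exact invert₁ (form_mul_til S h12) (til_mul_form S h12) base

theorem cross_yangBaxter_lrl {x : Line K M false W} {y : Line K M true W} {z : Line K M false W}
    (h12 : x.Indep y) (h13 : x.Indep z) (h23 : y.Indep z) :
    S.cross x y * S.cross x z * S.cross y z = S.cross y z * S.cross x z * S.cross x y := by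
  have base := yangBaxter_of_tri x.slot_false z.slot_false y.slot_true h13 h12 h23.symm
    (f := Q.form) (g := Q.inv) (h := Q.form ∘ₗ (sw).toLinearMap)
    fun a c b => by rw [comm_comul, comm_comulOp, comm_comulOp]; exact tri_lrl_base a b c
  rw [← pairOp_flip h23] at base
  exact (invert₁ (form_mul_til S h23) (til_mul_form S h23) base.symm).symm

/-- The Yang–Baxter equation for lines of arbitrary types. -/
theorem cross_yangBaxter {s t u : Bool} {x : Line K M s W} {y : Line K M t W} {z : Line K M u W}
    (h12 : x.Indep y) (h13 : x.Indep z) (h23 : y.Indep z) :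
    S.cross x y * S.cross x z * S.cross y z = S.cross y z * S.cross x z * S.cross x y := by
  match s, t, u with
  | true, true, true =>
    exact yangBaxter_of_tri x.slot_true y.slot_true z.slot_true h12 h13 h23 tri_rrr
  | false, false, false =>
    refine yangBaxter_of_tri x.slot_false y.slot_false z.slot_false h12 h13 h23 fun a b c => ?_
    simp only [comm_comulOp]
    exact (tri_rrr a b c).symm
  | false, true, true =>
    refine yangBaxter_of_tri x.slot_false y.slot_true z.slot_true h12 h13 h23 fun a b c => ?_
    simp only [comm_comulOp, comm_comul]
    exact tri_lrr a b c
  | false, false, true =>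
    refine yangBaxter_of_tri x.slot_false y.slot_false z.slot_true h12 h13 h23 fun a b c => ?_
    simp only [comm_comulOp, comm_comul]
    exact tri_llr a b c
  | true, true, false => exact cross_yangBaxter_rrl S h12 h13 h23
  | true, false, false => exact cross_yangBaxter_rll S h12 h13 h23
  | true, false, true => exact cross_yangBaxter_rlr S h12 h13 h23
  | false, true, false => exact cross_yangBaxter_lrl S h12 h13 h23

/-! ### Crossings along products -/

/-- The line `x` is the product of `x₁` and `x₂` along `P`. -/
def Line.Prod {s : Bool} (P : W →ₗ[K] W') (x₁ x₂ : Line K M s W) (x : Line K M s W') : Prop :=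
  ProdAlong P x₁.δ x₂.δ x.δ

theorem cross_prod_r {t : Bool} {P : W →ₗ[K] W'} {x₁ x₂ : Line K M true W}
    {x : Line K M true W'} {z : Line K M t W} {z' : Line K M t W'} (h : Line.Prod P x₁ x₂ x)
    (hz : Line.Along P z z') (h12 : x₁.Indep x₂) (h1 : x₁.Indep z) (h2 : x₂.Indep z)
    (h' : x.Indep z') :
    S.cross x z' ∘ₗ P = P ∘ₗ (S.cross x₁ z * S.cross x₂ z) := by
  match t with
  | true => exact h.pairOp_comp hz Q.mulAt_form z.slot_true h2
  | false =>
    have H := h.pairOp_comp' hz Q.mulAt_form z.slot_false h12 h1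
    refine inv_comp_eq H (til_mul_form S h') ?_
    rw [mul_assoc, ← mul_assoc (pairOp Q.form x₁.δ z.δ), form_mul_til S h1, one_mul,
      form_mul_til S h2]

theorem cross_prod_l {t : Bool} {P : W →ₗ[K] W'} {x₁ x₂ : Line K M false W}
    {x : Line K M false W'} {z : Line K M t W} {z' : Line K M t W'} (h : Line.Prod P x₁ x₂ x)
    (hz : Line.Along P z z') (h12 : x₁.Indep x₂) (h1 : x₁.Indep z) :
    S.cross x z' ∘ₗ P = P ∘ₗ (S.cross x₂ z * S.cross x₁ z) := by
  match t with
  | true =>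
    exact h.pairOp_comp' hz Q.mulAt_inv
      (by rw [comm_comp_comulOp]; exact z.slot_true) h12 h1
  | false => exact h.pairOp_comp' hz Q.mulAt_form z.slot_false h12 h1

theorem prod_cross_r {t : Bool} {P : W →ₗ[K] W'} {x₁ x₂ : Line K M true W}
    {x : Line K M true W'} {z : Line K M t W} {z' : Line K M t W'} (h : Line.Prod P x₁ x₂ x)
    (hz : Line.Along P z z') (h12 : x₁.Indep x₂) (h1 : z.Indep x₁) (h2 : z.Indep x₂)
    (h' : z'.Indep x) :
    S.cross z' x ∘ₗ P = P ∘ₗ (S.cross z x₂ * S.cross z x₁) := by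
  match t with
  | true =>
    simp only [DualQuasitriangular.SecondInverse.cross, DualQuasitriangular.SecondInverse.letter]
    rw [pairOp_flip h', pairOp_flip h1, pairOp_flip h2]
    exact h.pairOp_comp' hz Q.mulAt_form_comm
      (by rw [comm_comp_comulOp]; exact z.slot_true) h12 h1.symm
  | false =>
    simp only [DualQuasitriangular.SecondInverse.cross, DualQuasitriangular.SecondInverse.letter]
    rw [pairOp_flip h', pairOp_flip h1, pairOp_flip h2]
    exact h.pairOp_comp' hz Q.mulAt_inv_comm z.slot_false h12 h1.symm

theorem prod_cross_l {t : Bool} {P : W →ₗ[K] W'} {x₁ x₂ : Line K M false W}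
    {x : Line K M false W'} {z : Line K M t W} {z' : Line K M t W'} (h : Line.Prod P x₁ x₂ x)
    (hz : Line.Along P z z') (h12 : x₁.Indep x₂) (h1 : z.Indep x₁) (h2 : z.Indep x₂)
    (h' : z'.Indep x) :
    S.cross z' x ∘ₗ P = P ∘ₗ (S.cross z x₁ * S.cross z x₂) := by
  match t with
  | true =>
    have H : pairOp Q.form z'.δ x.δ ∘ₗ P =
        P ∘ₗ (pairOp Q.form z.δ x₂.δ * pairOp Q.form z.δ x₁.δ) := by
      rw [pairOp_flip h', pairOp_flip h1, pairOp_flip h2]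
      exact h.pairOp_comp' hz Q.mulAt_form_comm
        (by rw [comm_comp_comulOp]; exact z.slot_true) h12 h1.symm
    refine inv_comp_eq H (til_mul_form S h') ?_
    rw [mul_assoc, ← mul_assoc (pairOp Q.form z.δ x₁.δ), form_mul_til S h1, one_mul,
      form_mul_til S h2]
  | false =>
    simp only [DualQuasitriangular.SecondInverse.cross, DualQuasitriangular.SecondInverse.letter]
    rw [pairOp_flip h', pairOp_flip h1, pairOp_flip h2]
    exact h.pairOp_comp hz Q.mulAt_form_comm z.slot_false h2.symm

end YangBaxter

/-! ### Bicomodules -/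

/-- A bicomodule, as a pair of commuting lines. -/
structure Site (K M W : Type*) [Field K] [Semiring M] [Bialgebra K M]
    [AddCommMonoid W] [Module K W] where
  l : Line K M false W
  r : Line K M true W
  indep : l.Indep r

section Sites

variable {K M W W' : Type*} [Field K] [Semiring M] [Bialgebra K M]
  [AddCommMonoid W] [Module K W] [AddCommMonoid W'] [Module K W']

/-- The line commutes with those of the bicomodule. -/
structure Site.IndepLine {t : Bool} (a : Site K M W) (y : Line K M t W) : Prop where
  l : a.l.Indep y
  r : a.r.Indep y

/-- Bicomodules with commuting coactions. -/
structure Site.Indep (a b : Site K M W) : Prop where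
  l : a.IndepLine b.l
  r : a.IndepLine b.r

theorem Site.Indep.symm {a b : Site K M W} (h : a.Indep b) : b.Indep a :=
  ⟨⟨h.l.l.symm, h.r.l.symm⟩, ⟨h.l.r.symm, h.r.r.symm⟩⟩

/-- The map `p` respects the coactions. -/
structure Site.Along (p : W →ₗ[K] W') (a : Site K M W) (a' : Site K M W') : Prop where
  l : Line.Along p a.l a'.l
  r : Line.Along p a.r a'.r

/-- The coactions of `c` are the products of those of `a` and `b`, along `P`. -/
structure Site.Prod (P : W →ₗ[K] W') (a b : Site K M W) (c : Site K M W') : Prop where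
  l : Line.Prod P a.l b.l c.l
  r : Line.Prod P a.r b.r c.r

namespace DualQuasitriangular.SecondInverse

variable {Q : DualQuasitriangular K M} (S : Q.SecondInverse) {s t : Bool}

/-- The crossing of a bicomodule with a line. -/
noncomputable def crossL (a : Site K M W) (y : Line K M t W) : Module.End K W :=
  S.cross a.l y * S.cross a.r y

/-- The crossing of a line with a bicomodule. -/
noncomputable def crossR (y : Line K M t W) (b : Site K M W) : Module.End K W :=
  S.cross y b.r * S.cross y b.l

/-- The crossing of two bicomodules. -/
noncomputable def crossing (a b : Site K M W) : Module.End K W :=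
  S.crossL a b.r * S.crossL a b.l

/-- The operator that deforms the product. -/
noncomputable def twist (a b : Site K M W) : Module.End K W := S.crossL a b.l

variable {S}

theorem crossL_commute {a : Site K M W} {y : Line K M t W} {x : Line K M s W} {u : Bool}
    {z : Line K M u W} (h1 : a.IndepLine x) (h2 : a.IndepLine z) (h3 : y.Indep x)
    (h4 : y.Indep z) : Commute (S.crossL a y) (S.cross x z) :=
  (cross_commute S h1.l h2.l h3 h4).mul_left (cross_commute S h1.r h2.r h3 h4)

theorem crossL_commute_crossL {a b : Site K M W} {y : Line K M t W} {z : Line K M s W}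
    (hab : a.Indep b) (haz : a.IndepLine z) (hby : b.IndepLine y) (hyz : y.Indep z) :
    Commute (S.crossL a y) (S.crossL b z) :=
  (crossL_commute hab.l haz hby.l.symm hyz).mul_right
    (crossL_commute hab.r haz hby.r.symm hyz)

theorem crossing_eq {a b : Site K M W} (hab : a.Indep b) :
    S.crossing a b = S.crossR a.l b * S.crossR a.r b := by
  have h : Commute (S.cross a.r b.r) (S.cross a.l b.l) :=
    cross_commute S a.indep.symm hab.l.r hab.r.l.symm b.indep.symm
  simp only [crossing, crossL, crossR, mul_assoc]
  rw [← mul_assoc (S.cross a.r b.r), h.eq, mul_assoc]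

theorem crossL_yangBaxter {a : Site K M W} {y : Line K M s W} {z : Line K M t W}
    (hy : a.IndepLine y) (hz : a.IndepLine z) (hyz : y.Indep z) :
    S.crossL a y * S.crossL a z * S.cross y z = S.cross y z * S.crossL a z * S.crossL a y := by
  have h1 := cross_yangBaxter S hy.l hz.l hyz
  have h2 := cross_yangBaxter S hy.r hz.r hyz
  have c1 : Commute (S.cross a.r y) (S.cross a.l z) :=
    cross_commute S a.indep.symm hz.r hy.l.symm hyz
  have c2 : Commute (S.cross a.l y) (S.cross a.r z) :=
    cross_commute S a.indep hz.l hy.r.symm hyz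
  calc S.crossL a y * S.crossL a z * S.cross y z
      = S.cross a.l y * (S.cross a.r y * S.cross a.l z) * S.cross a.r z * S.cross y z := by
        simp only [crossL, mul_assoc]
    _ = S.cross a.l y * S.cross a.l z * (S.cross a.r y * S.cross a.r z * S.cross y z) := by
        rw [c1.eq]; simp only [mul_assoc]
    _ = (S.cross a.l y * S.cross a.l z * S.cross y z) * S.cross a.r z * S.cross a.r y := by
        rw [h2]; simp only [mul_assoc]
    _ = S.cross y z * S.cross a.l z * (S.cross a.l y * S.cross a.r z) * S.cross a.r y := by
        rw [h1]; simp only [mul_assoc]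
    _ = S.cross y z * S.crossL a z * S.crossL a y := by
        rw [c2.eq]; simp only [crossL, mul_assoc]

theorem crossR_yangBaxter {b : Site K M W} {x : Line K M s W} {z : Line K M t W}
    (hx : b.IndepLine x) (hz : b.IndepLine z) (hxz : x.Indep z) :
    S.crossR x b * S.cross x z * S.crossL b z = S.crossL b z * S.cross x z * S.crossR x b := by
  have h1 := cross_yangBaxter S hx.l.symm hxz hz.l
  have h2 := cross_yangBaxter S hx.r.symm hxz hz.r
  have c1 : Commute (S.cross x b.r) (S.cross b.l z) :=
    cross_commute S hx.l.symm hxz b.indep.symm hz.r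
  have c2 : Commute (S.cross x b.l) (S.cross b.r z) :=
    cross_commute S hx.r.symm hxz b.indep hz.l
  calc S.crossR x b * S.cross x z * S.crossL b z
      = S.cross x b.r * (S.cross x b.l * S.cross x z * S.cross b.l z) * S.cross b.r z := by
        simp only [crossR, crossL, mul_assoc]
    _ = (S.cross x b.r * S.cross b.l z) * S.cross x z * (S.cross x b.l * S.cross b.r z) := by
        rw [h1]; simp only [mul_assoc]
    _ = S.cross b.l z * (S.cross x b.r * S.cross x z * S.cross b.r z) * S.cross x b.l := by
        rw [c1.eq, c2.eq]; simp only [mul_assoc]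
    _ = S.crossL b z * S.cross x z * S.crossR x b := by
        rw [h2]; simp only [crossR, crossL, mul_assoc]

theorem crossing_crossL {a b : Site K M W} {z : Line K M t W} (hab : a.Indep b)
    (haz : a.IndepLine z) (hbz : b.IndepLine z) :
    S.crossing a b * S.crossL a z * S.crossL b z =
      S.crossL b z * S.crossL a z * S.crossing a b := by
  have h1 := crossL_yangBaxter (S := S) hab.l haz hbz.l
  have h2 := crossL_yangBaxter (S := S) hab.r haz hbz.r
  have c1 : Commute (S.crossL a b.r) (S.cross b.l z) :=
    crossL_commute hab.l haz b.indep.symm hbz.r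
  have c2 : Commute (S.crossL a b.l) (S.cross b.r z) :=
    crossL_commute hab.r haz b.indep hbz.l
  calc S.crossing a b * S.crossL a z * S.crossL b z
      = S.crossL a b.r * (S.crossL a b.l * S.crossL a z * S.cross b.l z) * S.cross b.r z := by
        rw [crossing, crossL.eq_1 S b z]; simp only [mul_assoc]
    _ = (S.crossL a b.r * S.cross b.l z) * S.crossL a z * (S.crossL a b.l * S.cross b.r z) := by
        rw [h1]; simp only [mul_assoc]
    _ = S.cross b.l z * (S.crossL a b.r * S.crossL a z * S.cross b.r z) * S.crossL a b.l := by
        rw [c1.eq, c2.eq]; simp only [mul_assoc]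
    _ = S.crossL b z * S.crossL a z * S.crossing a b := by
        rw [h2, crossing, crossL.eq_1 S b z]; simp only [mul_assoc]

/-- The Yang–Baxter equation for bicomodules. -/
theorem crossing_yangBaxter {a b c : Site K M W} (hab : a.Indep b) (hac : a.Indep c)
    (hbc : b.Indep c) : S.crossing a b * S.crossing a c * S.crossing b c =
      S.crossing b c * S.crossing a c * S.crossing a b := by
  have h1 := crossing_crossL (S := S) hab hac.l hbc.l
  have h2 := crossing_crossL (S := S) hab hac.r hbc.r
  have c1 : Commute (S.crossL a c.l) (S.crossL b c.r) :=
    crossL_commute_crossL hab hac.r hbc.l c.indep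
  have c2 : Commute (S.crossL a c.r) (S.crossL b c.l) :=
    crossL_commute_crossL hab hac.l hbc.r c.indep.symm
  calc S.crossing a b * S.crossing a c * S.crossing b c
      = S.crossing a b * S.crossL a c.r * (S.crossL a c.l * S.crossL b c.r) * S.crossL b c.l := by
        rw [crossing.eq_1 S a c, crossing.eq_1 S b c]; simp only [mul_assoc]
    _ = (S.crossing a b * S.crossL a c.r * S.crossL b c.r) * S.crossL a c.l * S.crossL b c.l := by
        rw [c1.eq]; simp only [mul_assoc]
    _ = S.crossL b c.r * S.crossL a c.r *
          (S.crossing a b * S.crossL a c.l * S.crossL b c.l) := by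
        rw [h2]; simp only [mul_assoc]
    _ = S.crossL b c.r * (S.crossL a c.r * S.crossL b c.l) * S.crossL a c.l * S.crossing a b := by
        rw [h1]; simp only [mul_assoc]
    _ = S.crossing b c * S.crossing a c * S.crossing a b := by
        rw [c2.eq, crossing.eq_1 S a c, crossing.eq_1 S b c]; simp only [mul_assoc]

theorem crossL_comp {a : Site K M W} {a' : Site K M W'} {y : Line K M t W} {y' : Line K M t W'}
    {p : W →ₗ[K] W'} (ha : Site.Along p a a') (hy : Line.Along p y y') :
    S.crossL a' y' ∘ₗ p = p ∘ₗ S.crossL a y := by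
  rw [crossL, Module.End.mul_eq_comp, comp_assoc, cross_comp S ha.r hy,
    ← comp_assoc, cross_comp S ha.l hy]
  rfl

theorem crossing_comp {a b : Site K M W} {a' b' : Site K M W'} {p : W →ₗ[K] W'}
    (ha : Site.Along p a a') (hb : Site.Along p b b') :
    S.crossing a' b' ∘ₗ p = p ∘ₗ S.crossing a b := by
  rw [crossing, Module.End.mul_eq_comp, comp_assoc, crossL_comp ha hb.l,
    ← comp_assoc, crossL_comp ha hb.r]
  rfl

/-! ### Products -/

section Products

variable {P : W →ₗ[K] W'} {a b : Site K M W} {c : Site K M W'}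

theorem crossL_prod (h : Site.Prod P a b c) (hab : a.Indep b) {y : Line K M t W}
    {y' : Line K M t W'} (hy : Line.Along P y y') (hay : a.IndepLine y) (hby : b.IndepLine y)
    (hcy : c.IndepLine y') :
    S.crossL c y' ∘ₗ P = P ∘ₗ (S.cross b.l y * S.crossL a y * S.cross b.r y) := by
  rw [crossL, Module.End.mul_eq_comp, comp_assoc,
    cross_prod_r S h.r hy hab.r.r hay.r hby.r hcy.r, ← comp_assoc,
    cross_prod_l S h.l hy hab.l.l hay.l, comp_assoc, ← Module.End.mul_eq_comp, crossL]
  simp only [mul_assoc]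

theorem crossR_prod (h : Site.Prod P a b c) (hab : a.Indep b) {y : Line K M t W}
    {y' : Line K M t W'} (hy : Line.Along P y y') (hay : a.IndepLine y) (hby : b.IndepLine y)
    (hcy : c.IndepLine y') :
    S.crossR y' c ∘ₗ P = P ∘ₗ (S.cross y b.r * S.crossR y a * S.cross y b.l) := by
  rw [crossR, Module.End.mul_eq_comp, comp_assoc,
    prod_cross_l S h.l hy hab.l.l hay.l.symm hby.l.symm hcy.l.symm, ← comp_assoc,
    prod_cross_r S h.r hy hab.r.r hay.r.symm hby.r.symm hcy.r.symm, comp_assoc,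
    ← Module.End.mul_eq_comp, crossR]
  simp only [mul_assoc]

theorem crossL_prod_twist (h : Site.Prod P a b c) (hab : a.Indep b) {y : Line K M t W}
    {y' : Line K M t W'} (hy : Line.Along P y y') (hay : a.IndepLine y) (hby : b.IndepLine y)
    (hcy : c.IndepLine y') :
    S.crossL c y' ∘ₗ P ∘ₗ S.twist a b = P ∘ₗ (S.twist a b * S.crossL a y * S.crossL b y) := by
  have c1 : Commute (S.crossL a b.l) (S.cross b.r y) :=
    crossL_commute hab.r hay b.indep hby.l
  have h1 := crossL_yangBaxter (S := S) hab.l hay hby.l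
  rw [← comp_assoc, crossL_prod h hab hy hay hby hcy, comp_assoc,
    ← Module.End.mul_eq_comp]
  congr 1
  calc S.cross b.l y * S.crossL a y * S.cross b.r y * S.crossL a b.l
      = (S.cross b.l y * S.crossL a y * S.crossL a b.l) * S.cross b.r y := by
        rw [mul_assoc, ← c1.eq, ← mul_assoc]
    _ = _ := by rw [← h1, twist, crossL.eq_1 S b y]; simp only [mul_assoc]

theorem crossR_prod_twist (h : Site.Prod P a b c) (hab : a.Indep b) {y : Line K M t W}
    {y' : Line K M t W'} (hy : Line.Along P y y') (hay : a.IndepLine y) (hby : b.IndepLine y)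
    (hcy : c.IndepLine y') :
    S.crossR y' c ∘ₗ P ∘ₗ S.twist a b = P ∘ₗ (S.twist a b * S.crossR y b * S.crossR y a) := by
  have c1 : Commute (S.crossL a b.l) (S.cross y b.r) :=
    crossL_commute hay hab.r hby.l b.indep
  have h1 := crossR_yangBaxter (S := S) hay hab.l hby.l.symm
  rw [← comp_assoc, crossR_prod h hab hy hay hby hcy, comp_assoc,
    ← Module.End.mul_eq_comp]
  congr 1
  calc S.cross y b.r * S.crossR y a * S.cross y b.l * S.crossL a b.l
      = S.cross y b.r * (S.crossR y a * S.cross y b.l * S.crossL a b.l) := by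
        simp only [mul_assoc]
    _ = (S.cross y b.r * S.crossL a b.l) * S.cross y b.l * S.crossR y a := by
        rw [h1]; simp only [mul_assoc]
    _ = _ := by rw [← c1.eq, twist, crossR.eq_1 S y b]; simp only [mul_assoc]

variable {z : Site K M W} {z' : Site K M W'}

theorem crossing_prod_twist (h : Site.Prod P a b c) (hab : a.Indep b) (hz : Site.Along P z z')
    (haz : a.Indep z) (hbz : b.Indep z) (hcz : c.Indep z') :
    S.crossing c z' ∘ₗ P ∘ₗ S.twist a b =
      P ∘ₗ S.twist a b ∘ₗ (S.crossing a z * S.crossing b z) := by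
  have c1 : Commute (S.crossL b z.r) (S.crossL a z.l) :=
    crossL_commute_crossL hab.symm hbz.l haz.r z.indep.symm
  have h1 := crossL_prod_twist (S := S) h hab hz.l haz.l hbz.l hcz.l
  have h2 := crossL_prod_twist (S := S) h hab hz.r haz.r hbz.r hcz.r
  have e : S.crossing a z * S.crossing b z =
      S.crossL a z.r * S.crossL b z.r * (S.crossL a z.l * S.crossL b z.l) := by
    rw [crossing, crossing, mul_assoc, ← mul_assoc (S.crossL a z.l), ← c1.eq]
    simp only [mul_assoc]
  calc S.crossing c z' ∘ₗ P ∘ₗ S.twist a b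
      = S.crossL c z'.r ∘ₗ (S.crossL c z'.l ∘ₗ P ∘ₗ S.twist a b) := rfl
    _ = (S.crossL c z'.r ∘ₗ P ∘ₗ S.twist a b) ∘ₗ (S.crossL a z.l * S.crossL b z.l) := by
        rw [h1, mul_assoc]; rfl
    _ = P ∘ₗ S.twist a b ∘ₗ (S.crossing a z * S.crossing b z) := by
        rw [h2, e, mul_assoc]; rfl

theorem crossing_twist_prod (h : Site.Prod P a b c) (hab : a.Indep b) (hz : Site.Along P z z')
    (haz : a.Indep z) (hbz : b.Indep z) (hcz : c.Indep z') :
    S.crossing z' c ∘ₗ P ∘ₗ S.twist a b =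
      P ∘ₗ S.twist a b ∘ₗ (S.crossing z b * S.crossing z a) := by
  have c1 : Commute (S.crossR z.l a) (S.crossR z.r b) := by
    exact ((cross_commute S z.indep hbz.l.r.symm haz.r.r hab.r.r).mul_right
        (cross_commute S z.indep hbz.l.l.symm haz.r.r hab.l.r)).mul_left
      ((cross_commute S z.indep hbz.l.r.symm haz.r.l hab.r.l).mul_right
        (cross_commute S z.indep hbz.l.l.symm haz.r.l hab.l.l))
  have h1 := crossR_prod_twist (S := S) h hab hz.r haz.r hbz.r hcz.r
  have h2 := crossR_prod_twist (S := S) h hab hz.l haz.l hbz.l hcz.l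
  have e : S.crossing z b * S.crossing z a =
      S.crossR z.l b * S.crossR z.l a * (S.crossR z.r b * S.crossR z.r a) := by
    rw [crossing_eq hbz.symm, crossing_eq haz.symm, mul_assoc, mul_assoc,
      ← mul_assoc (S.crossR z.l a), c1.eq]
    simp only [mul_assoc]
  calc S.crossing z' c ∘ₗ P ∘ₗ S.twist a b
      = S.crossR z'.l c ∘ₗ (S.crossR z'.r c ∘ₗ P ∘ₗ S.twist a b) := by
        rw [crossing_eq hcz.symm]; rfl
    _ = (S.crossR z'.l c ∘ₗ P ∘ₗ S.twist a b) ∘ₗ (S.crossR z.r b * S.crossR z.r a) := by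
        rw [h1, mul_assoc]; rfl
    _ = P ∘ₗ S.twist a b ∘ₗ (S.crossing z b * S.crossing z a) := by
        rw [h2, e, mul_assoc]; rfl

theorem twist_prod_twist (h : Site.Prod P a b c) (hab : a.Indep b) (hz : Site.Along P z z')
    (haz : a.Indep z) (hbz : b.Indep z) (hcz : c.Indep z') :
    S.twist c z' ∘ₗ P ∘ₗ S.twist a b = P ∘ₗ (S.twist a b * S.twist a z * S.twist b z) :=
  crossL_prod_twist h hab hz.l haz.l hbz.l hcz.l

theorem twist_twist_prod (h : Site.Prod P a b c) (hab : a.Indep b) (hz : Site.Along P z z')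
    (haz : a.Indep z) (hbz : b.Indep z) (hcz : c.Indep z') :
    S.twist z' c ∘ₗ P ∘ₗ S.twist a b = P ∘ₗ (S.twist z a * S.twist z b * S.twist a b) := by
  have c1 : Commute (S.cross z.l b.l) (S.cross z.r a.l) :=
    cross_commute S z.indep haz.l.l.symm hbz.r.l hab.l.l.symm
  have h1 : S.twist z' c ∘ₗ P = P ∘ₗ (S.twist z a * S.twist z b) := by
    rw [twist, crossL, Module.End.mul_eq_comp, comp_assoc,
      prod_cross_l S h.l hz.r hab.l.l haz.r.l.symm hbz.r.l.symm hcz.r.l.symm,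
      ← comp_assoc,
      prod_cross_l S h.l hz.l hab.l.l haz.l.l.symm hbz.l.l.symm hcz.l.l.symm,
      comp_assoc, ← Module.End.mul_eq_comp, twist, twist, crossL, crossL]
    rw [mul_assoc, ← mul_assoc (S.cross z.l b.l), c1.eq]
    simp only [mul_assoc]
  rw [← comp_assoc, h1, comp_assoc, ← Module.End.mul_eq_comp]

end Products

end DualQuasitriangular.SecondInverse

end Sites

section Unit

variable {K M : Type*} [Field K] [Semiring M] [Bialgebra K M]

local notation "sw" => TensorProduct.comm K M M
local notation "Δ" => (Coalgebra.comul : M →ₗ[K] M ⊗[K] M)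
local notation "Δop" => comulOp K M
local notation "ε" => (Coalgebra.counit : M →ₗ[K] K)

theorem pairAt_one (f g : M ⊗[K] M →ₗ[K] K) (v : M ⊗[K] M) : pairAt f g (1 ⊗ₜ 1) v =
    mul' K K (TensorProduct.map (TensorProduct.curry f 1) (TensorProduct.curry g 1) v) := by
  induction v with
  | zero => simp
  | add x y hx hy => simp only [map_add, hx, hy]
  | tmul a b => simp

theorem mul'_map_counit (φ : M →ₗ[K] K) (v : M ⊗[K] M) :
    mul' K K (TensorProduct.map ε φ v) =
      φ (TensorProduct.lid K M ((ε).rTensor M v)) := by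
  induction v with
  | zero => simp
  | add x y hx hy => simp only [map_add, hx, hy]
  | tmul a b => simp

theorem mul'_map_swap (φ ψ : M →ₗ[K] K) (v : M ⊗[K] M) :
    mul' K K (TensorProduct.map φ ψ (sw v)) =
      mul' K K (TensorProduct.map ψ φ v) := by
  induction v with
  | zero => simp
  | add x y hx hy => simp only [map_add, hx, hy]
  | tmul a b => simp [mul_comm]

theorem MulAt.one_left {k k' : M ⊗[K] M →ₗ[K] K} (hk : MulAt k Δ ∨ MulAt k Δop)
    (h1 : convWith k k' Δ Δ = counitPair K M) (c : M) : k (1 ⊗ₜ c) = ε c := by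
  have s := isSlot_comul (K := K) (M := M)
  have e1 : mul' K K ∘ₗ TensorProduct.map (TensorProduct.curry k 1)
      (TensorProduct.curry k 1) ∘ₗ Δ = TensorProduct.curry k 1 := by
    ext c
    simp only [comp_apply]
    rw [← pairAt_one]
    rcases hk with hk | hk
    · rw [← hk, one_mul]; rfl
    · rw [pairAt_swap, comm_tmul, comm_comul, ← hk, one_mul]; rfl
  have e2 : mul' K K ∘ₗ TensorProduct.map (TensorProduct.curry k 1)
      (TensorProduct.curry k' 1) ∘ₗ Δ = ε := by
    ext c
    simp only [comp_apply]
    rw [← pairAt_one]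
    have := LinearMap.congr_fun h1 (1 ⊗ₜ c)
    rw [convWith_tmul, Bialgebra.comul_one] at this
    rw [Algebra.TensorProduct.one_def] at this
    rw [this]
    simp [counitPair]
  have h2 : evalFun Δ (TensorProduct.curry k 1) = 1 := by
    have i1 := evalFun_mul s (TensorProduct.curry k 1) (TensorProduct.curry k 1)
    have i2 := evalFun_mul s (TensorProduct.curry k 1) (TensorProduct.curry k' 1)
    rw [e1] at i1
    rw [e2, s.counit] at i2
    calc _ = evalFun Δ (TensorProduct.curry k 1) * (evalFun Δ (TensorProduct.curry k 1) *
        evalFun Δ (TensorProduct.curry k' 1)) := by rw [i2, mul_one]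
      _ = 1 := by rw [← mul_assoc, i1, i2]
  have h3 := congrArg ε (LinearMap.congr_fun h2 c)
  have h4 : ∀ t : M ⊗[K] M, ε (TensorProduct.rid K M ((TensorProduct.curry k 1).lTensor M t)) =
      mul' K K (TensorProduct.map ε (TensorProduct.curry k 1) t) := by
    intro t
    induction t with
    | zero => simp
    | add x y hx hy => simp only [map_add, hx, hy]
    | tmul a b => simp [mul_comm]
  rw [evalFun_apply, h4, mul'_map_counit, lid_counit_comul] at h3
  exact h3

variable (Q : DualQuasitriangular K M)

theorem DualQuasitriangular.form_one_left (c : M) : Q.form (1 ⊗ₜ c) = ε c :=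
  MulAt.one_left (Or.inl Q.mulAt_form) Q.form_inv c

theorem DualQuasitriangular.form_one_right (c : M) : Q.form (c ⊗ₜ 1) = ε c :=
  MulAt.one_left (k' := Q.inv ∘ₗ (sw).toLinearMap) (Or.inr Q.mulAt_form_comm)
    (by rw [convWith_comm, Q.form_inv, counitPair_comm]) c

theorem DualQuasitriangular.inv_one_left (c : M) : Q.inv (1 ⊗ₜ c) = ε c :=
  MulAt.one_left (Or.inr Q.mulAt_inv) Q.inv_form c

theorem DualQuasitriangular.inv_one_right (c : M) : Q.inv (c ⊗ₜ 1) = ε c :=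
  MulAt.one_left (k' := Q.form ∘ₗ (sw).toLinearMap) (Or.inl Q.mulAt_inv_comm)
    (by rw [convWith_comm, Q.inv_form, counitPair_comm]) c

variable {Q} (S : Q.SecondInverse)

theorem DualQuasitriangular.SecondInverse.til_one_left (c : M) : S.til (1 ⊗ₜ c) = ε c := by
  have h := LinearMap.congr_fun S.til_form (1 ⊗ₜ c)
  rw [convWith_tmul, Bialgebra.comul_one, Algebra.TensorProduct.one_def, pairAt_one,
    show TensorProduct.curry Q.form 1 = ε by ext; exact Q.form_one_left _, comulOp_apply,
    mul'_map_swap, mul'_map_counit, lid_counit_comul] at h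
  exact h.trans (by simp [counitPair])

theorem DualQuasitriangular.SecondInverse.til_one_right (c : M) : S.til (c ⊗ₜ 1) = ε c := by
  have h := LinearMap.congr_fun S.form_til (c ⊗ₜ 1)
  rw [convWith_tmul, comulOp_apply, Bialgebra.comul_one, Algebra.TensorProduct.one_def,
    comm_tmul, ← pairAt_comm, pairAt_one,
    show TensorProduct.curry (Q.form ∘ₗ (sw).toLinearMap) 1 = ε by
      ext; exact Q.form_one_right _,
    mul'_map_counit, lid_counit_comul] at h
  exact h.trans (by simp [counitPair])

theorem DualQuasitriangular.SecondInverse.letter_one_left (s t : Bool) (c : M) :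
    S.letter s t (1 ⊗ₜ c) = ε c := by
  cases s <;> cases t
  exacts [Q.form_one_left c, Q.inv_one_left c, S.til_one_left c, Q.form_one_left c]

theorem DualQuasitriangular.SecondInverse.letter_one_right (s t : Bool) (c : M) :
    S.letter s t (c ⊗ₜ 1) = ε c := by
  cases s <;> cases t
  exacts [Q.form_one_right c, Q.inv_one_right c, S.til_one_right c, Q.form_one_right c]

end Unit

section Contract

variable {K M W W' : Type*} [Field K] [Semiring M] [Bialgebra K M]
  [AddCommMonoid W] [Module K W] [AddCommMonoid W'] [Module K W']

local notation "sw" => TensorProduct.comm K M M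
local notation "Δ" => (Coalgebra.comul : M →ₗ[K] M ⊗[K] M)
local notation "Δop" => comulOp K M
local notation "ε" => (Coalgebra.counit : M →ₗ[K] K)

/-- The line is trivial on the image of `p`. -/
def Line.TrivOn {s : Bool} (x : Line K M s W) (p : W' →ₗ[K] W) : Prop :=
  ∀ w, x.δ (p w) = p w ⊗ₜ 1

theorem Line.TrivOn.evalFun_comp {s : Bool} {x : Line K M s W} {p : W' →ₗ[K] W}
    (h : x.TrivOn p) (φ : M →ₗ[K] K) : evalFun x.δ φ ∘ₗ p = φ 1 • p := by
  ext w
  simp [evalFun_apply, h w]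

/-- The line `x` and the line `y`, restricted along `p`, form a copy of the coproduct. -/
def Line.Splits {s t : Bool} (p : W' →ₗ[K] W) (x : Line K M s W) (y : Line K M t W) : Prop :=
  ∃ κ : W' →ₗ[K] W ⊗[K] M, joint x.δ y.δ ∘ₗ p = (Δ).lTensor W ∘ₗ κ ∧
    (TensorProduct.rid K W).toLinearMap ∘ₗ (ε).lTensor W ∘ₗ κ = p

/-- The line `x` and the line `y`, followed by `p`, form a copy of the coproduct. -/
def Line.Merges {s t : Bool} (p : W →ₗ[K] W') (x : Line K M s W) (y : Line K M t W) : Prop :=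
  ∃ κ : W →ₗ[K] W' ⊗[K] M, p.rTensor (M ⊗[K] M) ∘ₗ joint x.δ y.δ = (Δ).lTensor W' ∘ₗ κ ∧
    (TensorProduct.rid K W').toLinearMap ∘ₗ (ε).lTensor W' ∘ₗ κ = p

theorem rid_lTensor_smul (κ : W' →ₗ[K] W ⊗[K] M) (a : K) (φ : M →ₗ[K] K) (h : φ = a • ε) :
    (TensorProduct.rid K W).toLinearMap ∘ₗ φ.lTensor W ∘ₗ κ =
      a • ((TensorProduct.rid K W).toLinearMap ∘ₗ (ε).lTensor W ∘ₗ κ) := by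
  rw [h, LinearMap.lTensor_smul]
  ext; simp

theorem Line.Splits.pairOp_comp {s t : Bool} {p : W' →ₗ[K] W} {x : Line K M s W}
    {y : Line K M t W} (h : Line.Splits p x y) (k : M ⊗[K] M →ₗ[K] K) (a : K)
    (hk : k ∘ₗ Δ = a • ε) : pairOp k x.δ y.δ ∘ₗ p = a • p := by
  obtain ⟨κ, h1, h2⟩ := h
  have e : pairOp k x.δ y.δ ∘ₗ p = (TensorProduct.rid K W).toLinearMap ∘ₗ k.lTensor W ∘ₗ
      (joint x.δ y.δ ∘ₗ p) := rfl
  rw [e, h1, ← comp_assoc κ _ (k.lTensor W), ← LinearMap.lTensor_comp,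
    rid_lTensor_smul κ a _ hk, h2]

theorem Line.Merges.comp_pairOp {s t : Bool} {p : W →ₗ[K] W'} {x : Line K M s W}
    {y : Line K M t W} (h : Line.Merges p x y) (k : M ⊗[K] M →ₗ[K] K) (a : K)
    (hk : k ∘ₗ Δ = a • ε) : p ∘ₗ pairOp k x.δ y.δ = a • p := by
  obtain ⟨κ, h1, h2⟩ := h
  have e : p ∘ₗ pairOp k x.δ y.δ = (TensorProduct.rid K W').toLinearMap ∘ₗ k.lTensor W' ∘ₗ
      (p.rTensor (M ⊗[K] M) ∘ₗ joint x.δ y.δ) := by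
    ext w
    simp only [comp_apply, pairOp, evalFun_apply]
    generalize joint x.δ y.δ w = t
    induction t with
    | zero => simp
    | add x y hx hy => simp only [map_add, hx, hy]
    | tmul x m => simp
  rw [e, h1, ← comp_assoc κ _ (k.lTensor W'), ← LinearMap.lTensor_comp,
    rid_lTensor_smul κ a _ hk, h2]

theorem pairAt_flip_comp (f g : M ⊗[K] M →ₗ[K] K) (d : M →ₗ[K] M ⊗[K] M)
    (h : convWith f g Δ d = counitPair K M) (m : M) :
    (pairAt f g).flip (d m) ∘ₗ Δ = ε m • ε := by
  ext x
  have := LinearMap.congr_fun h (x ⊗ₜ m)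
  rw [convWith_tmul] at this
  simpa [counitPair, mul_comm] using this

variable {Q : DualQuasitriangular K M} {S : Q.SecondInverse} {t : Bool}

theorem convWith_swap {f g : M ⊗[K] M →ₗ[K] K} {d d' : M →ₗ[K] M ⊗[K] M}
    (h : convWith f g d d' = counitPair K M) :
    convWith g f ((sw).toLinearMap ∘ₗ d) ((sw).toLinearMap ∘ₗ d') = counitPair K M := by
  rw [convWith_comm_slots, h]

theorem convWith_flip {f g : M ⊗[K] M →ₗ[K] K} {d d' : M →ₗ[K] M ⊗[K] M}
    (h : convWith f g d d' = counitPair K M) :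
    convWith (f ∘ₗ (sw).toLinearMap) (g ∘ₗ (sw).toLinearMap) d' d = counitPair K M := by
  rw [convWith_comm, h, counitPair_comm]

theorem convWith_letter_rl (t : Bool) :
    convWith (S.letter true t) (S.letter false t) Δ (cop K M t) = counitPair K M := by
  cases t
  · exact S.til_form
  · exact Q.form_inv

theorem convWith_letter_lr (t : Bool) :
    convWith (S.letter false t) (S.letter true t) Δ (cop K M t) = counitPair K M := by
  cases t
  · exact S.form_til
  · exact Q.inv_form

theorem convWith_letter_flip_rl (t : Bool) :
    convWith (S.letter t true ∘ₗ (sw).toLinearMap) (S.letter t false ∘ₗ (sw).toLinearMap) Δ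
      ((sw).toLinearMap ∘ₗ cop K M t) = counitPair K M := by
  cases t
  · simp only [cop, cond, comm_comp_comulOp]
    exact convWith_flip Q.inv_form
  · have := convWith_flip (convWith_swap S.til_form)
    rw [comm_comp_comulOp] at this
    exact this

theorem convWith_letter_flip_lr (t : Bool) :
    convWith (S.letter t false ∘ₗ (sw).toLinearMap) (S.letter t true ∘ₗ (sw).toLinearMap) Δ
      ((sw).toLinearMap ∘ₗ cop K M t) = counitPair K M := by
  cases t
  · simp only [cop, cond, comm_comp_comulOp]
    exact convWith_flip Q.form_inv
  · have := convWith_flip (convWith_swap S.form_til)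
    rw [comm_comp_comulOp] at this
    exact this

namespace DualQuasitriangular.SecondInverse

variable (S)

theorem splits_cross {p : W' →ₗ[K] W} {x : Line K M true W} {y : Line K M false W}
    {z' : Line K M t W'} {z : Line K M t W} (h : Line.Splits p x y) (hz : Line.Along p z' z)
    (hyz : y.Indep z) : (S.cross x z * S.cross y z) ∘ₗ p = p := by
  rw [cross, cross, pairOp_mul_pairOp z.isSlot hyz,
    coev_comp hz _ ((ε).smulRight p) fun m => ?_, evalFun_unit z'.isSlot.counit]
  exact h.pairOp_comp _ _ (pairAt_flip_comp _ _ _ (convWith_letter_rl t) m)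

theorem cross_splits {p : W' →ₗ[K] W} {x : Line K M true W} {y : Line K M false W}
    {z' : Line K M t W'} {z : Line K M t W} (h : Line.Splits p x y) (hz : Line.Along p z' z)
    (hxy : x.Indep y) (hxz : x.Indep z) (hyz : y.Indep z) :
    (S.cross z y * S.cross z x) ∘ₗ p = p := by
  rw [cross, cross, pairOp_flip hyz.symm, pairOp_flip hxz.symm,
    pairOp_mul_pairOp' z.isSlot hxy hxz,
    coev_comp hz _ ((ε).smulRight p) fun m => ?_, evalFun_unit z'.isSlot.counit]
  exact h.pairOp_comp _ _ (pairAt_flip_comp _ _ _ (convWith_letter_flip_rl t) m)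

theorem cross_merges {p : W →ₗ[K] W'} {x : Line K M false W} {y : Line K M true W}
    {z : Line K M t W} (h : Line.Merges p x y) (hyz : y.Indep z) :
    p ∘ₗ (S.cross x z * S.cross y z) = p := by
  rw [cross, cross, pairOp_mul_pairOp z.isSlot hyz,
    comp_coev _ _ ((ε).smulRight p) fun m => ?_, evalFun_unit z.isSlot.counit]
  exact h.comp_pairOp _ _ (pairAt_flip_comp _ _ _ (convWith_letter_lr t) m)

theorem merges_cross {p : W →ₗ[K] W'} {x : Line K M false W} {y : Line K M true W}
    {z : Line K M t W} (h : Line.Merges p x y) (hxy : x.Indep y) (hxz : x.Indep z)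
    (hyz : y.Indep z) : p ∘ₗ (S.cross z y * S.cross z x) = p := by
  rw [cross, cross, pairOp_flip hyz.symm, pairOp_flip hxz.symm,
    pairOp_mul_pairOp' z.isSlot hxy hxz,
    comp_coev _ _ ((ε).smulRight p) fun m => ?_, evalFun_unit z.isSlot.counit]
  exact h.comp_pairOp _ _ (pairAt_flip_comp _ _ _ (convWith_letter_flip_lr t) m)

theorem trivOn_cross {s : Bool} {p : W' →ₗ[K] W} {x : Line K M s W} {z' : Line K M t W'}
    {z : Line K M t W} (h : x.TrivOn p) (hz : Line.Along p z' z) : S.cross x z ∘ₗ p = p := by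
  rw [cross, pairOp_eq_coev, coev_comp hz _ ((ε).smulRight p) fun m => ?_,
    evalFun_unit z'.isSlot.counit]
  simp only [comp_apply, h.evalFun_comp, LinearMap.smulRight_apply]
  congr 1
  exact S.letter_one_left s t m

theorem cross_trivOn {s : Bool} {p : W' →ₗ[K] W} {x : Line K M s W} {z' : Line K M t W'}
    {z : Line K M t W} (h : x.TrivOn p) (hz : Line.Along p z' z) (hxz : x.Indep z) :
    S.cross z x ∘ₗ p = p := by
  rw [cross, pairOp_flip hxz.symm, pairOp_eq_coev, coev_comp hz _ ((ε).smulRight p) fun m => ?_,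
    evalFun_unit z'.isSlot.counit]
  simp only [comp_apply, h.evalFun_comp, LinearMap.smulRight_apply]
  congr 1
  exact S.letter_one_right t s m

end DualQuasitriangular.SecondInverse

end Contract

section Coact

variable {K M W W' : Type*} [Field K] [Semiring M] [Bialgebra K M]
  [AddCommMonoid W] [Module K W] [AddCommMonoid W'] [Module K W']

/-- The map `p` splits the bicomodule `a` into the bicomodules `v` and `n`. -/
structure Site.Coact (p : W' →ₗ[K] W) (a : Site K M W') (v n : Site K M W) : Prop where
  left : Line.Along p a.l v.l
  right : Line.Along p a.r n.r
  splits : Line.Splits p v.r n.l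

namespace DualQuasitriangular.SecondInverse

variable {Q : DualQuasitriangular K M} {S : Q.SecondInverse} {s t : Bool}
  {p : W' →ₗ[K] W} {a : Site K M W'} {v n : Site K M W}

theorem crossL_coact (h : Site.Coact p a v n) {y' : Line K M t W'}
    {y : Line K M t W} (hy : Line.Along p y' y) (hn : n.IndepLine y) :
    (S.crossL v y * S.crossL n y) ∘ₗ p = p ∘ₗ S.crossL a y' := by
  calc (S.crossL v y * S.crossL n y) ∘ₗ p
      = S.cross v.l y ∘ₗ (S.cross v.r y * S.cross n.l y) ∘ₗ (S.cross n.r y ∘ₗ p) := by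
        simp only [crossL, mul_assoc]; rfl
    _ = S.cross v.l y ∘ₗ ((S.cross v.r y * S.cross n.l y) ∘ₗ p) ∘ₗ S.cross a.r y' := by
        rw [cross_comp S h.right hy]; rfl
    _ = (S.cross v.l y ∘ₗ p) ∘ₗ S.cross a.r y' := by
        rw [splits_cross S h.splits hy hn.l]; rfl
    _ = p ∘ₗ S.crossL a y' := by rw [cross_comp S h.left hy]; rfl

theorem crossR_coact (h : Site.Coact p a v n) (hvn : v.Indep n) {y' : Line K M t W'}
    {y : Line K M t W} (hy : Line.Along p y' y) (hv : v.IndepLine y) (hn : n.IndepLine y) :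
    (S.crossR y n * S.crossR y v) ∘ₗ p = p ∘ₗ S.crossR y' a := by
  calc (S.crossR y n * S.crossR y v) ∘ₗ p
      = S.cross y n.r ∘ₗ (S.cross y n.l * S.cross y v.r) ∘ₗ (S.cross y v.l ∘ₗ p) := by
        simp only [crossR, mul_assoc]; rfl
    _ = S.cross y n.r ∘ₗ ((S.cross y n.l * S.cross y v.r) ∘ₗ p) ∘ₗ S.cross y' a.l := by
        rw [cross_comp S hy h.left]; rfl
    _ = (S.cross y n.r ∘ₗ p) ∘ₗ S.cross y' a.l := by
        rw [cross_splits S h.splits hy hvn.l.r hv.r hn.l]; rfl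
    _ = p ∘ₗ S.crossR y' a := by rw [cross_comp S hy h.right]; rfl

theorem crossing_coact (h : Site.Coact p a v n) {z' : Site K M W'} {z : Site K M W}
    (hz : Site.Along p z' z) (hvn : v.Indep n) (hv : v.Indep z) (hn : n.Indep z) :
    (S.crossing v z * S.crossing n z) ∘ₗ p = p ∘ₗ S.crossing a z' := by
  have c : Commute (S.crossL v z.l) (S.crossL n z.r) :=
    crossL_commute_crossL hvn hv.r hn.l z.indep
  calc (S.crossing v z * S.crossing n z) ∘ₗ p
      = (S.crossL v z.r * (S.crossL v z.l * S.crossL n z.r) * S.crossL n z.l) ∘ₗ p := by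
        simp only [crossing, mul_assoc]
    _ = (S.crossL v z.r * S.crossL n z.r) ∘ₗ ((S.crossL v z.l * S.crossL n z.l) ∘ₗ p) := by
        rw [c.eq]; simp only [mul_assoc]; rfl
    _ = ((S.crossL v z.r * S.crossL n z.r) ∘ₗ p) ∘ₗ S.crossL a z'.l := by
        rw [crossL_coact h hz.l hn.l]; rfl
    _ = p ∘ₗ S.crossing a z' := by rw [crossL_coact h hz.r hn.r]; rfl

theorem coact_crossing (h : Site.Coact p a v n) {z' : Site K M W'} {z : Site K M W}
    (hz : Site.Along p z' z) (hvn : v.Indep n) (hv : v.Indep z) (hn : n.Indep z)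
    (ha : a.Indep z') :
    (S.crossing z n * S.crossing z v) ∘ₗ p = p ∘ₗ S.crossing z' a := by
  have c : Commute (S.crossR z.r n) (S.crossR z.l v) := by
    exact ((cross_commute S z.indep.symm hv.r.r.symm hn.l.r hvn.symm.r.r).mul_right
        (cross_commute S z.indep.symm hv.r.l.symm hn.l.r hvn.symm.l.r)).mul_left
      ((cross_commute S z.indep.symm hv.r.r.symm hn.l.l hvn.symm.r.l).mul_right
        (cross_commute S z.indep.symm hv.r.l.symm hn.l.l hvn.symm.l.l))
  calc (S.crossing z n * S.crossing z v) ∘ₗ p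
      = (S.crossR z.l n * (S.crossR z.r n * S.crossR z.l v) * S.crossR z.r v) ∘ₗ p := by
        rw [crossing_eq hn.symm, crossing_eq hv.symm]; simp only [mul_assoc]
    _ = (S.crossR z.l n * S.crossR z.l v) ∘ₗ ((S.crossR z.r n * S.crossR z.r v) ∘ₗ p) := by
        rw [c.eq]; simp only [mul_assoc]; rfl
    _ = ((S.crossR z.l n * S.crossR z.l v) ∘ₗ p) ∘ₗ S.crossR z'.r a := by
        rw [crossR_coact h hvn hz.r hv.r hn.r]; rfl
    _ = p ∘ₗ S.crossing z' a := by
        rw [crossR_coact h hvn hz.l hv.l hn.l, crossing_eq ha.symm]; rfl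

theorem crossL_crossL_splits {p : W' →ₗ[K] W} {x : Line K M true W} {y : Line K M false W}
    {n' : Site K M W'} {n : Site K M W} (h : Line.Splits p x y) (hn : Site.Along p n' n)
    (hxy : x.Indep y) (hx : n.IndepLine x) (hy : n.IndepLine y) :
    (S.crossL n y * S.crossL n x) ∘ₗ p = p := by
  have c : Commute (S.cross n.r y) (S.cross n.l x) :=
    cross_commute S n.indep.symm hx.r hy.l.symm hxy.symm
  calc (S.crossL n y * S.crossL n x) ∘ₗ p
      = (S.cross n.l y * (S.cross n.r y * S.cross n.l x) * S.cross n.r x) ∘ₗ p := by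
        simp only [crossL, mul_assoc]
    _ = (S.cross n.l y * S.cross n.l x) ∘ₗ ((S.cross n.r y * S.cross n.r x) ∘ₗ p) := by
        rw [c.eq]; simp only [mul_assoc]; rfl
    _ = p := by
        rw [cross_splits S h hn.r hxy hx.r.symm hy.r.symm,
          cross_splits S h hn.l hxy hx.l.symm hy.l.symm]

/-- Coactions respect the deformed product and the braided tensor product. -/
theorem twist_coact {W₀ : Type*} [AddCommMonoid W₀] [Module K W₀] {p : W₀ →ₗ[K] W'}
    {q : W' →ₗ[K] W} {a a' : Site K M W₀} {v₁ n₁ a₁ : Site K M W'} {v n v' n' : Site K M W}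
    (hp : Site.Coact p a v₁ n₁) (ha' : Line.Along p a'.l a₁.l) (hq : Site.Coact q a₁ v' n')
    (hv : Site.Along q v₁ v) (hn : Site.Along q n₁ n) (hv'n' : v'.Indep n') (hnv' : n.Indep v')
    (hnn' : n.Indep n') (hn₁ : n₁.Indep a₁) :
    (S.twist v v' * S.twist n n' * S.crossing n v') ∘ₗ q ∘ₗ p = q ∘ₗ p ∘ₗ S.twist a a' := by
  calc (S.twist v v' * S.twist n n' * S.crossing n v') ∘ₗ q ∘ₗ p
      = (S.crossL v v'.l * (S.crossL n n'.l * S.crossL n v'.r)) ∘ₗ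
          (S.crossL n v'.l ∘ₗ q) ∘ₗ p := by
        simp only [twist, crossing, mul_assoc]; rfl
    _ = S.crossL v v'.l ∘ₗ ((S.crossL n n'.l * S.crossL n v'.r) ∘ₗ q) ∘ₗ
          S.crossL n₁ a₁.l ∘ₗ p := by
        rw [crossL_comp hn hq.left]; rfl
    _ = (S.crossL v v'.l ∘ₗ q) ∘ₗ S.crossL n₁ a₁.l ∘ₗ p := by
        rw [crossL_crossL_splits hq.splits hn hv'n'.l.r hnv'.r hnn'.l]; rfl
    _ = q ∘ₗ (S.crossL v₁ a₁.l * S.crossL n₁ a₁.l) ∘ₗ p := by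
        rw [crossL_comp hv hq.left]; rfl
    _ = q ∘ₗ p ∘ₗ S.twist a a' := by rw [crossL_coact hp ha' hn₁.l]; rfl

theorem comp_crossing_merges {p : W →ₗ[K] W'} {a z : Site K M W} (h : Line.Merges p a.l a.r)
    (ha : a.Indep z) : p ∘ₗ S.crossing a z = p := by
  rw [crossing, Module.End.mul_eq_comp, ← comp_assoc, crossL,
    cross_merges S h ha.r.r, crossL, cross_merges S h ha.l.r]

theorem comp_crossing_merges' {p : W →ₗ[K] W'} {a z : Site K M W} (h : Line.Merges p a.l a.r)
    (ha : a.Indep z) : p ∘ₗ S.crossing z a = p := by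
  rw [crossing_eq ha.symm, Module.End.mul_eq_comp, ← comp_assoc, crossR,
    merges_cross S h a.indep ha.l.l ha.l.r, crossR, merges_cross S h a.indep ha.r.l ha.r.r]

theorem crossing_triv {p : W' →ₗ[K] W} {a z : Site K M W} {z' : Site K M W'}
    (hl : a.l.TrivOn p) (hr : a.r.TrivOn p) (hz : Site.Along p z' z) :
    S.crossing a z ∘ₗ p = p := by
  simp only [crossing, crossL, Module.End.mul_eq_comp, comp_assoc]
  rw [trivOn_cross S hr hz.l, trivOn_cross S hl hz.l, trivOn_cross S hr hz.r, trivOn_cross S hl hz.r]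

theorem triv_crossing {p : W' →ₗ[K] W} {a z : Site K M W} {z' : Site K M W'}
    (hl : a.l.TrivOn p) (hr : a.r.TrivOn p) (hz : Site.Along p z' z) (ha : a.Indep z) :
    S.crossing z a ∘ₗ p = p := by
  simp only [crossing_eq ha.symm, crossR, Module.End.mul_eq_comp, comp_assoc]
  rw [cross_trivOn S hl hz.r ha.r.l, cross_trivOn S hr hz.r ha.r.r,
    cross_trivOn S hl hz.l ha.l.l, cross_trivOn S hr hz.l ha.l.r]

theorem twist_triv {p : W' →ₗ[K] W} {a z : Site K M W} {z' : Site K M W'}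
    (hl : a.l.TrivOn p) (hr : a.r.TrivOn p) (hz : Line.Along p z'.l z.l) :
    S.twist a z ∘ₗ p = p := by
  rw [twist, crossL, Module.End.mul_eq_comp, comp_assoc, trivOn_cross S hr hz,
    trivOn_cross S hl hz]

theorem triv_twist {p : W' →ₗ[K] W} {a z : Site K M W} {z' : Site K M W'}
    (hl : a.l.TrivOn p) (hz : Site.Along p z' z) (ha : z.IndepLine a.l) :
    S.twist z a ∘ₗ p = p := by
  rw [twist, crossL, Module.End.mul_eq_comp, comp_assoc,
    cross_trivOn S hl hz.r ha.r.symm, cross_trivOn S hl hz.l ha.l.symm]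

theorem comp_twist_merges {p : W →ₗ[K] W'} {a z : Site K M W} (h : Line.Merges p a.l a.r)
    (ha : a.IndepLine z.l) : p ∘ₗ S.twist a z = p := by
  rw [twist, crossL, cross_merges S h ha.r]

end DualQuasitriangular.SecondInverse

end Coact

/-! ### Lines and bicomodules on tensor products -/

section LineLifts

variable {K M X X' Y Y' Z : Type*} [Field K] [Semiring M] [Bialgebra K M]
  [AddCommMonoid X] [Module K X] [AddCommMonoid X'] [Module K X']
  [AddCommMonoid Y] [Module K Y] [AddCommMonoid Y'] [Module K Y']
  [AddCommMonoid Z] [Module K Z] {s t : Bool}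

/-- A line on the first factor. -/
noncomputable def Line.liftL (Y : Type*) [AddCommMonoid Y] [Module K Y] (x : Line K M t X) :
    Line K M t (X ⊗[K] Y) := ⟨_root_.liftL Y x.δ, x.isSlot.liftL⟩

/-- A line on the second factor. -/
noncomputable def Line.liftR (X : Type*) [AddCommMonoid X] [Module K X] (y : Line K M t Y) :
    Line K M t (X ⊗[K] Y) := ⟨_root_.liftR X y.δ, y.isSlot.liftR⟩

theorem Line.indep_liftL_liftR (x : Line K M s X) (y : Line K M t Y) :
    (x.liftL Y).Indep (y.liftR X) := coComm_liftL_liftR x.δ y.δ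

theorem Line.Indep.liftL {x : Line K M s X} {y : Line K M t X} (h : x.Indep y) :
    (x.liftL Y).Indep (y.liftL Y) := CoComm.liftL h

theorem Line.Indep.liftR {x : Line K M s Y} {y : Line K M t Y} (h : x.Indep y) :
    (x.liftR X).Indep (y.liftR X) := CoComm.liftR h

theorem Line.Along.comp {p : X →ₗ[K] Y} {q : Y →ₗ[K] Z} {x : Line K M s X} {y : Line K M s Y}
    {z : Line K M s Z} (h : Line.Along q y z) (h' : Line.Along p x y) :
    Line.Along (q ∘ₗ p) x z := by
  unfold Line.Along Colin at *
  rw [← comp_assoc, h, comp_assoc, h', ← comp_assoc,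
    ← rTensor_comp]

theorem Line.Along.symm {e : X ≃ₗ[K] Y} {x : Line K M s X} {y : Line K M s Y}
    (h : Line.Along e.toLinearMap x y) : Line.Along e.symm.toLinearMap y x := by
  unfold Line.Along Colin at *
  ext w
  have h1 := LinearMap.congr_fun h (e.symm w)
  simp only [comp_apply, coe_coe, LinearEquiv.apply_symm_apply] at h1 ⊢
  rw [h1, ← comp_apply, ← rTensor_comp]
  simp

theorem Line.Along.rTensor {p : X →ₗ[K] X'} {x : Line K M s X} {x' : Line K M s X'}
    (h : Line.Along p x x') : Line.Along (p.rTensor Y) (x.liftL Y) (x'.liftL Y) :=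
  Colin.rTensor_liftL h

theorem Line.Along.lTensor {p : Y →ₗ[K] Y'} {x : Line K M s Y} {x' : Line K M s Y'}
    (h : Line.Along p x x') : Line.Along (p.lTensor X) (x.liftR X) (x'.liftR X) :=
  Colin.lTensor_liftR h

theorem Line.along_rTensor (p : X →ₗ[K] X') (y : Line K M s Y) :
    Line.Along (p.rTensor Y) (y.liftR X) (y.liftR X') := colin_rTensor_liftR p y.δ

theorem Line.along_lTensor (p : Y →ₗ[K] Y') (x : Line K M s X) :
    Line.Along (p.lTensor X) (x.liftL Y) (x.liftL Y') := colin_lTensor_liftL p x.δ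

/-- A bicomodule on the first factor. -/
noncomputable def Site.liftL (Y : Type*) [AddCommMonoid Y] [Module K Y] (a : Site K M X) :
    Site K M (X ⊗[K] Y) := ⟨a.l.liftL Y, a.r.liftL Y, a.indep.liftL⟩

/-- A bicomodule on the second factor. -/
noncomputable def Site.liftR (X : Type*) [AddCommMonoid X] [Module K X] (b : Site K M Y) :
    Site K M (X ⊗[K] Y) := ⟨b.l.liftR X, b.r.liftR X, b.indep.liftR⟩

theorem Site.indep_liftL_liftR (a : Site K M X) (b : Site K M Y) :
    (a.liftL Y).Indep (b.liftR X) :=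
  ⟨⟨Line.indep_liftL_liftR _ _, Line.indep_liftL_liftR _ _⟩,
    ⟨Line.indep_liftL_liftR _ _, Line.indep_liftL_liftR _ _⟩⟩

theorem Site.Indep.liftL {a b : Site K M X} (h : a.Indep b) :
    (a.liftL Y).Indep (b.liftL Y) :=
  ⟨⟨h.l.l.liftL, h.l.r.liftL⟩, ⟨h.r.l.liftL, h.r.r.liftL⟩⟩

theorem Site.Indep.liftR {a b : Site K M Y} (h : a.Indep b) :
    (a.liftR X).Indep (b.liftR X) :=
  ⟨⟨h.l.l.liftR, h.l.r.liftR⟩, ⟨h.r.l.liftR, h.r.r.liftR⟩⟩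

theorem Site.Along.comp {p : X →ₗ[K] Y} {q : Y →ₗ[K] Z} {x : Site K M X} {y : Site K M Y}
    {z : Site K M Z} (h : Site.Along q y z) (h' : Site.Along p x y) :
    Site.Along (q ∘ₗ p) x z := ⟨h.l.comp h'.l, h.r.comp h'.r⟩

theorem Site.Along.symm {e : X ≃ₗ[K] Y} {x : Site K M X} {y : Site K M Y}
    (h : Site.Along e.toLinearMap x y) : Site.Along e.symm.toLinearMap y x :=
  ⟨h.l.symm, h.r.symm⟩

theorem Site.Along.rTensor {p : X →ₗ[K] X'} {x : Site K M X} {x' : Site K M X'}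
    (h : Site.Along p x x') : Site.Along (p.rTensor Y) (x.liftL Y) (x'.liftL Y) :=
  ⟨h.l.rTensor, h.r.rTensor⟩

theorem Site.Along.lTensor {p : Y →ₗ[K] Y'} {x : Site K M Y} {x' : Site K M Y'}
    (h : Site.Along p x x') : Site.Along (p.lTensor X) (x.liftR X) (x'.liftR X) :=
  ⟨h.l.lTensor, h.r.lTensor⟩

theorem Site.along_rTensor (p : X →ₗ[K] X') (y : Site K M Y) :
    Site.Along (p.rTensor Y) (y.liftR X) (y.liftR X') :=
  ⟨Line.along_rTensor _ _, Line.along_rTensor _ _⟩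

theorem Site.along_lTensor (p : Y →ₗ[K] Y') (x : Site K M X) :
    Site.Along (p.lTensor X) (x.liftL Y) (x.liftL Y') :=
  ⟨Line.along_lTensor _ _, Line.along_lTensor _ _⟩

theorem Site.along_assoc₁ (a : Site K M X) :
    Site.Along (TensorProduct.assoc K X Y Z).toLinearMap ((a.liftL Y).liftL Z)
      (a.liftL (Y ⊗[K] Z)) := ⟨colin_assoc₁ a.l.δ, colin_assoc₁ a.r.δ⟩

theorem Site.along_assoc₂ (a : Site K M Y) :
    Site.Along (TensorProduct.assoc K X Y Z).toLinearMap ((a.liftR X).liftL Z)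
      ((a.liftL Z).liftR X) := ⟨colin_assoc₂ a.l.δ, colin_assoc₂ a.r.δ⟩

theorem Site.along_assoc₃ (a : Site K M Z) :
    Site.Along (TensorProduct.assoc K X Y Z).toLinearMap (a.liftR (X ⊗[K] Y))
      ((a.liftR Y).liftR X) := ⟨colin_assoc₃ a.l.δ, colin_assoc₃ a.r.δ⟩

theorem Site.Prod.rTensor {P : X →ₗ[K] X'} {a b : Site K M X} {c : Site K M X'}
    (h : Site.Prod P a b c) :
    Site.Prod (P.rTensor Z) (a.liftL Z) (b.liftL Z) (c.liftL Z) :=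
  ⟨ProdAlong.rTensor h.l, ProdAlong.rTensor h.r⟩

theorem Site.Prod.lTensor {P : X →ₗ[K] X'} {a b : Site K M X} {c : Site K M X'}
    (h : Site.Prod P a b c) :
    Site.Prod (P.lTensor Z) (a.liftR Z) (b.liftR Z) (c.liftR Z) :=
  ⟨ProdAlong.lTensor h.l, ProdAlong.lTensor h.r⟩

theorem ProdAlong.comp_colin {P : Y →ₗ[K] Z} {e : X →ₗ[K] Y} {s₁ s₂ : Y →ₗ[K] Y ⊗[K] M}
    {r₁ r₂ : X →ₗ[K] X ⊗[K] M} {z : Z →ₗ[K] Z ⊗[K] M} (h : ProdAlong P s₁ s₂ z)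
    (h₁ : Colin e r₁ s₁) (h₂ : Colin e r₂ s₂) : ProdAlong (P ∘ₗ e) r₁ r₂ z := by
  have h' := h₁.joint h₂
  unfold Colin ProdAlong at *
  rw [← comp_assoc, h, comp_assoc, h', ← comp_assoc,
    LinearMap.rTensor, ← TensorProduct.map_comp, LinearMap.comp_id]

theorem Site.Prod.comp_along {P : Y →ₗ[K] Z} {e : X →ₗ[K] Y} {a b : Site K M Y}
    {a' b' : Site K M X} {c : Site K M Z} (h : Site.Prod P a b c) (ha : Site.Along e a' a)
    (hb : Site.Along e b' b) : Site.Prod (P ∘ₗ e) a' b' c :=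
  ⟨ProdAlong.comp_colin h.l ha.l hb.l, ProdAlong.comp_colin h.r ha.r hb.r⟩

theorem Line.Splits.rTensor {p : X →ₗ[K] X'} {x : Line K M s X'} {y : Line K M t X'}
    (h : Line.Splits p x y) : Line.Splits (p.rTensor Z) (x.liftL Z) (y.liftL Z) := by
  obtain ⟨κ, h1, h2⟩ := h
  refine ⟨(rightComm K X' M Z).toLinearMap ∘ₗ κ.rTensor Z, ?_, ?_⟩
  · ext w z
    have h3 := LinearMap.congr_fun h1 w
    simp only [comp_apply] at h3
    simp only [Line.liftL, joint_liftL, TensorProduct.AlgebraTensorModule.curry_apply,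
      restrictScalars_self, curry_apply, comp_apply,
      rTensor_tmul, h3, coe_coe]
    generalize κ w = u
    induction u with
    | zero => simp
    | add x y hx hy => simp only [map_add, add_tmul, hx, hy]
    | tmul x m => simp
  · ext w z
    have h3 := LinearMap.congr_fun h2 w
    simp only [comp_apply, coe_coe] at h3
    simp only [TensorProduct.AlgebraTensorModule.curry_apply,
      restrictScalars_self, curry_apply, comp_apply,
      rTensor_tmul, ← h3, coe_coe]
    generalize κ w = u
    induction u with
    | zero => simp
    | add x y hx hy => simp only [map_add, add_tmul, hx, hy]
    | tmul x m => simp [smul_tmul']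

theorem Line.Splits.lTensor {p : X →ₗ[K] X'} {x : Line K M s X'} {y : Line K M t X'}
    (h : Line.Splits p x y) : Line.Splits (p.lTensor Z) (x.liftR Z) (y.liftR Z) := by
  obtain ⟨κ, h1, h2⟩ := h
  refine ⟨(TensorProduct.assoc K Z X' M).symm.toLinearMap ∘ₗ κ.lTensor Z, ?_, ?_⟩
  · ext z w
    have h3 := LinearMap.congr_fun h1 w
    simp only [comp_apply] at h3
    simp only [Line.liftR, joint_liftR, TensorProduct.AlgebraTensorModule.curry_apply,
      restrictScalars_self, curry_apply, comp_apply,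
      lTensor_tmul, h3, coe_coe]
    generalize κ w = u
    induction u with
    | zero => simp
    | add x y hx hy => simp only [map_add, tmul_add, hx, hy]
    | tmul x m => simp
  · ext z w
    have h3 := LinearMap.congr_fun h2 w
    simp only [comp_apply, coe_coe] at h3
    simp only [TensorProduct.AlgebraTensorModule.curry_apply,
      restrictScalars_self, curry_apply, comp_apply,
      lTensor_tmul, ← h3, coe_coe]
    generalize κ w = u
    induction u with
    | zero => simp
    | add x y hx hy => simp only [map_add, tmul_add, hx, hy]
    | tmul x m => simp

theorem Line.Merges.rTensor {p : X →ₗ[K] X'} {x : Line K M s X} {y : Line K M t X}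
    (h : Line.Merges p x y) : Line.Merges (p.rTensor Z) (x.liftL Z) (y.liftL Z) := by
  obtain ⟨κ, h1, h2⟩ := h
  refine ⟨(rightComm K X' M Z).toLinearMap ∘ₗ κ.rTensor Z, ?_, ?_⟩
  · have e : (p.rTensor Z).rTensor (M ⊗[K] M) ∘ₗ
        (rightComm K X (M ⊗[K] M) Z).toLinearMap =
        (rightComm K X' (M ⊗[K] M) Z).toLinearMap ∘ₗ
          (p.rTensor (M ⊗[K] M)).rTensor Z := by
      ext; simp
    simp only [Line.liftL, joint_liftL]
    rw [← comp_assoc, e, comp_assoc, ← rTensor_comp, h1,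
      rTensor_comp, ← comp_assoc, ← comp_assoc]
    congr 1
    ext; simp
  · ext w z
    have h3 := LinearMap.congr_fun h2 w
    simp only [comp_apply, coe_coe] at h3
    simp only [TensorProduct.AlgebraTensorModule.curry_apply,
      restrictScalars_self, curry_apply, comp_apply,
      rTensor_tmul, ← h3, coe_coe]
    generalize κ w = u
    induction u with
    | zero => simp
    | add x y hx hy => simp only [map_add, add_tmul, hx, hy]
    | tmul x m => simp [smul_tmul']

theorem Line.Merges.lTensor {p : X →ₗ[K] X'} {x : Line K M s X} {y : Line K M t X}
    (h : Line.Merges p x y) : Line.Merges (p.lTensor Z) (x.liftR Z) (y.liftR Z) := by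
  obtain ⟨κ, h1, h2⟩ := h
  refine ⟨(TensorProduct.assoc K Z X' M).symm.toLinearMap ∘ₗ κ.lTensor Z, ?_, ?_⟩
  · have e : (p.lTensor Z).rTensor (M ⊗[K] M) ∘ₗ
        (TensorProduct.assoc K Z X (M ⊗[K] M)).symm.toLinearMap =
        (TensorProduct.assoc K Z X' (M ⊗[K] M)).symm.toLinearMap ∘ₗ
          (p.rTensor (M ⊗[K] M)).lTensor Z := by
      ext; simp
    simp only [Line.liftR, joint_liftR]
    rw [← comp_assoc, e, comp_assoc, ← LinearMap.lTensor_comp, h1,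
      LinearMap.lTensor_comp, ← comp_assoc, ← comp_assoc]
    congr 1
    ext; simp
  · ext z w
    have h3 := LinearMap.congr_fun h2 w
    simp only [comp_apply, coe_coe] at h3
    simp only [TensorProduct.AlgebraTensorModule.curry_apply,
      restrictScalars_self, curry_apply, comp_apply,
      lTensor_tmul, ← h3, coe_coe]
    generalize κ w = u
    induction u with
    | zero => simp
    | add x y hx hy => simp only [map_add, tmul_add, hx, hy]
    | tmul x m => simp

theorem Site.Coact.rTensor {p : X →ₗ[K] X'} {a : Site K M X} {v n : Site K M X'}
    (h : Site.Coact p a v n) :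
    Site.Coact (p.rTensor Z) (a.liftL Z) (v.liftL Z) (n.liftL Z) :=
  ⟨h.left.rTensor, h.right.rTensor, h.splits.rTensor⟩

theorem Site.Coact.lTensor {p : X →ₗ[K] X'} {a : Site K M X} {v n : Site K M X'}
    (h : Site.Coact p a v n) :
    Site.Coact (p.lTensor Z) (a.liftR Z) (v.liftR Z) (n.liftR Z) :=
  ⟨h.left.lTensor, h.right.lTensor, h.splits.lTensor⟩

theorem Line.Splits.comp_equiv {p : X →ₗ[K] X'} {e : X' ≃ₗ[K] Y} {x : Line K M s X'}
    {y : Line K M t X'} {x' : Line K M s Y} {y' : Line K M t Y} (h : Line.Splits p x y)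
    (hx : Line.Along e.toLinearMap x x') (hy : Line.Along e.toLinearMap y y') :
    Line.Splits (e.toLinearMap ∘ₗ p) x' y' := by
  obtain ⟨κ, h1, h2⟩ := h
  refine ⟨e.toLinearMap.rTensor M ∘ₗ κ, ?_, ?_⟩
  · have h3 := hx.joint hy
    unfold Colin at h3
    rw [← comp_assoc, h3, comp_assoc, h1, ← comp_assoc,
      ← comp_assoc]
    congr 1
    ext; simp
  · conv_rhs => rw [← h2]
    rw [← comp_assoc, ← comp_assoc, ← comp_assoc,
      ← comp_assoc]
    congr 1
    ext; simp

theorem Site.Coact.comp_equiv {p : X →ₗ[K] X'} {e : X' ≃ₗ[K] Y} {a : Site K M X}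
    {v n : Site K M X'} {v' n' : Site K M Y} (h : Site.Coact p a v n)
    (hv : Site.Along e.toLinearMap v v') (hn : Site.Along e.toLinearMap n n') :
    Site.Coact (e.toLinearMap ∘ₗ p) a v' n' :=
  ⟨hv.l.comp h.left, hn.r.comp h.right, h.splits.comp_equiv hv.r hn.l⟩

end LineLifts

section Legs

variable {K M X Y Z : Type*} [Field K] [Semiring M] [Bialgebra K M]
  [AddCommMonoid X] [Module K X] [AddCommMonoid Y] [Module K Y]
  [AddCommMonoid Z] [Module K Z] {s t : Bool}

namespace DualQuasitriangular.SecondInverse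

variable {Q : DualQuasitriangular K M} (S : Q.SecondInverse)

theorem crossL_leg12 (a : Site K M (X ⊗[K] Y)) (y : Line K M t (X ⊗[K] Y)) :
    S.crossL (a.liftL Z) (y.liftL Z) = leg12 Z (S.crossL a y) := by
  rw [crossL, crossL, leg12_mul]
  exact congrArg₂ _ (pairOp_leg12 _ _ _) (pairOp_leg12 _ _ _)

theorem crossL_leg23 (a : Site K M Y) (y : Line K M t Z) :
    S.crossL ((a.liftR X).liftL Z) (y.liftR (X ⊗[K] Y)) =
      leg23 X (S.crossL (a.liftL Z) (y.liftR Y)) := by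
  rw [crossL, crossL, leg23_mul]
  exact congrArg₂ _ (pairOp_leg23 _ _ _) (pairOp_leg23 _ _ _)

theorem crossL_leg13 (a : Site K M X) (y : Line K M t Z) :
    S.crossL ((a.liftL Y).liftL Z) (y.liftR (X ⊗[K] Y)) =
      leg13 Y (S.crossL (a.liftL Z) (y.liftR X)) := by
  rw [crossL, crossL, leg13_mul]
  exact congrArg₂ _ (pairOp_leg13 _ _ _) (pairOp_leg13 _ _ _)

theorem crossing_leg12 (a b : Site K M (X ⊗[K] Y)) :
    S.crossing (a.liftL Z) (b.liftL Z) = leg12 Z (S.crossing a b) := by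
  rw [crossing, crossing, leg12_mul]
  exact congrArg₂ _ (crossL_leg12 S _ _) (crossL_leg12 S _ _)

theorem crossing_leg23 (a : Site K M Y) (b : Site K M Z) :
    S.crossing ((a.liftR X).liftL Z) (b.liftR (X ⊗[K] Y)) =
      leg23 X (S.crossing (a.liftL Z) (b.liftR Y)) := by
  rw [crossing, crossing, leg23_mul]
  exact congrArg₂ _ (crossL_leg23 S _ _) (crossL_leg23 S _ _)

theorem crossing_leg13 (a : Site K M X) (b : Site K M Z) :
    S.crossing ((a.liftL Y).liftL Z) (b.liftR (X ⊗[K] Y)) =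
      leg13 Y (S.crossing (a.liftL Z) (b.liftR X)) := by
  rw [crossing, crossing, leg13_mul]
  exact congrArg₂ _ (crossL_leg13 S _ _) (crossL_leg13 S _ _)

theorem twist_leg12 (a b : Site K M (X ⊗[K] Y)) :
    S.twist (a.liftL Z) (b.liftL Z) = leg12 Z (S.twist a b) := crossL_leg12 S _ _

theorem twist_leg23 (a : Site K M Y) (b : Site K M Z) :
    S.twist ((a.liftR X).liftL Z) (b.liftR (X ⊗[K] Y)) =
      leg23 X (S.twist (a.liftL Z) (b.liftR Y)) := crossL_leg23 S _ _

end DualQuasitriangular.SecondInverse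

end Legs

/-! ### The braided category of bicomodules -/

section Category

variable {K M X X' Y Z V N : Type*} [Field K] [Semiring M] [Bialgebra K M]
  [AddCommMonoid X] [Module K X] [AddCommMonoid X'] [Module K X']
  [AddCommMonoid Y] [Module K Y] [AddCommMonoid Z] [Module K Z]
  [AddCommMonoid V] [Module K V] [AddCommMonoid N] [Module K N]

namespace DualQuasitriangular.SecondInverse

variable {Q : DualQuasitriangular K M} (S : Q.SecondInverse)

/-- The braiding of two bicomodules. -/
noncomputable def braid (a : Site K M X) (b : Site K M Y) : X ⊗[K] Y →ₗ[K] Y ⊗[K] X :=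
  flipOp (S.crossing (a.liftL Y) (b.liftR X))

/-- The deformation of a product. -/
noncomputable def twistMul (m : X ⊗[K] Y →ₗ[K] X') (a : Site K M X) (b : Site K M Y) :
    X ⊗[K] Y →ₗ[K] X' :=
  m ∘ₗ S.twist (a.liftL Y) (b.liftR X)

theorem braidRelation (a : Site K M X) (b : Site K M Y) (c : Site K M Z) :
    BraidRelation (S.braid a b) (S.braid a c) (S.braid b c) := by
  refine braidRelation_flipOp ?_
  rw [← crossing_leg12, ← crossing_leg13, ← crossing_leg23]
  exact crossing_yangBaxter (Site.indep_liftL_liftR a b).liftL (Site.indep_liftL_liftR _ c)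
    (Site.indep_liftL_liftR _ c)

variable {S}

theorem naturalLeft_twistMul {m : X ⊗[K] Y →ₗ[K] X'} {a : Site K M X} {b : Site K M Y}
    {c : Site K M X'} (h : Site.Prod m (a.liftL Y) (b.liftR X) c) (z : Site K M Z) :
    NaturalLeft (S.twistMul m a b) (braidTensorLeft (S.braid a z) (S.braid b z))
      (S.braid c z) := by
  rw [braid, braid, braidTensorLeft_flipOp]
  refine naturalLeft_flipOp ?_
  have e1 : (S.twistMul m a b).rTensor Z = m.rTensor Z ∘ₗ
      S.twist ((a.liftL Y).liftL Z) ((b.liftR X).liftL Z) := by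
    rw [twist_leg12]
    exact rTensor_comp _ _ _
  rw [← crossing_leg13, ← crossing_leg23, e1, comp_assoc]
  exact crossing_prod_twist h.rTensor (Site.indep_liftL_liftR a b).liftL
    (Site.along_rTensor m z) (Site.indep_liftL_liftR _ z) (Site.indep_liftL_liftR _ z)
    (Site.indep_liftL_liftR c z)

theorem assoc_comp_leg23 (F : Module.End K (Y ⊗[K] Z)) :
    F.lTensor X ∘ₗ (TensorProduct.assoc K X Y Z).toLinearMap =
      (TensorProduct.assoc K X Y Z).toLinearMap ∘ₗ leg23 X F := by
  ext; simp [leg23]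

theorem conj_equiv {A B C : Type*} [AddCommMonoid A] [Module K A] [AddCommMonoid B] [Module K B]
    [AddCommMonoid C] [Module K C] (e : A ≃ₗ[K] B) {G : Module.End K C} {m : B →ₗ[K] C}
    {F : Module.End K B} {T H : Module.End K A} (h1 : F ∘ₗ e.toLinearMap = e.toLinearMap ∘ₗ T)
    (h2 : G ∘ₗ (m ∘ₗ e.toLinearMap) ∘ₗ T = (m ∘ₗ e.toLinearMap) ∘ₗ T ∘ₗ H) :
    G ∘ₗ (m ∘ₗ F) = (m ∘ₗ F) ∘ₗ (e.toLinearMap ∘ₗ H ∘ₗ e.symm.toLinearMap) := by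
  ext x
  obtain ⟨y, rfl⟩ := e.surjective x
  have h1' (y) := LinearMap.congr_fun h1 y
  have h2' := LinearMap.congr_fun h2 y
  simp only [comp_apply, coe_coe] at h1' h2'
  simp [h1', h2']

theorem naturalRight_twistMul {m : X ⊗[K] Y →ₗ[K] X'} {a : Site K M X} {b : Site K M Y}
    {c : Site K M X'} (h : Site.Prod m (a.liftL Y) (b.liftR X) c) (z : Site K M Z) :
    NaturalRight (S.twistMul m a b) (braidTensorRight (S.braid z a) (S.braid z b))
      (S.braid z c) := by
  rw [braid, braid, braidTensorRight_flipOp]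
  refine naturalRight_flipOp ?_
  rw [← crossing_leg13, ← crossing_leg12, twistMul, LinearMap.lTensor_comp]
  have P := (h.lTensor (Z := Z)).comp_along (Site.along_assoc₂ a) (Site.along_assoc₃ b)
  have hz : Site.Along (m.lTensor Z ∘ₗ (TensorProduct.assoc K Z X Y).toLinearMap)
      ((z.liftL X).liftL Y) (z.liftL X') :=
    (Site.along_lTensor m z).comp (Site.along_assoc₁ z)
  have key := crossing_twist_prod (S := S) P (Site.indep_liftL_liftR _ b) hz
    (Site.indep_liftL_liftR z a).symm.liftL (Site.indep_liftL_liftR _ b).symm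
    (Site.indep_liftL_liftR z c).symm
  have e : ((S.twist (a.liftL Y) (b.liftR X)).lTensor Z ∘ₗ
      (TensorProduct.assoc K Z X Y).toLinearMap) = (TensorProduct.assoc K Z X Y).toLinearMap ∘ₗ
        S.twist ((a.liftR Z).liftL Y) (b.liftR (Z ⊗[K] X)) := by
    rw [assoc_comp_leg23, ← twist_leg23]
  exact conj_equiv _ e key

theorem comp_comp_of_comp {A B C : Type*} [AddCommMonoid A] [Module K A] [AddCommMonoid B]
    [Module K B] [AddCommMonoid C] [Module K C] (m : B →ₗ[K] C) {t : Module.End K B}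
    {p : A →ₗ[K] B} {t' H : Module.End K A} (h : t ∘ₗ p ∘ₗ t' = p ∘ₗ H) :
    (m ∘ₗ t) ∘ₗ (p ∘ₗ t') = m ∘ₗ (p ∘ₗ H) := by
  rw [comp_assoc, h]

theorem comp_comp_congr {A B C : Type*} [AddCommMonoid A] [Module K A] [AddCommMonoid B]
    [Module K B] [AddCommMonoid C] [Module K C] {m : B →ₗ[K] C} {p q : A →ₗ[K] B}
    (h : m ∘ₗ p = m ∘ₗ q) (H : Module.End K A) : m ∘ₗ (p ∘ₗ H) = m ∘ₗ (q ∘ₗ H) := by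
  rw [← comp_assoc, h, comp_assoc]

theorem twistMul_assoc {m : V ⊗[K] V →ₗ[K] V} {v : Site K M V}
    (h : Site.Prod m (v.liftL V) (v.liftR V) v)
    (hm : m ∘ₗ m.rTensor V = m ∘ₗ m.lTensor V ∘ₗ (TensorProduct.assoc K V V V).toLinearMap) :
    S.twistMul m v v ∘ₗ (S.twistMul m v v).rTensor V =
      S.twistMul m v v ∘ₗ (S.twistMul m v v).lTensor V ∘ₗ
        (TensorProduct.assoc K V V V).toLinearMap := by
  have i12 := (Site.indep_liftL_liftR v v).liftL (Y := V)
  have i13 := Site.indep_liftL_liftR (v.liftL V) v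
  have i23 := Site.indep_liftL_liftR (v.liftR V) v
  have k1 := twist_prod_twist (S := S) h.rTensor i12 (Site.along_rTensor m v) i13 i23
    (Site.indep_liftL_liftR v v)
  have P := (h.lTensor (Z := V)).comp_along (Site.along_assoc₂ v) (Site.along_assoc₃ v)
  have hz := (Site.along_lTensor m v).comp (Site.along_assoc₁ v)
  have k2 := twist_twist_prod (S := S) P i23 hz i12.symm i13.symm
    (Site.indep_liftL_liftR v v).symm
  have e1 : (S.twistMul m v v).rTensor V = m.rTensor V ∘ₗ
      S.twist ((v.liftL V).liftL V) ((v.liftR V).liftL V) := by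
    rw [twist_leg12]
    exact rTensor_comp _ _ _
  have e2 : (S.twistMul m v v).lTensor V ∘ₗ (TensorProduct.assoc K V V V).toLinearMap =
      (m.lTensor V ∘ₗ (TensorProduct.assoc K V V V).toLinearMap) ∘ₗ
        S.twist ((v.liftR V).liftL V) (v.liftR (V ⊗[K] V)) := by
    have e0 : (S.twistMul m v v).lTensor V =
      m.lTensor V ∘ₗ (S.twist (v.liftL V) (v.liftR V)).lTensor V := LinearMap.lTensor_comp _ _ _
    rw [e0, comp_assoc, assoc_comp_leg23, ← twist_leg23, comp_assoc]
  have A1 := (congrArg (S.twistMul m v v ∘ₗ ·) e1).trans (comp_comp_of_comp m k1)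
  have A2 := (congrArg (S.twistMul m v v ∘ₗ ·) e2).trans (comp_comp_of_comp m k2)
  exact A1.trans ((comp_comp_congr hm _).trans A2.symm)

theorem naturalLeft_coact {β : V →ₗ[K] V ⊗[K] N} {v : Site K M V} {n : Site K M N}
    (h : Site.Coact β v (v.liftL N) (n.liftR V)) (z : Site K M Z) :
    NaturalLeft β (S.braid v z) (braidTensorLeft (S.braid v z) (S.braid n z)) := by
  rw [braid, braid, braidTensorLeft_flipOp]
  refine naturalLeft_flipOp ?_
  rw [← crossing_leg13, ← crossing_leg23]
  exact crossing_coact h.rTensor (Site.along_rTensor β z)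
    (Site.indep_liftL_liftR v n).liftL (Site.indep_liftL_liftR _ z) (Site.indep_liftL_liftR _ z)

theorem naturalRight_coact {β : V →ₗ[K] V ⊗[K] N} {v : Site K M V} {n : Site K M N}
    (h : Site.Coact β v (v.liftL N) (n.liftR V)) (z : Site K M Z) :
    NaturalRight β (S.braid z v) (braidTensorRight (S.braid z v) (S.braid z n)) := by
  rw [braid, braid, braidTensorRight_flipOp]
  refine naturalRight_flipOp ?_
  rw [← crossing_leg12, ← crossing_leg13]
  have h1 := (h.lTensor (Z := Z)).comp_equiv (e := (TensorProduct.assoc K Z V N).symm)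
    (Site.along_assoc₂ v).symm (Site.along_assoc₃ n).symm
  have hz : Site.Along ((TensorProduct.assoc K Z V N).symm.toLinearMap ∘ₗ β.lTensor Z)
      (z.liftL V) ((z.liftL V).liftL N) :=
    (Site.along_assoc₁ z).symm.comp (Site.along_lTensor β z)
  have key := coact_crossing (S := S) h1 hz (Site.indep_liftL_liftR _ n)
    (Site.indep_liftL_liftR z v).symm.liftL (Site.indep_liftL_liftR _ n).symm
    (Site.indep_liftL_liftR z v).symm
  have e2 : (TensorProduct.assoc K Z V N).toLinearMap ∘ₗ
      (TensorProduct.assoc K Z V N).symm.toLinearMap = LinearMap.id := by ext; simp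
  rw [comp_assoc, comp_assoc, key, comp_assoc,
    ← comp_assoc, e2, LinearMap.id_comp]

theorem naturalLeft_counit {p : V →ₗ[K] K} {v : Site K M V} (h : Line.Merges p v.l v.r)
    (z : Site K M Z) :
    NaturalLeft p (S.braid v z) (TensorProduct.comm K K Z).toLinearMap := by
  have e : (TensorProduct.comm K K Z).toLinearMap = flipOp (1 : Module.End K (K ⊗[K] Z)) := rfl
  rw [e]
  refine naturalLeft_flipOp ?_
  have := comp_crossing_merges (S := S) (p := p.rTensor Z) (a := v.liftL Z) (z := z.liftR V)
    (Line.Merges.rTensor h) (Site.indep_liftL_liftR v z)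
  rw [this]; rfl

theorem naturalRight_counit {p : V →ₗ[K] K} {v : Site K M V} (h : Line.Merges p v.l v.r)
    (z : Site K M Z) :
    NaturalRight p (S.braid z v) (TensorProduct.comm K Z K).toLinearMap := by
  have e : (TensorProduct.comm K Z K).toLinearMap = flipOp (1 : Module.End K (Z ⊗[K] K)) := rfl
  rw [e]
  refine naturalRight_flipOp ?_
  have := comp_crossing_merges' (S := S) (p := p.lTensor Z) (a := v.liftR Z) (z := z.liftL V)
    (Line.Merges.lTensor h) (Site.indep_liftL_liftR z v).symm
  rw [this]; rfl

/-- The coactions are trivial on `x`. -/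
structure _root_.Site.TrivAt (v : Site K M V) (x : V) : Prop where
  l : v.l.δ x = x ⊗ₜ 1
  r : v.r.δ x = x ⊗ₜ 1

theorem _root_.Site.TrivAt.liftL {v : Site K M V} {x : V} (h : v.TrivAt x) :
    (v.liftL Z).l.TrivOn (TensorProduct.mk K V Z x) ∧
      (v.liftL Z).r.TrivOn (TensorProduct.mk K V Z x) := by
  constructor <;> intro z
  · simp [Site.liftL, Line.liftL, liftL_tmul, h.l]
  · simp [Site.liftL, Line.liftL, liftL_tmul, h.r]

theorem _root_.Site.TrivAt.liftR {v : Site K M V} {x : V} (h : v.TrivAt x) :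
    (v.liftR Z).l.TrivOn ((TensorProduct.mk K Z V).flip x) ∧
      (v.liftR Z).r.TrivOn ((TensorProduct.mk K Z V).flip x) := by
  constructor <;> intro z
  · simp [Site.liftR, Line.liftR, liftR_tmul, h.l]
  · simp [Site.liftR, Line.liftR, liftR_tmul, h.r]

theorem _root_.Site.along_mk (z : Site K M Z) (x : V) :
    Site.Along (TensorProduct.mk K V Z x) z (z.liftR V) := by
  have h (t : Z ⊗[K] M) : (TensorProduct.assoc K V Z M).symm (x ⊗ₜ t) =
      (TensorProduct.mk K V Z x).rTensor M t := by
    induction t with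
    | zero => simp
    | add x y hx hy => simp only [map_add, tmul_add, hx, hy]
    | tmul x m => simp
  constructor <;> ext w <;>
    simp [Site.liftR, Line.liftR, liftR_tmul, h]

theorem _root_.Site.along_mk_flip (z : Site K M Z) (x : V) :
    Site.Along ((TensorProduct.mk K Z V).flip x) z (z.liftL V) := by
  have h (t : Z ⊗[K] M) : rightComm K Z M V (t ⊗ₜ x) =
      ((TensorProduct.mk K Z V).flip x).rTensor M t := by
    induction t with
    | zero => simp
    | add x y hx hy => simp only [map_add, add_tmul, hx, hy]
    | tmul x m => simp
  constructor <;> ext w <;>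
    simp [Site.liftL, Line.liftL, liftL_tmul, h]

theorem braid_triv {v : Site K M V} {x : V} (h : v.TrivAt x) (w : Site K M Z) (z : Z) :
    S.braid v w (x ⊗ₜ z) = z ⊗ₜ x := by
  have := LinearMap.congr_fun
    (crossing_triv (S := S) h.liftL.1 h.liftL.2 (Site.along_mk w x)) z
  simp only [comp_apply, TensorProduct.mk_apply] at this
  simp [braid, flipOp, this]

theorem triv_braid {v : Site K M V} {x : V} (h : v.TrivAt x) (w : Site K M Z) (z : Z) :
    S.braid w v (z ⊗ₜ x) = x ⊗ₜ z := by
  have := LinearMap.congr_fun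
    (triv_crossing (S := S) h.liftR.1 h.liftR.2 (Site.along_mk_flip w x)
      (Site.indep_liftL_liftR w v).symm) z
  simp only [comp_apply, LinearMap.flip_apply, TensorProduct.mk_apply] at this
  simp [braid, flipOp, this]

theorem twistMul_triv {v : Site K M V} {x : V} (h : v.TrivAt x) (w : Site K M Z)
    (m : V ⊗[K] Z →ₗ[K] Y) (z : Z) : S.twistMul m v w (x ⊗ₜ z) = m (x ⊗ₜ z) := by
  have := LinearMap.congr_fun
    (twist_triv (S := S) h.liftL.1 h.liftL.2 (Site.along_mk w x).l) z
  simp only [comp_apply, TensorProduct.mk_apply] at this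
  simp [twistMul, this]

theorem triv_twistMul {v : Site K M V} {x : V} (h : v.l.δ x = x ⊗ₜ 1) (w : Site K M Z)
    (m : Z ⊗[K] V →ₗ[K] Y) (z : Z) : S.twistMul m w v (z ⊗ₜ x) = m (z ⊗ₜ x) := by
  have h' : (v.liftR Z).l.TrivOn ((TensorProduct.mk K Z V).flip x) := by
    intro z
    simp [Site.liftR, Line.liftR, liftR_tmul, h]
  have := LinearMap.congr_fun
    (triv_twist (S := S) (z := w.liftL V) h' (Site.along_mk_flip w x)
      (Site.indep_liftL_liftR w v).l) z
  simp only [comp_apply, LinearMap.flip_apply, TensorProduct.mk_apply] at this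
  simp [twistMul, this]

end DualQuasitriangular.SecondInverse

end Category

theorem comp_comp_swap {K Y Z W : Type*} [CommSemiring K]
    [AddCommMonoid Y] [Module K Y] [AddCommMonoid Z] [Module K Z] [AddCommMonoid W] [Module K W]
    {m : Z →ₗ[K] W} {a : Z →ₗ[K] Z} {t : Y →ₗ[K] Z} {b : Module.End K Y} {c : Module.End K Y}
    (h : a ∘ₗ t = t ∘ₗ b) : (m ∘ₗ a) ∘ₗ t ∘ₗ c = m ∘ₗ t ∘ₗ (b * c) := by
  rw [comp_assoc, ← comp_assoc c, h]
  rfl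

theorem comp_comp_transfer {K V X Y Z W : Type*} [CommSemiring K] [AddCommMonoid X] [Module K X]
    [AddCommMonoid Y] [Module K Y] [AddCommMonoid Z] [Module K Z] [AddCommMonoid W] [Module K W]
    [AddCommMonoid V] [Module K V] {m : Z →ₗ[K] W} {t : Y →ₗ[K] Z} {c : Module.End K Y}
    {p : V →ₗ[K] X} {q : X →ₗ[K] Y} {g : Module.End K V} (h : c ∘ₗ q ∘ₗ p = q ∘ₗ p ∘ₗ g) :
    m ∘ₗ t ∘ₗ (q ∘ₗ p) ∘ₗ g = (m ∘ₗ t ∘ₗ c) ∘ₗ q ∘ₗ p := by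
  simp only [comp_assoc, h]

section TensorSquare

variable {K M V N X Y : Type*} [Field K] [Semiring M] [Bialgebra K M]
  [AddCommMonoid V] [Module K V] [AddCommMonoid N] [Module K N]
  [AddCommMonoid X] [Module K X] [AddCommMonoid Y] [Module K Y]

section Shuffle

variable {X₁ X₂ X₃ X₄ : Type*} [AddCommMonoid X₁] [Module K X₁] [AddCommMonoid X₂] [Module K X₂]
  [AddCommMonoid X₃] [Module K X₃] [AddCommMonoid X₄] [Module K X₄]

local notation "ttt" =>
  LinearEquiv.toLinearMap (tensorTensorTensorComm K X₁ X₂ X₃ X₄)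

theorem colin_shuffle₁ (δ : X₁ →ₗ[K] X₁ ⊗[K] M) :
    Colin ttt (liftL (X₃ ⊗[K] X₄) (liftL X₂ δ)) (liftL (X₂ ⊗[K] X₄) (liftL X₃ δ)) := by
  ext x y z w
  simp only [TensorProduct.AlgebraTensorModule.curry_apply, restrictScalars_self,
    curry_apply, comp_apply, liftL_tmul, coe_coe,
    tensorTensorTensorComm_tmul]
  generalize δ x = t
  induction t with
  | zero => simp
  | add x y hx hy => simp only [map_add, add_tmul, hx, hy]
  | tmul x m => simp

theorem colin_shuffle₂ (δ : X₂ →ₗ[K] X₂ ⊗[K] M) :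
    Colin ttt (liftL (X₃ ⊗[K] X₄) (liftR X₁ δ)) (liftR (X₁ ⊗[K] X₃) (liftL X₄ δ)) := by
  ext x y z w
  simp only [TensorProduct.AlgebraTensorModule.curry_apply, restrictScalars_self,
    curry_apply, comp_apply, liftL_tmul, liftR_tmul, coe_coe,
    tensorTensorTensorComm_tmul]
  generalize δ y = t
  induction t with
  | zero => simp
  | add x y hx hy => simp only [map_add, add_tmul, tmul_add, hx, hy]
  | tmul x m => simp

theorem colin_shuffle₃ (δ : X₃ →ₗ[K] X₃ ⊗[K] M) :
    Colin ttt (liftR (X₁ ⊗[K] X₂) (liftL X₄ δ)) (liftL (X₂ ⊗[K] X₄) (liftR X₁ δ)) := by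
  ext x y z w
  simp only [TensorProduct.AlgebraTensorModule.curry_apply, restrictScalars_self,
    curry_apply, comp_apply, liftL_tmul, liftR_tmul, coe_coe,
    tensorTensorTensorComm_tmul]
  generalize δ z = t
  induction t with
  | zero => simp
  | add x y hx hy => simp only [map_add, add_tmul, tmul_add, hx, hy]
  | tmul x m => simp

theorem colin_shuffle₄ (δ : X₄ →ₗ[K] X₄ ⊗[K] M) :
    Colin ttt (liftR (X₁ ⊗[K] X₂) (liftR X₃ δ)) (liftR (X₁ ⊗[K] X₃) (liftR X₂ δ)) := by
  ext x y z w
  simp only [TensorProduct.AlgebraTensorModule.curry_apply, restrictScalars_self,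
    curry_apply, comp_apply, liftR_tmul, coe_coe,
    tensorTensorTensorComm_tmul]
  generalize δ w = t
  induction t with
  | zero => simp
  | add x y hx hy => simp only [map_add, tmul_add, hx, hy]
  | tmul x m => simp

end Shuffle

/-- An operator on the two middle factors. -/
noncomputable def midEquiv (K V N : Type*) [Field K] [AddCommMonoid V] [Module K V]
    [AddCommMonoid N] [Module K N] :
    (V ⊗[K] N) ⊗[K] (V ⊗[K] N) ≃ₗ[K] V ⊗[K] ((N ⊗[K] V) ⊗[K] N) :=
  TensorProduct.assoc K V N (V ⊗[K] N) ≪≫ₗ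
    LinearEquiv.lTensor V (TensorProduct.assoc K N V N).symm

theorem midEquiv_eq : (midEquiv K V N).toLinearMap =
    (TensorProduct.assoc K N V N).symm.toLinearMap.lTensor V ∘ₗ
      (TensorProduct.assoc K V N (V ⊗[K] N)).toLinearMap := rfl

theorem along_midEquiv₂ (n : Site K M N) : Site.Along (midEquiv K V N).toLinearMap
    ((n.liftR V).liftL (V ⊗[K] N)) (((n.liftL V).liftL N).liftR V) := by
  rw [midEquiv_eq]
  exact (Site.Along.lTensor (Site.along_assoc₁ n).symm).comp (Site.along_assoc₂ n)

theorem along_midEquiv₃ (v : Site K M V) : Site.Along (midEquiv K V N).toLinearMap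
    ((v.liftL N).liftR (V ⊗[K] N)) (((v.liftR N).liftL N).liftR V) := by
  rw [midEquiv_eq]
  exact (Site.Along.lTensor (Site.along_assoc₂ v).symm).comp (Site.along_assoc₃ (v.liftL N))

theorem braidedTensorMul_flipOp (mX : V ⊗[K] V →ₗ[K] V) (mY : N ⊗[K] N →ₗ[K] N)
    (H : Module.End K (N ⊗[K] V)) :
    braidedTensorMul mX mY (flipOp H) = TensorProduct.map mX mY ∘ₗ
      (tensorTensorTensorComm K V N V N).toLinearMap ∘ₗ
      (midEquiv K V N).symm.toLinearMap ∘ₗ (H.rTensor N).lTensor V ∘ₗ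
      (midEquiv K V N).toLinearMap := by
  ext x y z w
  have e (t : N ⊗[K] V) : (midEquiv K V N).symm (x ⊗ₜ (t ⊗ₜ w)) =
      (TensorProduct.assoc K V N (V ⊗[K] N)).symm (x ⊗ₜ (TensorProduct.assoc K N V N (t ⊗ₜ w))) :=
    rfl
  simp only [TensorProduct.AlgebraTensorModule.curry_apply, restrictScalars_self,
    curry_apply, comp_apply, braidedTensorMul, coe_coe,
    assoc_tmul, map_tmul, assoc_symm_tmul, flipOp,
    LinearMap.id_apply, midEquiv, LinearEquiv.trans_apply, LinearEquiv.lTensor_tmul,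
    lTensor_tmul, rTensor_tmul] at e ⊢
  rw [e]
  generalize H (y ⊗ₜ z) = t
  induction t with
  | zero => simp
  | add x y hx hy => simp only [map_add, add_tmul, tmul_add, hx, hy]
  | tmul x m => simp

namespace DualQuasitriangular.SecondInverse

variable {Q : DualQuasitriangular K M} (S : Q.SecondInverse)

theorem twist_lTensor (a b : Site K M Y) :
    S.twist (a.liftR X) (b.liftR X) = (S.twist a b).lTensor X := by
  rw [twist, crossL, twist, crossL, LinearMap.lTensor_mul]
  exact congrArg₂ _ (pairOp_liftR _ _ _) (pairOp_liftR _ _ _)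

theorem crossing_lTensor (a b : Site K M Y) :
    S.crossing (a.liftR X) (b.liftR X) = (S.crossing a b).lTensor X := by
  rw [crossing, crossL, crossL, crossing, crossL, crossL, LinearMap.lTensor_mul,
    LinearMap.lTensor_mul, LinearMap.lTensor_mul]
  exact congrArg₂ _ (congrArg₂ _ (pairOp_liftR _ _ _) (pairOp_liftR _ _ _))
    (congrArg₂ _ (pairOp_liftR _ _ _) (pairOp_liftR _ _ _))

theorem crossing_mid (n : Site K M N) (v : Site K M V) :
    (midEquiv K V N).symm.toLinearMap ∘ₗ
      ((S.crossing (n.liftL V) (v.liftR N)).rTensor N).lTensor V ∘ₗ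
      (midEquiv K V N).toLinearMap =
    S.crossing ((n.liftR V).liftL (V ⊗[K] N)) ((v.liftL N).liftR (V ⊗[K] N)) := by
  have h := crossing_comp (S := S) (along_midEquiv₂ (V := V) n) (along_midEquiv₃ (N := N) v)
  rw [crossing_lTensor, crossing_leg12] at h
  change _ ∘ₗ (leg12 N _).lTensor V ∘ₗ _ = _
  rw [h, ← comp_assoc]
  have : (midEquiv K V N).symm.toLinearMap ∘ₗ (midEquiv K V N).toLinearMap = LinearMap.id :=
    LinearMap.ext fun x => by simp
  rw [this, LinearMap.id_comp]

theorem shuffle_twist (v : Site K M V) (n : Site K M N) :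
    TensorProduct.map (S.twist (v.liftL V) (v.liftR V)) (S.twist (n.liftL N) (n.liftR N)) ∘ₗ
      (tensorTensorTensorComm K V N V N).toLinearMap =
    (tensorTensorTensorComm K V N V N).toLinearMap ∘ₗ
      (S.twist ((v.liftL N).liftL (V ⊗[K] N)) ((v.liftL N).liftR (V ⊗[K] N)) *
        S.twist ((n.liftR V).liftL (V ⊗[K] N)) ((n.liftR V).liftR (V ⊗[K] N))) := by
  have a1 : Site.Along (tensorTensorTensorComm K V N V N).toLinearMap
      ((v.liftL N).liftL (V ⊗[K] N)) ((v.liftL V).liftL (N ⊗[K] N)) :=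
    ⟨colin_shuffle₁ _, colin_shuffle₁ _⟩
  have a2 : Site.Along (tensorTensorTensorComm K V N V N).toLinearMap
      ((n.liftR V).liftL (V ⊗[K] N)) ((n.liftL N).liftR (V ⊗[K] V)) :=
    ⟨colin_shuffle₂ _, colin_shuffle₂ _⟩
  have a3 : Site.Along (tensorTensorTensorComm K V N V N).toLinearMap
      ((v.liftL N).liftR (V ⊗[K] N)) ((v.liftR V).liftL (N ⊗[K] N)) :=
    ⟨colin_shuffle₃ _, colin_shuffle₃ _⟩
  have a4 : Site.Along (tensorTensorTensorComm K V N V N).toLinearMap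
      ((n.liftR V).liftR (V ⊗[K] N)) ((n.liftR N).liftR (V ⊗[K] V)) :=
    ⟨colin_shuffle₄ _, colin_shuffle₄ _⟩
  have h1 := crossL_comp (S := S) a1 a3.l
  have h2 := crossL_comp (S := S) a2 a4.l
  rw [← LinearMap.rTensor_comp_lTensor]
  have e1 := twist_leg12 S (Z := N ⊗[K] N) (v.liftL V) (v.liftR V)
  have e2 := twist_lTensor S (X := V ⊗[K] V) (n.liftL N) (n.liftR N)
  rw [leg12] at e1
  rw [← e1, ← e2, Module.End.mul_eq_comp, ← comp_assoc]
  refine (comp_assoc _ _ _).trans ?_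
  refine (congrArg (S.twist _ _ ∘ₗ ·) h2).trans ?_
  rw [← comp_assoc]
  exact congrArg (· ∘ₗ _) h1

variable {S}

theorem coact_twistMul {β : V →ₗ[K] V ⊗[K] N} {v : Site K M V} {n : Site K M N}
    {mV : V ⊗[K] V →ₗ[K] V} {mN : N ⊗[K] N →ₗ[K] N}
    (h : Site.Coact β v (v.liftL N) (n.liftR V))
    (hm : β ∘ₗ mV = TensorProduct.map mV mN ∘ₗ
      (tensorTensorTensorComm K V N V N).toLinearMap ∘ₗ TensorProduct.map β β) :
    β ∘ₗ S.twistMul mV v v =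
      braidedTensorMul (S.twistMul mV v v) (S.twistMul mN n n) (S.braid n v) ∘ₗ
        TensorProduct.map β β := by
  have i := Site.indep_liftL_liftR v n
  have key := twist_coact (S := S) h.rTensor (Site.along_rTensor β v).l h.lTensor
    (Site.along_lTensor β (v.liftL N)) (Site.along_lTensor β (n.liftR V))
    i.liftR (Site.indep_liftL_liftR _ _) (Site.indep_liftL_liftR _ _)
    (Site.indep_liftL_liftR _ _)
  have e : TensorProduct.map β β = β.lTensor (V ⊗[K] N) ∘ₗ β.rTensor V :=
    (LinearMap.lTensor_comp_rTensor _ _ _).symm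
  have e' : TensorProduct.map (S.twistMul mV v v) (S.twistMul mN n n) =
      TensorProduct.map mV mN ∘ₗ TensorProduct.map (S.twist (v.liftL V) (v.liftR V))
        (S.twist (n.liftL N) (n.liftR N)) := TensorProduct.map_comp _ _ _ _
  have e3 : braidedTensorMul (S.twistMul mV v v) (S.twistMul mN n n) (S.braid n v) =
      TensorProduct.map mV mN ∘ₗ
        (tensorTensorTensorComm K V N V N).toLinearMap ∘ₗ
        ((S.twist ((v.liftL N).liftL (V ⊗[K] N)) ((v.liftL N).liftR (V ⊗[K] N)) *
          S.twist ((n.liftR V).liftL (V ⊗[K] N)) ((n.liftR V).liftR (V ⊗[K] N))) *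
        S.crossing ((n.liftR V).liftL (V ⊗[K] N)) ((v.liftL N).liftR (V ⊗[K] N))) := by
    rw [braid, braidedTensorMul_flipOp, crossing_mid, e']
    exact comp_comp_swap (shuffle_twist S v n)
  have k2 : β ∘ₗ S.twistMul mV v v = TensorProduct.map mV mN ∘ₗ
      (tensorTensorTensorComm K V N V N).toLinearMap ∘ₗ
      (TensorProduct.map β β ∘ₗ S.twist (v.liftL V) (v.liftR V)) := by
    exact (congrArg (· ∘ₗ S.twist (v.liftL V) (v.liftR V)) hm)
  rw [k2, e3, e]
  exact comp_comp_transfer key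

/-- All crossings are invertible if `𝓡⁻¹` has a second inverse. -/
theorem isUnit_cross {W : Type*} [AddCommMonoid W] [Module K W] {s t : Bool}
    {sil : M ⊗[K] M →ₗ[K] K}
    (h1 : convWith Q.inv sil (comulOp K M) Coalgebra.comul = counitPair K M)
    (h2 : convWith sil Q.inv (comulOp K M) Coalgebra.comul = counitPair K M)
    {x : Line K M s W} {y : Line K M t W} (h : x.Indep y) : IsUnit (S.cross x y) := by
  match s, t with
  | true, true => exact ⟨⟨_, _, form_mul_inv h, inv_mul_form h⟩, rfl⟩
  | false, false => exact ⟨⟨_, _, form_mul_inv h, inv_mul_form h⟩, rfl⟩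
  | true, false => exact ⟨⟨_, _, til_mul_form S h, form_mul_til S h⟩, rfl⟩
  | false, true =>
    exact ⟨⟨_, _, pairOp_eq_one_of_counitPair x.slot_false y.slot_true h h1,
      pairOp_eq_one_of_counitPair x.slot_false y.slot_true h h2⟩, rfl⟩

theorem bijective_braid {sil : M ⊗[K] M →ₗ[K] K}
    (h1 : convWith Q.inv sil (comulOp K M) Coalgebra.comul = counitPair K M)
    (h2 : convWith sil Q.inv (comulOp K M) Coalgebra.comul = counitPair K M)
    (a : Site K M X) (b : Site K M Y) : Function.Bijective (S.braid a b) := by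
  have i := Site.indep_liftL_liftR a b
  have u : IsUnit (S.crossing (a.liftL Y) (b.liftR X)) :=
    ((isUnit_cross h1 h2 i.r.l).mul (isUnit_cross h1 h2 i.r.r)).mul
      ((isUnit_cross h1 h2 i.l.l).mul (isUnit_cross h1 h2 i.l.r))
  exact (TensorProduct.comm K X Y).bijective.comp ((Module.End.isUnit_iff _).mp u)

end DualQuasitriangular.SecondInverse

end TensorSquare

section Regular

variable {K M V U X Y : Type*} [Field K] [Semiring M] [Bialgebra K M]
  [AddCommMonoid V] [Module K V] [AddCommMonoid U] [Module K U]
  [AddCommMonoid X] [Module K X] [AddCommMonoid Y] [Module K Y]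

local notation "Δ" => (Coalgebra.comul : M →ₗ[K] M ⊗[K] M)
local notation "Δop" => comulOp K M
local notation "ε" => (Coalgebra.counit : M →ₗ[K] K)

/-- The regular bicomodule. -/
noncomputable def Site.regular (K M : Type*) [Field K] [Semiring M] [Bialgebra K M] :
    Site K M M where
  l := ⟨comulOp K M, isSlot_comulOp⟩
  r := ⟨Coalgebra.comul, isSlot_comul⟩
  indep := coComm_comulOp_comul

theorem Site.prod_regular : Site.Prod (mul' K M) ((Site.regular K M).liftL M)
    ((Site.regular K M).liftR M) (Site.regular K M) :=
  ⟨prodAlong_mul'_comulOp, prodAlong_mul'_comul⟩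

/-- The bicomodule structure transported along an equivalence. -/
noncomputable def Line.map {t : Bool} (e : X ≃ₗ[K] Y) (x : Line K M t X) : Line K M t Y where
  δ := e.toLinearMap.rTensor M ∘ₗ x.δ ∘ₗ e.symm.toLinearMap
  isSlot := by
    have h (f : M →ₗ[K] M ⊗[K] M) (u : X ⊗[K] M) :
        f.lTensor Y (e.toLinearMap.rTensor M u) =
        e.toLinearMap.rTensor (M ⊗[K] M) (f.lTensor X u) := by
      rw [← comp_apply, ← comp_apply, LinearMap.rTensor_comp_lTensor,
        LinearMap.lTensor_comp_rTensor]
    constructor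
    · ext y
      have h1 := LinearMap.congr_fun x.isSlot.coassoc (e.symm y)
      simp only [joint, comp_apply, coe_coe] at h1 ⊢
      rw [h, ← h1]
      generalize x.δ (e.symm y) = t
      induction t with
      | zero => simp
      | add x y hx hy => simp only [map_add, hx, hy]
      | tmul w m =>
        simp only [rTensor_tmul, comp_apply, coe_coe,
          LinearEquiv.symm_apply_apply]
        generalize x.δ w = t
        induction t with
        | zero => simp
        | add x y hx hy => simp only [map_add, add_tmul, hx, hy]
        | tmul w m => simp
    · ext y
      have h1 := LinearMap.congr_fun x.isSlot.counit (e.symm y)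
      simp only [evalFun_apply, Module.End.one_apply, comp_apply,
        coe_coe] at h1 ⊢
      apply e.symm.injective
      refine Eq.trans ?_ h1
      generalize x.δ (e.symm y) = t
      induction t with
      | zero => simp
      | add x y hx hy => simp only [map_add, hx, hy]
      | tmul w m => simp

theorem Line.along_map {t : Bool} (e : X ≃ₗ[K] Y) (x : Line K M t X) :
    Line.Along e.toLinearMap x (x.map e) := by
  unfold Line.Along Colin Line.map
  ext w
  simp

theorem Line.Along.indep_map {s t : Bool} (e : X ≃ₗ[K] Y) {x : Line K M s X} {y : Line K M t X}
    (h : x.Indep y) : (x.map e).Indep (y.map e) := by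
  have h1 := (Line.along_map e x).symm
  unfold Line.Indep CoComm at *
  ext w
  have h' := LinearMap.congr_fun h (e.symm w)
  simp only [Line.map, comp_apply, coe_coe] at h' ⊢
  have e1 (δ : X →ₗ[K] X ⊗[K] M) (u : X ⊗[K] M) :
      (e.toLinearMap.rTensor M ∘ₗ δ ∘ₗ e.symm.toLinearMap).rTensor M
        (e.toLinearMap.rTensor M u) = (e.toLinearMap.rTensor M).rTensor M (δ.rTensor M u) := by
    induction u with
    | zero => simp
    | add x y hx hy => simp only [map_add, hx, hy]
    | tmul w m => simp
  rw [e1, e1, h']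
  generalize y.δ.rTensor M (x.δ (e.symm w)) = t
  induction t with
  | zero => simp
  | add x y hx hy => simp only [map_add, hx, hy]
  | tmul t m =>
    induction t with
    | zero => simp
    | add x y hx hy => simp only [map_add, add_tmul, hx, hy]
    | tmul w m => simp

/-- The bicomodule structure transported along an equivalence. -/
noncomputable def Site.map (e : X ≃ₗ[K] Y) (x : Site K M X) : Site K M Y :=
  ⟨x.l.map e, x.r.map e, Line.Along.indep_map e x.indep⟩

theorem Site.along_map (e : X ≃ₗ[K] Y) (x : Site K M X) :
    Site.Along e.toLinearMap x (x.map e) := ⟨Line.along_map e _, Line.along_map e _⟩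

theorem Line.Splits.comp_along {t s : Bool} {p : V →ₗ[K] X} {q : X →ₗ[K] Y} {x : Line K M t X}
    {y : Line K M s X} {x' : Line K M t Y} {y' : Line K M s Y} (h : Line.Splits p x y)
    (hx : Line.Along q x x') (hy : Line.Along q y y') : Line.Splits (q ∘ₗ p) x' y' := by
  obtain ⟨κ, h1, h2⟩ := h
  have h' := Colin.joint (C := M) (D := M) hx hy
  refine ⟨q.rTensor M ∘ₗ κ, ?_, ?_⟩
  · unfold Colin at h'
    rw [← comp_assoc, h', comp_assoc, h1, ← comp_assoc,
      ← comp_assoc, LinearMap.rTensor_comp_lTensor, LinearMap.lTensor_comp_rTensor]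
  · conv_rhs => rw [← h2]
    ext w
    simp only [comp_apply]
    generalize κ w = t
    induction t with
    | zero => simp
    | add x y hx hy => simp only [map_add, hx, hy]
    | tmul w m => simp

theorem Site.Coact.comp_along {p : V →ₗ[K] X} {q : X →ₗ[K] Y} {a : Site K M V} {v n : Site K M X}
    {v' n' : Site K M Y} (h : Site.Coact p a v n) (hv : Site.Along q v v')
    (hn : Site.Along q n n') : Site.Coact (q ∘ₗ p) a v' n' :=
  ⟨hv.l.comp h.left, hn.r.comp h.right, h.splits.comp_along hv.r hn.l⟩

/-- The right coaction of a bicomodule is a morphism to the relative tensor product with the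
regular bicomodule. -/
theorem Site.coact_regular (v : Site K M V) :
    Site.Coact v.r.δ v (v.liftL M) ((Site.regular K M).liftR V) := by
  refine ⟨?_, ?_, ?_⟩
  · have h := v.indep
    unfold Line.Indep CoComm at h
    change (rightComm K V M M).toLinearMap ∘ₗ v.l.δ.rTensor M ∘ₗ v.r.δ = _
    rw [h]
    ext w
    exact (rightComm K V M M).symm_apply_apply _
  · have h := v.r.isSlot.coassoc
    change (TensorProduct.assoc K V M M).symm.toLinearMap ∘ₗ (Δ).lTensor V ∘ₗ v.r.δ = _
    change _ = (Δ).lTensor V ∘ₗ v.r.δ at h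
    rw [← h]
    ext w
    simp [joint]
  · refine ⟨_root_.liftR V Δop ∘ₗ v.r.δ, ?_, ?_⟩
    · let G : (V ⊗[K] M) ⊗[K] M →ₗ[K] (V ⊗[K] M) ⊗[K] (M ⊗[K] M) :=
        (tensorTensorTensorComm K V M M M).toLinearMap ∘ₗ
          (Δop).lTensor (V ⊗[K] M)
      have hA (t : V ⊗[K] M) : joint (_root_.liftL M v.r.δ) (_root_.liftR V Δop) t =
          G (v.r.δ.rTensor M t) := by
        induction t with
        | zero => simp
        | add x y hx hy => simp only [map_add, hx, hy]
        | tmul x m =>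
          simp only [joint, comp_apply, liftR_tmul, coe_coe, G,
            rTensor_tmul, lTensor_tmul]
          generalize Δop m = u
          induction u with
          | zero => simp
          | add x y hx hy => simp only [map_add, tmul_add, hx, hy]
          | tmul a b =>
            rw [assoc_symm_tmul, rTensor_tmul, liftL_tmul]
            generalize v.r.δ x = s
            induction s with
            | zero => simp
            | add x y hx hy => simp only [map_add, add_tmul, hx, hy]
            | tmul w c => simp
      have hB (t : V ⊗[K] M) : G ((TensorProduct.assoc K V M M).symm ((Δ).lTensor V t)) =
          (Δ).lTensor (V ⊗[K] M) (_root_.liftR V Δop t) := by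
        induction t with
        | zero => simp
        | add x y hx hy => simp only [map_add, hx, hy]
        | tmul x m =>
          let H : M ⊗[K] (M ⊗[K] M) →ₗ[K] (V ⊗[K] M) ⊗[K] (M ⊗[K] M) :=
            (TensorProduct.mk K V M x).rTensor (M ⊗[K] M) ∘ₗ
              (TensorProduct.comm K (M ⊗[K] M) M).toLinearMap ∘ₗ
              (TensorProduct.assoc K M M M).symm.toLinearMap
          have h1 (u : M ⊗[K] M) : G ((TensorProduct.assoc K V M M).symm (x ⊗ₜ u)) =
              H ((Δ).lTensor M u) := by
            induction u with
            | zero => simp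
            | add x y hx hy => simp only [map_add, tmul_add, hx, hy]
            | tmul a b =>
              simp only [G, H, comp_apply, lTensor_tmul, coe_coe,
                assoc_symm_tmul, comulOp_apply]
              generalize Δ b = s
              induction s with
              | zero => simp
              | add x y hx hy => simp only [map_add, tmul_add, hx, hy]
              | tmul w c => simp
          have h2 (u : M ⊗[K] M) : (Δ).lTensor (V ⊗[K] M) ((TensorProduct.assoc K V M M).symm
              (x ⊗ₜ TensorProduct.comm K M M u)) =
              H (TensorProduct.assoc K M M M ((Δ).rTensor M u)) := by
            induction u with
            | zero => simp
            | add x y hx hy => simp only [map_add, tmul_add, hx, hy]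
            | tmul a b => simp [H]
          rw [lTensor_tmul, liftR_tmul, comulOp_apply, h1, h2, Coalgebra.coassoc_apply]
      have h := v.r.isSlot.coassoc
      change _ = (Δ).lTensor V ∘ₗ v.r.δ at h
      ext w
      have h' := LinearMap.congr_fun h w
      simp only [comp_apply, joint, coe_coe] at h'
      change joint (_root_.liftL M v.r.δ) (_root_.liftR V Δop) (v.r.δ w) = _
      rw [comp_apply, comp_apply, hA, ← hB, ← h', LinearEquiv.symm_apply_apply]
    · ext w
      have h := LinearMap.congr_fun v.r.isSlot.counit w
      simp only [evalFun_apply, Module.End.one_apply, comp_apply, coe_coe]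
        at h ⊢
      generalize v.r.δ w = t
      induction t with
      | zero => simp
      | add x y hx hy => simp only [map_add, hx, hy]
      | tmul x m =>
        rw [liftR_tmul, comulOp_apply]
        have := lid_counit_comul (K := K) m
        conv_rhs => rw [← this]
        generalize Δ m = u
        induction u with
        | zero => simp
        | add x y hx hy => simp only [map_add, tmul_add, hx, hy]
        | tmul a b => simp [smul_tmul']

theorem Site.trivAt_regular : (Site.regular K M).TrivAt 1 := by
  constructor
  · simp only [Site.regular, comulOp_apply, Bialgebra.comul_one, Algebra.TensorProduct.one_def]
    rfl
  · simp [Site.regular, Algebra.TensorProduct.one_def]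

theorem Site.merges_regular :
    Line.Merges ε (Site.regular K M).l (Site.regular K M).r := by
  refine ⟨(TensorProduct.lid K M).symm.toLinearMap, ?_, ?_⟩
  · ext x
    have h (t : M ⊗[K] M) : (ε).rTensor (M ⊗[K] M) (TensorProduct.assoc K M M M
        ((Δop).rTensor M t)) = 1 ⊗ₜ t := by
      induction t with
      | zero => simp
      | add x y hx hy => simp only [map_add, tmul_add, hx, hy]
      | tmul a b =>
        have h2 (u : M ⊗[K] M) : (ε).rTensor (M ⊗[K] M) (TensorProduct.assoc K M M M
            (TensorProduct.comm K M M u ⊗ₜ b)) =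
            1 ⊗ₜ (TensorProduct.rid K M ((ε).lTensor M u) ⊗ₜ b) := by
          induction u with
          | zero => simp
          | add x y hx hy =>
            simp only [map_add, tmul_add, add_tmul, hx, hy]
          | tmul c d => 
            have : ((ε) d : K) ⊗ₜ[K] (c ⊗ₜ[K] b) = (1 : K) ⊗ₜ[K] ((ε) d • (c ⊗ₜ[K] b)) := by
              rw [tmul_smul, smul_tmul', smul_eq_mul, mul_one]
            simpa [smul_tmul'] using this
        rw [rTensor_tmul, comulOp_apply, h2]
        simp
    exact h (Δ x)
  · ext x; simp

end Regular

section Transported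

variable {K M U V : Type*} [Field K] [Semiring M] [Bialgebra K M]
  [AddCommMonoid U] [Module K U] [AddCommMonoid V] [Module K V]

local notation "Δ" => (Coalgebra.comul : M →ₗ[K] M ⊗[K] M)
local notation "ε" => (Coalgebra.counit : M →ₗ[K] K)

/-- The product of `M` transported to `U`. -/
noncomputable def pullMul (φ : U ≃ₗ[K] M) : U ⊗[K] U →ₗ[K] U :=
  φ.symm.toLinearMap ∘ₗ mul' K M ∘ₗ TensorProduct.map φ.toLinearMap φ.toLinearMap

/-- The regular bicomodule transported to `U`. -/
noncomputable def Site.pull (φ : U ≃ₗ[K] M) : Site K M U := (Site.regular K M).map φ.symm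

/-- The right coaction of a bicomodule, with values transported to `U`. -/
noncomputable def Site.coaction (φ : U ≃ₗ[K] M) (v : Site K M V) : V →ₗ[K] V ⊗[K] U :=
  φ.symm.toLinearMap.lTensor V ∘ₗ v.r.δ

theorem ProdAlong.comp_left {W W' W'' : Type*} [AddCommMonoid W] [Module K W]
    [AddCommMonoid W'] [Module K W'] [AddCommMonoid W''] [Module K W''] {P : W →ₗ[K] W'}
    {q : W' →ₗ[K] W''} {s₁ s₂ : W →ₗ[K] W ⊗[K] M} {s : W' →ₗ[K] W' ⊗[K] M}
    {s' : W'' →ₗ[K] W'' ⊗[K] M} (h : ProdAlong P s₁ s₂ s) (hq : Colin q s s') :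
    ProdAlong (q ∘ₗ P) s₁ s₂ s' := by
  unfold ProdAlong Colin at *
  rw [← comp_assoc, hq, comp_assoc, h, ← comp_assoc,
    LinearMap.rTensor, ← TensorProduct.map_comp, LinearMap.id_comp]

theorem Site.along_pull (φ : U ≃ₗ[K] M) :
    Site.Along φ.symm.toLinearMap (Site.regular K M) (Site.pull φ) := Site.along_map _ _

theorem Site.along_pull' (φ : U ≃ₗ[K] M) :
    Site.Along φ.toLinearMap (Site.pull φ) (Site.regular K M) := (Site.along_map φ.symm _).symm

theorem Site.along_map₁ (φ : U ≃ₗ[K] M) :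
    Site.Along (TensorProduct.map φ.toLinearMap φ.toLinearMap) ((Site.pull φ).liftL U)
      ((Site.regular K M).liftL M) := by
  rw [← LinearMap.lTensor_comp_rTensor]
  exact (Site.along_lTensor _ _).comp (Site.along_pull' φ).rTensor

theorem Site.along_map₂ (φ : U ≃ₗ[K] M) :
    Site.Along (TensorProduct.map φ.toLinearMap φ.toLinearMap) ((Site.pull φ).liftR U)
      ((Site.regular K M).liftR M) := by
  rw [← LinearMap.lTensor_comp_rTensor]
  exact (Site.along_pull' φ).lTensor.comp (Site.along_rTensor _ _)

theorem Site.prod_pull (φ : U ≃ₗ[K] M) : Site.Prod (pullMul φ) ((Site.pull φ).liftL U)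
    ((Site.pull φ).liftR U) (Site.pull φ) := by
  have h := (Site.prod_regular (K := K) (M := M)).comp_along (Site.along_map₁ φ)
    (Site.along_map₂ φ)
  exact ⟨ProdAlong.comp_left h.l (Site.along_pull φ).l, ProdAlong.comp_left h.r (Site.along_pull φ).r⟩

theorem pullMul_assoc (φ : U ≃ₗ[K] M) : pullMul φ ∘ₗ (pullMul φ).rTensor U =
    pullMul φ ∘ₗ (pullMul φ).lTensor U ∘ₗ (TensorProduct.assoc K U U U).toLinearMap := by
  ext x y z
  simp [pullMul, mul_assoc]

theorem Site.trivAt_pull (φ : U ≃ₗ[K] M) : (Site.pull φ).TrivAt (φ.symm 1) := by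
  constructor
  · rw [← coe_coe, Colin.apply (Site.along_pull φ).l, Site.trivAt_regular.l]; simp
  · rw [← coe_coe, Colin.apply (Site.along_pull φ).r, Site.trivAt_regular.r]; simp

theorem Line.Merges.comp_along {s t : Bool} {W W' W'' : Type*} [AddCommMonoid W] [Module K W]
    [AddCommMonoid W'] [Module K W'] [AddCommMonoid W''] [Module K W''] {p : W →ₗ[K] W'}
    {q : W'' →ₗ[K] W} {x : Line K M s W} {y : Line K M t W} {x' : Line K M s W''}
    {y' : Line K M t W''} (h : Line.Merges p x y)
    (hx : Line.Along q x' x) (hy : Line.Along q y' y) : Line.Merges (p ∘ₗ q) x' y' := by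
  obtain ⟨κ, h1, h2⟩ := h
  have h' := Colin.joint (C := M) (D := M) hx hy
  refine ⟨κ ∘ₗ q, ?_, ?_⟩
  · unfold Colin at h'
    rw [rTensor_comp, comp_assoc, ← h', ← comp_assoc, h1,
      comp_assoc]
  · conv_rhs => rw [← h2]
    simp only [comp_assoc]

theorem Site.merges_pull (φ : U ≃ₗ[K] M) :
    Line.Merges (ε ∘ₗ φ.toLinearMap) (Site.pull φ).l (Site.pull φ).r :=
  Site.merges_regular.comp_along (Site.along_pull' φ).l (Site.along_pull' φ).r

theorem Site.coact_pull (φ : U ≃ₗ[K] M) (v : Site K M V) :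
    Site.Coact (v.coaction φ) v (v.liftL U) ((Site.pull φ).liftR V) :=
  (Site.coact_regular v).comp_along (Site.along_lTensor _ _) (Site.along_pull φ).lTensor

theorem Site.coaction_mul (φ : U ≃ₗ[K] M) {v : Site K M V} {m : V ⊗[K] V →ₗ[K] V}
    (h : Site.Prod m (v.liftL V) (v.liftR V) v) :
    v.coaction φ ∘ₗ m = TensorProduct.map m (pullMul φ) ∘ₗ
      (tensorTensorTensorComm K V U V U).toLinearMap ∘ₗ
        TensorProduct.map (v.coaction φ) (v.coaction φ) := by
  have h' := h.r
  unfold Line.Prod ProdAlong at h'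
  ext x y
  have h1 := LinearMap.congr_fun h' (x ⊗ₜ y)
  simp only [comp_apply, joint, Site.liftL, Site.liftR, Line.liftL, Line.liftR,
    liftR_tmul, coe_coe] at h1
  simp only [TensorProduct.AlgebraTensorModule.curry_apply, restrictScalars_self,
    curry_apply, comp_apply, map_tmul, Site.coaction, h1,
    coe_coe]
  generalize v.r.δ y = t
  induction t with
  | zero => simp
  | add x y hx hy => simp only [map_add, tmul_add, hx, hy]
  | tmul w m =>
    simp only [assoc_symm_tmul, rTensor_tmul, liftL_tmul]
    generalize v.r.δ x = t
    induction t with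
    | zero => simp
    | add x y hx hy => simp only [map_add, add_tmul, hx, hy]
    | tmul w m => simp [pullMul]

namespace DualQuasitriangular.SecondInverse

variable {Q : DualQuasitriangular K M} (S : Q.SecondInverse)

/-- The transmutation, transported to `U`. -/
noncomputable def pulled (φ : U ≃ₗ[K] M) : BraidedBialgebraData K U where
  mul := S.twistMul (pullMul φ) (Site.pull φ) (Site.pull φ)
  one := φ.symm 1
  comul := (Site.pull φ).coaction φ
  counit := ε ∘ₗ φ.toLinearMap
  braiding := S.braid (Site.pull φ) (Site.pull φ)

theorem twist_regular : S.twist ((Site.regular K M).liftL M) ((Site.regular K M).liftR M) =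
    actWith Q.form Coalgebra.comul Coalgebra.comul ∘ₗ
      actWith S.til (comulOp K M) Coalgebra.comul := by
  simp only [actWith_eq_pairOp, comm_comp_comulOp, comm_comp_comul]
  rfl

theorem crossing_regular : S.crossing ((Site.regular K M).liftL M) ((Site.regular K M).liftR M) =
    actWith Q.inv Coalgebra.comul (comulOp K M) ∘ₗ
    actWith Q.form Coalgebra.comul Coalgebra.comul ∘ₗ
    actWith Q.form (comulOp K M) (comulOp K M) ∘ₗ
    actWith S.til (comulOp K M) Coalgebra.comul := by
  have i := Site.indep_liftL_liftR (Site.regular K M) (Site.regular K M)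
  have c : Commute (S.cross ((Site.regular K M).liftL M).r ((Site.regular K M).liftR M).r)
      (S.cross ((Site.regular K M).liftL M).l ((Site.regular K M).liftR M).l) :=
    cross_commute S (Site.regular K M).indep.symm.liftL i.l.r i.r.l.symm
      (Site.regular K M).indep.symm.liftR
  have e : S.crossing ((Site.regular K M).liftL M) ((Site.regular K M).liftR M) =
      S.cross ((Site.regular K M).liftL M).l ((Site.regular K M).liftR M).r *
      (S.cross ((Site.regular K M).liftL M).l ((Site.regular K M).liftR M).l *
      (S.cross ((Site.regular K M).liftL M).r ((Site.regular K M).liftR M).r *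
      S.cross ((Site.regular K M).liftL M).r ((Site.regular K M).liftR M).l)) := by
    simp only [crossing, crossL, mul_assoc]
    rw [← mul_assoc (S.cross ((Site.regular K M).liftL M).r ((Site.regular K M).liftR M).r),
      c.eq, mul_assoc]
  rw [e]
  simp only [actWith_eq_pairOp, comm_comp_comulOp, comm_comp_comul]
  rfl

theorem pulled_isIso (φ : U ≃ₗ[K] M) : (S.pulled φ).IsIso (transmutation Q S) φ where
  map_mul x y := by
    have h := LinearMap.congr_fun
      (crossL_comp (S := S) (Site.along_map₁ φ) (Site.along_map₂ φ).l) (x ⊗ₜ y)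
    change S.twist ((Site.regular K M).liftL M) ((Site.regular K M).liftR M) (φ x ⊗ₜ φ y) = _ at h
    rw [twist_regular] at h
    change φ (φ.symm _) = _
    rw [LinearEquiv.apply_symm_apply]
    exact congrArg (mul' K M) h.symm
  map_one := by simp [pulled, transmutation]
  map_comul x := by
    simp only [pulled, transmutation, Site.coaction, Site.pull, Site.map, Line.map,
      Site.regular, comp_apply, coe_coe, LinearEquiv.symm_symm]
    generalize Δ (φ x) = t
    induction t with
    | zero => simp
    | add x y hx hy => simp only [map_add, hx, hy]
    | tmul w m => simp
  map_counit x := rfl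
  map_braiding x y := by
    have h := LinearMap.congr_fun
      (crossing_comp (S := S) (Site.along_map₁ φ) (Site.along_map₂ φ)) (x ⊗ₜ y)
    rw [crossing_regular] at h
    have h2 (t : U ⊗[K] U) : TensorProduct.map φ.toLinearMap φ.toLinearMap
        (TensorProduct.comm K U U t) =
        TensorProduct.comm K M M (TensorProduct.map φ.toLinearMap φ.toLinearMap t) := by
      induction t with
      | zero => simp
      | add x y hx hy => simp only [map_add, hx, hy]
      | tmul w m => simp
    exact (h2 _).trans (congrArg (TensorProduct.comm K M M) h.symm)

variable {S}

theorem coaction_coassoc (φ : U ≃ₗ[K] M) (v : Site K M V) :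
    (TensorProduct.assoc K V U U).toLinearMap ∘ₗ
      TensorProduct.map (v.coaction φ) (LinearMap.id : U →ₗ[K] U) ∘ₗ v.coaction φ =
    TensorProduct.map (LinearMap.id : V →ₗ[K] V) (S.pulled φ).comul ∘ₗ v.coaction φ := by
  have h := v.r.isSlot.coassoc
  change _ = (Δ).lTensor V ∘ₗ v.r.δ at h
  ext w
  have h' := LinearMap.congr_fun h w
  simp only [comp_apply, joint, coe_coe] at h'
  have e1 (t : V ⊗[K] M) : TensorProduct.assoc K V U U
      (TensorProduct.map (v.coaction φ) LinearMap.id (φ.symm.toLinearMap.lTensor V t)) =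
      (TensorProduct.map φ.symm.toLinearMap φ.symm.toLinearMap).lTensor V
        (TensorProduct.assoc K V M M (v.r.δ.rTensor M t)) := by
    induction t with
    | zero => simp
    | add x y hx hy => simp only [map_add, hx, hy]
    | tmul x m =>
      simp only [lTensor_tmul, rTensor_tmul, map_tmul,
        Site.coaction, comp_apply]
      generalize v.r.δ x = t
      induction t with
      | zero => simp
      | add x y hx hy => simp only [map_add, add_tmul, hx, hy]
      | tmul w m => simp
  have e2 (t : V ⊗[K] M) : TensorProduct.map LinearMap.id (S.pulled φ).comul
      (φ.symm.toLinearMap.lTensor V t) =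
      (TensorProduct.map φ.symm.toLinearMap φ.symm.toLinearMap).lTensor V ((Δ).lTensor V t) := by
    induction t with
    | zero => simp
    | add x y hx hy => simp only [map_add, hx, hy]
    | tmul x m =>
      simp only [lTensor_tmul, map_tmul, pulled, Site.coaction, Site.pull,
        Site.map, Line.map, Site.regular, comp_apply, coe_coe,
        LinearEquiv.symm_symm, LinearEquiv.apply_symm_apply]
      generalize Δ m = t
      induction t with
      | zero => simp
      | add x y hx hy => simp only [map_add, tmul_add, hx, hy]
      | tmul w m => simp
  change TensorProduct.assoc K V U U (TensorProduct.map (v.coaction φ) LinearMap.id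
    (φ.symm.toLinearMap.lTensor V (v.r.δ w))) = TensorProduct.map LinearMap.id (S.pulled φ).comul
      (φ.symm.toLinearMap.lTensor V (v.r.δ w))
  rw [e1, e2, h']

theorem coaction_counit (φ : U ≃ₗ[K] M) (v : Site K M V) (x : V) :
    TensorProduct.map (LinearMap.id : V →ₗ[K] V) (S.pulled φ).counit (v.coaction φ x) =
      x ⊗ₜ (1 : K) := by
  have h := LinearMap.congr_fun v.r.isSlot.counit x
  simp only [evalFun_apply, Module.End.one_apply] at h
  conv_rhs => rw [← h]
  simp only [Site.coaction, pulled, comp_apply]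
  generalize v.r.δ x = t
  induction t with
  | zero => simp
  | add x y hx hy => simp only [map_add, add_tmul, hx, hy]
  | tmul w m => simp [TensorProduct.smul_tmul]

theorem pulled_counit_comul (φ : U ≃ₗ[K] M) (x : U) :
    TensorProduct.map (S.pulled φ).counit (LinearMap.id : U →ₗ[K] U) ((S.pulled φ).comul x) =
      (1 : K) ⊗ₜ x := by
  have e (t : M ⊗[K] M) : TensorProduct.map (ε ∘ₗ φ.toLinearMap) (LinearMap.id : U →ₗ[K] U)
      (φ.symm.toLinearMap.lTensor U (φ.symm.toLinearMap.rTensor M t)) =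
      (1 : K) ⊗ₜ φ.symm (TensorProduct.lid K M ((ε).rTensor M t)) := by
    induction t with
    | zero => simp
    | add x y hx hy => simp only [map_add, tmul_add, hx, hy]
    | tmul w m =>
      have : ((ε) w : K) ⊗ₜ[K] φ.symm m = (1 : K) ⊗ₜ[K] ((ε) w • φ.symm m) := by
        rw [tmul_smul, smul_tmul', smul_eq_mul, mul_one]
      simpa using this
  refine (e _).trans ?_
  change _ ⊗ₜ φ.symm (TensorProduct.lid K M ((ε).rTensor M (Δ (φ x)))) = _
  rw [lid_counit_comul, LinearEquiv.symm_apply_apply]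

theorem map_mul_of_rTensor_comp {p : U →ₗ[K] K} {m : U ⊗[K] U →ₗ[K] U}
    {T : Module.End K (U ⊗[K] U)} (hm : ∀ x y, p (m (x ⊗ₜ y)) = p x * p y)
    (hT : p.rTensor U ∘ₗ T = p.rTensor U) (x y : U) : p ((m ∘ₗ T) (x ⊗ₜ y)) = p x * p y := by
  have e (t : U ⊗[K] U) : p (m t) = mul' K K (p.lTensor K (p.rTensor U t)) := by
    induction t with
    | zero => simp
    | add x y hx hy => simp only [map_add, hx, hy]
    | tmul w m => simp [hm]
  have h' := LinearMap.congr_fun hT (x ⊗ₜ y)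
  rw [comp_apply] at h'
  rw [comp_apply, e, h']
  simp

theorem pulled_functorialLeft {Z : Type*} [AddCommMonoid Z] [Module K Z] (φ : U ≃ₗ[K] M)
    (z : Site K M Z) : (S.pulled φ).FunctorialLeft (S.braid (Site.pull φ) z) where
  mul := naturalLeft_twistMul (Site.prod_pull φ) z
  one := braid_triv (Site.trivAt_pull φ) z
  comul := naturalLeft_coact (Site.coact_pull φ _) z
  counit := naturalLeft_counit (Site.merges_pull φ) z

theorem pulled_functorialRight {Z : Type*} [AddCommMonoid Z] [Module K Z] (φ : U ≃ₗ[K] M)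
    (z : Site K M Z) : (S.pulled φ).FunctorialRight (S.braid z (Site.pull φ)) where
  mul := naturalRight_twistMul (Site.prod_pull φ) z
  one := triv_braid (Site.trivAt_pull φ) z
  comul := naturalRight_coact (Site.coact_pull φ _) z
  counit := naturalRight_counit (Site.merges_pull φ) z

theorem pulled_isBraidedBialgebra (φ : U ≃ₗ[K] M) {sil : M ⊗[K] M →ₗ[K] K}
    (h1 : convWith Q.inv sil (comulOp K M) Coalgebra.comul = counitPair K M)
    (h2 : convWith sil Q.inv (comulOp K M) Coalgebra.comul = counitPair K M) :
    (S.pulled φ).IsBraidedBialgebra where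
  mul_assoc x y z :=
    LinearMap.congr_fun (twistMul_assoc (S := S) (Site.prod_pull φ) (pullMul_assoc φ)) ((x ⊗ₜ y) ⊗ₜ z)
  one_mul x := (twistMul_triv (Site.trivAt_pull φ) _ _ _).trans (by simp [pullMul])
  mul_one x := (triv_twistMul (Site.trivAt_pull φ).l _ _ _).trans (by simp [pullMul])
  coassoc := coaction_coassoc φ _
  counit_comul := pulled_counit_comul φ
  comul_counit x := coaction_counit φ _ x
  comul_mul := coact_twistMul (Site.coact_pull φ _) (Site.coaction_mul φ (Site.prod_pull φ))
  comul_one := by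
    simp [pulled, Site.coaction, (Site.trivAt_pull φ).r]
  counit_mul := map_mul_of_rTensor_comp (fun x y => by simp [pulled, pullMul])
    (comp_twist_merges (S := S) (Site.merges_pull φ).rTensor
      (Site.indep_liftL_liftR (Site.pull φ) (Site.pull φ)).l)
  counit_one := by simp [pulled]
  braiding_bijective := bijective_braid h1 h2 _ _
  braid := S.braidRelation _ _ _
  functorial_left := pulled_functorialLeft φ _
  functorial_right := pulled_functorialRight φ _

theorem pulled_isBraidedComeasuring {A : Type*} [NonUnitalRing A] [Module K A]
    [SMulCommClass K A A] [IsScalarTower K A A] (φ : U ≃ₗ[K] M) {sil : M ⊗[K] M →ₗ[K] K}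
    (h1 : convWith Q.inv sil (comulOp K M) Coalgebra.comul = counitPair K M)
    (h2 : convWith sil Q.inv (comulOp K M) Coalgebra.comul = counitPair K M) (a : Site K M A)
    (hl : ∀ x, a.l.δ x = x ⊗ₜ 1)
    (ha : Site.Prod (mul' K A) (a.liftL A) (a.liftR A) a) :
    IsBraidedComeasuring (S.braid a a) (S.pulled φ) (S.braid (Site.pull φ) a)
      (S.braid a (Site.pull φ)) (a.coaction φ) := by
  have ht : S.twistMul (mul' K A) a a = mul' K A := by
    refine TensorProduct.ext' fun x y => ?_
    exact triv_twistMul (S := S) (v := a) (hl y) a _ x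
  have hp := naturalLeft_twistMul (S := S) ha (Site.pull φ)
  have hp' := naturalRight_twistMul (S := S) ha (Site.pull φ)
  have hm := coact_twistMul (S := S) (Site.coact_pull φ a) (Site.coaction_mul φ ha)
  rw [ht] at hp hp' hm
  exact {
    bijective_BA := bijective_braid h1 h2 _ _
    bijective_AB := bijective_braid h1 h2 _ _
    braid_AAB := S.braidRelation _ _ _
    braid_ABA := S.braidRelation _ _ _
    braid_BAA := S.braidRelation _ _ _
    braid_ABB := S.braidRelation _ _ _
    braid_BAB := S.braidRelation _ _ _
    braid_BBA := S.braidRelation _ _ _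
    functorial_left := pulled_functorialLeft φ _
    functorial_right := pulled_functorialRight φ _
    mul_left := hp
    mul_right := hp'
    coact_left_A := naturalLeft_coact (Site.coact_pull φ _) a
    coact_left_B := naturalLeft_coact (Site.coact_pull φ _) _
    coact_right_A := naturalRight_coact (Site.coact_pull φ _) a
    coact_right_B := naturalRight_coact (Site.coact_pull φ _) _
    coact_mul := hm
    coact_comul := coaction_coassoc φ _
    coact_counit := coaction_counit φ _ }

end DualQuasitriangular.SecondInverse

end Transported

section Coordinates

/-- The Yang–Baxter equation `R₁₂ R₁₃ R₂₃ = R₂₃ R₁₃ R₁₂`. -/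
def YangBaxterMatrix {K ι : Type*} [Field K] [Fintype ι] (R : Matrix (ι × ι) (ι × ι) K) : Prop :=
  ∀ i j k m n q,
  ∑ a, ∑ b, ∑ p, R (a, b) (j, k) * R (p, q) (i, b) * R (m, n) (p, a) =
    ∑ a, ∑ b, ∑ r, R (a, b) (i, j) * R (m, r) (a, k) * R (n, q) (b, r)

/-- Compatibility of `R` with structure constants in the first tensor factor. -/
def MulLeftMatrix {K ι : Type*} [Field K] [Fintype ι] (R : Matrix (ι × ι) (ι × ι) K)
    (c : Matrix ι (ι × ι) K) : Prop :=
  ∀ i j k m q, ∑ l, c l (i, j) * R (m, q) (l, k) =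
    ∑ a, ∑ b, ∑ p, R (a, b) (j, k) * R (p, q) (i, b) * c m (p, a)

/-- Compatibility of `R` with structure constants in the second tensor factor. -/
def MulRightMatrix {K ι : Type*} [Field K] [Fintype ι] (R : Matrix (ι × ι) (ι × ι) K)
    (c : Matrix ι (ι × ι) K) : Prop :=
  ∀ i j k m q, ∑ l, c l (j, k) * R (m, q) (i, l) =
    ∑ a, ∑ b, ∑ r, R (a, b) (i, j) * R (m, r) (a, k) * c q (b, r)

theorem basis_mul_basis {K ι A : Type*} [Field K] [Fintype ι] [NonUnitalRing A] [Module K A]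
    (e : Module.Basis ι K A) (i j : ι) : e i * e j = ∑ l, structureMatrix e l (i, j) • e l :=
  (e.sum_repr _).symm

variable {K ι A : Type*} [Field K] [Fintype ι] [DecidableEq ι]
  [NonUnitalRing A] [Module K A] [SMulCommClass K A A] [IsScalarTower K A A]
  (e : Module.Basis ι K A) {Ψ : A ⊗[K] A →ₗ[K] A ⊗[K] A} {R : Matrix (ι × ι) (ι × ι) K}

theorem yangBaxterMatrix (hΨ : IsBraidedAlgebra Ψ)
    (hRΨ : ∀ i j, Ψ (e i ⊗ₜ e j) = ∑ a, ∑ b, R (a, b) (i, j) • (e b ⊗ₜ[K] e a)) :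
    YangBaxterMatrix R := by
  intro i j k m n q
  have h := LinearMap.congr_fun hΨ.braid ((e i ⊗ₜ e j) ⊗ₜ e k)
  have h' := congrArg (fun t => (e.tensorProduct (e.tensorProduct e)).repr t (q, (n, m))) h
  simp only [braidTensorLeft, comp_apply, coe_coe, assoc_tmul,
    map_tmul, LinearMap.id_apply, hRΨ, tmul_sum, sum_tmul,
    map_sum, map_smul, tmul_smul, assoc_symm_tmul,
    ← smul_tmul', Finset.smul_sum, Finsupp.coe_finsetSum, Finset.sum_apply,
    Finsupp.coe_smul, Pi.smul_apply, Module.Basis.tensorProduct_repr_tmul_apply,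
    Module.Basis.repr_self, Finsupp.single_apply, smul_eq_mul, mul_ite, mul_one, mul_zero,
    Finset.sum_ite_eq', Finset.mem_univ,
    if_true, Finset.sum_ite_irrel, Finset.sum_const_zero] at h'
  simpa only [mul_assoc] using h'

theorem mulLeftMatrix (hΨ : IsBraidedAlgebra Ψ)
    (hRΨ : ∀ i j, Ψ (e i ⊗ₜ e j) = ∑ a, ∑ b, R (a, b) (i, j) • (e b ⊗ₜ[K] e a)) :
    MulLeftMatrix R (structureMatrix e) := by
  intro i j k m q
  have h := LinearMap.congr_fun hΨ.mul_left ((e i ⊗ₜ e j) ⊗ₜ e k)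
  have h' := congrArg (fun t => (e.tensorProduct e).repr t (q, m)) h
  simp only [braidTensorLeft, comp_apply, coe_coe, assoc_tmul,
    map_tmul, LinearMap.id_apply, hRΨ, tmul_sum, sum_tmul,
    map_sum, map_smul, tmul_smul, assoc_symm_tmul,
    mul'_apply, basis_mul_basis,
    ← smul_tmul', Finset.smul_sum, Finsupp.coe_finsetSum, Finset.sum_apply,
    Finsupp.coe_smul, Pi.smul_apply, Module.Basis.tensorProduct_repr_tmul_apply,
    Module.Basis.repr_self, Finsupp.single_apply, smul_eq_mul, mul_ite, mul_one, mul_zero,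
    Finset.sum_ite_eq', Finset.mem_univ,
    if_true, Finset.sum_ite_irrel, Finset.sum_const_zero] at h'
  simpa only [mul_assoc] using h'

theorem mulRightMatrix (hΨ : IsBraidedAlgebra Ψ)
    (hRΨ : ∀ i j, Ψ (e i ⊗ₜ e j) = ∑ a, ∑ b, R (a, b) (i, j) • (e b ⊗ₜ[K] e a)) :
    MulRightMatrix R (structureMatrix e) := by
  intro i j k m q
  have h := LinearMap.congr_fun hΨ.mul_right (e i ⊗ₜ (e j ⊗ₜ e k))
  have h' := congrArg (fun t => (e.tensorProduct e).repr t (q, m)) h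
  simp only [braidTensorRight, comp_apply, coe_coe, assoc_tmul,
    map_tmul, LinearMap.id_apply, hRΨ, tmul_sum, sum_tmul,
    map_sum, map_smul, tmul_smul, assoc_symm_tmul,
    mul'_apply, basis_mul_basis,
    ← smul_tmul', Finset.smul_sum, Finsupp.coe_finsetSum, Finset.sum_apply,
    Finsupp.coe_smul, Pi.smul_apply, Module.Basis.tensorProduct_repr_tmul_apply,
    Module.Basis.repr_self, Finsupp.single_apply, smul_eq_mul, mul_ite, mul_one, mul_zero,
    Finset.sum_ite_eq', Finset.mem_univ,
    if_true, Finset.sum_ite_irrel, Finset.sum_const_zero] at h'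
  simpa only [mul_assoc] using h'

end Coordinates

section Tilde

variable {K ι : Type*} [Field K] [Fintype ι] [DecidableEq ι] {R : Matrix (ι × ι) (ι × ι) K}

theorem sum_mul_tilde (h : IsUnit (transpose₂ R)) (i j k l : ι) :
    ∑ a, ∑ b, R (i, b) (a, k) * tildeMatrix R (a, l) (j, b) =
      if i = j ∧ k = l then 1 else 0 := by
  have h1 := Matrix.mul_nonsing_inv _ ((Matrix.isUnit_iff_isUnit_det _).mp h)
  have := congrFun (congrFun h1 (i, k)) (j, l)
  simpa [Matrix.mul_apply, Fintype.sum_prod_type, transpose₂, tildeMatrix, Matrix.one_apply]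
    using this

theorem sum_tilde_mul (h : IsUnit (transpose₂ R)) (i j k l : ι) :
    ∑ a, ∑ b, tildeMatrix R (i, b) (a, k) * R (a, l) (j, b) =
      if i = j ∧ k = l then 1 else 0 := by
  have h1 := Matrix.nonsing_inv_mul _ ((Matrix.isUnit_iff_isUnit_det _).mp h)
  have := congrFun (congrFun h1 (i, k)) (j, l)
  simpa [Matrix.mul_apply, Fintype.sum_prod_type, transpose₂, tildeMatrix, Matrix.one_apply]
    using this

end Tilde

section Generators

variable {K ι : Type*} [Field K] [Fintype ι] [DecidableEq ι] {R : Matrix (ι × ι) (ι × ι) K}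
  {c : Matrix ι (ι × ι) K}

theorem FreeAlgebra.mkAlgHom_induction {X : Type*} {r : FreeAlgebra K X → FreeAlgebra K X → Prop}
    {p : RingQuot r → Prop}
    (gen : ∀ x, p (RingQuot.mkAlgHom K r (FreeAlgebra.ι K x))) (one : p 1)
    (smul : ∀ (a : K) x, p x → p (a • x)) (add : ∀ x y, p x → p y → p (x + y))
    (mul : ∀ x y, p x → p y → p (x * y)) (x : RingQuot r) : p x := by
  obtain ⟨y, rfl⟩ := RingQuot.mkAlgHom_surjective K r x
  induction y using FreeAlgebra.induction with
  | grade0 a =>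
    have := smul a 1 one
    rwa [← Algebra.algebraMap_eq_smul_one, ← AlgHom.commutes (RingQuot.mkAlgHom K r)] at this
  | grade1 x => exact gen x
  | mul x y hx hy => rw [map_mul]; exact mul _ _ hx hy
  | add x y hx hy => rw [map_add]; exact add _ _ hx hy

theorem Comeasuring.induction {p : Comeasuring R c → Prop} (gen : ∀ i j, p (tGen R c i j))
    (one : p 1) (smul : ∀ (a : K) x, p x → p (a • x)) (add : ∀ x y, p x → p y → p (x + y))
    (mul : ∀ x y, p x → p y → p (x * y)) (x : Comeasuring R c) : p x :=
  FreeAlgebra.mkAlgHom_induction (fun q => gen q.1 q.2) one smul add mul x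

theorem comul_tGen (i j : ι) : Coalgebra.comul (R := K) (tGen R c i j) =
    ∑ a, tGen R c i a ⊗ₜ[K] tGen R c a j :=
  Comeasuring.lift_tGen (tComul R c) (satisfiesComeasuring_tComul R c) i j

theorem counit_tGen (i j : ι) : Coalgebra.counit (R := K) (tGen R c i j) =
    if i = j then 1 else 0 :=
  (Comeasuring.lift_tGen _ (satisfiesComeasuring_one R c) i j).trans (Matrix.one_apply)

end Generators

section InverseMatrix

variable {K ι S : Type*} [Field K] [Fintype ι] [DecidableEq ι] [Semiring S] [Algebra K S]
  {R : Matrix (ι × ι) (ι × ι) K} {c : Matrix ι (ι × ι) K}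

theorem leg₁_one : leg₁ (1 : Matrix ι ι S) = 1 := by
  ext p q
  simp only [leg₁, Matrix.of_apply, Matrix.one_apply, Prod.ext_iff]
  split_ifs <;> simp_all

theorem leg₂_one : leg₂ (1 : Matrix ι ι S) = 1 := by
  ext p q
  simp only [leg₂, Matrix.of_apply, Matrix.one_apply, Prod.ext_iff]
  split_ifs <;> simp_all

/-- The relations satisfied by the inverse of a matrix that satisfies the relations of
`M₁(R, A)`. -/
def SatisfiesOpposite (R : Matrix (ι × ι) (ι × ι) K) (c : Matrix ι (ι × ι) K)
    (x : Matrix ι ι S) : Prop :=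
  scalars S R * leg₂ x * leg₁ x = leg₁ x * leg₂ x * scalars S R ∧
    x * scalars S c = scalars S c * leg₂ x * leg₁ x

variable {x y : Matrix ι ι S}

theorem SatisfiesComeasuring.inverse (h : SatisfiesComeasuring R c x) (hxy : x * y = 1)
    (hyx : y * x = 1) : SatisfiesOpposite R c y := by
  have a1 : leg₁ y * leg₁ x = 1 := by rw [← leg₁_mul, hyx, leg₁_one]
  have a2 : leg₂ y * leg₂ x = 1 := by rw [← leg₂_mul, hyx, leg₂_one]
  have b1 : leg₁ x * leg₁ y = 1 := by rw [← leg₁_mul, hxy, leg₁_one]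
  have b2 : leg₂ x * leg₂ y = 1 := by rw [← leg₂_mul, hxy, leg₂_one]
  constructor
  · calc scalars S R * leg₂ y * leg₁ y
        = leg₁ y * (leg₂ y * leg₂ x) * leg₁ x * scalars S R * leg₂ y * leg₁ y := by
          rw [a2, Matrix.mul_one, a1, Matrix.one_mul]
      _ = leg₁ y * leg₂ y * (leg₂ x * leg₁ x * scalars S R) * leg₂ y * leg₁ y := by
          simp only [Matrix.mul_assoc]
      _ = leg₁ y * leg₂ y * scalars S R * leg₁ x * (leg₂ x * leg₂ y) * leg₁ y := by
          rw [← h.1]; simp only [Matrix.mul_assoc]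
      _ = leg₁ y * leg₂ y * scalars S R := by
          rw [b2, Matrix.mul_one, Matrix.mul_assoc, b1, Matrix.mul_one]
  · calc y * scalars S c = y * scalars S c * (leg₁ x * (leg₂ x * leg₂ y) * leg₁ y) := by
          rw [b2, Matrix.mul_one, b1, Matrix.mul_one]
      _ = y * (scalars S c * leg₁ x * leg₂ x) * leg₂ y * leg₁ y := by
          simp only [Matrix.mul_assoc]
      _ = y * x * scalars S c * leg₂ y * leg₁ y := by
          rw [← h.2]; simp only [Matrix.mul_assoc]
      _ = scalars S c * leg₂ y * leg₁ y := by rw [hyx, Matrix.one_mul]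

theorem SatisfiesOpposite.inverse (h : SatisfiesOpposite R c x) (hxy : x * y = 1)
    (hyx : y * x = 1) : SatisfiesComeasuring R c y := by
  have a1 : leg₁ y * leg₁ x = 1 := by rw [← leg₁_mul, hyx, leg₁_one]
  have a2 : leg₂ y * leg₂ x = 1 := by rw [← leg₂_mul, hyx, leg₂_one]
  have b1 : leg₁ x * leg₁ y = 1 := by rw [← leg₁_mul, hxy, leg₁_one]
  have b2 : leg₂ x * leg₂ y = 1 := by rw [← leg₂_mul, hxy, leg₂_one]
  constructor
  · calc scalars S R * leg₁ y * leg₂ y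
        = leg₂ y * (leg₁ y * leg₁ x) * leg₂ x * scalars S R * leg₁ y * leg₂ y := by
          rw [a1, Matrix.mul_one, a2, Matrix.one_mul]
      _ = leg₂ y * leg₁ y * (leg₁ x * leg₂ x * scalars S R) * leg₁ y * leg₂ y := by
          simp only [Matrix.mul_assoc]
      _ = leg₂ y * leg₁ y * scalars S R * leg₂ x * (leg₁ x * leg₁ y) * leg₂ y := by
          rw [← h.1]; simp only [Matrix.mul_assoc]
      _ = leg₂ y * leg₁ y * scalars S R := by
          rw [b1, Matrix.mul_one, Matrix.mul_assoc, b2, Matrix.mul_one]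
  · calc y * scalars S c = y * scalars S c * (leg₂ x * (leg₁ x * leg₁ y) * leg₂ y) := by
          rw [b1, Matrix.mul_one, b2, Matrix.mul_one]
      _ = y * (scalars S c * leg₂ x * leg₁ x) * leg₁ y * leg₂ y := by
          simp only [Matrix.mul_assoc]
      _ = y * x * scalars S c * leg₁ y * leg₂ y := by
          rw [← h.2]; simp only [Matrix.mul_assoc]
      _ = scalars S c * leg₁ y * leg₂ y := by rw [hyx, Matrix.one_mul]

theorem satisfiesComeasuring_iff : SatisfiesComeasuring R c x ↔
    (∀ i k j l, ∑ a, ∑ b, R (i, k) (a, b) • (x a j * x b l) =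
      ∑ a, ∑ b, R (a, b) (j, l) • (x k b * x i a)) ∧
    ∀ l i j, ∑ a, c a (i, j) • x l a = ∑ a, ∑ b, c l (a, b) • (x a i * x b j) := by
  have e1 (i k j l : ι) : (scalars S R * leg₁ x * leg₂ x) (i, k) (j, l) =
      ∑ a, ∑ b, R (i, k) (a, b) • (x a j * x b l) := by
    rw [Matrix.mul_assoc, Matrix.mul_apply, Fintype.sum_prod_type]
    simp [leg₁_mul_leg₂, scalars, Algebra.smul_def]
  have e2 (i k j l : ι) : (leg₂ x * leg₁ x * scalars S R) (i, k) (j, l) =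
      ∑ a, ∑ b, R (a, b) (j, l) • (x k b * x i a) := by
    rw [Matrix.mul_apply, Fintype.sum_prod_type]
    simp [leg₂_mul_leg₁, scalars, Algebra.smul_def, Algebra.commutes]
  have e3 (l i j : ι) : (x * scalars S c) l (i, j) = ∑ a, c a (i, j) • x l a := by
    simp [Matrix.mul_apply, scalars, Algebra.smul_def, Algebra.commutes]
  have e4 (l i j : ι) : (scalars S c * leg₁ x * leg₂ x) l (i, j) =
      ∑ a, ∑ b, c l (a, b) • (x a i * x b j) := by
    rw [Matrix.mul_assoc, Matrix.mul_apply, Fintype.sum_prod_type]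
    simp [leg₁_mul_leg₂, scalars, Algebra.smul_def]
  constructor
  · intro h
    refine ⟨fun i k j l => ?_, fun l i j => ?_⟩
    · rw [← e1, ← e2, h.1]
    · rw [← e3, ← e4, h.2]
  · rintro ⟨h1, h2⟩
    constructor
    · ext ⟨i, k⟩ ⟨j, l⟩
      rw [e1, e2, h1]
    · ext l ⟨i, j⟩
      rw [e3, e4, h2]

theorem satisfiesOpposite_iff : SatisfiesOpposite R c x ↔
    (∀ i k j l, ∑ a, ∑ b, R (i, k) (a, b) • (x b l * x a j) =
      ∑ a, ∑ b, R (a, b) (j, l) • (x i a * x k b)) ∧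
    ∀ l i j, ∑ a, c a (i, j) • x l a = ∑ a, ∑ b, c l (a, b) • (x b j * x a i) := by
  have e1 (i k j l : ι) : (scalars S R * leg₂ x * leg₁ x) (i, k) (j, l) =
      ∑ a, ∑ b, R (i, k) (a, b) • (x b l * x a j) := by
    rw [Matrix.mul_assoc, Matrix.mul_apply, Fintype.sum_prod_type]
    simp [leg₂_mul_leg₁, scalars, Algebra.smul_def]
  have e2 (i k j l : ι) : (leg₁ x * leg₂ x * scalars S R) (i, k) (j, l) =
      ∑ a, ∑ b, R (a, b) (j, l) • (x i a * x k b) := by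
    rw [Matrix.mul_apply, Fintype.sum_prod_type]
    simp [leg₁_mul_leg₂, scalars, Algebra.smul_def, Algebra.commutes]
  have e3 (l i j : ι) : (x * scalars S c) l (i, j) = ∑ a, c a (i, j) • x l a := by
    simp [Matrix.mul_apply, scalars, Algebra.smul_def, Algebra.commutes]
  have e4 (l i j : ι) : (scalars S c * leg₂ x * leg₁ x) l (i, j) =
      ∑ a, ∑ b, c l (a, b) • (x b j * x a i) := by
    rw [Matrix.mul_assoc, Matrix.mul_apply, Fintype.sum_prod_type]
    simp [leg₂_mul_leg₁, scalars, Algebra.smul_def]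
  constructor
  · intro h
    refine ⟨fun i k j l => ?_, fun l i j => ?_⟩
    · rw [← e1, ← e2, h.1]
    · rw [← e3, ← e4, h.2]
  · rintro ⟨h1, h2⟩
    constructor
    · ext ⟨i, k⟩ ⟨j, l⟩
      rw [e1, e2, h1]
    · ext l ⟨i, j⟩
      rw [e3, e4, h2]

theorem SatisfiesOpposite.op (h : SatisfiesOpposite R c x) :
    SatisfiesComeasuring R c (x.map MulOpposite.op) := by
  rw [satisfiesOpposite_iff] at h
  rw [satisfiesComeasuring_iff]
  refine ⟨fun i k j l => MulOpposite.unop_injective ?_,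
    fun l i j => MulOpposite.unop_injective ?_⟩
  · simpa using h.1 i k j l
  · simpa using h.2 l i j

theorem SatisfiesComeasuring.unop {x : Matrix ι ι Sᵐᵒᵖ} (h : SatisfiesComeasuring R c x) :
    SatisfiesOpposite R c (x.map MulOpposite.unop) := by
  rw [satisfiesComeasuring_iff] at h
  rw [satisfiesOpposite_iff]
  refine ⟨fun i k j l => ?_, fun l i j => ?_⟩
  · simpa using congrArg MulOpposite.unop (h.1 i k j l)
  · simpa using congrArg MulOpposite.unop (h.2 l i j)

end InverseMatrix

section ConvolutionInverse

variable {K ι B : Type*} [Field K] [Fintype ι] [DecidableEq ι] [Semiring B] [Algebra K B]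
  {R : Matrix (ι × ι) (ι × ι) K} {c : Matrix ι (ι × ι) K}

local notation "M" => Comeasuring R c

/-- The convolution product of two maps is the unit. -/
def ConvInverse (f g : Comeasuring R c →ₗ[K] B) : Prop :=
  ∀ b, mul' K B (TensorProduct.map f g (Coalgebra.comul b)) =
    algebraMap K B (Coalgebra.counit b)

theorem convInverse_of_gen {f g : M →ₗ[K] B} (f1 : f 1 = 1) (g1 : g 1 = 1)
    (hgen : ∀ i j, ∑ a, f (tGen R c i a) * g (tGen R c a j) = if i = j then 1 else 0)
    (hmul : ∀ a b, mul' K B (TensorProduct.map f g (Coalgebra.comul a)) =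
      algebraMap K B (Coalgebra.counit a) →
      mul' K B (TensorProduct.map f g (Coalgebra.comul b)) =
      algebraMap K B (Coalgebra.counit b) →
      mul' K B (TensorProduct.map f g (Coalgebra.comul (a * b))) =
      algebraMap K B (Coalgebra.counit (a * b))) : ConvInverse f g := by
  intro b
  induction b using Comeasuring.induction with
  | gen i j =>
    rw [comul_tGen, counit_tGen]
    simp only [map_sum, map_tmul, mul'_apply, hgen]
    split_ifs <;> simp
  | one => simp [Algebra.TensorProduct.one_def, f1, g1]
  | smul a x hx =>
    rw [map_smul, map_smul, map_smul, hx, map_smul, smul_eq_mul, map_mul, Algebra.smul_def]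
  | add x y hx hy => simp [hx, hy]
  | mul x y hx hy => exact hmul x y hx hy

theorem convInverse_of_hom_anti {f g : M →ₗ[K] B} (f1 : f 1 = 1) (g1 : g 1 = 1)
    (hf : ∀ a b, f (a * b) = f a * f b) (hg : ∀ a b, g (a * b) = g b * g a)
    (hgen : ∀ i j, ∑ a, f (tGen R c i a) * g (tGen R c a j) = if i = j then 1 else 0) :
    ConvInverse f g := by
  refine convInverse_of_gen f1 g1 hgen fun a b ha hb => ?_
  have key (u : M ⊗[K] M) : mul' K B (TensorProduct.map f g (u * Coalgebra.comul b)) =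
      Coalgebra.counit (R := K) b • mul' K B (TensorProduct.map f g u) := by
    induction u with
    | zero => simp
    | add x y hx hy => simp only [map_add, add_mul, smul_add, hx, hy]
    | tmul x y =>
      have (v : M ⊗[K] M) : mul' K B (TensorProduct.map f g ((x ⊗ₜ y) * v)) =
          f x * mul' K B (TensorProduct.map f g v) * g y := by
        induction v with
        | zero => simp
        | add x y hx hy => simp only [map_add, mul_add, add_mul, hx, hy]
        | tmul z w => simp [hf, hg, mul_assoc]
      rw [this, hb, map_tmul, mul'_apply, ← Algebra.commutes, mul_assoc,
        Algebra.smul_def]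
  rw [Bialgebra.comul_mul, key, ha, Bialgebra.counit_mul, map_mul, Algebra.smul_def,
    Algebra.commutes]

theorem convInverse_of_anti_hom {f g : M →ₗ[K] B} (f1 : f 1 = 1) (g1 : g 1 = 1)
    (hf : ∀ a b, f (a * b) = f b * f a) (hg : ∀ a b, g (a * b) = g a * g b)
    (hgen : ∀ i j, ∑ a, f (tGen R c i a) * g (tGen R c a j) = if i = j then 1 else 0) :
    ConvInverse f g := by
  refine convInverse_of_gen f1 g1 hgen fun a b ha hb => ?_
  have key (u : M ⊗[K] M) : mul' K B (TensorProduct.map f g (Coalgebra.comul a * u)) =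
      Coalgebra.counit (R := K) a • mul' K B (TensorProduct.map f g u) := by
    induction u with
    | zero => simp
    | add x y hx hy => simp only [map_add, mul_add, smul_add, hx, hy]
    | tmul x y =>
      have (v : M ⊗[K] M) : mul' K B (TensorProduct.map f g (v * (x ⊗ₜ y))) =
          f x * mul' K B (TensorProduct.map f g v) * g y := by
        induction v with
        | zero => simp
        | add x y hx hy => simp only [map_add, mul_add, add_mul, hx, hy]
        | tmul z w => simp [hf, hg, mul_assoc]
      rw [this, ha, map_tmul, mul'_apply, ← Algebra.commutes, mul_assoc,
        Algebra.smul_def]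
  rw [Bialgebra.comul_mul, key, hb, Bialgebra.counit_mul, map_mul, Algebra.smul_def]

theorem sum_mul_of_mul_eq_one {x y : Matrix ι ι B} (h : x * y = 1) (i j : ι) :
    ∑ a, x i a * y a j = if i = j then 1 else 0 := by
  rw [← Matrix.mul_apply, h, Matrix.one_apply]

/-- A map whose matrix of values on the generators is invertible has a convolution inverse. -/
theorem exists_convInverse_of_hom (α : M →ₐ[K] B) {y : Matrix ι ι B}
    (hxy : (tGen R c).map α * y = 1) (hyx : y * (tGen R c).map α = 1) :
    ∃ β : M →ₗ[K] B, β 1 = 1 ∧ (∀ a b, β (a * b) = β b * β a) ∧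
      (∀ i j, β (tGen R c i j) = y i j) ∧ ConvInverse α.toLinearMap β ∧
      ConvInverse β α.toLinearMap := by
  have h := (((satisfiesComeasuring_tGen R c).map α).inverse hxy hyx).op
  let β : M →ₗ[K] B := (MulOpposite.opLinearEquiv K).symm.toLinearMap ∘ₗ
    (Comeasuring.lift _ h).toLinearMap
  have b1 : β 1 = 1 := by simp [β]
  have bm (a b) : β (a * b) = β b * β a := by simp [β]
  have bt (i j) : β (tGen R c i j) = y i j := by
    simp only [β, comp_apply, AlgHom.toLinearMap_apply, Comeasuring.lift_tGen]
    rfl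
  refine ⟨β, b1, bm, bt, ?_, ?_⟩
  · refine convInverse_of_hom_anti (map_one α) b1 (map_mul α) bm fun i j => ?_
    simp only [bt]
    exact sum_mul_of_mul_eq_one hxy i j
  · refine convInverse_of_anti_hom b1 (map_one α) bm (map_mul α) fun i j => ?_
    simp only [bt]
    exact sum_mul_of_mul_eq_one hyx i j

theorem exists_convInverse_of_anti (α : M →ₐ[K] Bᵐᵒᵖ) {y : Matrix ι ι B}
    (hxy : (tGen R c).map (fun t => (α t).unop) * y = 1)
    (hyx : y * (tGen R c).map (fun t => (α t).unop) = 1) :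
    ∃ β : M →ₐ[K] B, (∀ i j, β (tGen R c i j) = y i j) ∧
      ConvInverse ((MulOpposite.opLinearEquiv K).symm.toLinearMap ∘ₗ α.toLinearMap)
        β.toLinearMap ∧
      ConvInverse β.toLinearMap
        ((MulOpposite.opLinearEquiv K).symm.toLinearMap ∘ₗ α.toLinearMap) := by
  have h := ((satisfiesComeasuring_tGen R c).map α).unop.inverse (y := y) hxy hyx
  let β : M →ₐ[K] B := Comeasuring.lift _ h
  let α' : M →ₗ[K] B := (MulOpposite.opLinearEquiv K).symm.toLinearMap ∘ₗ α.toLinearMap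
  have a1 : α' 1 = 1 := by simp [α']
  have am (a b) : α' (a * b) = α' b * α' a := by simp [α']
  have bt (i j) : β (tGen R c i j) = y i j := Comeasuring.lift_tGen _ h i j
  refine ⟨β, bt, ?_, ?_⟩
  · refine convInverse_of_anti_hom a1 (map_one β) am (map_mul β) fun i j => ?_
    simp only [AlgHom.toLinearMap_apply, bt]
    exact sum_mul_of_mul_eq_one hxy i j
  · refine convInverse_of_hom_anti (map_one β) a1 (map_mul β) am fun i j => ?_
    simp only [AlgHom.toLinearMap_apply, bt]
    exact sum_mul_of_mul_eq_one hyx i j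

end ConvolutionInverse

section Sums

variable {ι N : Type*} [Fintype ι] [AddCommMonoid N]

theorem sum₃_rotate (f : ι → ι → ι → N) :
    ∑ a, ∑ b, ∑ c, f a b c = ∑ c, ∑ a, ∑ b, f a b c := by
  rw [Finset.sum_comm' (t' := Finset.univ) (s' := fun _ => Finset.univ) (by simp)]
  simp_rw [sum_comm (f := fun a c => f a _ c)]
  rw [sum_comm]
  refine sum_congr rfl fun c _ => ?_
  rw [sum_comm]

theorem sum₃_swap (f : ι → ι → ι → N) :
    ∑ a, ∑ b, ∑ c, f a b c = ∑ a, ∑ c, ∑ b, f a b c :=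
  sum_congr rfl fun _ _ => sum_comm

end Sums

section Representation

variable {K ι : Type*} [Field K] [Fintype ι] [DecidableEq ι] {R : Matrix (ι × ι) (ι × ι) K}
  {c : Matrix ι (ι × ι) K}

/-- The blocks of `R` with respect to the second tensor factor. -/
def blocks (R : Matrix (ι × ι) (ι × ι) K) : Matrix ι ι (Matrix ι ι K) :=
  Matrix.of fun k l => Matrix.of fun i j => R (i, k) (j, l)

theorem blocks_apply (k l i j : ι) : blocks R k l i j = R (i, k) (j, l) := rfl

theorem satisfiesOpposite_blocks (hY : YangBaxterMatrix R) (hc : MulRightMatrix R c) :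
    SatisfiesOpposite R c (blocks R) := by
  rw [satisfiesOpposite_iff]
  constructor
  · intro i k j l
    ext x y
    simp only [Matrix.sum_apply, Matrix.smul_apply, Matrix.mul_apply, blocks_apply, smul_eq_mul,
      Finset.mul_sum]
    have h := hY y j l x i k
    refine Eq.trans ?_ (h.symm.trans ?_)
    · rw [sum₃_rotate]
      refine sum_congr rfl fun _ _ => sum_congr rfl fun _ _ =>
        sum_congr rfl fun _ _ => ?_
      ring
    · refine sum_congr rfl fun _ _ => sum_congr rfl fun _ _ =>
        sum_congr rfl fun _ _ => ?_
      ring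
  · intro l i j
    ext x y
    simp only [Matrix.sum_apply, Matrix.smul_apply, Matrix.mul_apply, blocks_apply, smul_eq_mul,
      Finset.mul_sum]
    rw [hc y i j x l, sum₃_rotate, sum₃_rotate]
    rw [sum₃_swap, sum₃_rotate, sum₃_swap, sum₃_rotate]
    refine sum_congr rfl fun _ _ => sum_congr rfl fun _ _ =>
      sum_congr rfl fun _ _ => ?_
    ring

/-- The representation of the opposite algebra of `M₁(R, A)` given by the blocks of `R`. -/
noncomputable def blockRep (h : SatisfiesOpposite R c (blocks R)) :
    Comeasuring R c →ₐ[K] (Matrix ι ι K)ᵐᵒᵖ :=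
  Comeasuring.lift _ h.op

end Representation

section ConvolutionAlgebra

open WithConv

variable {K C A : Type*} [Field K] [AddCommMonoid C] [Module K C] [Coalgebra K C]
  [Semiring A] [Algebra K A]

/-- The constant map `b ↦ ε(b) a`. -/
def convConst (C : Type*) [AddCommMonoid C] [Module K C] [Coalgebra K C] (a : A) :
    WithConv (C →ₗ[K] A) :=
  toConv (LinearMap.toSpanSingleton K A a ∘ₗ Coalgebra.counit)

theorem convConst_mul_apply (a : A) (g : WithConv (C →ₗ[K] A)) (b : C) :
    (convConst (K := K) C a * g) b = a * g b := by
  rw [convMul_apply]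
  have : TensorProduct.map (convConst (K := K) C a).ofConv g.ofConv =
      TensorProduct.map (LinearMap.toSpanSingleton K A a) g.ofConv ∘ₗ
        LinearMap.rTensor C Coalgebra.counit := by
    ext; simp [convConst]
  rw [this, comp_apply, Coalgebra.rTensor_counit_comul]
  simp

theorem mul_convConst_apply (a : A) (g : WithConv (C →ₗ[K] A)) (b : C) :
    (g * convConst (K := K) C a) b = g b * a := by
  rw [convMul_apply]
  have : TensorProduct.map g.ofConv (convConst (K := K) C a).ofConv =
      TensorProduct.map g.ofConv (LinearMap.toSpanSingleton K A a) ∘ₗ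
        LinearMap.lTensor C Coalgebra.counit := by
    ext; simp [convConst]
  rw [this, comp_apply, Coalgebra.lTensor_counit_comul]
  simp

theorem convConst_apply (a : A) (b : C) :
    (convConst C a : WithConv (C →ₗ[K] A)) b = Coalgebra.counit (R := K) b • a := rfl

theorem convConst_mul (x y : A) : (convConst C (x * y) : WithConv (C →ₗ[K] A)) =
    convConst C x * convConst C y := by
  ext b
  rw [convConst_mul_apply, convConst_apply, convConst_apply, mul_smul_comm]

/-- Constant maps form a subalgebra of the convolution algebra. -/
noncomputable def convConstHom (K C A : Type*) [Field K] [AddCommMonoid C] [Module K C]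
    [Coalgebra K C] [Semiring A] [Algebra K A] : A →ₐ[K] WithConv (C →ₗ[K] A) :=
  AlgHom.ofLinearMap
    { toFun := convConst C
      map_add' := fun x y => by ext b; simp [convConst_apply]
      map_smul' := fun r x => by
        ext b
        exact smul_comm _ _ _ }
    (by ext b; exact (Algebra.algebraMap_eq_smul_one _).symm)
    convConst_mul

/-- Scalar valued maps, viewed as `A`-valued maps. -/
noncomputable def convScalarHom (K C A : Type*) [Field K] [AddCommMonoid C] [Module K C]
    [Coalgebra K C] [Semiring A] [Algebra K A] :
    WithConv (C →ₗ[K] K) →ₐ[K] WithConv (C →ₗ[K] A) :=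
  AlgHom.ofLinearMap
    { toFun := fun φ => toConv (Algebra.linearMap K A ∘ₗ φ.ofConv)
      map_add' := fun x y => by ext b; simp
      map_smul' := fun r x => by ext b; simp [Algebra.algebraMap_eq_smul_one, mul_smul] }
    (by ext b; simp)
    (fun x y => WithConv.ext
      (LinearMap.algHom_comp_convMul_distrib (Algebra.ofId K A) x y))

theorem convScalarHom_apply (φ : WithConv (C →ₗ[K] K)) (b : C) :
    (convScalarHom K C A φ) b = algebraMap K A (φ b) := rfl

theorem commute_convConstHom_convScalarHom (a : A) (φ : WithConv (C →ₗ[K] K)) :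
    Commute (convConstHom K C A a) (convScalarHom K C A φ) := by
  ext b
  exact (convConst_mul_apply a _ b).trans
    ((Algebra.commutes _ _).symm.trans
      (mul_convConst_apply a (convScalarHom K C A φ) b).symm)

end ConvolutionAlgebra

section Form

open WithConv

variable {K ι : Type*} [Field K] [Fintype ι] [DecidableEq ι] {R : Matrix (ι × ι) (ι × ι) K}
  {c : Matrix ι (ι × ι) K}

local notation "M" => Comeasuring R c

/-- The matrix of a linear map applied to both factors of a tensor. -/
noncomputable def kroneckerMap₂ (r : M →ₗ[K] Matrix ι ι K) :
    M ⊗[K] M →ₗ[K] Matrix (ι × ι) (ι × ι) K :=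
  TensorProduct.lift ((Matrix.kroneckerBilinear (R := K) (α := K) (l := ι) (m := ι) (n := ι)
    (p := ι)).compl₁₂ r r)

theorem kroneckerMap₂_tmul (r : M →ₗ[K] Matrix ι ι K) (x y : M) (p q : ι × ι) :
    kroneckerMap₂ r (x ⊗ₜ y) p q = r x p.1 q.1 * r y p.2 q.2 := rfl

theorem kroneckerMap₂_apply (r : M →ₗ[K] Matrix ι ι K) (u : M ⊗[K] M) (i j k l : ι) :
    kroneckerMap₂ r u (i, k) (j, l) = mul' K K
      (TensorProduct.map (Matrix.entryLinearMap K K i j ∘ₗ r) (Matrix.entryLinearMap K K k l ∘ₗ r)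
        u) := by
  induction u with
  | zero => simp
  | add x y hx hy => simp only [map_add, Matrix.add_apply, hx, hy]
  | tmul x y => rfl

theorem kroneckerMap₂_mul {r : M →ₗ[K] Matrix ι ι K} (hr : ∀ x y, r (x * y) = r y * r x)
    (u v : M ⊗[K] M) : kroneckerMap₂ r (u * v) = kroneckerMap₂ r v * kroneckerMap₂ r u := by
  induction u with
  | zero => simp
  | add x y hx hy => simp only [map_add, add_mul, mul_add, hx, hy]
  | tmul x y =>
    induction v with
    | zero => simp
    | add x y hx hy => simp only [map_add, add_mul, mul_add, hx, hy]
    | tmul z w =>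
      simp only [Algebra.TensorProduct.tmul_mul_tmul, kroneckerMap₂, TensorProduct.lift.tmul,
        LinearMap.compl₁₂_apply, hr]
      exact Matrix.mul_kronecker_mul _ _ _ _

theorem kroneckerMap₂_one {r : M →ₗ[K] Matrix ι ι K} (hr : r 1 = 1) :
    kroneckerMap₂ r 1 = 1 := by
  simp only [Algebra.TensorProduct.one_def, kroneckerMap₂, TensorProduct.lift.tmul,
    LinearMap.compl₁₂_apply, hr]
  exact Matrix.one_kronecker_one

theorem mul_kroneckerMap₂ {r : M →ₗ[K] Matrix ι ι K}
    (hY : YangBaxterMatrix R) (r1 : r 1 = 1)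
    (hr : ∀ x y, r (x * y) = r y * r x) (rt : ∀ k l, r (tGen R c k l) = blocks R k l) (b : M) :
    R * kroneckerMap₂ r (Coalgebra.comul b) = kroneckerMap₂ r (comulOp K M b) * R := by
  induction b using Comeasuring.induction with
  | gen k l =>
    rw [comulOp_apply, comul_tGen]
    ext ⟨x, y⟩ ⟨j, i⟩
    simp only [map_sum, Matrix.sum_apply, Matrix.mul_apply,
      Fintype.sum_prod_type, kroneckerMap₂_tmul, comm_tmul,
      rt, blocks_apply]
    simp only [Finset.mul_sum, Finset.sum_mul]
    refine Eq.trans (Eq.symm ?_) ((hY j i l x y k).trans ?_)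
    · rw [sum₃_rotate]
      refine sum_congr rfl fun _ _ => sum_congr rfl fun _ _ =>
        sum_congr rfl fun _ _ => ?_
      ring
    · refine sum_congr rfl fun _ _ => sum_congr rfl fun _ _ =>
        sum_congr rfl fun _ _ => ?_
      ring
  | one =>
    rw [comulOp_apply, Bialgebra.comul_one,
      Algebra.TensorProduct.one_def, comm_tmul, ← Algebra.TensorProduct.one_def,
      kroneckerMap₂_one r1, mul_one, one_mul]
  | smul a x hx => simp only [map_smul, Matrix.mul_smul, Matrix.smul_mul, hx]
  | add x y hx hy => simp only [map_add, mul_add, add_mul, hx, hy]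
  | mul x y hx hy =>
    have hop : comulOp K M (x * y) = comulOp K M x * comulOp K M y := by
      simp only [comulOp_apply, Bialgebra.comul_mul]
      exact map_mul (Algebra.TensorProduct.comm K M M) _ _
    rw [hop, Bialgebra.comul_mul, kroneckerMap₂_mul hr, kroneckerMap₂_mul hr, ← mul_assoc, hy,
      mul_assoc, hx, mul_assoc]

theorem mul_structure_kroneckerMap₂ {r : M →ₗ[K] Matrix ι ι K}
    (hc : MulLeftMatrix R c) (r1 : r 1 = 1)
    (hr : ∀ x y, r (x * y) = r y * r x) (rt : ∀ k l, r (tGen R c k l) = blocks R k l) (b : M) :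
    r b * c = c * kroneckerMap₂ r (Coalgebra.comul b) := by
  induction b using Comeasuring.induction with
  | gen q k =>
    rw [comul_tGen]
    ext m ⟨i, j⟩
    simp only [map_sum, Matrix.sum_apply, Matrix.mul_apply,
      Fintype.sum_prod_type, kroneckerMap₂_tmul, rt, blocks_apply]
    simp only [Finset.mul_sum]
    refine Eq.trans ?_ ((hc i j k m q).trans ?_)
    · exact sum_congr rfl fun _ _ => mul_comm _ _
    · rw [sum₃_rotate]
      refine sum_congr rfl fun _ _ => sum_congr rfl fun _ _ =>
        sum_congr rfl fun _ _ => ?_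
      ring
  | one => rw [Bialgebra.comul_one, kroneckerMap₂_one r1, r1, Matrix.one_mul, Matrix.mul_one]
  | smul a x hx => simp only [map_smul, Matrix.mul_smul, Matrix.smul_mul, hx]
  | add x y hx hy => simp only [map_add, Matrix.mul_add, Matrix.add_mul, hx, hy]
  | mul x y hx hy =>
    rw [Bialgebra.comul_mul, kroneckerMap₂_mul hr, hr, Matrix.mul_assoc, hx, ← Matrix.mul_assoc,
      hy, Matrix.mul_assoc]

theorem satisfiesComeasuring_conv {r : M →ₗ[K] Matrix ι ι K}
    (hY : YangBaxterMatrix R) (hc : MulLeftMatrix R c) (r1 : r 1 = 1)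
    (hr : ∀ x y, r (x * y) = r y * r x) (rt : ∀ k l, r (tGen R c k l) = blocks R k l) :
    SatisfiesComeasuring R c (Matrix.of fun i j =>
      (toConv (Matrix.entryLinearMap K K i j ∘ₗ r) : WithConv (M →ₗ[K] K))) := by
  rw [satisfiesComeasuring_iff]
  constructor
  · intro i k j l
    ext b
    have h := congrFun (congrFun (mul_kroneckerMap₂ hY r1 hr rt b) (i, k)) (j, l)
    have hx (i j k l : ι) : kroneckerMap₂ r (comulOp K M b) (i, k) (j, l) =
        mul' K K (TensorProduct.map (Matrix.entryLinearMap K K k l ∘ₗ r)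
          (Matrix.entryLinearMap K K i j ∘ₗ r) (Coalgebra.comul b)) := by
      rw [kroneckerMap₂_apply, comulOp_apply,
        TensorProduct.map_comm, LinearMap.mul'_comm]
    simp only [Matrix.mul_apply, Fintype.sum_prod_type, hx, kroneckerMap₂_apply] at h
    simpa only [ofConv_sum, ofConv_smul, LinearMap.sum_apply, LinearMap.smul_apply, Matrix.of_apply,
      convMul_apply, ofConv_toConv, smul_eq_mul, mul_comm] using h
  · intro l i j
    ext b
    have h := congrFun (congrFun (mul_structure_kroneckerMap₂ hc r1 hr rt b) l) (i, j)
    simp only [Matrix.mul_apply, Fintype.sum_prod_type, kroneckerMap₂_apply] at h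
    simpa only [ofConv_sum, ofConv_smul, LinearMap.sum_apply, LinearMap.smul_apply, Matrix.of_apply,
      convMul_apply, comp_apply, Matrix.entryLinearMap_apply, ofConv_toConv, smul_eq_mul, mul_comm] using h

end Form

section BialgebraForm

open WithConv

variable {K M : Type*} [Field K] [Ring M] [Bialgebra K M]

/-- The bilinear form attached to a map to the convolution dual. -/
noncomputable def convForm (α : M →ₐ[K] WithConv (M →ₗ[K] K)) : M ⊗[K] M →ₗ[K] K :=
  TensorProduct.lift ((WithConv.linearEquiv K (M →ₗ[K] K)).toLinearMap ∘ₗ α.toLinearMap)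

variable (α : M →ₐ[K] WithConv (M →ₗ[K] K))

theorem convForm_tmul (a b : M) : convForm α (a ⊗ₜ b) = (α a) b := rfl

theorem convForm_mul_tmul (a b c : M) : convForm α ((a * b) ⊗ₜ c) =
    pairAt (convForm α) (convForm α) (a ⊗ₜ b) (Coalgebra.comul c) := by
  rw [convForm_tmul, map_mul, convMul_apply]
  induction Coalgebra.comul (R := K) c with
  | zero => simp
  | add x y hx hy => simp only [map_add, hx, hy]
  | tmul x y => rfl

theorem pairAt_convForm_mul (u v : M ⊗[K] M) (b d : M) :
    pairAt (convForm α) (convForm α) (u * v) (d ⊗ₜ b) = mul' K K (TensorProduct.map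
      (pairAt (convForm α) (convForm α) u) (pairAt (convForm α) (convForm α) v)
      (tensorTensorTensorComm K M M M M
        (Coalgebra.comul d ⊗ₜ Coalgebra.comul b))) := by
  induction u with
  | zero => simp
  | add x y hx hy =>
    simp only [map_add, add_mul, LinearMap.add_apply, hx, hy, TensorProduct.map_add_left]
  | tmul x₁ x₂ =>
    induction v with
    | zero => simp
    | add x y hx hy =>
      simp only [map_add, mul_add, LinearMap.add_apply, hx, hy, TensorProduct.map_add_right]
    | tmul y₁ y₂ =>
      rw [Algebra.TensorProduct.tmul_mul_tmul, pairAt_tmul, convForm_mul_tmul, convForm_mul_tmul]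
      induction Coalgebra.comul (R := K) d with
      | zero => simp
      | add x y hx hy => simp only [map_add, add_mul, hx, hy, add_tmul]
      | tmul d₁ d₂ =>
        induction Coalgebra.comul (R := K) b with
        | zero => simp
        | add x y hx hy => simp only [map_add, mul_add, hx, hy, tmul_add]
        | tmul b₁ b₂ =>
          simp only [pairAt_tmul, tensorTensorTensorComm_tmul,
            map_tmul, mul'_apply]
          ring

theorem convForm_tmul_mul_of_mul {a a' : M}
    (ha : ∀ b d, convForm α (a ⊗ₜ (b * d)) =
      pairAt (convForm α) (convForm α) (Coalgebra.comul a) (d ⊗ₜ b))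
    (ha' : ∀ b d, convForm α (a' ⊗ₜ (b * d)) =
      pairAt (convForm α) (convForm α) (Coalgebra.comul a') (d ⊗ₜ b)) (b d : M) :
    convForm α ((a * a') ⊗ₜ (b * d)) =
      pairAt (convForm α) (convForm α) (Coalgebra.comul (a * a')) (d ⊗ₜ b) := by
  rw [convForm_mul_tmul, Bialgebra.comul_mul, Bialgebra.comul_mul, pairAt_convForm_mul]
  induction Coalgebra.comul (R := K) b with
  | zero => simp
  | add x y hx hy => simp only [map_add, add_mul, hx, hy, tmul_add]
  | tmul b₁ b₂ =>
    induction Coalgebra.comul (R := K) d with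
    | zero => simp
    | add x y hx hy => simp only [map_add, mul_add, hx, hy, add_tmul]
    | tmul d₁ d₂ =>
      simp only [Algebra.TensorProduct.tmul_mul_tmul, pairAt_tmul, ha, ha',
        tensorTensorTensorComm_tmul, map_tmul, mul'_apply]

/-- The convolution product of two commuting homomorphisms. -/
noncomputable def algHomConv {X : Type*} [Semiring X] [Algebra K X] (f g : M →ₐ[K] X)
    (h : ∀ x y, Commute (f x) (g y)) : M →ₐ[K] X :=
  (Algebra.TensorProduct.lift f g h).comp (Bialgebra.comulAlgHom K M)

theorem algHomConv_apply {X : Type*} [Semiring X] [Algebra K X] (f g : M →ₐ[K] X)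
    (h : ∀ x y, Commute (f x) (g y)) (a : M) : algHomConv f g h a =
      mul' K X (TensorProduct.map f.toLinearMap g.toLinearMap (Coalgebra.comul a)) := by
  simp only [algHomConv, AlgHom.comp_apply, Bialgebra.comulAlgHom_apply]
  induction Coalgebra.comul (R := K) a with
  | zero => simp
  | add x y hx hy => simp only [map_add, hx, hy]
  | tmul x y => rw [Algebra.TensorProduct.lift_tmul]; rfl

/-- The homomorphism `a ↦ a₁ 𝓡(a₂, ·)` to the convolution algebra. -/
noncomputable def convFormHom (α : M →ₐ[K] WithConv (M →ₗ[K] K)) :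
    M →ₐ[K] WithConv (M →ₗ[K] M) :=
  algHomConv (convConstHom K M M) ((convScalarHom K M M).comp α)
    fun a b => commute_convConstHom_convScalarHom a (α b)

/-- The homomorphism `a ↦ 𝓡(a₁, ·) a₂` to the convolution algebra. -/
noncomputable def convFormHomOp (α : M →ₐ[K] WithConv (M →ₗ[K] K)) :
    M →ₐ[K] WithConv (M →ₗ[K] M) :=
  algHomConv ((convScalarHom K M M).comp α) (convConstHom K M M)
    fun a b => (commute_convConstHom_convScalarHom b (α a)).symm

theorem convFormHom_apply (a : M) : convFormHom α a = mul' K _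
    (TensorProduct.map (convConstHom K M M).toLinearMap
      ((convScalarHom K M M).comp α).toLinearMap (Coalgebra.comul a)) :=
  algHomConv_apply _ _ _ a

theorem convFormHomOp_apply (a : M) : convFormHomOp α a = mul' K _
    (TensorProduct.map ((convScalarHom K M M).comp α).toLinearMap
      (convConstHom K M M).toLinearMap (Coalgebra.comul a)) :=
  algHomConv_apply _ _ _ a

theorem id_mul_convFormHom_apply (a b : M) :
    (toConv (LinearMap.id : M →ₗ[K] M) * convFormHom α a) b =
      mul' K M (TensorProduct.comm K M M
        (actWith (convForm α) (comulOp K M) (comulOp K M) (a ⊗ₜ b))) := by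
  simp only [convFormHom_apply, actWith,
    comp_apply, map_tmul, coe_coe, comulOp_apply]
  induction Coalgebra.comul (R := K) a with
  | zero => simp
  | add x y hx hy => 
    simp only [map_add, mul_add, hx, hy, add_tmul, ofConv_add, LinearMap.add_apply]
  | tmul a₁ a₂ =>
    rw [map_tmul, mul'_apply, ← mul_assoc, convMul_apply]
    induction Coalgebra.comul (R := K) b with
    | zero => simp
    | add x y hx hy => simp only [map_add, hx, hy, tmul_add]
    | tmul b₁ b₂ =>
      have h : (toConv (LinearMap.id : M →ₗ[K] M) * convConstHom K M M a₁) b₁ = b₁ * a₁ :=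
        mul_convConst_apply a₁ _ b₁
      simp only [map_tmul, mul'_apply, AlgHom.toLinearMap_apply, h, comm_tmul,
        tensorTensorTensorComm_tmul, LinearMap.id_apply, TensorProduct.lid_tmul,
        map_smul, AlgHom.toLinearMap_apply, AlgHom.comp_apply, convScalarHom_apply, convForm_tmul]
      rw [← Algebra.commutes, Algebra.smul_def]

theorem convFormHomOp_mul_id_apply (a b : M) :
    (convFormHomOp α a * toConv (LinearMap.id : M →ₗ[K] M)) b =
      mul' K M (actWith (convForm α) Coalgebra.comul Coalgebra.comul (a ⊗ₜ b)) := by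
  simp only [convFormHomOp_apply, actWith,
    comp_apply, map_tmul, coe_coe]
  induction Coalgebra.comul (R := K) a with
  | zero => simp
  | add x y hx hy => 
    simp only [map_add, add_mul, hx, hy, add_tmul, ofConv_add, LinearMap.add_apply]
  | tmul a₁ a₂ =>
    rw [map_tmul, mul'_apply, mul_assoc, convMul_apply]
    induction Coalgebra.comul (R := K) b with
    | zero => simp
    | add x y hx hy => simp only [map_add, hx, hy, tmul_add]
    | tmul b₁ b₂ =>
      have h : (convConstHom K M M a₂ * toConv (LinearMap.id : M →ₗ[K] M)) b₂ = a₂ * b₂ :=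
        convConst_mul_apply a₂ _ b₂
      simp only [map_tmul, mul'_apply, AlgHom.toLinearMap_apply, h,
        tensorTensorTensorComm_tmul, LinearMap.id_apply, TensorProduct.lid_tmul,
        map_smul, AlgHom.toLinearMap_apply, AlgHom.comp_apply, convScalarHom_apply, convForm_tmul]
      rw [Algebra.smul_def]

/-- Elements on which two homomorphisms are intertwined by `z`. -/
def intertwined {S T : Type*} [Semiring S] [Algebra K S] [Semiring T] [Algebra K T] (f g : S →ₐ[K] T)
    (z : T) : Subalgebra K S where
  carrier := {a | z * f a = g a * z}
  mul_mem' {a b} ha hb := by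
    simp only [Set.mem_ofPred_eq, map_mul] at *
    rw [← mul_assoc, ha, mul_assoc, hb, mul_assoc]
  add_mem' {a b} ha hb := by
    simp only [Set.mem_ofPred_eq, map_add, mul_add, add_mul] at *
    rw [ha, hb]
  algebraMap_mem' r := by
    simp only [Set.mem_ofPred_eq, AlgHom.commutes]
    exact (Algebra.commutes r z).symm

end BialgebraForm

section MatrixForm

variable {K ι : Type*} [Field K] [Fintype ι] [DecidableEq ι] {R : Matrix (ι × ι) (ι × ι) K}
  {c : Matrix ι (ι × ι) K}

local notation "M" => Comeasuring R c

/-- The operator `t ↦ x t r(y)` on matrices. -/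
noncomputable def matrixOp (r : M →ₗ[K] Matrix ι ι K) :
    M ⊗[K] M →ₗ[K] Module.End K (Matrix ι ι M) :=
  mul' K _ ∘ₗ TensorProduct.map
    (LinearMap.mul K _ ∘ₗ (Matrix.scalarAlgHom ι K : M →ₐ[K] Matrix ι ι M).toLinearMap)
    ((LinearMap.mul K _).flip ∘ₗ (Algebra.linearMap K M).mapMatrix ∘ₗ r)

/-- The operator `t ↦ r(x) t y` on matrices. -/
noncomputable def matrixOp' (r : M →ₗ[K] Matrix ι ι K) :
    M ⊗[K] M →ₗ[K] Module.End K (Matrix ι ι M) :=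
  mul' K _ ∘ₗ TensorProduct.map
    (LinearMap.mul K _ ∘ₗ (Algebra.linearMap K M).mapMatrix ∘ₗ r)
    ((LinearMap.mul K _).flip ∘ₗ (Matrix.scalarAlgHom ι K : M →ₐ[K] Matrix ι ι M).toLinearMap)

theorem matrixOp_tmul (r : M →ₗ[K] Matrix ι ι K) (x y : M) (z : Matrix ι ι M) :
    matrixOp r (x ⊗ₜ y) z = Matrix.scalar ι x * (z * (r y).map (algebraMap K M)) := rfl

theorem matrixOp'_tmul (r : M →ₗ[K] Matrix ι ι K) (x y : M) (z : Matrix ι ι M) :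
    matrixOp' r (x ⊗ₜ y) z = (r x).map (algebraMap K M) * (z * Matrix.scalar ι y) := rfl

theorem scalar_comm_map (x : M) (A : Matrix ι ι K) :
    Matrix.scalar ι x * A.map (algebraMap K M) = A.map (algebraMap K M) * Matrix.scalar ι x := by
  ext i j
  simp [Matrix.scalar_apply, Algebra.commutes]

theorem matrixOp_mul {r : M →ₗ[K] Matrix ι ι K} (hr : ∀ x y, r (x * y) = r y * r x)
    (u v : M ⊗[K] M) : matrixOp r (u * v) = matrixOp r u * matrixOp r v := by
  induction u with
  | zero => simp
  | add x y hx hy => simp only [map_add, add_mul, hx, hy]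
  | tmul x y =>
    induction v with
    | zero => simp
    | add x y hx hy => simp only [map_add, mul_add, hx, hy]
    | tmul x' y' =>
      refine LinearMap.ext fun z => ?_
      rw [Algebra.TensorProduct.tmul_mul_tmul, Module.End.mul_apply, matrixOp_tmul, matrixOp_tmul,
        matrixOp_tmul, hr, Matrix.map_mul, map_mul]
      simp only [Matrix.mul_assoc]

theorem matrixOp'_mul {r : M →ₗ[K] Matrix ι ι K} (hr : ∀ x y, r (x * y) = r y * r x)
    (u v : M ⊗[K] M) : matrixOp' r (u * v) = matrixOp' r v * matrixOp' r u := by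
  induction u with
  | zero => simp
  | add x y hx hy => simp only [map_add, add_mul, mul_add, hx, hy]
  | tmul x y =>
    induction v with
    | zero => simp
    | add x y hx hy => simp only [map_add, mul_add, add_mul, hx, hy]
    | tmul x' y' =>
      refine LinearMap.ext fun z => ?_
      rw [Algebra.TensorProduct.tmul_mul_tmul, Module.End.mul_apply, matrixOp'_tmul,
        matrixOp'_tmul, matrixOp'_tmul, hr, Matrix.map_mul, map_mul]
      simp only [Matrix.mul_assoc]

theorem matrixOp_comm (r : M →ₗ[K] Matrix ι ι K) (u v : M ⊗[K] M) :
    matrixOp r u * matrixOp' r v = matrixOp' r v * matrixOp r u := by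
  induction u with
  | zero => simp
  | add x y hx hy => simp only [map_add, add_mul, mul_add, hx, hy]
  | tmul x y =>
    induction v with
    | zero => simp
    | add x y hx hy => simp only [map_add, mul_add, add_mul, hx, hy]
    | tmul x' y' =>
      refine LinearMap.ext fun z => ?_
      rw [Module.End.mul_apply, Module.End.mul_apply, matrixOp_tmul, matrixOp'_tmul,
        matrixOp'_tmul, matrixOp_tmul]
      simp only [Matrix.mul_assoc, scalar_comm_map]
      rw [← Matrix.mul_assoc, scalar_comm_map, Matrix.mul_assoc]

theorem matrixOp_tGen {r : M →ₗ[K] Matrix ι ι K} (r1 : r 1 = 1)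
    (hr : ∀ x y, r (x * y) = r y * r x) (rt : ∀ k l, r (tGen R c k l) = blocks R k l) (b : M) :
    matrixOp r (Coalgebra.comul b) (tGen R c) = matrixOp' r (Coalgebra.comul b) (tGen R c) := by
  induction b using Comeasuring.induction with
  | gen k l =>
    rw [comul_tGen]
    simp only [map_sum, LinearMap.sum_apply, matrixOp_tmul, matrixOp'_tmul, rt]
    ext i j
    have h := (satisfiesComeasuring_iff.mp (satisfiesComeasuring_tGen R c)).1 i k j l
    simp only [Algebra.smul_def] at h
    simp only [Matrix.sum_apply, Matrix.scalar_apply, Matrix.diagonal_mul]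
    simp only [← Matrix.mul_assoc, Matrix.mul_diagonal]
    simp only [Matrix.mul_apply, Matrix.map_apply, blocks_apply, Finset.mul_sum, Finset.sum_mul]
    rw [sum_comm]
    refine Eq.trans ?_ (h.symm.trans ?_)
    · refine sum_congr rfl fun x _ => sum_congr rfl fun y _ => ?_
      rw [← mul_assoc, ← Algebra.commutes]
    · rw [sum_comm]
      simp only [mul_assoc]
  | one =>
    rw [Bialgebra.comul_one, Algebra.TensorProduct.one_def, matrixOp_tmul, matrixOp'_tmul, r1]
    simp
  | smul a x hx => simp only [map_smul, LinearMap.smul_apply, hx]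
  | add x y hx hy => simp only [map_add, LinearMap.add_apply, hx, hy]
  | mul x y hx hy =>
    rw [Bialgebra.comul_mul, matrixOp_mul hr, matrixOp'_mul hr, Module.End.mul_apply, hy,
      ← Module.End.mul_apply, matrixOp_comm, Module.End.mul_apply, hx, Module.End.mul_apply]

end MatrixForm

section BlockInverse

theorem sum₄_reverse {ι N : Type*} [Fintype ι] [AddCommMonoid N] (f : ι → ι → ι → ι → N) :
    ∑ a, ∑ b, ∑ c, ∑ d, f a b c d = ∑ d, ∑ c, ∑ b, ∑ a, f a b c d := by
  have h (a : ι) : ∑ b, ∑ c, ∑ d, f a b c d = ∑ d, ∑ c, ∑ b, f a b c d := by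
    rw [sum₃_rotate, sum₃_swap]
  simp only [h]
  rw [sum_comm]
  exact sum_congr rfl fun d _ => (sum₃_rotate fun c b a => f a b c d).symm

variable {K ι : Type*} [Field K] [Fintype ι] [DecidableEq ι] {R : Matrix (ι × ι) (ι × ι) K}
  {c : Matrix ι (ι × ι) K}

theorem blocks_mul (X Y : Matrix (ι × ι) (ι × ι) K) : blocks X * blocks Y = blocks (X * Y) := by
  ext k l i j
  simp only [Matrix.mul_apply, Matrix.sum_apply, blocks_apply, Fintype.sum_prod_type]
  exact sum_comm

theorem blocks_one : blocks (1 : Matrix (ι × ι) (ι × ι) K) = 1 := by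
  ext k l i j
  by_cases hk : k = l <;> by_cases hi : i = j <;> simp [blocks_apply, Matrix.one_apply, hk, hi]

theorem op_blocks_mul_tilde (h : IsUnit (transpose₂ R)) :
    (blocks R).map MulOpposite.op * (blocks (tildeMatrix R)).map MulOpposite.op = 1 := by
  ext k l
  apply MulOpposite.unop_injective
  ext i j
  simp only [Matrix.mul_apply, Matrix.map_apply, Finset.unop_sum, MulOpposite.unop_mul,
    MulOpposite.unop_op, Matrix.sum_apply, blocks_apply]
  rw [sum_comm, sum_tilde_mul h, Matrix.one_apply]
  split_ifs <;> simp_all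

theorem tilde_mul_op_blocks (h : IsUnit (transpose₂ R)) :
    (blocks (tildeMatrix R)).map MulOpposite.op * (blocks R).map MulOpposite.op = 1 := by
  ext k l
  apply MulOpposite.unop_injective
  ext i j
  simp only [Matrix.mul_apply, Matrix.map_apply, Finset.unop_sum, MulOpposite.unop_mul,
    MulOpposite.unop_op, Matrix.sum_apply, blocks_apply]
  rw [sum_comm, sum_mul_tilde h, Matrix.one_apply]
  split_ifs <;> simp_all

/-- The matrix `uⁱⱼ = ∑ R̃ᵃⱼⁱₐ`. -/
noncomputable def tildeTrace (R : Matrix (ι × ι) (ι × ι) K) : Matrix ι ι K :=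
  Matrix.of fun i j => ∑ a, tildeMatrix R (a, i) (j, a)

theorem mul_tildeTrace_mul_tilde (h : IsUnit (transpose₂ R))
    (hR : SatisfiesOpposite R c (blocks R)) :
    R * leg₁ (tildeTrace R) * tildeMatrix R = leg₁ (tildeTrace R) := by
  have h1 := (satisfiesOpposite_iff.mp
    (hR.op.inverse (op_blocks_mul_tilde h) (tilde_mul_op_blocks h))).1
  ext ⟨i, k⟩ ⟨y, l⟩
  have h2 (j : ι) : ∑ a, ∑ b, R (i, k) (a, b) •
      (blocks (tildeMatrix R) a j * blocks (tildeMatrix R) b l) =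
      ∑ a, ∑ b, R (a, b) (j, l) • (blocks (tildeMatrix R) k b * blocks (tildeMatrix R) i a) := by
    simpa using congrArg MulOpposite.unop (h1 i k j l)
  have h3 := sum_congr rfl fun (j : ι) (_ : j ∈ Finset.univ) =>
    congrFun (congrFun (h2 j) j) y
  simp only [Matrix.sum_apply, Matrix.smul_apply, Matrix.mul_apply, blocks_apply,
    smul_eq_mul, Finset.mul_sum] at h3
  have hl : (R * leg₁ (tildeTrace R) * tildeMatrix R) (i, k) (y, l) =
      ∑ j, ∑ a, ∑ b, ∑ z, R (i, k) (a, b) *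
        (tildeMatrix R (j, a) (z, j) * tildeMatrix R (z, b) (y, l)) := by
    simp only [Matrix.mul_apply, Fintype.sum_prod_type, leg₁, Matrix.of_apply, tildeTrace,
      mul_ite, mul_zero, Finset.sum_ite_eq', Finset.mem_univ, if_true, Finset.mul_sum,
      Finset.sum_mul, mul_assoc]
    rw [sum₄_reverse]
  have hr : ∑ j, ∑ a, ∑ b, ∑ z, R (a, b) (j, l) *
        (tildeMatrix R (j, k) (z, b) * tildeMatrix R (z, i) (y, a)) =
      leg₁ (tildeTrace R) (i, k) (y, l) := by
    have (a z : ι) : ∑ j, ∑ b, R (a, b) (j, l) *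
        (tildeMatrix R (j, k) (z, b) * tildeMatrix R (z, i) (y, a)) =
        (if a = z ∧ l = k then 1 else 0) * tildeMatrix R (z, i) (y, a) := by
      rw [← sum_mul_tilde h a z l k]
      simp only [Finset.sum_mul, mul_assoc]
    calc _ = ∑ a, ∑ z, ∑ j, ∑ b, R (a, b) (j, l) *
        (tildeMatrix R (j, k) (z, b) * tildeMatrix R (z, i) (y, a)) := by
          rw [sum_comm]
          exact sum_congr rfl fun a _ => sum₃_rotate _
      _ = _ := by
        simp only [this, leg₁, tildeTrace, Matrix.of_apply]
        by_cases hlk : k = l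
        · simp [hlk, Finset.sum_ite_eq]
        · simp [hlk, Ne.symm hlk]
  rw [hl, h3, hr]

theorem sum_tildeTrace_mul (h : IsUnit (transpose₂ R)) (j l : ι) :
    ∑ k, ∑ i, tildeTrace R k i * R (i, l) (j, k) = if j = l then 1 else 0 := by
  have h1 (a : ι) := sum_tilde_mul h a j a l
  have h2 := sum_congr rfl fun (a : ι) (_ : a ∈ Finset.univ) => h1 a
  calc _ = ∑ a, ∑ i, ∑ k, tildeMatrix R (a, k) (i, a) * R (i, l) (j, k) := by
        simp only [tildeTrace, Matrix.of_apply, Finset.sum_mul]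
        rw [← sum₃_rotate, sum_comm]
    _ = _ := by
      rw [h2]
      by_cases hj : j = l
      · subst hj; simp
      · simp only [hj, if_false]
        refine Finset.sum_eq_zero fun a _ => if_neg ?_
        rintro ⟨rfl, rfl⟩
        exact hj rfl

theorem transpose₂_leg₁_mul (u : Matrix ι ι K) (X : Matrix (ι × ι) (ι × ι) K) :
    transpose₂ (leg₁ u * X) = leg₁ u * transpose₂ X := by
  ext ⟨i, k⟩ ⟨j, l⟩
  simp [transpose₂, leg₁, Matrix.mul_apply, Fintype.sum_prod_type]

theorem transpose₂_mul_leg₁ (u : Matrix ι ι K) (X : Matrix (ι × ι) (ι × ι) K) :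
    transpose₂ (X * leg₁ u) = transpose₂ X * leg₁ u := by
  ext ⟨i, k⟩ ⟨j, l⟩
  simp [transpose₂, leg₁, Matrix.mul_apply, Fintype.sum_prod_type]

theorem isUnit_leg₁ {u : Matrix ι ι K} (hu : IsUnit u) : IsUnit (leg₁ u) := by
  obtain ⟨v, h1, h2⟩ := isUnit_iff_exists.mp hu
  exact isUnit_iff_exists.mpr ⟨leg₁ v, by rw [← leg₁_mul, h1, leg₁_one],
    by rw [← leg₁_mul, h2, leg₁_one]⟩

theorem mulVec_eq_zero_of_stable {n : Type*} [Fintype n] [DecidableEq n] {U X Y S : Matrix n n K}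
    (h : U * X = S * U) (hXY : X * Y = 1) (hYX : Y * X = 1) {f : n → K} (hf : U.mulVec f = 0) :
    U.mulVec (Y.mulVec f) = 0 := by
  let p := LinearMap.ker U.mulVecLin
  let E : (n → K) ≃ₗ[K] (n → K) := LinearEquiv.ofLinearMap X.mulVecLin Y.mulVecLin
    (by rw [← Matrix.mulVecLin_mul, hXY, Matrix.mulVecLin_one])
    (by rw [← Matrix.mulVecLin_mul, hYX, Matrix.mulVecLin_one])
  have hle : p.map E.toLinearMap ≤ p := by
    rintro _ ⟨g, hg, rfl⟩
    have hg' : U.mulVec g = 0 := hg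
    change U.mulVec (X.mulVec g) = 0
    rw [Matrix.mulVec_mulVec, h, ← Matrix.mulVec_mulVec, hg', Matrix.mulVec_zero]
  have heq := Submodule.eq_of_le_of_finrank_eq hle (LinearEquiv.finrank_map_eq E p)
  obtain ⟨g, hg, hgf⟩ : f ∈ p.map E.toLinearMap := by
    rw [heq]
    exact hf
  have hg' : U.mulVec g = 0 := hg
  have : Y.mulVec f = g := by
    rw [← hgf]
    exact E.symm_apply_apply g
  rw [this, hg']

/-- The second inverse condition passes from `R` to its inverse. -/
theorem isUnit_transpose₂_inv (hu : IsUnit R) (h : IsUnit (transpose₂ R))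
    (hR : SatisfiesOpposite R c (blocks R)) : IsUnit (transpose₂ R⁻¹) := by
  have hd := (Matrix.isUnit_iff_isUnit_det _).mp hu
  have hd₂ := (Matrix.isUnit_iff_isUnit_det _).mp h
  have htt : transpose₂ (tildeMatrix R) = (transpose₂ R)⁻¹ := rfl
  have h1 : leg₁ (tildeTrace R) * tildeMatrix R = R⁻¹ * leg₁ (tildeTrace R) := by
    conv_rhs => rw [← mul_tildeTrace_mul_tilde h hR]
    rw [Matrix.mul_assoc R, ← Matrix.mul_assoc R⁻¹, Matrix.nonsing_inv_mul _ hd, Matrix.one_mul]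
  have h2 : leg₁ (tildeTrace R) * (transpose₂ R)⁻¹ = transpose₂ R⁻¹ * leg₁ (tildeTrace R) := by
    rw [← htt, ← transpose₂_leg₁_mul, h1, transpose₂_mul_leg₁]
  have hun : IsUnit (tildeTrace R) := by
    rw [← Matrix.mulVec_injective_iff_isUnit, ← Matrix.coe_mulVecLin,
      ← LinearMap.ker_eq_bot, LinearMap.ker_eq_bot']
    intro w hw
    replace hw : (tildeTrace R).mulVec w = 0 := hw
    ext l
    let f : ι × ι → K := fun p => if p.2 = l then w p.1 else 0
    have hf : (leg₁ (tildeTrace R)).mulVec f = 0 := by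
      ext ⟨i, k⟩
      have := congrFun hw i
      by_cases hk : k = l
      · simpa [leg₁, Matrix.mulVec, dotProduct, Fintype.sum_prod_type, f, hk] using this
      · simp [leg₁, Matrix.mulVec, dotProduct, Fintype.sum_prod_type, f, hk]
    have h3 := mulVec_eq_zero_of_stable h2 (Matrix.nonsing_inv_mul _ hd₂)
      (Matrix.mul_nonsing_inv _ hd₂) hf
    have h4 (k : ι) := congrFun h3 (k, k)
    have h5 := sum_congr rfl fun (k : ι) (_ : k ∈ Finset.univ) => h4 k
    simp only [leg₁, Matrix.mulVec, dotProduct, Fintype.sum_prod_type, f, Matrix.of_apply,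
      transpose₂, mul_ite, mul_zero, ite_mul, zero_mul, Finset.sum_ite_eq, Finset.sum_ite_eq',
      Finset.mem_univ, if_true, Pi.zero_apply, Finset.sum_const_zero] at h5
    rw [Pi.zero_apply, ← h5]
    calc w l = ∑ j, (∑ k, ∑ i, tildeTrace R k i * R (i, l) (j, k)) * w j := by
          simp only [sum_tildeTrace_mul h]
          simp
      _ = _ := by
        simp only [Finset.sum_mul, Finset.mul_sum, mul_assoc]
        exact (sum₃_rotate _).symm
  have h6 := isUnit_leg₁ hun
  have hd6 := (Matrix.isUnit_iff_isUnit_det _).mp h6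
  have : transpose₂ R⁻¹ = leg₁ (tildeTrace R) * (transpose₂ R)⁻¹ * (leg₁ (tildeTrace R))⁻¹ := by
    rw [h2, Matrix.mul_assoc, Matrix.mul_nonsing_inv _ hd6, Matrix.mul_one]
  rw [this]
  exact (h6.mul (Matrix.isUnit_nonsing_inv_iff.mpr h)).mul (Matrix.isUnit_nonsing_inv_iff.mpr h6)

end BlockInverse

section ConvolutionPairing

open WithConv

variable {K M : Type*} [Field K] [Ring M] [Bialgebra K M]

/-- The bilinear form of a linear map to the dual. -/
noncomputable def dualForm (f : M →ₗ[K] WithConv (M →ₗ[K] K)) : M ⊗[K] M →ₗ[K] K :=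
  TensorProduct.lift ((WithConv.linearEquiv K (M →ₗ[K] K)).toLinearMap ∘ₗ f)

theorem convWith_dualForm (f g : M →ₗ[K] WithConv (M →ₗ[K] K)) (a b : M) :
    convWith (dualForm f) (dualForm g) Coalgebra.comul Coalgebra.comul (a ⊗ₜ b) =
      (mul' K _ (TensorProduct.map f g (Coalgebra.comul a))) b := by
  rw [convWith_tmul]
  induction Coalgebra.comul (R := K) a with
  | zero => simp
  | add x y hx hy => simp only [map_add, LinearMap.add_apply, hx, hy, ofConv_add]
  | tmul x y =>
    rw [map_tmul, mul'_apply, convMul_apply]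
    induction Coalgebra.comul (R := K) b with
    | zero => simp
    | add x y hx hy => simp only [map_add, hx, hy]
    | tmul z w => rw [pairAt_tmul]; rfl

/-- The linear map to the dual underlying a map to its opposite algebra. -/
noncomputable def unopDual (f : M →ₗ[K] (WithConv (M →ₗ[K] K))ᵐᵒᵖ) :
    M →ₗ[K] WithConv (M →ₗ[K] K) :=
  (MulOpposite.opLinearEquiv K).symm.toLinearMap ∘ₗ f

theorem convWith_dualForm_op (f g : M →ₗ[K] (WithConv (M →ₗ[K] K))ᵐᵒᵖ) (a b : M) :
    convWith (dualForm (unopDual f)) (dualForm (unopDual g)) Coalgebra.comul (comulOp K M)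
      (a ⊗ₜ b) =
      (mul' K _ (TensorProduct.map f g (Coalgebra.comul a))).unop b := by
  rw [convWith_tmul, comulOp_apply]
  induction Coalgebra.comul (R := K) a with
  | zero => simp
  | add x y hx hy =>
    simp only [map_add, LinearMap.add_apply, hx, hy, ofConv_add, MulOpposite.unop_add]
  | tmul x y =>
    rw [map_tmul, mul'_apply, MulOpposite.unop_mul,
      convMul_apply]
    induction Coalgebra.comul (R := K) b with
    | zero => simp
    | add x y hx hy => simp only [map_add, hx, hy]
    | tmul z w =>
      rw [comm_tmul, pairAt_tmul, mul_comm]; rfl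

end ConvolutionPairing

section MatrixInverse

open WithConv

variable {K ι : Type*} [Field K] [Fintype ι] [DecidableEq ι] {R : Matrix (ι × ι) (ι × ι) K}
  {c : Matrix ι (ι × ι) K}

local notation "M" => Comeasuring R c

theorem mul'_map_matrix_apply (f g : M →ₗ[K] Matrix ι ι K) (u : M ⊗[K] M) (i j : ι) :
    mul' K (Matrix ι ι K) (TensorProduct.map f g u) i j =
      ∑ a, mul' K K (TensorProduct.map (Matrix.entryLinearMap K K i a ∘ₗ f)
        (Matrix.entryLinearMap K K a j ∘ₗ g) u) := by
  induction u with
  | zero => simp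
  | add x y hx hy => simp only [map_add, Matrix.add_apply, hx, hy, Finset.sum_add_distrib]
  | tmul x y => simp [Matrix.mul_apply]

/-- The matrix of functionals of a matrix representation. -/
noncomputable def entryMatrix (f : M →ₗ[K] Matrix ι ι K) : Matrix ι ι (WithConv (M →ₗ[K] K)) :=
  Matrix.of fun i j => toConv (Matrix.entryLinearMap K K i j ∘ₗ f)

theorem entryMatrix_apply (f : M →ₗ[K] Matrix ι ι K) (i j : ι) (b : M) :
    (entryMatrix f i j) b = f b i j := rfl

theorem entryMatrix_mul {f g : M →ₗ[K] Matrix ι ι K} (h : ConvInverse f g) :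
    entryMatrix f * entryMatrix g = 1 := by
  ext i j b
  have h1 := congrFun (congrFun (h b) i) j
  rw [mul'_map_matrix_apply] at h1
  have h2 : (((1 : Matrix ι ι (WithConv (M →ₗ[K] K))) i j) b : K) =
      (algebraMap K (Matrix ι ι K) (Coalgebra.counit b)) i j := by
    rw [Matrix.algebraMap_matrix_apply, Matrix.one_apply]
    split_ifs <;> simp
  rw [h2, ← h1, Matrix.mul_apply]
  simp only [ofConv_sum, LinearMap.sum_apply, convMul_apply]
  rfl

theorem entryMatrix_op_mul {f g : M →ₗ[K] (Matrix ι ι K)ᵐᵒᵖ} (h : ConvInverse f g) :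
    (entryMatrix ((MulOpposite.opLinearEquiv K).symm.toLinearMap ∘ₗ g)).map MulOpposite.op *
      (entryMatrix ((MulOpposite.opLinearEquiv K).symm.toLinearMap ∘ₗ f)).map MulOpposite.op = 1 := by
  ext i j
  apply MulOpposite.unop_injective
  ext b
  have h1 := congrFun (congrFun (congrArg MulOpposite.unop (h b)) i) j
  have h2 : (((1 : Matrix ι ι (WithConv (M →ₗ[K] K))ᵐᵒᵖ) i j).unop b : K) =
      (MulOpposite.unop (algebraMap K (Matrix ι ι K)ᵐᵒᵖ (Coalgebra.counit b))) i j := by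
    rw [MulOpposite.algebraMap_apply, MulOpposite.unop_op, Matrix.algebraMap_matrix_apply,
      Matrix.one_apply]
    split_ifs <;> simp
  refine Eq.trans ?_ (h1.trans h2.symm)
  rw [Matrix.mul_apply]
  simp only [Finset.unop_sum, ofConv_sum, LinearMap.sum_apply, MulOpposite.unop_mul,
    convMul_apply, Matrix.map_apply, MulOpposite.unop_op]
  induction Coalgebra.comul (R := K) b with
  | zero => simp only [map_zero, Finset.sum_const_zero]; rfl
  | add x y hx hy => simp only [map_add, Finset.sum_add_distrib, hx, hy]; rfl
  | tmul x y =>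
    simp only [map_tmul, mul'_apply]
    exact sum_congr rfl fun a _ => mul_comm _ _

end MatrixInverse

section Existence

open WithConv

variable {K ι : Type*} [Field K] [Fintype ι] [DecidableEq ι] {R : Matrix (ι × ι) (ι × ι) K}
  {c : Matrix ι (ι × ι) K}

local notation "M" => Comeasuring R c

theorem matrixOp_apply_apply (r : M →ₗ[K] Matrix ι ι K) (u : M ⊗[K] M) (z : Matrix ι ι M) (i j : ι) :
    matrixOp r u z i j = ∑ a, mul' K M (TensorProduct.map
      ((LinearMap.mul K M).flip (z i a))
      (Algebra.linearMap K M ∘ₗ Matrix.entryLinearMap K K a j ∘ₗ r) u) := by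
  induction u with
  | zero => simp
  | add x y hx hy => simp only [map_add, LinearMap.add_apply, Matrix.add_apply, hx, hy,
      Finset.sum_add_distrib]
  | tmul x y =>
    rw [matrixOp_tmul, Matrix.scalar_apply, Matrix.diagonal_mul]
    simp [Matrix.mul_apply, Finset.mul_sum, mul_assoc]

theorem matrixOp'_apply_apply (r : M →ₗ[K] Matrix ι ι K) (u : M ⊗[K] M) (z : Matrix ι ι M)
    (i j : ι) :
    matrixOp' r u z i j = ∑ a, mul' K M (TensorProduct.map
      (Algebra.linearMap K M ∘ₗ Matrix.entryLinearMap K K i a ∘ₗ r)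
      (LinearMap.mul K M (z a j)) u) := by
  induction u with
  | zero => simp
  | add x y hx hy => simp only [map_add, LinearMap.add_apply, Matrix.add_apply, hx, hy,
      Finset.sum_add_distrib]
  | tmul x y =>
    rw [matrixOp'_tmul, ← Matrix.mul_assoc, Matrix.scalar_apply, Matrix.mul_diagonal]
    simp [Matrix.mul_apply, Finset.sum_mul, mul_assoc]

theorem convForm_comm {r : M →ₗ[K] Matrix ι ι K} (r1 : r 1 = 1)
    (hr : ∀ x y, r (x * y) = r y * r x) (rt : ∀ k l, r (tGen R c k l) = blocks R k l)
    {α : M →ₐ[K] WithConv (M →ₗ[K] K)} (hα : ∀ i j, α (tGen R c i j) = entryMatrix r i j) (a b : M) :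
    mul' K M (TensorProduct.comm K M M
        (actWith (convForm α) (comulOp K M) (comulOp K M) (a ⊗ₜ b))) =
      mul' K M (actWith (convForm α) Coalgebra.comul Coalgebra.comul (a ⊗ₜ b)) := by
  rw [← id_mul_convFormHom_apply, ← convFormHomOp_mul_id_apply]
  suffices a ∈ intertwined (convFormHom α) (convFormHomOp α)
      (toConv (LinearMap.id : M →ₗ[K] M)) from
    congrArg (fun f : WithConv (M →ₗ[K] M) => f b) this
  induction a using Comeasuring.induction with
  | gen i j =>
    change toConv (LinearMap.id : M →ₗ[K] M) * convFormHom α (tGen R c i j) =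
      convFormHomOp α (tGen R c i j) * toConv (LinearMap.id : M →ₗ[K] M)
    ext b
    have h := congrFun (congrFun (matrixOp_tGen r1 hr rt b) i) j
    rw [matrixOp_apply_apply, matrixOp'_apply_apply] at h
    rw [convFormHom_apply, convFormHomOp_apply, comul_tGen]
    simp only [map_sum, map_tmul, mul'_apply, Finset.mul_sum,
      Finset.sum_mul, AlgHom.toLinearMap_apply, AlgHom.comp_apply, hα, ofConv_sum,
      LinearMap.sum_apply]
    refine Eq.trans (sum_congr rfl fun a _ => ?_)
      (h.trans (sum_congr rfl fun a _ => ?_))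
    · rw [← mul_assoc, convMul_apply]
      congr 2
      have : (toConv (LinearMap.id : M →ₗ[K] M) * convConstHom K M M (tGen R c i a)).ofConv =
          (LinearMap.mul K M).flip (tGen R c i a) :=
        LinearMap.ext fun b => mul_convConst_apply _ _ b
      rw [this]
      rfl
    · rw [mul_assoc, convMul_apply]
      congr 2
      have : (convConstHom K M M (tGen R c a j) * toConv (LinearMap.id : M →ₗ[K] M)).ofConv =
          LinearMap.mul K M (tGen R c a j) :=
        LinearMap.ext fun b => convConst_mul_apply _ _ b
      rw [this]
      rfl
  | one => exact one_mem _
  | smul k x hx => exact Subalgebra.smul_mem _ hx k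
  | add x y hx hy => exact add_mem hx hy
  | mul x y hx hy => exact mul_mem hx hy

theorem convForm_tmul_mul {r : M →ₗ[K] Matrix ι ι K} 
    (hr : ∀ x y, r (x * y) = r y * r x) 
    {α : M →ₐ[K] WithConv (M →ₗ[K] K)} (hα : ∀ i j, α (tGen R c i j) = entryMatrix r i j)
    (a b d : M) : convForm α (a ⊗ₜ (b * d)) =
      pairAt (convForm α) (convForm α) (Coalgebra.comul a) (d ⊗ₜ b) := by
  revert b d
  induction a using Comeasuring.induction with
  | gen i j =>
    intro b d
    rw [comul_tGen, convForm_tmul, hα, entryMatrix_apply, hr, Matrix.mul_apply]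
    simp only [map_sum, LinearMap.sum_apply, pairAt_tmul, convForm_tmul, hα, entryMatrix_apply]
  | one =>
    intro b d
    rw [Bialgebra.comul_one, Algebra.TensorProduct.one_def, pairAt_tmul]
    simp only [convForm_tmul, map_one, LinearMap.convOne_apply, Bialgebra.counit_mul,
      Algebra.algebraMap_self, RingHom.id_apply]
    exact mul_comm _ _
  | smul k x hx =>
    intro b d
    rw [map_smul, map_smul, LinearMap.smul_apply, ← hx, ← smul_tmul', map_smul]
  | add x y hx hy =>
    intro b d
    rw [map_add, map_add, LinearMap.add_apply, ← hx, ← hy, add_tmul, map_add]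
  | mul x y hx hy => exact convForm_tmul_mul_of_mul α hx hy

end Existence

section Existence

open WithConv

variable {K ι : Type*} [Field K] [Fintype ι] [DecidableEq ι] {R : Matrix (ι × ι) (ι × ι) K}
  {c : Matrix ι (ι × ι) K}

local notation "M" => Comeasuring R c

theorem convWith_eq_counitPair {f g : M →ₗ[K] WithConv (M →ₗ[K] K)} (h : ConvInverse f g) :
    convWith (dualForm f) (dualForm g) Coalgebra.comul Coalgebra.comul = counitPair K M := by
  ext a b
  refine (convWith_dualForm f g a b).trans ?_
  rw [h a, LinearMap.convAlgebraMap_apply]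
  rfl

theorem convWith_op_eq_counitPair {f g : M →ₗ[K] (WithConv (M →ₗ[K] K))ᵐᵒᵖ}
    (h : ConvInverse f g) :
    convWith (dualForm (unopDual f)) (dualForm (unopDual g)) Coalgebra.comul (comulOp K M) =
      counitPair K M := by
  ext a b
  refine (convWith_dualForm_op f g a b).trans ?_
  rw [h a, MulOpposite.algebraMap_apply, MulOpposite.unop_op, LinearMap.convAlgebraMap_apply]
  rfl

theorem convWith_comulOp_comul {N : Type*} [Ring N] [Bialgebra K N] (f g : N ⊗[K] N →ₗ[K] K) :
    convWith f g (comulOp K N) Coalgebra.comul = convWith g f Coalgebra.comul (comulOp K N) := by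
  conv_lhs => rw [← comm_comp_comulOp]
  exact convWith_comm_slots f g Coalgebra.comul (comulOp K N)

theorem unop_unop_opOp {B : Type*} [Semiring B] [Algebra K B] (f : M →ₐ[K] B) :
    (MulOpposite.opLinearEquiv K).symm.toLinearMap ∘ₗ (MulOpposite.opLinearEquiv K).symm.toLinearMap ∘ₗ
      ((AlgEquiv.opOp K B).toAlgHom.comp f).toLinearMap = f.toLinearMap := rfl

theorem convForm_eq_dualForm (α : M →ₐ[K] WithConv (M →ₗ[K] K)) :
    convForm α = dualForm α.toLinearMap := rfl

/-- The dual quasitriangular structure given by a homomorphism to the dual. -/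
noncomputable def dualQuasitriangularOfHom (α : M →ₐ[K] WithConv (M →ₗ[K] K))
    {β : M →ₗ[K] WithConv (M →ₗ[K] K)} (h1 : ConvInverse α.toLinearMap β)
    (h2 : ConvInverse β α.toLinearMap)
    (hmul : ∀ a b d, convForm α (a ⊗ₜ (b * d)) =
      pairAt (convForm α) (convForm α) (Coalgebra.comul a) (d ⊗ₜ b))
    (hcomm : ∀ a b, mul' K M (TensorProduct.comm K M M
        (actWith (convForm α) (comulOp K M) (comulOp K M) (a ⊗ₜ b))) =
      mul' K M (actWith (convForm α) Coalgebra.comul Coalgebra.comul (a ⊗ₜ b))) :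
    DualQuasitriangular K M where
  form := convForm α
  inv := dualForm β
  form_inv := by rw [convForm_eq_dualForm]; exact convWith_eq_counitPair h1
  inv_form := by rw [convForm_eq_dualForm]; exact convWith_eq_counitPair h2
  form_mul_left a b d := convForm_mul_tmul α a b d
  form_mul_right a b d := hmul a b d
  form_comm := hcomm

theorem exists_dualQuasitriangular (hY : YangBaxterMatrix R) (hl : MulLeftMatrix R c)
    (hr : MulRightMatrix R c) (hR : IsUnit R) (hR₂ : IsUnit (transpose₂ R)) :
    ∃ (Q : DualQuasitriangular K M) (_ : Q.SecondInverse) (sil : M ⊗[K] M →ₗ[K] K),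
      (∀ i j k l, Q.form (tGen R c i j ⊗ₜ tGen R c k l) = R (i, k) (j, l)) ∧
      convWith Q.inv sil (comulOp K M) Coalgebra.comul = counitPair K M ∧
      convWith sil Q.inv (comulOp K M) Coalgebra.comul = counitPair K M := by
  have hB := satisfiesOpposite_blocks hY hr
  have hd := (Matrix.isUnit_iff_isUnit_det _).mp hR
  have hR₃ := isUnit_transpose₂_inv hR hR₂ hB
  obtain ⟨ρ, hρ⟩ : ∃ ρ : M →ₐ[K] (Matrix ι ι K)ᵐᵒᵖ,
      ∀ k l, ρ (tGen R c k l) = MulOpposite.op (blocks R k l) :=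
    ⟨blockRep hB, fun k l => Comeasuring.lift_tGen _ _ k l⟩
  obtain ⟨r, hrρ⟩ : ∃ r : M →ₗ[K] Matrix ι ι K,
      r = (MulOpposite.opLinearEquiv K).symm.toLinearMap ∘ₗ ρ.toLinearMap := ⟨_, rfl⟩
  have r1 : r 1 = 1 := by simp [hrρ]
  have rm (x y : M) : r (x * y) = r y * r x := by simp [hrρ]
  have rt (k l : ι) : r (tGen R c k l) = blocks R k l := by
    rw [hrρ]
    exact congrArg MulOpposite.unop (hρ k l)
  have hx := satisfiesComeasuring_conv hY hl r1 rm rt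
  obtain ⟨α, hα⟩ : ∃ α : M →ₐ[K] WithConv (M →ₗ[K] K),
      ∀ i j, α (tGen R c i j) = entryMatrix r i j :=
    ⟨Comeasuring.lift _ hx, Comeasuring.lift_tGen _ hx⟩
  have hαm : (tGen R c).map α = entryMatrix r := Matrix.ext fun i j =>
    hα i j
  obtain ⟨ρ', hρ', hc1, hc2⟩ := exists_convInverse_of_anti (y := blocks R⁻¹) ρ
    (by
      rw [show (tGen R c).map (fun t => (ρ t).unop) = blocks R from
        Matrix.ext fun i j => congrArg MulOpposite.unop (hρ i j),
        blocks_mul, Matrix.mul_nonsing_inv _ hd, blocks_one])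
    (by
      rw [show (tGen R c).map (fun t => (ρ t).unop) = blocks R from
        Matrix.ext fun i j => congrArg MulOpposite.unop (hρ i j),
        blocks_mul, Matrix.nonsing_inv_mul _ hd, blocks_one])
  rw [← hrρ] at hc1 hc2
  obtain ⟨β, β1, βm, βt, hβ1, hβ2⟩ := exists_convInverse_of_hom α
    (y := entryMatrix ρ'.toLinearMap) (by rw [hαm]; exact entryMatrix_mul hc1)
    (by rw [hαm]; exact entryMatrix_mul hc2)
  have hρm : (tGen R c).map ρ = (blocks R).map MulOpposite.op := Matrix.ext fun i j =>
    hρ i j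
  obtain ⟨σ, -, -, -, hσ1, hσ2⟩ := exists_convInverse_of_hom ρ
    (y := (blocks (tildeMatrix R)).map MulOpposite.op)
    (by rw [hρm]; exact op_blocks_mul_tilde hR₂) (by rw [hρm]; exact tilde_mul_op_blocks hR₂)
  have hα' : (tGen R c).map (fun t => ((AlgEquiv.opOp K (WithConv (M →ₗ[K] K))).toAlgHom.comp α
      t).unop) = (entryMatrix r).map MulOpposite.op :=
    Matrix.ext fun i j => congrArg MulOpposite.op (hα i j)
  have τ1 := entryMatrix_op_mul hσ1
  have τ2 := entryMatrix_op_mul hσ2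
  rw [← hrρ] at τ1 τ2
  obtain ⟨τ, hτ, hτ1, hτ2⟩ := exists_convInverse_of_anti
    ((AlgEquiv.opOp K (WithConv (M →ₗ[K] K))).toAlgHom.comp α)
    (y := (entryMatrix ((MulOpposite.opLinearEquiv K).symm.toLinearMap ∘ₗ σ)).map MulOpposite.op)
    (by rw [hα']; exact τ2) (by rw [hα']; exact τ1)
  have hρ'' : (tGen R c).map (fun t => ((AlgEquiv.opOp K (Matrix ι ι K)).toAlgHom.comp ρ'
      t).unop) = (blocks R⁻¹).map MulOpposite.op := Matrix.ext fun i j =>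
    congrArg MulOpposite.op (hρ' i j)
  obtain ⟨κ, -, hκ1, hκ2⟩ := exists_convInverse_of_anti
    ((AlgEquiv.opOp K (Matrix ι ι K)).toAlgHom.comp ρ')
    (y := (blocks (tildeMatrix R⁻¹)).map MulOpposite.op)
    (by rw [hρ'']; exact op_blocks_mul_tilde hR₃) (by rw [hρ'']; exact tilde_mul_op_blocks hR₃)
  obtain ⟨γ, hγ⟩ : ∃ γ : M →ₐ[K] (WithConv (M →ₗ[K] K))ᵐᵒᵖ, ∀ x, γ x = MulOpposite.op (β x) :=
    ⟨AlgHom.ofLinearMap ((MulOpposite.opLinearEquiv K).toLinearMap ∘ₗ β)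
      (congrArg MulOpposite.op β1) (fun x y => congrArg MulOpposite.op (βm x y)), fun _ => rfl⟩
  have hγm : (tGen R c).map γ = (entryMatrix ρ'.toLinearMap).map MulOpposite.op :=
    Matrix.ext fun i j => (hγ _).trans (congrArg MulOpposite.op (βt i j))
  have κ1 := entryMatrix_op_mul hκ1
  have κ2 := entryMatrix_op_mul hκ2
  rw [unop_unop_opOp] at κ1 κ2
  obtain ⟨ω, -, -, -, hω1, hω2⟩ := exists_convInverse_of_hom γ
    (y := (entryMatrix ((MulOpposite.opLinearEquiv K).symm.toLinearMap ∘ₗ κ.toLinearMap)).map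
      MulOpposite.op)
    (by rw [hγm]; exact κ2) (by rw [hγm]; exact κ1)
  have til1 := convWith_op_eq_counitPair hτ2
  have til2 := convWith_op_eq_counitPair hτ1
  have hu : dualForm (unopDual ((MulOpposite.opLinearEquiv K).symm.toLinearMap ∘ₗ
      ((AlgEquiv.opOp K (WithConv (M →ₗ[K] K))).toAlgHom.comp α).toLinearMap)) = convForm α := by
    rw [unopDual, unop_unop_opOp, convForm_eq_dualForm]
  rw [hu] at til1 til2
  have sil1 := convWith_op_eq_counitPair hω2
  have sil2 := convWith_op_eq_counitPair hω1
  have hg : unopDual γ.toLinearMap = β :=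
    LinearMap.ext fun x => congrArg MulOpposite.unop (hγ x)
  rw [hg] at sil1 sil2
  have hmul := convForm_tmul_mul rm hα
  have hcomm := convForm_comm r1 rm rt hα
  obtain ⟨Q, hQ, hQi⟩ : ∃ Q : DualQuasitriangular K M,
      Q.form = convForm α ∧ Q.inv = dualForm β :=
    ⟨dualQuasitriangularOfHom α hβ1 hβ2 hmul hcomm, rfl, rfl⟩
  rw [← hQ] at til1 til2
  rw [← hQi] at sil1 sil2
  refine ⟨Q, ⟨dualForm (unopDual τ.toLinearMap), til1, til2⟩, dualForm (unopDual ω),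
    fun i j k l => ?_, ?_, ?_⟩
  · rw [hQ, convForm_tmul, hα, entryMatrix_apply, rt, blocks_apply]
  · rw [convWith_comulOp_comul, sil1]
  · rw [convWith_comulOp_comul, sil2]

end Existence

section StableSubmodules

variable {K M X Y : Type*} [Field K] [AddCommMonoid M] [Module K M] [AddCommGroup X] [Module K X]
  [AddCommGroup Y] [Module K Y]

/-- The image of `Z ⊗ M` in `X ⊗ M`. -/
def Submodule.extend (M : Type*) [AddCommMonoid M] [Module K M] (Z : Submodule K X) :
    Submodule K (X ⊗[K] M) := Submodule.map₂ (TensorProduct.mk K X M) Z ⊤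

theorem Submodule.tmul_mem_extend {Z : Submodule K X} {z : X} (hz : z ∈ Z) (m : M) :
    z ⊗ₜ[K] m ∈ Z.extend M := Submodule.apply_mem_map₂ _ hz trivial

/-- The submodule is stable under the coaction. -/
def StableUnder (δ : X →ₗ[K] X ⊗[K] M) (Z : Submodule K X) : Prop :=
  Z ≤ (Z.extend M).comap δ

theorem StableUnder.exists_colin {δ : X →ₗ[K] X ⊗[K] M} {Z : Submodule K X}
    (h : StableUnder δ Z) : ∃ δ' : Z →ₗ[K] Z ⊗[K] M, Colin Z.subtype δ' δ := by
  obtain ⟨p, hp⟩ := Z.subtype.exists_leftInverse_of_injective (Submodule.ker_subtype Z)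
  have key : Z.extend M ≤ LinearMap.eqLocus ((Z.subtype ∘ₗ p).rTensor M) LinearMap.id := by
    refine Submodule.map₂_le.2 fun z hz m _ => ?_
    have := LinearMap.congr_fun hp ⟨z, hz⟩
    simp only [comp_apply, Submodule.subtype_apply, LinearMap.id_apply] at this
    simp [this]
  refine ⟨p.rTensor M ∘ₗ δ ∘ₗ Z.subtype, ?_⟩
  ext z
  simp only [comp_apply]
  rw [← comp_apply (Z.subtype.rTensor M), ← rTensor_comp]
  exact (key (h z.2)).symm

theorem map_pairOp_le {δ : X →ₗ[K] X ⊗[K] M} {ε : Y →ₗ[K] Y ⊗[K] M} {Z : Submodule K X}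
    {Z' : Submodule K Y} (h : StableUnder δ Z) (h' : StableUnder ε Z')
    (f : M ⊗[K] M →ₗ[K] K) :
    (LinearMap.range (TensorProduct.mapIncl Z Z')).map (pairOp f (liftL Y δ) (liftR X ε)) ≤
      LinearMap.range (TensorProduct.mapIncl Z Z') := by
  obtain ⟨δ', hδ⟩ := h.exists_colin
  obtain ⟨ε', hε⟩ := h'.exists_colin
  have hl : Colin (TensorProduct.mapIncl Z Z') (liftL Z' δ') (liftL Y δ) := by
    unfold Colin TensorProduct.mapIncl
    have h1 := Colin.rTensor_liftL (Y := Y) hδ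
    have h2 := colin_lTensor_liftL Z'.subtype δ'
    unfold Colin at h1 h2
    rw [← LinearMap.rTensor_comp_lTensor, ← comp_assoc, h1, comp_assoc, h2,
      rTensor_comp _ (LinearMap.rTensor Y _), comp_assoc]
  have hr : Colin (TensorProduct.mapIncl Z Z') (liftR Z ε') (liftR X ε) := by
    unfold Colin TensorProduct.mapIncl
    have h1 := Colin.lTensor_liftR (X := X) hε
    have h2 := colin_rTensor_liftR Z.subtype ε'
    unfold Colin at h1 h2
    rw [← LinearMap.lTensor_comp_rTensor, ← comp_assoc, h1, comp_assoc, h2,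
      rTensor_comp _ (LinearMap.lTensor X _), comp_assoc]
  rw [← LinearMap.range_comp, pairOp_comp hl hr, LinearMap.range_comp]
  exact LinearMap.map_le_range

end StableSubmodules

section StableAlgebra

variable {K M B : Type*} [Field K] [Semiring M] [Algebra K M] [Ring B] [Algebra K B]

theorem Submodule.mul_mem_extend {Z Z' : Submodule K B} {u v : B ⊗[K] M} (hu : u ∈ Z.extend M)
    (hv : v ∈ Z'.extend M) : u * v ∈ (Z * Z').extend M := by
  have h : Z.extend M ≤ ((Z * Z').extend M).comap (LinearMap.mulRight K v) := by
    refine Submodule.map₂_le.2 fun z hz m _ => ?_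
    have h' : Z'.extend M ≤ ((Z * Z').extend M).comap (LinearMap.mulLeft K (z ⊗ₜ[K] m)) := by
      refine Submodule.map₂_le.2 fun z' hz' m' _ => ?_
      simp only [Submodule.mem_comap, LinearMap.mulLeft_apply, TensorProduct.mk_apply,
        Algebra.TensorProduct.tmul_mul_tmul]
      exact Submodule.tmul_mem_extend (Submodule.mul_mem_mul hz hz') _
    exact h' hv
  exact h hu

theorem StableUnder.mul {δ : B →ₐ[K] B ⊗[K] M} {Z Z' : Submodule K B}
    (h : StableUnder δ.toLinearMap Z) (h' : StableUnder δ.toLinearMap Z') :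
    StableUnder δ.toLinearMap (Z * Z') := by
  refine Submodule.mul_le.2 fun x hx y hy => ?_
  have := Submodule.mul_mem_extend (h hx) (h' hy)
  simpa only [AlgHom.toLinearMap_apply, Submodule.mem_comap, map_mul] using this

theorem stableUnder_one (δ : B →ₐ[K] B ⊗[K] M) : StableUnder δ.toLinearMap 1 := by
  refine Submodule.one_le.2 ?_
  simp only [AlgHom.toLinearMap_apply, Submodule.mem_comap, map_one]
  exact Submodule.tmul_mem_extend (Submodule.one_le.1 le_rfl) _

theorem StableUnder.pow {δ : B →ₐ[K] B ⊗[K] M} {Z : Submodule K B}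
    (h : StableUnder δ.toLinearMap Z) (n : ℕ) : StableUnder δ.toLinearMap (Z ^ n) := by
  induction n with
  | zero => simpa using stableUnder_one δ
  | succ n ih => rw [pow_succ]; exact ih.mul h

theorem stableUnder_top (δ : B →ₗ[K] B ⊗[K] M) : StableUnder δ ⊤ := by
  intro x _
  rw [Submodule.mem_comap, Submodule.extend, TensorProduct.map₂_mk_top_top_eq_top]
  trivial

theorem prodAlong_mul' (δ : B →ₐ[K] B ⊗[K] M) : ProdAlong (mul' K B)
    (liftL B δ.toLinearMap) (liftR B δ.toLinearMap) δ.toLinearMap := by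
  ext x y
  simp only [TensorProduct.AlgebraTensorModule.curry_apply, restrictScalars_self,
    curry_apply, comp_apply, mul'_apply, joint, liftR_tmul,
    coe_coe, AlgHom.toLinearMap_apply, map_mul]
  generalize δ y = t
  induction t with
  | zero => simp
  | add x y hx hy => simp only [map_add, tmul_add, mul_add, hx, hy]
  | tmul y y' =>
    simp only [assoc_symm_tmul, rTensor_tmul, liftL_tmul,
      AlgHom.toLinearMap_apply]
    generalize δ x = t
    induction t with
    | zero => simp
    | add x y hx hy => simp only [map_add, add_tmul, add_mul, hx, hy]
    | tmul x x' => simp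

end StableAlgebra

section TwistInverse

variable {K M X : Type*} [Field K] [Semiring M] [Bialgebra K M] [AddCommMonoid X] [Module K X]

namespace DualQuasitriangular.SecondInverse

variable {Q : DualQuasitriangular K M} {S : Q.SecondInverse}

theorem twist_mul_cancel {a b : Site K M X} (h : a.Indep b) : S.twist a b *
    (pairOp Q.form a.r.δ b.l.δ * pairOp Q.inv a.l.δ b.l.δ) = 1 := by
  have h1 : S.cross a.l b.l * pairOp Q.inv a.l.δ b.l.δ = 1 := form_mul_inv h.l.l
  rw [twist, crossL, mul_assoc, ← mul_assoc (S.cross a.r b.l), til_mul_form S h.l.r, one_mul, h1]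

theorem twist_comp_form {a b : Site K M X} (h : a.Indep b) :
    S.twist a b * pairOp Q.form a.r.δ b.l.δ = pairOp Q.form a.l.δ b.l.δ := by
  rw [twist, crossL, mul_assoc, til_mul_form S h.l.r, mul_one]
  rfl

end DualQuasitriangular.SecondInverse

end TwistInverse

section Twist

variable {K M X Y X' : Type*} [Field K] [Semiring M] [Bialgebra K M] [AddCommGroup X] [Module K X]
  [AddCommGroup Y] [Module K Y] [AddCommMonoid X'] [Module K X']

/-- A submodule stable under both coactions. -/
structure Site.Stable (a : Site K M X) (Z : Submodule K X) : Prop where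
  l : StableUnder a.l.δ Z
  r : StableUnder a.r.δ Z

namespace DualQuasitriangular.SecondInverse

variable {Q : DualQuasitriangular K M} {S : Q.SecondInverse}

theorem map_twist {a : Site K M X} {b : Site K M Y} {Z : Submodule K X} {Z' : Submodule K Y}
    (h : a.Stable Z) (h' : b.Stable Z') :
    (LinearMap.range (TensorProduct.mapIncl Z Z')).map (S.twist (a.liftL Y) (b.liftR X)) =
      LinearMap.range (TensorProduct.mapIncl Z Z') := by
  refine le_antisymm ?_ ?_
  · refine (Submodule.map_comp _ _ _).trans_le ?_
    exact (Submodule.map_mono (map_pairOp_le h.r h'.l _)).trans (map_pairOp_le h.l h'.l _)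
  · have e := congrArg (fun F => (LinearMap.range (TensorProduct.mapIncl Z Z')).map F)
      (twist_mul_cancel (S := S) (Site.indep_liftL_liftR a b))
    refine ((Submodule.map_id _).symm.trans e.symm).trans_le ?_
    refine (Submodule.map_comp _ _ _).trans_le (Submodule.map_mono ?_)
    refine (Submodule.map_comp _ _ _).trans_le ?_
    exact (Submodule.map_mono (map_pairOp_le h.l h'.l _)).trans (map_pairOp_le h.r h'.l _)

/-- On stable submodules, the deformed product has the same span as the product. -/
theorem map₂_twistMul {a : Site K M X} {b : Site K M Y} {Z : Submodule K X} {Z' : Submodule K Y}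
    (h : a.Stable Z) (h' : b.Stable Z') (m : X ⊗[K] Y →ₗ[K] X') :
    Submodule.map₂ (TensorProduct.curry (S.twistMul m a b)) Z Z' =
      Submodule.map₂ (TensorProduct.curry m) Z Z' := by
  have e (n : X ⊗[K] Y →ₗ[K] X') : TensorProduct.lift (TensorProduct.curry n) = n :=
    TensorProduct.ext' fun _ _ => rfl
  rw [TensorProduct.map₂_eq_range_lift_comp_mapIncl, TensorProduct.map₂_eq_range_lift_comp_mapIncl,
    e, e, LinearMap.range_comp, LinearMap.range_comp,
    twistMul, Submodule.map_comp, map_twist h h']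

end DualQuasitriangular.SecondInverse

end Twist

section MatrixSites

variable {K M V V' ι : Type*} [Field K] [Semiring M] [Bialgebra K M] [AddCommMonoid V] [Module K V]
  [AddCommMonoid V'] [Module K V'] [Fintype ι]

theorem pairOp_lift_sum {κ κ' : Type*} [Fintype κ] [Fintype κ'] {δ : V →ₗ[K] V ⊗[K] M}
    {ε : V' →ₗ[K] V' ⊗[K] M} (f : M ⊗[K] M →ₗ[K] K) {x : V} {y : V'} {x' : κ → V} {m : κ → M}
    {y' : κ' → V'} {n : κ' → M} (hx : δ x = ∑ a, x' a ⊗ₜ m a) (hy : ε y = ∑ b, y' b ⊗ₜ n b) :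
    pairOp f (liftL V' δ) (liftR V ε) (x ⊗ₜ y) =
      ∑ a, ∑ b, f (m a ⊗ₜ n b) • (x' a ⊗ₜ[K] y' b) := by
  simp only [pairOp, joint, evalFun_apply, comp_apply, liftR_tmul, hy,
    tmul_sum, map_sum, assoc_symm_tmul, rTensor_tmul,
    liftL_tmul, hx, sum_tmul, rightComm_tmul, coe_coe,
    assoc_tmul, lTensor_tmul, TensorProduct.rid_tmul]
  exact sum_comm

/-- The entries of `t` are coacted on as the entries of the matrix coalgebra `τ`. -/
structure Site.IsMatrix (v : Site K M V) (τ : Matrix ι ι M) (t : Matrix ι ι V) : Prop where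
  l : ∀ i j, v.l.δ (t i j) = ∑ a, t a j ⊗ₜ τ i a
  r : ∀ i j, v.r.δ (t i j) = ∑ a, t i a ⊗ₜ τ a j

namespace DualQuasitriangular.SecondInverse

variable {Q : DualQuasitriangular K M} {S : Q.SecondInverse}

theorem sum_form_smul_twistMul {v : Site K M V} {τ : Matrix ι ι M} {t : Matrix ι ι V}
    (h : v.IsMatrix τ t) (m : V ⊗[K] V →ₗ[K] V') (i k j l : ι) :
    ∑ a, ∑ b, Q.form (τ a j ⊗ₜ τ k b) • S.twistMul m v v (t i a ⊗ₜ t b l) =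
      ∑ a, ∑ b, Q.form (τ i a ⊗ₜ τ k b) • m (t a j ⊗ₜ t b l) := by
  have e := congrArg m (LinearMap.congr_fun
    (twist_comp_form (S := S) (Site.indep_liftL_liftR v v)) (t i j ⊗ₜ t k l))
  have e1 := pairOp_lift_sum Q.form (h.r i j) (h.l k l)
  have e2 := pairOp_lift_sum Q.form (h.l i j) (h.l k l)
  have e3 : S.twistMul m v v (pairOp Q.form (liftL V v.r.δ) (liftR V v.l.δ) (t i j ⊗ₜ t k l)) =
    m (pairOp Q.form (liftL V v.l.δ) (liftR V v.l.δ) (t i j ⊗ₜ t k l)) := e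
  simp only [e1, e2, map_sum, map_smul] at e3
  exact e3

end DualQuasitriangular.SecondInverse

end MatrixSites

section AssociativeProducts

variable {K V : Type*} [Field K] [AddCommGroup V] [Module K V]

theorem exists_algebra_of_mul {μ : V ⊗[K] V →ₗ[K] V} {e : V}
    (assoc : μ ∘ₗ μ.rTensor V = μ ∘ₗ μ.lTensor V ∘ₗ (TensorProduct.assoc K V V V).toLinearMap)
    (one_mul : ∀ x, μ (e ⊗ₜ x) = x) (mul_one : ∀ x, μ (x ⊗ₜ e) = x) :
    ∃ (E : Subalgebra K (Module.End K V)) (j : V ≃ₗ[K] E), j e = 1 ∧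
      ∀ x y, j (μ (x ⊗ₜ y)) = j x * j y := by
  have h (x y z : V) : μ (μ (x ⊗ₜ y) ⊗ₜ z) = μ (x ⊗ₜ μ (y ⊗ₜ z)) :=
    LinearMap.congr_fun assoc ((x ⊗ₜ y) ⊗ₜ z)
  let E : Subalgebra K (Module.End K V) :=
    { carrier := {f | ∀ x, f x = μ (f e ⊗ₜ x)}
      mul_mem' := fun {f g} hf hg x => by
        rw [Module.End.mul_apply, Module.End.mul_apply, hg x, hf, hf (g e), h]
      add_mem' := fun {f g} hf hg x => by
        rw [LinearMap.add_apply, LinearMap.add_apply, add_tmul, map_add, ← hf, ← hg]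
      algebraMap_mem' := fun k x => by
        rw [Module.algebraMap_end_apply, Module.algebraMap_end_apply, ← smul_tmul',
          map_smul, one_mul] }
  let j : V ≃ₗ[K] E :=
    { toFun := fun v => ⟨TensorProduct.curry μ v, fun x => by
        rw [curry_apply, curry_apply, mul_one]⟩
      invFun := fun f => f.1 e
      map_add' := fun v w => Subtype.ext (map_add _ v w)
      map_smul' := fun k v => Subtype.ext (map_smul _ k v)
      left_inv := mul_one
      right_inv := fun f => Subtype.ext (LinearMap.ext fun x => (f.2 x).symm) }
  refine ⟨E, j, Subtype.ext (LinearMap.ext one_mul), fun x y => Subtype.ext ?_⟩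
  exact LinearMap.ext fun z => h x y z

end AssociativeProducts

section AlgebraLines

variable {K M B : Type*} [Field K] [Semiring M] [Algebra K M] [Semiring B] [Algebra K B]

theorem isSlot_of_algHom {δ : B →ₐ[K] B ⊗[K] M} {d : M →ₐ[K] M ⊗[K] M} {e : M →ₐ[K] K}
    (h : (Algebra.TensorProduct.assoc K K K B M M).toAlgHom.comp
        ((Algebra.TensorProduct.map δ (AlgHom.id K M)).comp δ) =
      (Algebra.TensorProduct.map (AlgHom.id K B) d).comp δ)
    (h' : (Algebra.TensorProduct.rid K K B).toAlgHom.comp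
      ((Algebra.TensorProduct.map (AlgHom.id K B) e).comp δ) = AlgHom.id K B) :
    IsSlot d.toLinearMap e.toLinearMap δ.toLinearMap where
  coassoc := LinearMap.ext fun x => DFunLike.congr_fun h x
  counit := LinearMap.ext fun x => DFunLike.congr_fun h' x

theorem coComm_of_algHom {δ ε : B →ₐ[K] B ⊗[K] M}
    (h : (Algebra.TensorProduct.map δ (AlgHom.id K M)).comp ε =
      ((Algebra.TensorProduct.assoc K K K B M M).symm.toAlgHom.comp
        ((Algebra.TensorProduct.map (AlgHom.id K B) (Algebra.TensorProduct.comm K M M).toAlgHom).comp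
          (Algebra.TensorProduct.assoc K K K B M M).toAlgHom)).comp
        ((Algebra.TensorProduct.map ε (AlgHom.id K M)).comp δ)) :
    CoComm δ.toLinearMap ε.toLinearMap := by
  have e : (rightComm K B M M).toLinearMap =
      ((Algebra.TensorProduct.assoc K K K B M M).symm.toAlgHom.comp
        ((Algebra.TensorProduct.map (AlgHom.id K B) (Algebra.TensorProduct.comm K M M).toAlgHom).comp
          (Algebra.TensorProduct.assoc K K K B M M).toAlgHom)).toLinearMap := by
    ext; rfl
  unfold CoComm
  rw [e]
  exact LinearMap.ext fun x => DFunLike.congr_fun h x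

end AlgebraLines

section FreeSite

variable {K M ι : Type*} [Field K] [Semiring M] [Bialgebra K M] [Fintype ι] [DecidableEq ι]

/-- `Δ τⁱⱼ = ∑ τⁱₐ ⊗ τᵃⱼ` and `ε τⁱⱼ = δⁱⱼ`. -/
structure IsMatrixCoalgebra (K : Type*) {M ι : Type*} [Field K] [Semiring M] [Bialgebra K M]
    [Fintype ι] [DecidableEq ι] (τ : Matrix ι ι M) : Prop where
  comul : ∀ i j, Coalgebra.comul (R := K) (τ i j) = ∑ a, τ i a ⊗ₜ[K] τ a j
  counit : ∀ i j, Coalgebra.counit (R := K) (τ i j) = if i = j then 1 else 0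

/-- The right coaction `tⁱⱼ ↦ ∑ tⁱₐ ⊗ τᵃⱼ` on the free algebra. -/
noncomputable def freeRight (K : Type*) {M ι : Type*} [Field K] [Semiring M] [Bialgebra K M]
    [Fintype ι] (τ : Matrix ι ι M) :
    FreeAlgebra K (ι × ι) →ₐ[K] FreeAlgebra K (ι × ι) ⊗[K] M :=
  FreeAlgebra.lift K fun p => ∑ a, freeGen K ι p.1 a ⊗ₜ τ a p.2

/-- The left coaction `tⁱⱼ ↦ ∑ τⁱₐ ⊗ tᵃⱼ` on the free algebra, with its factors exchanged. -/
noncomputable def freeLeft (K : Type*) {M ι : Type*} [Field K] [Semiring M] [Bialgebra K M]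
    [Fintype ι] (τ : Matrix ι ι M) :
    FreeAlgebra K (ι × ι) →ₐ[K] FreeAlgebra K (ι × ι) ⊗[K] M :=
  FreeAlgebra.lift K fun p => ∑ a, freeGen K ι a p.2 ⊗ₜ τ p.1 a

theorem freeRight_gen (τ : Matrix ι ι M) (i j : ι) :
    freeRight K τ (freeGen K ι i j) = ∑ a, freeGen K ι i a ⊗ₜ τ a j := by
  simp [freeRight, freeGen]

theorem freeLeft_gen (τ : Matrix ι ι M) (i j : ι) :
    freeLeft K τ (freeGen K ι i j) = ∑ a, freeGen K ι a j ⊗ₜ τ i a := by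
  simp [freeLeft, freeGen]

theorem freeGen_hom_ext {S : Type*} [Semiring S] [Algebra K S] {f g : FreeAlgebra K (ι × ι) →ₐ[K] S}
    (h : ∀ i j, f (freeGen K ι i j) = g (freeGen K ι i j)) : f = g :=
  FreeAlgebra.hom_ext (funext fun p => h p.1 p.2)

variable {τ : Matrix ι ι M}

theorem isSlot_freeRight (h : IsMatrixCoalgebra K τ) :
    IsSlot (Coalgebra.comul (R := K) (A := M)) Coalgebra.counit (freeRight K τ).toLinearMap := by
  refine isSlot_of_algHom (d := Bialgebra.comulAlgHom K M) (e := Bialgebra.counitAlgHom K M)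
    (freeGen_hom_ext fun i j => ?_) (freeGen_hom_ext fun i j => ?_)
  · simp only [AlgHom.comp_apply, freeRight_gen, map_sum, Algebra.TensorProduct.map_tmul,
      AlgHom.id_apply, sum_tmul, Bialgebra.comulAlgHom_apply, h.comul,
      tmul_sum]
    rw [sum_comm]
    rfl
  · simp only [AlgHom.comp_apply, freeRight_gen, map_sum, Algebra.TensorProduct.map_tmul,
      AlgHom.id_apply, Bialgebra.counitAlgHom_apply, h.counit]
    change ∑ a, Algebra.TensorProduct.rid K K _ _ = _
    simp [Algebra.TensorProduct.rid_tmul]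

theorem isSlot_freeLeft (h : IsMatrixCoalgebra K τ) :
    IsSlot (comulOp K M) Coalgebra.counit (freeLeft K τ).toLinearMap := by
  refine isSlot_of_algHom (d := (Algebra.TensorProduct.comm K M M).toAlgHom.comp
    (Bialgebra.comulAlgHom K M)) (e := Bialgebra.counitAlgHom K M)
    (freeGen_hom_ext fun i j => ?_) (freeGen_hom_ext fun i j => ?_)
  · simp only [AlgHom.comp_apply, freeLeft_gen, map_sum, Algebra.TensorProduct.map_tmul,
      AlgHom.id_apply, sum_tmul, Bialgebra.comulAlgHom_apply, h.comul,
      tmul_sum]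
    rw [sum_comm]
    rfl
  · simp only [AlgHom.comp_apply, freeLeft_gen, map_sum, Algebra.TensorProduct.map_tmul,
      AlgHom.id_apply, Bialgebra.counitAlgHom_apply, h.counit]
    change ∑ a, Algebra.TensorProduct.rid K K _ _ = _
    simp [Algebra.TensorProduct.rid_tmul]

theorem coComm_freeLeft_freeRight (τ : Matrix ι ι M) :
    CoComm (freeLeft K τ).toLinearMap (freeRight K τ).toLinearMap := by
  refine coComm_of_algHom (freeGen_hom_ext fun i j => ?_)
  simp only [AlgHom.comp_apply, freeLeft_gen, freeRight_gen, map_sum,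
    Algebra.TensorProduct.map_tmul, AlgHom.id_apply, sum_tmul]
  rw [sum_comm]
  rfl

/-- The bicomodule structure of the free algebra. -/
noncomputable def Site.free (h : IsMatrixCoalgebra K τ) : Site K M (FreeAlgebra K (ι × ι)) where
  l := ⟨(freeLeft K τ).toLinearMap, isSlot_freeLeft h⟩
  r := ⟨(freeRight K τ).toLinearMap, isSlot_freeRight h⟩
  indep := coComm_freeLeft_freeRight τ

theorem Site.isMatrix_free (h : IsMatrixCoalgebra K τ) : (Site.free h).IsMatrix τ (freeGen K ι) :=
  ⟨freeLeft_gen τ, freeRight_gen τ⟩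

theorem Site.prod_free (h : IsMatrixCoalgebra K τ) : Site.Prod (mul' K _)
    ((Site.free h).liftL _) ((Site.free h).liftR _) (Site.free h) :=
  ⟨prodAlong_mul' (freeLeft K τ), prodAlong_mul' (freeRight K τ)⟩

theorem Site.trivAt_free (h : IsMatrixCoalgebra K τ) : (Site.free h).TrivAt 1 :=
  ⟨map_one (freeLeft K τ), map_one (freeRight K τ)⟩

theorem Site.stable_free_mul (h : IsMatrixCoalgebra K τ)
    {Z Z' : Submodule K (FreeAlgebra K (ι × ι))}
    (hz : (Site.free h).Stable Z) (hz' : (Site.free h).Stable Z') : (Site.free h).Stable (Z * Z') :=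
  ⟨StableUnder.mul (δ := freeLeft K τ) hz.l hz'.l, StableUnder.mul (δ := freeRight K τ) hz.r hz'.r⟩

theorem Site.stable_free_pow (h : IsMatrixCoalgebra K τ)
    {Z : Submodule K (FreeAlgebra K (ι × ι))}
    (hz : (Site.free h).Stable Z) (n : ℕ) : (Site.free h).Stable (Z ^ n) :=
  ⟨StableUnder.pow (δ := freeLeft K τ) hz.l n, StableUnder.pow (δ := freeRight K τ) hz.r n⟩

end FreeSite

section Deformation

variable {K M ι : Type*} [Field K] [Ring M] [Bialgebra K M] [Fintype ι] [DecidableEq ι]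

/-- The span of `1` and the generators. -/
def freeLow (K ι : Type*) [Field K] : Submodule K (FreeAlgebra K (ι × ι)) :=
  Submodule.span K (insert 1 (Set.range fun p : ι × ι => freeGen K ι p.1 p.2))

theorem one_le_freeLow : 1 ≤ freeLow K ι :=
  Submodule.one_le.2 (Submodule.subset_span (Set.mem_insert _ _))

theorem freeGen_mem_freeLow (i j : ι) : freeGen K ι i j ∈ freeLow K ι :=
  Submodule.subset_span (Set.mem_insert_of_mem _ ⟨(i, j), rfl⟩)

theorem stable_freeLow {τ : Matrix ι ι M} (h : IsMatrixCoalgebra K τ) :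
    (Site.free h).Stable (freeLow K ι) := by
  constructor
  · refine Submodule.span_le.2 ?_
    rintro _ (rfl | ⟨p, rfl⟩)
    · have := (Site.trivAt_free h).l
      rw [SetLike.mem_coe, Submodule.mem_comap, this]
      exact Submodule.tmul_mem_extend (one_le_freeLow (Submodule.one_le.1 le_rfl)) _
    · have := (Site.isMatrix_free h).l p.1 p.2
      rw [SetLike.mem_coe, Submodule.mem_comap, this]
      exact sum_mem fun a _ => Submodule.tmul_mem_extend (freeGen_mem_freeLow _ _) _
  · refine Submodule.span_le.2 ?_
    rintro _ (rfl | ⟨p, rfl⟩)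
    · have := (Site.trivAt_free h).r
      rw [SetLike.mem_coe, Submodule.mem_comap, this]
      exact Submodule.tmul_mem_extend (one_le_freeLow (Submodule.one_le.1 le_rfl)) _
    · have := (Site.isMatrix_free h).r p.1 p.2
      rw [SetLike.mem_coe, Submodule.mem_comap, this]
      exact sum_mem fun a _ => Submodule.tmul_mem_extend (freeGen_mem_freeLow _ _) _

theorem exists_mem_freeLow_pow (x : FreeAlgebra K (ι × ι)) : ∃ n, x ∈ freeLow K ι ^ n := by
  have mono (m n : ℕ) (hmn : m ≤ n) : freeLow K ι ^ m ≤ freeLow K ι ^ n :=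
    pow_le_pow_right₀ one_le_freeLow hmn
  induction x using FreeAlgebra.induction with
  | grade0 a => exact ⟨0, by simp⟩
  | grade1 p => exact ⟨1, by rw [pow_one]; exact freeGen_mem_freeLow p.1 p.2⟩
  | mul x y hx hy =>
    obtain ⟨m, hm⟩ := hx
    obtain ⟨n, hn⟩ := hy
    exact ⟨m + n, by rw [pow_add]; exact Submodule.mul_mem_mul hm hn⟩
  | add x y hx hy =>
    obtain ⟨m, hm⟩ := hx
    obtain ⟨n, hn⟩ := hy
    exact ⟨max m n, add_mem (mono _ _ (le_max_left _ _) hm) (mono _ _ (le_max_right _ _) hn)⟩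

theorem fg_freeLow_pow (n : ℕ) : (freeLow K ι ^ n).FG :=
  Submodule.FG.pow (Submodule.fg_span ((Set.finite_range _).insert _)) n

variable {Q : DualQuasitriangular K M} (S : Q.SecondInverse)

namespace DualQuasitriangular.SecondInverse

/-- The deformed product of the free algebra. -/
noncomputable def freeMul {τ : Matrix ι ι M} (h : IsMatrixCoalgebra K τ) :
    FreeAlgebra K (ι × ι) ⊗[K] FreeAlgebra K (ι × ι) →ₗ[K] FreeAlgebra K (ι × ι) :=
  S.twistMul (mul' K _) (Site.free h) (Site.free h)

variable {S} in
theorem map₂_freeMul {τ : Matrix ι ι M} (h : IsMatrixCoalgebra K τ)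
    {Z Z' : Submodule K (FreeAlgebra K (ι × ι))} (hZ : (Site.free h).Stable Z)
    (hZ' : (Site.free h).Stable Z') :
    Submodule.map₂ (TensorProduct.curry (S.freeMul h)) Z Z' = Z * Z' :=
  (map₂_twistMul hZ hZ' _).trans Submodule.mul_eq_map₂.symm

theorem exists_freeEquiv {τ : Matrix ι ι M} (h : IsMatrixCoalgebra K τ) :
    ∃ θ : FreeAlgebra K (ι × ι) ≃ₗ[K] FreeAlgebra K (ι × ι), θ 1 = 1 ∧
      (∀ i j, θ (freeGen K ι i j) = freeGen K ι i j) ∧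
      ∀ x y, θ (x * y) = S.freeMul h (θ x ⊗ₜ θ y) := by
  obtain ⟨E, j, j1, jm⟩ := exists_algebra_of_mul (μ := S.freeMul h) (e := 1)
    (twistMul_assoc (Site.prod_free h) (by ext x y z; simp [mul_assoc]))
    (fun x => (twistMul_triv (Site.trivAt_free h) _ _ _).trans (by simp))
    (fun x => (triv_twistMul (Site.trivAt_free h).l _ _ _).trans (by simp))
  let f : FreeAlgebra K (ι × ι) →ₐ[K] E :=
    FreeAlgebra.lift K fun p => j (freeGen K ι p.1 p.2)
  let θ : FreeAlgebra K (ι × ι) →ₗ[K] FreeAlgebra K (ι × ι) := j.symm.toLinearMap ∘ₗ f.toLinearMap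
  have θ1 : θ 1 = 1 := by
    simp [θ, ← j1]
  have θt (i k : ι) : θ (freeGen K ι i k) = freeGen K ι i k := by
    simp [θ, f, freeGen]
  have θm (x y : FreeAlgebra K (ι × ι)) : θ (x * y) = S.freeMul h (θ x ⊗ₜ θ y) := by
    apply j.injective
    rw [jm]
    simp [θ]
  have hP : (freeLow K ι).map θ = freeLow K ι := by
    have e : Set.EqOn θ (LinearMap.id : FreeAlgebra K (ι × ι) →ₗ[K] _) (freeLow K ι) := by
      refine LinearMap.eqOn_span' ?_
      rintro _ (rfl | ⟨p, rfl⟩)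
      · exact θ1
      · exact θt _ _
    refine SetLike.coe_injective ?_
    rw [Submodule.map_coe, Set.EqOn.image_eq e]
    simp
  have hn (n : ℕ) : (freeLow K ι ^ n).map θ = freeLow K ι ^ n := by
    induction n with
    | zero =>
      rw [pow_zero, Submodule.one_eq_span, Submodule.map_span, Set.image_singleton, θ1]
    | succ n ih =>
      have e1 : (freeLow K ι * freeLow K ι ^ n).map θ =
          Submodule.map₂ (TensorProduct.curry (S.freeMul h)) (freeLow K ι) (freeLow K ι ^ n) := by
        rw [show Submodule.map₂ (TensorProduct.curry (S.freeMul h)) (freeLow K ι) (freeLow K ι ^ n) =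
          Submodule.map₂ (TensorProduct.curry (S.freeMul h)) ((freeLow K ι).map θ)
            ((freeLow K ι ^ n).map θ) by rw [hP, ih]]
        rw [Submodule.mul_eq_map₂, Submodule.map_map₂, Submodule.map₂_map_map]
        exact congrArg (fun g => Submodule.map₂ g _ _) (LinearMap.ext₂ θm)
      rw [pow_succ', e1]
      exact map₂_freeMul h (stable_freeLow h) (Site.stable_free_pow h (stable_freeLow h) n)
  have inj : Function.Injective θ := by
    refine (injective_iff_map_eq_zero θ).2 fun x hx => ?_
    obtain ⟨n, hxn⟩ := exists_mem_freeLow_pow x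
    have hmem : ∀ y ∈ freeLow K ι ^ n, θ y ∈ freeLow K ι ^ n := fun y hy => by
      have := Submodule.mem_map_of_mem (f := θ) hy
      rwa [hn] at this
    have : FiniteDimensional K (freeLow K ι ^ n : Submodule K (FreeAlgebra K (ι × ι))) :=
      Module.Finite.iff_fg.2 (fg_freeLow_pow n)
    have surj : Function.Surjective (θ.restrict hmem) := by
      rintro ⟨y, hy⟩
      rw [← hn] at hy
      obtain ⟨z, hz, rfl⟩ := hy
      exact ⟨⟨z, hz⟩, rfl⟩
    have := LinearMap.injective_iff_surjective.2 surj
    exact congrArg Subtype.val (@this ⟨x, hxn⟩ 0 (Subtype.ext (hx.trans (map_zero θ).symm)))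
  have surj : Function.Surjective θ := fun x => by
    obtain ⟨n, hxn⟩ := exists_mem_freeLow_pow x
    rw [← hn] at hxn
    obtain ⟨y, -, hy⟩ := hxn
    exact ⟨y, hy⟩
  exact ⟨LinearEquiv.ofBijective θ ⟨inj, surj⟩, θ1, θt, θm⟩

end DualQuasitriangular.SecondInverse

end Deformation

section BraidedRelations

variable {K ι S B : Type*} [Field K] [Fintype ι] [DecidableEq ι] [Semiring S] [Algebra K S]
  [Semiring B] [Algebra K B] {R : Matrix (ι × ι) (ι × ι) K} {c : Matrix ι (ι × ι) K}

/-- `x` satisfies the defining relations of the braided comeasuring bialgebra. -/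
def SatisfiesBraided (R : Matrix (ι × ι) (ι × ι) K) (c : Matrix ι (ι × ι) K)
    (x : Matrix ι ι S) : Prop :=
  scalars S (flip₂₁ R) * leg₁ x * scalars S R * leg₂ x =
      leg₂ x * scalars S (flip₂₁ R) * leg₁ x * scalars S R ∧
    x * scalars S c = scalars S c * scalars S R⁻¹ * leg₁ x * scalars S R * leg₂ x

theorem satisfiesBraided_uGen (R : Matrix (ι × ι) (ι × ι) K) (c : Matrix ι (ι × ι) K) :
    SatisfiesBraided R c (uGen R c) := by
  let π := RingQuot.mkAlgHom K (BraidedComeasuringRel R c)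
  have ht : uGen R c = (freeGen K ι).map (π : FreeAlgebra K (ι × ι) →+* BraidedComeasuring R c) :=
    rfl
  have h1 := Matrix.ext fun p q => RingQuot.mkAlgHom_rel K (BraidedComeasuringRel.braided
    (R := R) (c := c) p q)
  have h2 := Matrix.ext fun p q => RingQuot.mkAlgHom_rel K (BraidedComeasuringRel.comeasure
    (R := R) (c := c) p q)
  change Matrix.map _ (π : FreeAlgebra K (ι × ι) →+* BraidedComeasuring R c) =
    Matrix.map _ (π : FreeAlgebra K (ι × ι) →+* BraidedComeasuring R c) at h1 h2
  simp only [Matrix.map_mul, leg₁_map, leg₂_map, scalars_map, ← ht] at h1 h2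
  exact ⟨h1, h2⟩

/-- Universal property of the algebra of the braided comeasuring bialgebra. -/
theorem BraidedComeasuring.exists_lift {x : Matrix ι ι S} (h : SatisfiesBraided R c x) :
    ∃ f : BraidedComeasuring R c →ₐ[K] S, ∀ i j, f (uGen R c i j) = x i j := by
  let f : FreeAlgebra K (ι × ι) →ₐ[K] S := FreeAlgebra.lift K fun p : ι × ι => x p.1 p.2
  have hx : x = (freeGen K ι).map (f : FreeAlgebra K (ι × ι) →+* S) := by
    ext i j
    simp [freeGen, f]
  refine ⟨RingQuot.liftAlgHom K ⟨f, fun a b hab => ?_⟩, fun i j => ?_⟩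
  · cases hab with
    | braided p q =>
      have := congrFun (congrFun h.1 p) q
      rw [hx] at this
      simp only [← leg₁_map, ← leg₂_map, ← scalars_map f, ← Matrix.map_mul] at this
      exact this
    | comeasure l q =>
      have := congrFun (congrFun h.2 l) q
      rw [hx] at this
      simp only [← leg₁_map, ← leg₂_map, ← scalars_map f, ← Matrix.map_mul] at this
      exact this
  · simp [uGen, freeGen, f]

theorem scalars_mul {l m n : Type*} [Fintype m] (X : Matrix l m K) (Y : Matrix m n K) :
    scalars S (X * Y) = scalars S X * scalars S Y := Matrix.map_mul

theorem scalars_one {m : Type*} [DecidableEq m] : scalars S (1 : Matrix m m K) = 1 :=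
  Matrix.map_one _ (map_zero _) (map_one _)

theorem scalars_mul_map {l m n : Type*} [Fintype m] (h : B →ₗ[K] S) (X : Matrix l m K)
    (Y : Matrix m n B) : (scalars B X * Y).map h = scalars S X * Y.map h := by
  refine Matrix.ext fun p q => ?_
  simp only [Matrix.map_apply, Matrix.mul_apply, scalars, ← Algebra.smul_def, map_sum, map_smul]

theorem mul_scalars_map {l m n : Type*} [Fintype m] (h : B →ₗ[K] S) (X : Matrix m n K)
    (Y : Matrix l m B) : (Y * scalars B X).map h = Y.map h * scalars S X := by
  refine Matrix.ext fun p q => ?_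
  simp only [Matrix.map_apply, Matrix.mul_apply, scalars, ← Algebra.commutes, ← Algebra.smul_def,
    map_sum, map_smul]

theorem flip₂₁_mul (X Y : Matrix (ι × ι) (ι × ι) S) : flip₂₁ (X * Y) = flip₂₁ X * flip₂₁ Y := by
  refine Matrix.ext fun p q => ?_
  simp only [flip₂₁, Matrix.of_apply, Matrix.mul_apply]
  exact Fintype.sum_equiv (Equiv.prodComm ι ι) _ _ fun _ => rfl

theorem flip₂₁_leg₁ (x : Matrix ι ι S) : flip₂₁ (leg₁ x) = leg₂ x := rfl

theorem flip₂₁_leg₂ (x : Matrix ι ι S) : flip₂₁ (leg₂ x) = leg₁ x := rfl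

theorem leg₂_mul_leg₁_eq_flip₂₁ (t : Matrix ι ι S) : leg₂ t * leg₁ t = flip₂₁ (leg₁ t * leg₂ t) := by
  refine Matrix.ext fun p q => ?_
  rw [leg₂_mul_leg₁]
  exact (leg₁_mul_leg₂ t t (p.2, p.1) (q.2, q.1)).symm

/-- If a linear map `h` takes `R t₁ t₂` to `x₁ R x₂` then `x` satisfies the braided relations if
and only if `h` respects the relations of `M₁(R, A)` at `t`. -/
theorem satisfiesBraided_iff_map (hR : IsUnit R) {h : B →ₗ[K] S} {t : Matrix ι ι B}
    {x : Matrix ι ι S} (hx : t.map h = x)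
    (hq : leg₁ x * scalars S R * leg₂ x = (scalars B R * leg₁ t * leg₂ t).map h) :
    SatisfiesBraided R c x ↔
      (scalars B R * leg₁ t * leg₂ t).map h = (leg₂ t * leg₁ t * scalars B R).map h ∧
      (t * scalars B c).map h = (scalars B c * leg₁ t * leg₂ t).map h := by
  rw [Matrix.isUnit_iff_isUnit_det] at hR
  have i1 : scalars S R⁻¹ * scalars S R = 1 := by
    rw [← scalars_mul, Matrix.nonsing_inv_mul _ hR, scalars_one]
  have i2 : scalars S (flip₂₁ R⁻¹) * scalars S (flip₂₁ R) = 1 := by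
    rw [← scalars_mul, ← flip₂₁_mul, Matrix.nonsing_inv_mul _ hR]
    refine Eq.trans (congrArg _ ?_) scalars_one
    ext p q
    simp [flip₂₁, Matrix.one_apply, Prod.ext_iff, and_comm]
  have hN : (leg₂ t * leg₁ t).map h = flip₂₁ ((leg₁ t * leg₂ t).map h) := by
    rw [leg₂_mul_leg₁_eq_flip₂₁]; rfl
  have hq' : scalars S R * (leg₁ t * leg₂ t).map h = leg₁ x * scalars S R * leg₂ x := by
    rw [hq, ← scalars_mul_map, Matrix.mul_assoc]
  have hf : scalars S (flip₂₁ R) * (leg₂ t * leg₁ t).map h =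
      leg₂ x * scalars S (flip₂₁ R) * leg₁ x := by
    have := congrArg flip₂₁ hq'
    rw [flip₂₁_mul, flip₂₁_mul, flip₂₁_mul, flip₂₁_leg₁, flip₂₁_leg₂, ← hN] at this
    exact this
  rw [mul_scalars_map, mul_scalars_map, hx, Matrix.mul_assoc (scalars B c), scalars_mul_map, ← hq]
  have e2 : scalars S c * scalars S R⁻¹ * leg₁ x * scalars S R * leg₂ x =
      scalars S c * (leg₁ t * leg₂ t).map h := by
    calc _ = scalars S c * (scalars S R⁻¹ * (leg₁ x * scalars S R * leg₂ x)) := by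
          simp only [Matrix.mul_assoc]
      _ = _ := by rw [← hq', ← Matrix.mul_assoc (scalars S R⁻¹), i1, Matrix.one_mul]
  unfold SatisfiesBraided
  rw [e2, ← hf]
  refine and_congr_left' ⟨fun h' => ?_, fun h' => ?_⟩
  · have := congrArg (scalars S (flip₂₁ R⁻¹) * ·) h'
    simp only [Matrix.mul_assoc] at this
    simp only [← Matrix.mul_assoc, i2, Matrix.one_mul] at this
    exact this
  · rw [Matrix.mul_assoc, Matrix.mul_assoc, Matrix.mul_assoc, ← h']
    simp only [Matrix.mul_assoc]

theorem leg₁_mul_scalars_mul_leg₂ (x y : Matrix ι ι S) (i k j l : ι) :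
    (leg₁ x * scalars S R * leg₂ y) (i, k) (j, l) =
      ∑ a, ∑ b, R (a, k) (j, b) • (x i a * y b l) := by
  simp [Matrix.mul_apply, Fintype.sum_prod_type, leg₁, leg₂, scalars, Algebra.smul_def,
    Finset.sum_mul, ← Algebra.commutes, mul_assoc]
  rw [sum_comm]

theorem scalars_mul_leg₁_mul_leg₂ (x y : Matrix ι ι S) (i k j l : ι) :
    (scalars S R * leg₁ x * leg₂ y) (i, k) (j, l) =
      ∑ a, ∑ b, R (i, k) (a, b) • (x a j * y b l) := by
  rw [Matrix.mul_assoc, Matrix.mul_apply, Fintype.sum_prod_type]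
  simp [leg₁_mul_leg₂, scalars, Algebra.smul_def]

end BraidedRelations

section Defects

variable {K ι S T : Type*} [Field K] [Fintype ι] [DecidableEq ι] [Ring S] [Algebra K S]
  [Ring T] [Algebra K T] {R : Matrix (ι × ι) (ι × ι) K} {c : Matrix ι (ι × ι) K}

/-- The failure of the quantum matrix relations. -/
def quantumDefect (R : Matrix (ι × ι) (ι × ι) K) (x : Matrix ι ι S) : Matrix (ι × ι) (ι × ι) S :=
  scalars S R * leg₁ x * leg₂ x - leg₂ x * leg₁ x * scalars S R

/-- The failure of the comeasuring relations. -/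
def comeasureDefect (c : Matrix ι (ι × ι) K) (x : Matrix ι ι S) : Matrix ι (ι × ι) S :=
  x * scalars S c - scalars S c * leg₁ x * leg₂ x

theorem quantumDefect_map (f : S →ₐ[K] T) (x : Matrix ι ι S) :
    (quantumDefect R x).map f = quantumDefect R (x.map f) := by
  change Matrix.map _ (f : S →+* T) = quantumDefect R (x.map (f : S →+* T))
  simp only [quantumDefect, ← leg₁_map, ← leg₂_map, ← scalars_map f, ← Matrix.map_mul]
  exact Matrix.map_sub _ (map_sub _) _ _

theorem comeasureDefect_map (f : S →ₐ[K] T) (x : Matrix ι ι S) :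
    (comeasureDefect c x).map f = comeasureDefect c (x.map f) := by
  change Matrix.map _ (f : S →+* T) = comeasureDefect c (x.map (f : S →+* T))
  simp only [comeasureDefect, ← leg₁_map, ← leg₂_map, ← scalars_map f, ← Matrix.map_mul]
  exact Matrix.map_sub _ (map_sub _) _ _

variable {x y : Matrix ι ι S}

theorem quantumDefect_mul (hy : SatisfiesComeasuring R c y)
    (h : ∀ i j a b, Commute (x i j) (y a b)) :
    quantumDefect R (x * y) = quantumDefect R x * (leg₁ y * leg₂ y) := by
  have e1 : leg₁ y * leg₂ x = leg₂ x * leg₁ y := leg₁_comm_leg₂ fun i j a b => (h a b i j).symm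
  have e2 : leg₁ x * leg₂ y = leg₂ y * leg₁ x := leg₁_comm_leg₂ h
  unfold quantumDefect
  rw [Matrix.sub_mul, leg₁_mul, leg₂_mul]
  congr 1
  · calc _ = scalars S R * leg₁ x * (leg₁ y * leg₂ x) * leg₂ y := by simp only [Matrix.mul_assoc]
      _ = _ := by simp only [e1, Matrix.mul_assoc]
  · calc _ = leg₂ x * (leg₂ y * leg₁ x) * leg₁ y * scalars S R := by simp only [Matrix.mul_assoc]
      _ = leg₂ x * leg₁ x * (leg₂ y * leg₁ y * scalars S R) := by
        simp only [← e2, Matrix.mul_assoc]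
      _ = _ := by simp only [← hy.1, Matrix.mul_assoc]

theorem mul_quantumDefect (hy : SatisfiesComeasuring R c y)
    (h : ∀ i j a b, Commute (x i j) (y a b)) :
    quantumDefect R (y * x) = leg₂ y * leg₁ y * quantumDefect R x := by
  have e1 : leg₁ y * leg₂ x = leg₂ x * leg₁ y := leg₁_comm_leg₂ fun i j a b => (h a b i j).symm
  have e2 : leg₁ x * leg₂ y = leg₂ y * leg₁ x := leg₁_comm_leg₂ h
  unfold quantumDefect
  rw [Matrix.mul_sub, leg₁_mul, leg₂_mul]
  congr 1
  · calc _ = scalars S R * leg₁ y * (leg₁ x * leg₂ y) * leg₂ x := by simp only [Matrix.mul_assoc]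
      _ = scalars S R * leg₁ y * leg₂ y * (leg₁ x * leg₂ x) := by simp only [e2, Matrix.mul_assoc]
      _ = _ := by simp only [hy.1, Matrix.mul_assoc]
  · calc _ = leg₂ y * (leg₂ x * leg₁ y) * leg₁ x * scalars S R := by simp only [Matrix.mul_assoc]
      _ = _ := by simp only [← e1, Matrix.mul_assoc]

theorem comeasureDefect_mul (hy : SatisfiesComeasuring R c y)
    (h : ∀ i j a b, Commute (x i j) (y a b)) :
    comeasureDefect c (x * y) = comeasureDefect c x * (leg₁ y * leg₂ y) := by
  have e1 : leg₁ y * leg₂ x = leg₂ x * leg₁ y := leg₁_comm_leg₂ fun i j a b => (h a b i j).symm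
  unfold comeasureDefect
  rw [Matrix.sub_mul, leg₁_mul, leg₂_mul]
  congr 1
  · calc _ = x * (y * scalars S c) := Matrix.mul_assoc _ _ _
      _ = _ := by simp only [hy.2, Matrix.mul_assoc]
  · calc _ = scalars S c * leg₁ x * (leg₁ y * leg₂ x) * leg₂ y := by simp only [Matrix.mul_assoc]
      _ = _ := by simp only [e1, Matrix.mul_assoc]

theorem mul_comeasureDefect (hy : SatisfiesComeasuring R c y)
    (h : ∀ i j a b, Commute (x i j) (y a b)) :
    comeasureDefect c (y * x) = y * comeasureDefect c x := by
  have e2 : leg₁ x * leg₂ y = leg₂ y * leg₁ x := leg₁_comm_leg₂ h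
  unfold comeasureDefect
  rw [Matrix.mul_sub, leg₁_mul, leg₂_mul]
  congr 1
  · exact Matrix.mul_assoc _ _ _
  · calc _ = scalars S c * leg₁ y * (leg₁ x * leg₂ y) * leg₂ x := by simp only [Matrix.mul_assoc]
      _ = scalars S c * leg₁ y * leg₂ y * (leg₁ x * leg₂ x) := by simp only [e2, Matrix.mul_assoc]
      _ = _ := by simp only [← hy.2, Matrix.mul_assoc]

end Defects

section RelationSpan

variable {K ι : Type*} [Field K] [Fintype ι] [DecidableEq ι]
  {R : Matrix (ι × ι) (ι × ι) K} {c : Matrix ι (ι × ι) K}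

local notation "F" => FreeAlgebra K (ι × ι)
local notation "M" => Comeasuring R c

theorem isMatrixCoalgebra_tGen (R : Matrix (ι × ι) (ι × ι) K) (c : Matrix ι (ι × ι) K) :
    IsMatrixCoalgebra K (tGen R c) := ⟨comul_tGen, counit_tGen⟩

/-- The span of the relations of `M₁(R, A)`. -/
def relationSpan (R : Matrix (ι × ι) (ι × ι) K) (c : Matrix ι (ι × ι) K) : Submodule K F :=
  Submodule.span K
    (Set.range (fun p : (ι × ι) × (ι × ι) => quantumDefect R (freeGen K ι) p.1 p.2) ∪
      Set.range (fun p : ι × (ι × ι) => comeasureDefect c (freeGen K ι) p.1 p.2))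

theorem mul_map_mem_extend {l m n : Type*} [Fintype m] {W : Submodule K F} {X : Matrix l m F}
    (hX : ∀ p q, X p q ∈ W) (Y : Matrix m n M) (p : l) (q : n) :
    (X.map (Algebra.TensorProduct.includeLeft : F →ₐ[K] F ⊗[K] M) *
      Y.map (Algebra.TensorProduct.includeRight : M →ₐ[K] F ⊗[K] M)) p q ∈ W.extend M := by
  rw [Matrix.mul_apply]
  refine sum_mem fun a _ => ?_
  simpa using Submodule.tmul_mem_extend (hX p a) (Y a q)

theorem map_mul_mem_extend {l m n : Type*} [Fintype m] {W : Submodule K F} {X : Matrix m n F}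
    (hX : ∀ p q, X p q ∈ W) (Y : Matrix l m M) (p : l) (q : n) :
    (Y.map (Algebra.TensorProduct.includeRight : M →ₐ[K] F ⊗[K] M) *
      X.map (Algebra.TensorProduct.includeLeft : F →ₐ[K] F ⊗[K] M)) p q ∈ W.extend M := by
  rw [Matrix.mul_apply]
  refine sum_mem fun a _ => ?_
  simpa using Submodule.tmul_mem_extend (hX a q) (Y p a)

theorem quantumDefect_mem (p q : ι × ι) :
    quantumDefect R (freeGen K ι) p q ∈ relationSpan R c :=
  Submodule.subset_span (Or.inl ⟨(p, q), rfl⟩)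

theorem comeasureDefect_mem (l : ι) (q : ι × ι) :
    comeasureDefect c (freeGen K ι) l q ∈ relationSpan R c :=
  Submodule.subset_span (Or.inr ⟨(l, q), rfl⟩)

theorem stable_relationSpan :
    (Site.free (isMatrixCoalgebra_tGen R c)).Stable (relationSpan R c) := by
  let il : F →ₐ[K] F ⊗[K] M := Algebra.TensorProduct.includeLeft
  let ir : M →ₐ[K] F ⊗[K] M := Algebra.TensorProduct.includeRight
  have hy : SatisfiesComeasuring R c ((tGen R c).map ir) := (satisfiesComeasuring_tGen R c).map ir
  have hc : ∀ i j a b, Commute ((freeGen K ι).map il i j) ((tGen R c).map ir a b) :=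
    fun i j a b => by simp [Commute, SemiconjBy, il, ir]
  have hl : (freeGen K ι).map (freeLeft K (tGen R c)) =
      (tGen R c).map ir * (freeGen K ι).map il := by
    refine Matrix.ext fun i j => ?_
    refine (freeLeft_gen _ i j).trans ?_
    simp [Matrix.mul_apply, il, ir]
  have hr : (freeGen K ι).map (freeRight K (tGen R c)) =
      (freeGen K ι).map il * (tGen R c).map ir := by
    refine Matrix.ext fun i j => ?_
    refine (freeRight_gen _ i j).trans ?_
    simp [Matrix.mul_apply, il, ir]
  have m1 : leg₁ ((tGen R c).map ir) * leg₂ ((tGen R c).map ir) =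
      (leg₁ (tGen R c) * leg₂ (tGen R c)).map ir := by
    change _ = Matrix.map _ (ir : M →+* F ⊗[K] M)
    rw [Matrix.map_mul, leg₁_map, leg₂_map]; rfl
  have m2 : leg₂ ((tGen R c).map ir) * leg₁ ((tGen R c).map ir) =
      (leg₂ (tGen R c) * leg₁ (tGen R c)).map ir := by
    change _ = Matrix.map _ (ir : M →+* F ⊗[K] M)
    rw [Matrix.map_mul, leg₁_map, leg₂_map]; rfl
  constructor
  · refine Submodule.span_le.2 ?_
    rintro _ (⟨⟨p, q⟩, rfl⟩ | ⟨⟨l, q⟩, rfl⟩)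
    · have e := quantumDefect_map (R := R) (freeLeft K (tGen R c)) (freeGen K ι)
      rw [hl, mul_quantumDefect hy hc, m2, ← quantumDefect_map il] at e
      exact Set.mem_of_eq_of_mem (s := (relationSpan R c).extend M)
        (congrFun (congrFun e p) q) (map_mul_mem_extend quantumDefect_mem _ p q)
    · have e := comeasureDefect_map (c := c) (freeLeft K (tGen R c)) (freeGen K ι)
      rw [hl, mul_comeasureDefect hy hc, ← comeasureDefect_map il] at e
      exact Set.mem_of_eq_of_mem (s := (relationSpan R c).extend M)
        (congrFun (congrFun e l) q) (map_mul_mem_extend comeasureDefect_mem _ l q)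
  · refine Submodule.span_le.2 ?_
    rintro _ (⟨⟨p, q⟩, rfl⟩ | ⟨⟨l, q⟩, rfl⟩)
    · have e := quantumDefect_map (R := R) (freeRight K (tGen R c)) (freeGen K ι)
      rw [hr, quantumDefect_mul hy hc, m1, ← quantumDefect_map il] at e
      exact Set.mem_of_eq_of_mem (s := (relationSpan R c).extend M)
        (congrFun (congrFun e p) q) (mul_map_mem_extend quantumDefect_mem _ p q)
    · have e := comeasureDefect_map (c := c) (freeRight K (tGen R c)) (freeGen K ι)
      rw [hr, comeasureDefect_mul hy hc, m1, ← comeasureDefect_map il] at e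
      exact Set.mem_of_eq_of_mem (s := (relationSpan R c).extend M)
        (congrFun (congrFun e l) q) (mul_map_mem_extend comeasureDefect_mem _ l q)

end RelationSpan

section DeformedMaps

variable {K M X Y : Type*} [Field K] [Semiring M] [Bialgebra K M] [AddCommMonoid X] [Module K X]
  [AddCommMonoid Y] [Module K Y]

namespace DualQuasitriangular.SecondInverse

variable {Q : DualQuasitriangular K M} {S : Q.SecondInverse}

theorem twistMul_map {X' Y' : Type*} [AddCommMonoid X'] [Module K X'] [AddCommMonoid Y']
    [Module K Y'] {m : X ⊗[K] X →ₗ[K] X'} {m' : Y ⊗[K] Y →ₗ[K] Y'} {a : Site K M X}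
    {a' : Site K M Y} {p : X →ₗ[K] Y} {p' : X' →ₗ[K] Y'} (h : Site.Along p a a')
    (hp : ∀ x y, p' (m (x ⊗ₜ y)) = m' (p x ⊗ₜ p y)) (x y : X) :
    p' (S.twistMul m a a (x ⊗ₜ y)) = S.twistMul m' a' a' (p x ⊗ₜ p y) := by
  have h1 : Site.Along (TensorProduct.map p p) (a.liftL X) (a'.liftL Y) := by
    rw [← LinearMap.lTensor_comp_rTensor]
    exact (Site.along_lTensor _ _).comp h.rTensor
  have h2 : Site.Along (TensorProduct.map p p) (a.liftR X) (a'.liftR Y) := by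
    rw [← LinearMap.lTensor_comp_rTensor]
    exact h.lTensor.comp (Site.along_rTensor _ _)
  have e := LinearMap.congr_fun (crossL_comp (S := S) h1 h2.l) (x ⊗ₜ y)
  have e' : p' ∘ₗ m = m' ∘ₗ TensorProduct.map p p := TensorProduct.ext' hp
  exact (LinearMap.congr_fun e' _).trans (congrArg m' e.symm)

end DualQuasitriangular.SecondInverse

end DeformedMaps

section BraidedEquiv

variable {K ι : Type*} [Field K] [Fintype ι] [DecidableEq ι]
  {R : Matrix (ι × ι) (ι × ι) K} {c : Matrix ι (ι × ι) K}

local notation "F" => FreeAlgebra K (ι × ι)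
local notation "M" => Comeasuring R c
local notation "U" => BraidedComeasuring R c

theorem Site.isMatrix_regular : (Site.regular K M).IsMatrix (tGen R c) (tGen R c) := by
  refine ⟨fun i j => ?_, comul_tGen⟩
  change comulOp K M _ = _
  rw [comulOp, comp_apply, comul_tGen, map_sum]
  rfl

theorem along_mkAlgHom :
    Site.Along (RingQuot.mkAlgHom K (ComeasuringRel R c)).toLinearMap
      (Site.free (isMatrixCoalgebra_tGen R c)) (Site.regular K M) := by
  have hl : (((Algebra.TensorProduct.comm K M M).toAlgHom.comp (Bialgebra.comulAlgHom K M)).comp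
      (RingQuot.mkAlgHom K (ComeasuringRel R c))) =
      (Algebra.TensorProduct.map (RingQuot.mkAlgHom K (ComeasuringRel R c)) (AlgHom.id K M)).comp
        (freeLeft K (tGen R c)) := by
    refine freeGen_hom_ext fun i j => ?_
    refine (Site.isMatrix_regular.l i j).trans ?_
    simp only [AlgHom.comp_apply, freeLeft_gen, map_sum, Algebra.TensorProduct.map_tmul]
    rfl
  have hr : (Bialgebra.comulAlgHom K M).comp (RingQuot.mkAlgHom K (ComeasuringRel R c)) =
      (Algebra.TensorProduct.map (RingQuot.mkAlgHom K (ComeasuringRel R c)) (AlgHom.id K M)).comp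
        (freeRight K (tGen R c)) := by
    refine freeGen_hom_ext fun i j => ?_
    refine (Site.isMatrix_regular.r i j).trans ?_
    simp only [AlgHom.comp_apply, freeRight_gen, map_sum, Algebra.TensorProduct.map_tmul]
    rfl
  exact ⟨LinearMap.ext fun x => DFunLike.congr_fun hl x,
    LinearMap.ext fun x => DFunLike.congr_fun hr x⟩

namespace DualQuasitriangular.SecondInverse

variable {Q : DualQuasitriangular K (Comeasuring R c)} {S : Q.SecondInverse}

/-- A linear map that is multiplicative for the deformed product takes `R t₁ t₂` to `x₁ R x₂`. -/
theorem map_scalars_mul_leg₁_mul_leg₂ {B C : Type*} [Semiring B] [Algebra K B] [Semiring C]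
    [Algebra K C] (hQ : ∀ i j k l, Q.form (tGen R c i j ⊗ₜ tGen R c k l) = R (i, k) (j, l))
    {v : Site K M B} {t : Matrix ι ι B} (ht : v.IsMatrix (tGen R c) t) {h : B →ₗ[K] C}
    (hm : ∀ x y, h (S.twistMul (mul' K B) v v (x ⊗ₜ y)) = h x * h y) :
    leg₁ (t.map h) * scalars C R * leg₂ (t.map h) = (scalars B R * leg₁ t * leg₂ t).map h := by
  refine Matrix.ext fun p q => ?_
  obtain ⟨i, k⟩ := p
  obtain ⟨j, l⟩ := q
  have e := congrArg h (sum_form_smul_twistMul (S := S) ht (mul' K B) i k j l)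
  simp only [map_sum, map_smul, hm, hQ, mul'_apply] at e
  rw [leg₁_mul_scalars_mul_leg₂, Matrix.map_apply, scalars_mul_leg₁_mul_leg₂]
  simpa only [map_sum, map_smul, Matrix.map_apply] using e

variable (S) in
theorem exists_toComeasuring (hR : IsUnit R)
    (hQ : ∀ i j k l, Q.form (tGen R c i j ⊗ₜ tGen R c k l) = R (i, k) (j, l)) :
    ∃ φ : U →ₗ[K] M, φ 1 = 1 ∧ (∀ i j, φ (uGen R c i j) = tGen R c i j) ∧
      ∀ x y, φ (x * y) = S.twistMul (mul' K M) (Site.regular K M) (Site.regular K M)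
        (φ x ⊗ₜ φ y) := by
  obtain ⟨E, j, j1, jm⟩ := exists_algebra_of_mul
    (μ := S.twistMul (mul' K M) (Site.regular K M) (Site.regular K M)) (e := 1)
    (twistMul_assoc Site.prod_regular (by ext x y z; simp [mul_assoc]))
    (fun x => (twistMul_triv Site.trivAt_regular _ _ _).trans (by simp))
    (fun x => (triv_twistMul Site.trivAt_regular.l _ _ _).trans (by simp))
  have hx : SatisfiesBraided R c ((tGen R c).map j) := by
    refine (satisfiesBraided_iff_map hR (h := j.toLinearMap) rfl
      (map_scalars_mul_leg₁_mul_leg₂ hQ Site.isMatrix_regular jm)).2 ?_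
    exact ⟨congrArg (fun X => Matrix.map X j) (satisfiesComeasuring_tGen R c).1,
      congrArg (fun X => Matrix.map X j) (satisfiesComeasuring_tGen R c).2⟩
  obtain ⟨f, hf⟩ := BraidedComeasuring.exists_lift hx
  refine ⟨j.symm.toLinearMap ∘ₗ f.toLinearMap, ?_, fun i k => ?_, fun x y => ?_⟩
  · simp [← j1]
  · simp [hf]
  · apply j.injective
    rw [jm]
    simp

variable (S) in
theorem exists_ofFree (hR : IsUnit R)
    (hQ : ∀ i j k l, Q.form (tGen R c i j ⊗ₜ tGen R c k l) = R (i, k) (j, l)) :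
    ∃ (θ : F ≃ₗ[K] F), θ 1 = 1 ∧ (∀ i j, θ (freeGen K ι i j) = freeGen K ι i j) ∧
      (∀ x y, θ (x * y) = S.freeMul (isMatrixCoalgebra_tGen R c) (θ x ⊗ₜ θ y)) ∧
      ∀ x y, RingQuot.mkAlgHom K (ComeasuringRel R c) x =
        RingQuot.mkAlgHom K (ComeasuringRel R c) y →
        RingQuot.mkAlgHom K (BraidedComeasuringRel R c) (θ.symm x) =
          RingQuot.mkAlgHom K (BraidedComeasuringRel R c) (θ.symm y) := by
  obtain ⟨θ, θ1, θt, θm⟩ := S.exists_freeEquiv (isMatrixCoalgebra_tGen R c)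
  refine ⟨θ, θ1, θt, θm, ?_⟩
  obtain ⟨g, hg⟩ : ∃ g : F →ₗ[K] U,
      ∀ x, g x = RingQuot.mkAlgHom K (BraidedComeasuringRel R c) (θ.symm x) :=
    ⟨(RingQuot.mkAlgHom K (BraidedComeasuringRel R c)).toLinearMap ∘ₗ θ.symm.toLinearMap,
      fun x => rfl⟩
  have gm (x y : F) : g (S.freeMul (isMatrixCoalgebra_tGen R c) (x ⊗ₜ y)) = g x * g y := by
    have := θm (θ.symm x) (θ.symm y)
    rw [LinearEquiv.apply_symm_apply, LinearEquiv.apply_symm_apply] at this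
    rw [hg, hg, hg, ← this, LinearEquiv.symm_apply_apply, map_mul]
  have gt : (freeGen K ι).map g = uGen R c := by
    refine Matrix.ext fun i j => ?_
    rw [Matrix.map_apply, hg, ← θt i j, LinearEquiv.symm_apply_apply]
    rfl
  have hW := (satisfiesBraided_iff_map hR gt
    (gt ▸ map_scalars_mul_leg₁_mul_leg₂ hQ (Site.isMatrix_free _) gm)).1 (satisfiesBraided_uGen R c)
  have W0 : relationSpan R c ≤ LinearMap.ker g := by
    refine Submodule.span_le.2 ?_
    rintro _ (⟨⟨p, q⟩, rfl⟩ | ⟨⟨l, q⟩, rfl⟩)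
    · exact (map_sub g _ _).trans (sub_eq_zero.2 (congrFun (congrFun hW.1 p) q))
    · exact (map_sub g _ _).trans (sub_eq_zero.2 (congrFun (congrFun hW.2 l) q))
  have st : (Site.free (isMatrixCoalgebra_tGen R c)).Stable ⊤ :=
    ⟨stableUnder_top _, stableUnder_top _⟩
  have W1 : ⊤ * relationSpan R c ≤ LinearMap.ker g := by
    rw [← map₂_freeMul (S := S) _ st stable_relationSpan]
    refine Submodule.map₂_le.2 fun x _ w hw => ?_
    exact (gm x w).trans (by rw [W0 hw, mul_zero])
  have W2 : ⊤ * relationSpan R c * ⊤ ≤ LinearMap.ker g := by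
    rw [← map₂_freeMul (S := S) _ (Site.stable_free_mul _ st stable_relationSpan) st]
    refine Submodule.map₂_le.2 fun x hx w _ => ?_
    exact (gm x w).trans (by rw [W1 hx, zero_mul])
  let r : RingCon F :=
    { r := fun x y => ∀ a b, g (a * x * b) = g (a * y * b)
      iseqv := ⟨fun _ _ _ => rfl, fun h a b => (h a b).symm, fun h h' a b => (h a b).trans (h' a b)⟩
      mul' := fun {w x y z} h h' a b => by
        have h1 := h a (y * b)
        have h2 := h' (a * x) b
        simp only [mul_assoc] at h1 h2 ⊢
        exact h1.trans h2
      add' := fun {w x y z} h h' a b => by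
        simp only [mul_add, add_mul, map_add, h a b, h' a b] }
  have hr : ∀ ⦃x y⦄, ComeasuringRel R c x y → r.toQuotient x = r.toQuotient y := by
    intro x y hxy
    refine (RingCon.eq r).2 fun a b => ?_
    have hw : x - y ∈ relationSpan R c := by
      cases hxy with
      | quantum p q => exact quantumDefect_mem p q
      | comeasure l q => exact comeasureDefect_mem l q
    have := W2 (Submodule.mul_mem_mul (Submodule.mul_mem_mul (Submodule.mem_top (x := a)) hw)
      (Submodule.mem_top (x := b)))
    rw [LinearMap.mem_ker, mul_sub, sub_mul, map_sub, sub_eq_zero] at this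
    exact this
  let χ : M →+* r.Quotient := RingQuot.lift ⟨r.mk', hr⟩
  intro x y hxy
  rw [← hg, ← hg]
  have h1 : r.mk' x = r.mk' y := by
    have e (z : F) : χ (RingQuot.mkAlgHom K (ComeasuringRel R c) z) = r.mk' z := by
      rw [← AlgHom.coe_toRingHom, RingQuot.mkAlgHom_coe]
      exact RingQuot.lift_mkRingHom_apply _ hr z
    rw [← e, ← e, hxy]
  simpa using (RingCon.eq r).1 h1 1 1

end DualQuasitriangular.SecondInverse

end BraidedEquiv

section BraidingValues

variable {K M V W ι : Type*} [Field K] [Semiring M] [Bialgebra K M] [AddCommMonoid V] [Module K V]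
  [AddCommMonoid W] [Module K W] [Fintype ι] [DecidableEq ι]

/-- The elements of `e` are coacted on as the basis of a right comodule. -/
structure Site.IsRow (v : Site K M V) (τ : Matrix ι ι M) (e : ι → V) : Prop where
  l : ∀ j, v.l.δ (e j) = e j ⊗ₜ 1
  r : ∀ j, v.r.δ (e j) = ∑ a, e a ⊗ₜ τ a j

theorem Site.IsRow.l_sum {v : Site K M V} {τ : Matrix ι ι M} {e : ι → V} (h : v.IsRow τ e) (j : ι) :
    v.l.δ (e j) = ∑ _ : Unit, e j ⊗ₜ 1 := by
  rw [h.l, Fintype.sum_unique]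

namespace DualQuasitriangular.SecondInverse

variable {Q : DualQuasitriangular K M} {S : Q.SecondInverse}

theorem cross_lift_sum {s t : Bool} {x : Line K M s V} {y : Line K M t W} {κ κ' : Type*} [Fintype κ]
    [Fintype κ'] {v : V} {w : W} {v' : κ → V} {m : κ → M} {w' : κ' → W} {n : κ' → M}
    (hx : x.δ v = ∑ a, v' a ⊗ₜ m a) (hy : y.δ w = ∑ b, w' b ⊗ₜ n b) :
    S.cross (x.liftL W) (y.liftR V) (v ⊗ₜ w) =
      ∑ a, ∑ b, S.letter s t (m a ⊗ₜ n b) • (v' a ⊗ₜ[K] w' b) :=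
  pairOp_lift_sum _ hx hy

theorem crossing_apply (a b : Site K M V) (v : V) : S.crossing a b v =
    S.cross a.l b.r (S.cross a.r b.r (S.cross a.l b.l (S.cross a.r b.l v))) := rfl

variable {τ : Matrix ι ι M}

theorem braid_matrix_matrix {v : Site K M V} {w : Site K M W} {t : Matrix ι ι V} {s : Matrix ι ι W}
    (h : v.IsMatrix τ t) (h' : w.IsMatrix τ s) (i j k l : ι) :
    S.braid v w (t i j ⊗ₜ s k l) = ∑ x, ∑ d, ∑ a, ∑ m, ∑ p, ∑ b, ∑ r, ∑ n,
      (S.til (τ x j ⊗ₜ τ k d) * Q.form (τ i a ⊗ₜ τ d m) * Q.form (τ p x ⊗ₜ τ b l) *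
        Q.inv (τ a r ⊗ₜ τ n b)) • (s m n ⊗ₜ[K] t r p) := by
  simp only [braid, flipOp, comp_apply, crossing_apply, Site.liftL, Site.liftR,
    cross_lift_sum (h.r _ _) (h'.l _ _), cross_lift_sum (h.l _ _) (h'.l _ _),
    cross_lift_sum (h.r _ _) (h'.r _ _), cross_lift_sum (h.l _ _) (h'.r _ _),
    map_sum, map_smul, Finset.smul_sum, smul_smul, coe_coe, comm_tmul]
  rfl

theorem braid_matrix_row {v : Site K M V} {w : Site K M W} {t : Matrix ι ι V} {e : ι → W}
    (hτ : IsMatrixCoalgebra K τ) (h : v.IsMatrix τ t) (h' : w.IsRow τ e) (i j k : ι) :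
    S.braid v w (t i j ⊗ₜ e k) = ∑ b, ∑ n, ∑ a, ∑ m,
      (Q.inv (τ i a ⊗ₜ τ m n) * Q.form (τ b j ⊗ₜ τ n k)) • (e m ⊗ₜ[K] t a b) := by
  simp only [mul_comm (Q.inv _)]
  simp only [braid, flipOp, comp_apply, crossing_apply, Site.liftL, Site.liftR,
    cross_lift_sum (h.r _ _) (h'.l_sum _), cross_lift_sum (h.l _ _) (h'.l_sum _),
    cross_lift_sum (h.r _ _) (h'.r _), cross_lift_sum (h.l _ _) (h'.r _), letter_one_right,
    hτ.counit, ite_smul, zero_smul, one_smul, Finset.sum_ite_eq, Finset.sum_ite_eq',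
    Finset.mem_univ, if_true, Finset.univ_unique, Finset.sum_singleton,
    map_sum, map_smul, Finset.smul_sum, smul_smul, coe_coe, comm_tmul]
  rfl

theorem braid_row_matrix {v : Site K M V} {w : Site K M W} {t : Matrix ι ι V} {e : ι → W}
    (hτ : IsMatrixCoalgebra K τ) (h : v.IsMatrix τ t) (h' : w.IsRow τ e) (i j k : ι) :
    S.braid w v (e k ⊗ₜ t i j) = ∑ n, ∑ a, ∑ m, ∑ b,
      (S.til (τ n k ⊗ₜ τ i a) * Q.form (τ m n ⊗ₜ τ b j)) • (t a b ⊗ₜ[K] e m) := by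
  simp only [braid, flipOp, comp_apply, crossing_apply, Site.liftL, Site.liftR,
    cross_lift_sum (h'.r _) (h.l _ _), cross_lift_sum (h'.l_sum _) (h.l _ _),
    cross_lift_sum (h'.r _) (h.r _ _), cross_lift_sum (h'.l_sum _) (h.r _ _), letter_one_left,
    hτ.counit, ite_smul, zero_smul, one_smul, Finset.sum_ite_eq, Finset.sum_ite_eq',
    Finset.mem_univ, if_true, Finset.univ_unique, Finset.sum_singleton,
    map_sum, map_smul, Finset.smul_sum, smul_smul, coe_coe, comm_tmul]
  rfl

theorem braid_row_row {v : Site K M V} {w : Site K M W} {e : ι → V} {f : ι → W}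
    (hτ : IsMatrixCoalgebra K τ) (h : v.IsRow τ e) (h' : w.IsRow τ f) (i j : ι) :
    S.braid v w (e i ⊗ₜ f j) = ∑ a, ∑ b, Q.form (τ a i ⊗ₜ τ b j) • (f b ⊗ₜ[K] e a) := by
  simp only [braid, flipOp, comp_apply, crossing_apply, Site.liftL, Site.liftR,
    cross_lift_sum (h.r _) (h'.l_sum _), cross_lift_sum (h.l_sum _) (h'.l_sum _),
    cross_lift_sum (h.r _) (h'.r _), cross_lift_sum (h.l_sum _) (h'.r _), letter_one_left,
    letter_one_right, Bialgebra.counit_one,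
    hτ.counit, ite_smul, zero_smul, one_smul, Finset.sum_ite_eq',
    Finset.mem_univ, if_true, Finset.univ_unique, Finset.sum_singleton,
    map_sum, map_smul, coe_coe, comm_tmul]
  rfl

end DualQuasitriangular.SecondInverse

end BraidingValues

section GeneratorValues

variable {K M ι : Type*} [Field K] [Semiring M] [Bialgebra K M] [Fintype ι] [DecidableEq ι]
  {Q : DualQuasitriangular K M} {τ : Matrix ι ι M} {R : Matrix (ι × ι) (ι × ι) K}

theorem DualQuasitriangular.inv_matrix (hτ : IsMatrixCoalgebra K τ)
    (hQ : ∀ i j k l, Q.form (τ i j ⊗ₜ τ k l) = R (i, k) (j, l)) (i j k l : ι) :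
    Q.inv (τ i j ⊗ₜ τ k l) = R⁻¹ (i, k) (j, l) := by
  have h : R * Matrix.of (fun p q => Q.inv (τ p.1 q.1 ⊗ₜ τ p.2 q.2)) = 1 := by
    ext ⟨i, k⟩ ⟨j, l⟩
    have := LinearMap.congr_fun Q.form_inv (τ i j ⊗ₜ τ k l)
    simp only [convWith_tmul, hτ.comul, map_sum, LinearMap.sum_apply, pairAt_tmul, hQ, counitPair,
      comp_apply, map_tmul, hτ.counit, mul'_apply] at this
    rw [Matrix.mul_apply, Fintype.sum_prod_type, sum_comm]
    refine this.trans ?_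
    simp [Matrix.one_apply, Prod.ext_iff, ← ite_and, and_comm]
  rw [Matrix.inv_eq_right_inv h]
  rfl

theorem DualQuasitriangular.SecondInverse.til_matrix (S : Q.SecondInverse)
    (hτ : IsMatrixCoalgebra K τ)
    (hQ : ∀ i j k l, Q.form (τ i j ⊗ₜ τ k l) = R (i, k) (j, l)) (i j k l : ι) :
    S.til (τ i j ⊗ₜ τ k l) = tildeMatrix R (i, k) (j, l) := by
  have h : transpose₂ R * Matrix.of (fun p q => S.til (τ p.1 q.1 ⊗ₜ τ q.2 p.2)) = 1 := by
    ext ⟨i, l⟩ ⟨j, k⟩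
    have := LinearMap.congr_fun S.form_til (τ i j ⊗ₜ τ k l)
    simp only [convWith_tmul, hτ.comul, comulOp_apply, map_sum, LinearMap.sum_apply,
      comm_tmul, pairAt_tmul, hQ, counitPair,
      comp_apply, map_tmul, hτ.counit, mul'_apply] at this
    rw [Matrix.mul_apply, Fintype.sum_prod_type, sum_comm]
    refine this.trans ?_
    simp [Matrix.one_apply, Prod.ext_iff, ← ite_and, @eq_comm _ k l, and_comm]
  rw [tildeMatrix, Matrix.inv_eq_right_inv h]
  rfl

end GeneratorValues

section BraidingCoefficients

theorem sum_four_swap {ι N : Type*} [Fintype ι] [AddCommMonoid N] (f : ι → ι → ι → ι → N) :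
    ∑ b, ∑ n, ∑ a, ∑ m, f m a b n = ∑ m, ∑ a, ∑ b, ∑ n, f m a b n := by
  simp only [← Fintype.sum_prod_type']
  exact Fintype.sum_equiv ⟨fun (b, n, a, m) => (m, a, b, n), fun (m, a, b, n) => (b, n, a, m),
    fun _ => rfl, fun _ => rfl⟩ _ _ fun _ => rfl

theorem sum_four_rotate {ι N : Type*} [Fintype ι] [AddCommMonoid N] (f : ι → ι → ι → ι → N) :
    ∑ n, ∑ a, ∑ m, ∑ b, f a b m n = ∑ a, ∑ b, ∑ m, ∑ n, f a b m n := by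
  simp only [← Fintype.sum_prod_type']
  exact Fintype.sum_equiv ⟨fun (n, a, m, b) => (a, b, m, n), fun (a, b, m, n) => (n, a, m, b),
    fun _ => rfl, fun _ => rfl⟩ _ _ fun _ => rfl

variable {K M V W ι : Type*} [Field K] [Semiring M] [Bialgebra K M] [AddCommMonoid V] [Module K V]
  [AddCommMonoid W] [Module K W] [Fintype ι] [DecidableEq ι] {Q : DualQuasitriangular K M}
  {S : Q.SecondInverse} {τ : Matrix ι ι M} {R : Matrix (ι × ι) (ι × ι) K} {v : Site K M V}
  {w : Site K M W} {t : Matrix ι ι V} {e : ι → W}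

namespace DualQuasitriangular.SecondInverse

theorem braid_matrix_row_eq (hτ : IsMatrixCoalgebra K τ)
    (hQ : ∀ i j k l, Q.form (τ i j ⊗ₜ τ k l) = R (i, k) (j, l)) (h : v.IsMatrix τ t)
    (h' : w.IsRow τ e) (i j k : ι) :
    S.braid v w (t i j ⊗ₜ e k) = ∑ m, ∑ a, ∑ b, (∑ n, R⁻¹ (i, m) (a, n) * R (b, n) (j, k)) •
      (e m ⊗ₜ[K] t a b) := by
  rw [braid_matrix_row hτ h h']
  simp only [hQ, Q.inv_matrix hτ hQ, Finset.sum_smul]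
  exact sum_four_swap fun m a b n => (R⁻¹ (i, m) (a, n) * R (b, n) (j, k)) • (e m ⊗ₜ[K] t a b)

theorem braid_row_matrix_eq (hτ : IsMatrixCoalgebra K τ)
    (hQ : ∀ i j k l, Q.form (τ i j ⊗ₜ τ k l) = R (i, k) (j, l)) (h : v.IsMatrix τ t)
    (h' : w.IsRow τ e) (i j k : ι) :
    S.braid w v (e k ⊗ₜ t i j) = ∑ a, ∑ b, ∑ m,
      (∑ n, tildeMatrix R (n, i) (k, a) * R (m, b) (n, j)) • (t a b ⊗ₜ[K] e m) := by
  rw [braid_row_matrix hτ h h']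
  simp only [hQ, S.til_matrix hτ hQ, Finset.sum_smul]
  exact sum_four_rotate fun a b m n =>
    (tildeMatrix R (n, i) (k, a) * R (m, b) (n, j)) • (t a b ⊗ₜ[K] e m)

end DualQuasitriangular.SecondInverse

end BraidingCoefficients

section BraidedStructure

variable {K ι : Type*} [Field K] [Fintype ι] [DecidableEq ι]
  {R : Matrix (ι × ι) (ι × ι) K} {c : Matrix ι (ι × ι) K}

local notation "F" => FreeAlgebra K (ι × ι)
local notation "M" => Comeasuring R c
local notation "U" => BraidedComeasuring R c

theorem Site.isMatrix_pull {φ : BraidedComeasuring R c ≃ₗ[K] Comeasuring R c}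
    (hφ : ∀ i j, φ (uGen R c i j) = tGen R c i j) :
    (Site.pull φ).IsMatrix (tGen R c) (uGen R c) := by
  have e (i j : ι) : uGen R c i j = φ.symm (tGen R c i j) := by rw [← hφ, φ.symm_apply_apply]
  constructor
  · intro i j
    have h := Colin.apply (Site.along_pull φ).l (tGen R c i j)
    rw [Site.isMatrix_regular.l] at h
    simpa only [coe_coe, ← e, map_sum, rTensor_tmul] using h
  · intro i j
    have h := Colin.apply (Site.along_pull φ).r (tGen R c i j)
    rw [Site.isMatrix_regular.r] at h
    simpa only [coe_coe, ← e, map_sum, rTensor_tmul] using h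

namespace DualQuasitriangular.SecondInverse

variable {Q : DualQuasitriangular K (Comeasuring R c)} (S : Q.SecondInverse)

theorem exists_braidedEquiv (hR : IsUnit R)
    (hQ : ∀ i j k l, Q.form (tGen R c i j ⊗ₜ tGen R c k l) = R (i, k) (j, l)) :
    ∃ φ : U ≃ₗ[K] M, φ 1 = 1 ∧ (∀ i j, φ (uGen R c i j) = tGen R c i j) ∧
      ∀ x y, φ (x * y) = S.twistMul (mul' K M) (Site.regular K M) (Site.regular K M)
        (φ x ⊗ₜ φ y) := by
  obtain ⟨φ, φ1, φt, φm⟩ := S.exists_toComeasuring hR hQ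
  obtain ⟨θ, θ1, θt, θm, hθ⟩ := S.exists_ofFree hR hQ
  have key (x : F) : φ (RingQuot.mkAlgHom K (BraidedComeasuringRel R c) x) =
      RingQuot.mkAlgHom K (ComeasuringRel R c) (θ x) := by
    induction x using FreeAlgebra.induction with
    | grade0 a => simp only [Algebra.algebraMap_eq_smul_one, map_smul, map_one, φ1, θ1]
    | grade1 p => exact (φt p.1 p.2).trans (congrArg _ (θt p.1 p.2).symm)
    | mul x y hx hy =>
      rw [map_mul, φm, hx, hy, θm]
      exact (twistMul_map (m := mul' K F) (m' := mul' K M)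
        (p' := (RingQuot.mkAlgHom K (ComeasuringRel R c)).toLinearMap) along_mkAlgHom
        (fun a b => map_mul (RingQuot.mkAlgHom K (ComeasuringRel R c)) a b) _ _).symm
    | add x y hx hy => rw [map_add, map_add, hx, hy, map_add, map_add]
  have inj : Function.Injective φ := fun x y hxy => by
    obtain ⟨x, rfl⟩ := RingQuot.mkAlgHom_surjective K _ x
    obtain ⟨y, rfl⟩ := RingQuot.mkAlgHom_surjective K _ y
    rw [key, key] at hxy
    simpa using hθ _ _ hxy
  have surj : Function.Surjective φ := fun m => by
    obtain ⟨x, rfl⟩ := RingQuot.mkAlgHom_surjective K _ m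
    exact ⟨RingQuot.mkAlgHom K _ (θ.symm x), by rw [key, θ.apply_symm_apply]⟩
  exact ⟨LinearEquiv.ofBijective φ ⟨inj, surj⟩, φ1, φt, φm⟩

variable {S}

theorem map_braided_quadratic
    (hQ : ∀ i j k l, Q.form (tGen R c i j ⊗ₜ tGen R c k l) = R (i, k) (j, l))
    {φ : BraidedComeasuring R c ≃ₗ[K] Comeasuring R c}
    (φt : ∀ i j, φ (uGen R c i j) = tGen R c i j)
    (φm : ∀ x y, φ (x * y) = S.twistMul (mul' K M) (Site.regular K M)
      (Site.regular K M) (φ x ⊗ₜ φ y)) (p q : ι × ι) :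
    φ ((leg₁ (uGen R c) * scalars U R * leg₂ (uGen R c)) p q) =
      (scalars M R * leg₁ (tGen R c) * leg₂ (tGen R c)) p q := by
  have hm : ∀ x y, φ.symm.toLinearMap (S.twistMul (mul' K M) (Site.regular K M)
      (Site.regular K M) (x ⊗ₜ y)) = φ.symm.toLinearMap x * φ.symm.toLinearMap y := fun x y => by
    apply φ.injective
    rw [φm]
    simp
  have h := map_scalars_mul_leg₁_mul_leg₂ hQ Site.isMatrix_regular hm
  have e : (tGen R c).map φ.symm.toLinearMap = uGen R c :=
    Matrix.ext fun i j => by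
      rw [Matrix.map_apply, ← φt]
      exact φ.symm_apply_apply _
  rw [e] at h
  rw [h]
  exact φ.apply_symm_apply _

theorem sum_reindex {N : Type*} [AddCommMonoid N] (f : ι → ι → ι → ι → ι → ι → ι → ι → N) :
    ∑ x, ∑ d, ∑ a, ∑ m, ∑ s, ∑ b, ∑ r, ∑ n, f x d a m s b r n =
      ∑ m, ∑ n, ∑ r, ∑ s, ∑ a, ∑ b, ∑ x, ∑ d, f x d a m s b r n := by
  simp only [← Fintype.sum_prod_type']
  exact Fintype.sum_equiv
    ⟨fun (x, d, a, m, s, b, r, n) => (m, n, r, s, a, b, x, d),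
      fun (m, n, r, s, a, b, x, d) => (x, d, a, m, s, b, r, n), fun _ => rfl, fun _ => rfl⟩
    _ _ fun _ => rfl

theorem pulled_isBraidedComeasuringStructure
    (hQ : ∀ i j k l, Q.form (tGen R c i j ⊗ₜ tGen R c k l) = R (i, k) (j, l))
    {sil : Comeasuring R c ⊗[K] Comeasuring R c →ₗ[K] K}
    (h1 : convWith Q.inv sil (comulOp K M) Coalgebra.comul = counitPair K M)
    (h2 : convWith sil Q.inv (comulOp K M) Coalgebra.comul = counitPair K M)
    {φ : BraidedComeasuring R c ≃ₗ[K] Comeasuring R c} (φ1 : φ 1 = 1)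
    (φt : ∀ i j, φ (uGen R c i j) = tGen R c i j)
    (φm : ∀ x y, φ (x * y) = S.twistMul (mul' K M) (Site.regular K M)
      (Site.regular K M) (φ x ⊗ₜ φ y)) :
    IsBraidedComeasuringStructure R c (S.pulled φ) where
  isBraidedBialgebra := pulled_isBraidedBialgebra φ h1 h2
  mul_eq := by
    refine TensorProduct.ext' fun x y => φ.injective ?_
    rw [mul'_apply, φm]
    refine twistMul_map (p := φ.toLinearMap) (p' := φ.toLinearMap) (Site.along_pull' φ)
      (fun a b => ?_) x y
    simp [pullMul]
  one_eq := by
    change φ.symm 1 = 1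
    rw [← φ1, φ.symm_apply_apply]
  comul_gen i j := by
    change φ.symm.toLinearMap.lTensor U ((Site.pull φ).r.δ (uGen R c i j)) = _
    simp only [(Site.isMatrix_pull φt).r, map_sum, lTensor_tmul, coe_coe,
      ← φt, φ.symm_apply_apply]
  counit_gen i j := by
    change Coalgebra.counit (R := K) (φ (uGen R c i j)) = _
    rw [φt, counit_tGen]
  braiding_gen i j k l := by
    refine (braid_matrix_matrix (Site.isMatrix_pull φt) (Site.isMatrix_pull φt) i j k l).trans ?_
    rw [sum_reindex]
    simp only [Finset.sum_smul, hQ, Q.inv_matrix (isMatrixCoalgebra_tGen R c) hQ,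
      S.til_matrix (isMatrixCoalgebra_tGen R c) hQ]
    refine sum_congr rfl fun m _ => sum_congr rfl fun n _ =>
      sum_congr rfl fun r _ => sum_congr rfl fun s _ =>
      sum_congr rfl fun a _ => sum_congr rfl fun b _ =>
      sum_congr rfl fun x _ => sum_congr rfl fun d _ => ?_
    congr 1
    ring

end DualQuasitriangular.SecondInverse

end BraidedStructure

section Uniqueness

theorem DualQuasitriangular.ext_form {K M : Type*} [Field K] [Semiring M] [Bialgebra K M]
    {Q Q' : DualQuasitriangular K M} (h : Q.form = Q'.form) : Q = Q' := by
  have e : pairOp Q.inv (liftL M Coalgebra.comul) (liftR M Coalgebra.comul) =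
      pairOp Q'.inv (liftL M Coalgebra.comul) (liftR M Coalgebra.comul) := by
    have i := Site.indep_liftL_liftR (Site.regular K M) (Site.regular K M)
    have h1 := inv_mul_form (Q := Q) i.r.r
    have h2 := form_mul_inv (Q := Q') i.r.r
    rw [← h] at h2
    exact left_inv_eq_right_inv h1 h2
  have h' : Q.inv = Q'.inv := by rw [← counitPair_pairOp Q.inv, e, counitPair_pairOp]
  cases Q; cases Q'; simp_all

variable {K ι : Type*} [Field K] [Fintype ι] [DecidableEq ι]
  {R : Matrix (ι × ι) (ι × ι) K} {c : Matrix ι (ι × ι) K}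

local notation "M" => Comeasuring R c
local notation "U" => BraidedComeasuring R c

theorem DualQuasitriangular.ext_gen {Q Q' : DualQuasitriangular K (Comeasuring R c)}
    (h : ∀ i j k l, Q.form (tGen R c i j ⊗ₜ tGen R c k l) =
      Q'.form (tGen R c i j ⊗ₜ tGen R c k l)) : Q = Q' := by
  refine DualQuasitriangular.ext_form (TensorProduct.ext' fun x y => ?_)
  induction x using Comeasuring.induction generalizing y with
  | gen i j =>
    induction y using Comeasuring.induction generalizing i j with
    | gen k l => exact h i j k l
    | one => rw [Q.form_one_right, Q'.form_one_right]
    | smul a y hy => rw [tmul_smul, map_smul, map_smul, hy]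
    | add y z hy hz => rw [tmul_add, map_add, map_add, hy, hz]
    | mul y z hy hz =>
      rw [Q.form_mul_right, Q'.form_mul_right, comul_tGen]
      simp only [sum_tmul, map_sum, tensorTensorTensorComm_tmul,
        map_tmul, hy, hz]
  | one => rw [Q.form_one_left, Q'.form_one_left]
  | smul a x hx => rw [← smul_tmul', map_smul, map_smul, hx]
  | add x z hx hz => rw [add_tmul, map_add, map_add, hx, hz]
  | mul x z hx hz =>
    rw [Q.form_mul_left, Q'.form_mul_left]
    generalize Coalgebra.comul (R := K) y = t
    induction t with
    | zero => simp
    | add s t hs ht => simp only [tmul_add, map_add, hs, ht]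
    | tmul u v =>
      simp only [tensorTensorTensorComm_tmul, map_tmul, hx, hz]

theorem BraidedComeasuring.induction {p : U → Prop} (gen : ∀ i j, p (uGen R c i j))
    (one : p 1) (smul : ∀ (a : K) x, p x → p (a • x)) (add : ∀ x y, p x → p y → p (x + y))
    (mul : ∀ x y, p x → p y → p (x * y)) (x : U) : p x :=
  FreeAlgebra.mkAlgHom_induction (fun q => gen q.1 q.2) one smul add mul x

/-- The tensors with second factor in the span of `s`. -/
def spanRight (K : Type*) {B : Type*} [Field K] [Semiring B] [Algebra K B] (s : Set B) :
    Submodule K (B ⊗[K] B) :=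
  Submodule.map₂ (TensorProduct.mk K B B) ⊤ (Submodule.span K s)

theorem tmul_mem_spanRight {B : Type*} [Semiring B] [Algebra K B] {s : Set B} (x : B) {u : B}
    (hu : u ∈ s) : x ⊗ₜ[K] u ∈ spanRight K s :=
  Submodule.apply_mem_map₂ _ trivial (Submodule.subset_span hu)

theorem spanRight_le {B : Type*} [Semiring B] [Algebra K B] {s : Set B}
    {Z : Submodule K (B ⊗[K] B)} (h : ∀ x, ∀ u ∈ s, x ⊗ₜ u ∈ Z) : spanRight K s ≤ Z := by
  refine Submodule.map₂_le.2 fun x _ u hu => ?_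
  have : Submodule.span K s ≤ Z.comap (TensorProduct.mk K B B x) := Submodule.span_le.2 (h x)
  exact this hu

theorem braiding_ext {B : Type*} [Semiring B] [Algebra K B] {s : Set B}
    (hs : ∀ p : B → Prop, (∀ x ∈ s, p x) → p 1 → (∀ (a : K) x, p x → p (a • x)) →
      (∀ x y, p x → p y → p (x + y)) → (∀ x y, p x → p y → p (x * y)) → ∀ x, p x)
    {f g : B ⊗[K] B →ₗ[K] B ⊗[K] B}
    (fl : NaturalLeft (mul' K B) (braidTensorLeft f f) f)
    (gl : NaturalLeft (mul' K B) (braidTensorLeft g g) g)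
    (fr : NaturalRight (mul' K B) (braidTensorRight f f) f)
    (gr : NaturalRight (mul' K B) (braidTensorRight g g) g)
    (f1 : ∀ z, f (1 ⊗ₜ z) = z ⊗ₜ 1) (g1 : ∀ z, g (1 ⊗ₜ z) = z ⊗ₜ 1)
    (f1' : ∀ z, f (z ⊗ₜ 1) = 1 ⊗ₜ z) (g1' : ∀ z, g (z ⊗ₜ 1) = 1 ⊗ₜ z)
    (h : ∀ u ∈ s, ∀ v ∈ s, f (u ⊗ₜ v) = g (u ⊗ₜ v))
    (h' : ∀ u ∈ s, ∀ v ∈ s, f (u ⊗ₜ v) ∈ spanRight K s) : f = g := by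
  have key : ∀ y, ∀ u ∈ s, f (u ⊗ₜ y) = g (u ⊗ₜ y) ∧ f (u ⊗ₜ y) ∈ spanRight K s := by
    refine hs _ (fun v hv u hu => ⟨h u hu v hv, h' u hu v hv⟩)
      (fun u hu => by rw [f1', g1']; exact ⟨rfl, tmul_mem_spanRight _ hu⟩)
      (fun a y hy u hu => ?_) (fun y z hy hz u hu => ?_) (fun y z hy hz u hu => ?_)
    · rw [tmul_smul, map_smul, map_smul]
      exact ⟨by rw [(hy u hu).1], Submodule.smul_mem _ _ (hy u hu).2⟩
    · rw [tmul_add, map_add, map_add]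
      exact ⟨by rw [(hy u hu).1, (hz u hu).1], add_mem (hy u hu).2 (hz u hu).2⟩
    · let m : B → B ⊗[K] B →ₗ[K] B ⊗[K] B := fun x =>
        (mul' K B).rTensor B ∘ₗ (TensorProduct.assoc K B B B).symm.toLinearMap ∘ₗ
          TensorProduct.mk K B (B ⊗[K] B) x
      have hm {f : B ⊗[K] B →ₗ[K] B ⊗[K] B}
          (fr : NaturalRight (mul' K B) (braidTensorRight f f) f) :
          ∃ G : B ⊗[K] B →ₗ[K] B ⊗[K] B, (∀ x u, G (x ⊗ₜ u) = m x (f (u ⊗ₜ z))) ∧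
            ∀ u, f (u ⊗ₜ (y * z)) = G (f (u ⊗ₜ y)) := by
        refine ⟨(mul' K B).rTensor B ∘ₗ
          (TensorProduct.assoc K B B B).symm.toLinearMap ∘ₗ
          (f ∘ₗ (TensorProduct.mk K B B).flip z).lTensor B, fun x u => rfl, fun u => ?_⟩
        have := LinearMap.congr_fun fr (u ⊗ₜ (y ⊗ₜ z))
        simp only [comp_apply, map_tmul, mul'_apply,
          LinearMap.id_apply, braidTensorRight, coe_coe,
          assoc_symm_tmul] at this
        rw [this]
        generalize f (u ⊗ₜ y) = t
        induction t with
        | zero => simp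
        | add s t hs ht => simp only [map_add, add_tmul, hs, ht]
        | tmul s t => rfl
      obtain ⟨G, hG, hf⟩ := hm fr
      obtain ⟨G', hG', hg⟩ := hm gr
      have e1 : spanRight K s ≤ LinearMap.eqLocus G G' := spanRight_le fun x v hv => by
        change G (x ⊗ₜ v) = G' (x ⊗ₜ v)
        rw [hG, hG', (hz v hv).1]
      have e2 : spanRight K s ≤ (spanRight K s).comap G := spanRight_le fun x v hv => by
        have : spanRight K s ≤ (spanRight K s).comap (m x) := spanRight_le fun y w hw => by
          exact tmul_mem_spanRight (x * y) hw
        rw [Submodule.mem_comap, hG]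
        exact this (hz v hv).2
      rw [hf, hg, ← (hy u hu).1]
      exact ⟨e1 (hy u hu).2, e2 (hy u hu).2⟩
  have key' : ∀ x y, f (x ⊗ₜ y) = g (x ⊗ₜ y) := by
    refine hs _ (fun u hu y => (key y u hu).1) (fun y => by rw [f1, g1])
      (fun a x hx y => by rw [← smul_tmul', map_smul, map_smul, hx])
      (fun x z hx hz y => by rw [add_tmul, map_add, map_add, hx, hz])
      (fun x z hx hz y => ?_)
    have e1 := LinearMap.congr_fun fl ((x ⊗ₜ z) ⊗ₜ y)
    have e2 := LinearMap.congr_fun gl ((x ⊗ₜ z) ⊗ₜ y)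
    simp only [comp_apply, map_tmul, mul'_apply,
      LinearMap.id_apply, braidTensorLeft, coe_coe,
      assoc_tmul] at e1 e2
    rw [e1, e2, hz]
    generalize g (z ⊗ₜ y) = t
    induction t with
    | zero => simp
    | add s t hs ht => simp only [map_add, tmul_add, hs, ht]
    | tmul s t =>
      rw [assoc_symm_tmul, map_tmul, map_tmul, hx]
  exact TensorProduct.ext' key'

theorem IsBraidedComeasuringStructure.eq {D D' : BraidedBialgebraData K (BraidedComeasuring R c)}
    (h : IsBraidedComeasuringStructure R c D) (h' : IsBraidedComeasuringStructure R c D') :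
    D = D' := by
  obtain ⟨m, o, C, e, b⟩ := D
  obtain ⟨m', o', C', e', b'⟩ := D'
  obtain ⟨hB, rfl, rfl, hC, he, hb⟩ := h
  obtain ⟨hB', hm, ho, hC', he', hb'⟩ := h'
  simp only at hm ho hC hC' he he' hb hb'
  subst hm ho
  obtain rfl : b = b' := by
    refine braiding_ext (s := Set.range fun p : ι × ι => uGen R c p.1 p.2)
      (fun p gen one smul add mul => BraidedComeasuring.induction (fun i j => gen _ ⟨(i, j), rfl⟩)
        one smul add mul) hB.functorial_left.mul hB'.functorial_left.mul hB.functorial_right.mul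
      hB'.functorial_right.mul hB.functorial_left.one hB'.functorial_left.one
      hB.functorial_right.one hB'.functorial_right.one
      ?_ ?_
    · rintro _ ⟨⟨i, j⟩, rfl⟩ _ ⟨⟨k, l⟩, rfl⟩
      exact (hb i j k l).trans (hb' i j k l).symm
    rintro _ ⟨⟨i, j⟩, rfl⟩ _ ⟨⟨k, l⟩, rfl⟩
    rw [hb]
    exact sum_mem fun m _ => sum_mem fun n _ => sum_mem fun r _ => sum_mem fun s _ =>
      Submodule.smul_mem _ _ (tmul_mem_spanRight _ ⟨(r, s), rfl⟩)
  obtain rfl : C = C' := by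
    ext x
    induction x using BraidedComeasuring.induction with
    | gen i j => rw [hC, hC']
    | one => exact hB.comul_one.trans hB'.comul_one.symm
    | smul a x hx => rw [map_smul, map_smul, hx]
    | add x y hx hy => rw [map_add, map_add, hx, hy]
    | mul x y hx hy =>
      have h1 := LinearMap.congr_fun hB.comul_mul (x ⊗ₜ y)
      have h2 := LinearMap.congr_fun hB'.comul_mul (x ⊗ₜ y)
      simp only [comp_apply, mul'_apply, map_tmul] at h1 h2
      rw [h1, h2, hx, hy]
  obtain rfl : e = e' := by
    ext x
    induction x using BraidedComeasuring.induction with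
    | gen i j => rw [he, he']
    | one => exact hB.counit_one.trans hB'.counit_one.symm
    | smul a x hx => rw [map_smul, map_smul, hx]
    | add x y hx hy => rw [map_add, map_add, hx, hy]
    | mul x y hx hy =>
      have h1 := hB.counit_mul x y
      have h2 := hB'.counit_mul x y
      simp only [mul'_apply] at h1 h2
      rw [h1, h2, hx, hy]
  rfl

end Uniqueness

section CoactedAlgebra

variable {K M ι A : Type*} [Field K] [Semiring M] [Bialgebra K M] [Fintype ι] [DecidableEq ι]
  [AddCommGroup A] [Module K A] (e : Module.Basis ι K A) {τ : Matrix ι ι M}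

theorem joint_basis {δ : A →ₗ[K] A ⊗[K] M} (hδ : ∀ j, δ (e j) = ∑ a, e a ⊗ₜ τ a j)
    (hτ : IsMatrixCoalgebra K τ) : joint δ δ = (Coalgebra.comul (R := K) (A := M)).lTensor A ∘ₗ δ := by
  refine e.ext fun j => ?_
  simp only [joint, comp_apply, hδ, map_sum, rTensor_tmul,
    lTensor_tmul, sum_tmul, coe_coe, assoc_tmul,
    hτ.comul, tmul_sum]
  exact sum_comm

/-- The bicomodule with basis `e`, coaction `eⱼ ↦ ∑ eₐ ⊗ τᵃⱼ` and trivial left coaction. -/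
theorem exists_rowSite (hτ : IsMatrixCoalgebra K τ) :
    ∃ a : Site K M A, (∀ x, a.l.δ x = x ⊗ₜ 1) ∧ ∀ j, a.r.δ (e j) = ∑ b, e b ⊗ₜ τ b j := by
  obtain ⟨δ, hδ⟩ : ∃ δ : A →ₗ[K] A ⊗[K] M, ∀ j, δ (e j) = ∑ b, e b ⊗ₜ τ b j :=
    ⟨e.constr K fun j => ∑ b, e b ⊗ₜ τ b j, fun j => e.constr_basis K _ j⟩
  refine ⟨⟨⟨(TensorProduct.mk K A M).flip 1, ?_, ?_⟩, ⟨δ, joint_basis e hδ hτ, ?_⟩, ?_⟩,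
    fun x => rfl, hδ⟩
  · ext x
    simp [joint, cop, comulOp_apply, Algebra.TensorProduct.one_def]
  · ext x
    simp [evalFun_apply]
  · refine e.ext fun j => ?_
    simp [evalFun_apply, hδ, hτ.counit]
  · refine e.ext fun j => ?_
    simp [hδ]

theorem prod_rowSite {A : Type*} [NonUnitalRing A] [Module K A] [SMulCommClass K A A]
    [IsScalarTower K A A] (e : Module.Basis ι K A) {a : Site K M A}
    (hl : ∀ x, a.l.δ x = x ⊗ₜ 1) (hr : ∀ j, a.r.δ (e j) = ∑ b, e b ⊗ₜ τ b j)
    (hc : ∀ l i j, ∑ b, structureMatrix e b (i, j) • τ l b =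
      ∑ p, ∑ q, structureMatrix e l (p, q) • (τ p i * τ q j)) :
    Site.Prod (mul' K A) (a.liftL A) (a.liftR A) a := by
  constructor
  · refine TensorProduct.ext' fun x y => ?_
    simp [Site.liftL, Site.liftR, Line.liftL, Line.liftR, joint, liftR_tmul, liftL_tmul, hl]
  · refine (e.tensorProduct e).ext fun ⟨i, j⟩ => ?_
    have h1 : a.r.δ (e i * e j) = ∑ l, e l ⊗ₜ ∑ b, structureMatrix e b (i, j) • τ l b := by
      rw [basis_mul_basis]
      simp only [map_sum, map_smul, hr, tmul_sum, tmul_smul,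
        Finset.smul_sum]
      exact sum_comm
    have h2 : TensorProduct.map (mul' K A) (mul' K M)
        (joint (a.liftL A).r.δ (a.liftR A).r.δ (e i ⊗ₜ e j)) =
        ∑ p, ∑ q, (e p * e q) ⊗ₜ (τ p i * τ q j) := by
      simp only [Site.liftL, Site.liftR, Line.liftL, Line.liftR, joint, comp_apply,
        liftR_tmul, hr, tmul_sum, map_sum, assoc_symm_tmul,
        rTensor_tmul, liftL_tmul, sum_tmul, coe_coe,
        rightComm_tmul, assoc_tmul, map_tmul,
        mul'_apply]
      exact sum_comm
    rw [Module.Basis.tensorProduct_apply, comp_apply, comp_apply,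
      mul'_apply, h1, h2]
    simp only [hc, basis_mul_basis, sum_tmul, tmul_sum,
      TensorProduct.smul_tmul]
    rw [← sum_comm]
    exact sum_congr rfl fun p _ => sum_comm

end CoactedAlgebra

theorem corollary4p7 {K ι A : Type*} [Field K] [Fintype ι] [DecidableEq ι]
    [NonUnitalRing A] [Module K A] [SMulCommClass K A A] [IsScalarTower K A A]
    (e : Module.Basis ι K A) (Ψ : A ⊗[K] A →ₗ[K] A ⊗[K] A) (hΨ : IsBraidedAlgebra Ψ)
    (R : Matrix (ι × ι) (ι × ι) K)
    (hRΨ : ∀ i j, Ψ (e i ⊗ₜ e j) = ∑ a, ∑ b, R (a, b) (i, j) • (e b ⊗ₜ[K] e a))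
    (hR : IsUnit R) (hR₂ : IsUnit (transpose₂ R)) :
    (∃! Q : DualQuasitriangular K (Comeasuring R (structureMatrix e)),
      ∀ i j k l, Q.form (tGen R (structureMatrix e) i j ⊗ₜ tGen R (structureMatrix e) k l) =
        R (i, k) (j, l)) ∧
    (∃! D : BraidedBialgebraData K (BraidedComeasuring R (structureMatrix e)),
      IsBraidedComeasuringStructure R (structureMatrix e) D) ∧
    ∀ Q : DualQuasitriangular K (Comeasuring R (structureMatrix e)),
      (∀ i j k l, Q.form (tGen R (structureMatrix e) i j ⊗ₜ tGen R (structureMatrix e) k l) =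
        R (i, k) (j, l)) →
    ∀ D : BraidedBialgebraData K (BraidedComeasuring R (structureMatrix e)),
      IsBraidedComeasuringStructure R (structureMatrix e) D →
    Nonempty Q.SecondInverse ∧
    (∀ S : Q.SecondInverse,
      ∃ φ : BraidedComeasuring R (structureMatrix e) ≃ₗ[K] Comeasuring R (structureMatrix e),
        D.IsIso (transmutation Q S) φ ∧
        (∀ i j, φ (uGen R (structureMatrix e) i j) = tGen R (structureMatrix e) i j) ∧
        ∀ p q, φ ((leg₁ (uGen R (structureMatrix e)) * scalars (BraidedComeasuring R (structureMatrix e)) R *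
            leg₂ (uGen R (structureMatrix e))) p q) =
          (scalars (Comeasuring R (structureMatrix e)) R * leg₁ (tGen R (structureMatrix e)) *
            leg₂ (tGen R (structureMatrix e))) p q) ∧
    ∃ (ΨBA : BraidedComeasuring R (structureMatrix e) ⊗[K] A →ₗ[K]
          A ⊗[K] BraidedComeasuring R (structureMatrix e))
      (ΨAB : A ⊗[K] BraidedComeasuring R (structureMatrix e) →ₗ[K]
          BraidedComeasuring R (structureMatrix e) ⊗[K] A)
      (β : A →ₗ[K] A ⊗[K] BraidedComeasuring R (structureMatrix e)),
      IsBraidedComeasuring Ψ D ΨBA ΨAB β ∧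
      (∀ j, β (e j) = ∑ a, e a ⊗ₜ uGen R (structureMatrix e) a j) ∧
      (∀ i j k, ΨBA (uGen R (structureMatrix e) i j ⊗ₜ e k) =
        ∑ m, ∑ a, ∑ b, (∑ n, R⁻¹ (i, m) (a, n) * R (b, n) (j, k)) •
          (e m ⊗ₜ[K] uGen R (structureMatrix e) a b)) ∧
      (∀ i j k, ΨAB (e k ⊗ₜ uGen R (structureMatrix e) i j) =
        ∑ a, ∑ b, ∑ m, (∑ n, tildeMatrix R (n, i) (k, a) * R (m, b) (n, j)) •
          (uGen R (structureMatrix e) a b ⊗ₜ[K] e m)) := by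
  have hM : SatisfiesComeasuring R (structureMatrix e) (tGen R (structureMatrix e)) :=
    satisfiesComeasuring_tGen R (structureMatrix e)
  have hτ := isMatrixCoalgebra_tGen R (structureMatrix e)
  obtain ⟨Q, S, sil, hQ, h1, h2⟩ := exists_dualQuasitriangular (yangBaxterMatrix e hΨ hRΨ)
    (mulLeftMatrix e hΨ hRΨ) (mulRightMatrix e hΨ hRΨ) hR hR₂
  obtain ⟨φ, φ1, φt, φm⟩ := S.exists_braidedEquiv hR hQ
  refine ⟨⟨Q, hQ, fun Q' hQ' => DualQuasitriangular.ext_gen fun i j k l => by rw [hQ, hQ']⟩,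
    ⟨S.pulled φ, DualQuasitriangular.SecondInverse.pulled_isBraidedComeasuringStructure
      hQ h1 h2 φ1 φt φm, fun D hD => hD.eq
        (DualQuasitriangular.SecondInverse.pulled_isBraidedComeasuringStructure
          hQ h1 h2 φ1 φt φm)⟩, fun Q' hQ' D hD => ?_⟩
  obtain rfl : Q' = Q := DualQuasitriangular.ext_gen fun i j k l => by rw [hQ, hQ']
  refine ⟨⟨S⟩, fun S' => ?_, ?_⟩
  · obtain ⟨φ', φ1', φt', φm'⟩ := S'.exists_braidedEquiv hR hQ
    obtain rfl := hD.eq (DualQuasitriangular.SecondInverse.pulled_isBraidedComeasuringStructure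
      hQ h1 h2 φ1' φt' φm')
    exact ⟨φ', S'.pulled_isIso φ', φt',
      DualQuasitriangular.SecondInverse.map_braided_quadratic hQ φt' φm'⟩
  · obtain rfl := hD.eq (DualQuasitriangular.SecondInverse.pulled_isBraidedComeasuringStructure
      hQ h1 h2 φ1 φt φm)
    obtain ⟨a, hl, hr⟩ := exists_rowSite e hτ
    have ha : a.IsRow (tGen R (structureMatrix e)) e := ⟨fun j => hl _, hr⟩
    have hu := Site.isMatrix_pull φt
    have hprod := prod_rowSite e hl hr (satisfiesComeasuring_iff.1 hM).2
    have hb : S.braid a a = Ψ := by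
      refine (e.tensorProduct e).ext fun ⟨i, j⟩ => ?_
      rw [Module.Basis.tensorProduct_apply, hRΨ,
        DualQuasitriangular.SecondInverse.braid_row_row hτ ha ha]
      simp only [hQ]
    refine ⟨S.braid (Site.pull φ) a, S.braid a (Site.pull φ), a.coaction φ, ?_, ?_, ?_, ?_⟩
    · rw [← hb]
      exact DualQuasitriangular.SecondInverse.pulled_isBraidedComeasuring φ h1 h2 a hl hprod
    · intro j
      simp only [Site.coaction, LinearMap.comp_apply, hr, map_sum, LinearMap.lTensor_tmul, ← φt,
        LinearEquiv.coe_coe, φ.symm_apply_apply]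
    · exact DualQuasitriangular.SecondInverse.braid_matrix_row_eq hτ hQ hu ha
    · exact DualQuasitriangular.SecondInverse.braid_row_matrix_eq hτ hQ hu ha
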